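/- **Conventions.** A cdga is a commutative differential graded algebra $A=\bigoplus_{i\ge 0}A^i$ over $\mathbb{C}$. Let $q\ge 1$ be an integer. A map of cdgas is a *$q$-equivalence* if it induces isomorphisms in cohomology in degrees $\le q$ and a monomorphism in degree $q+1$; write $A\simeq_q B$ if $A$ and $B$ are connected by a finite zig-zag of $q$-equivalences. A cdga $A$ is *$q$-finite* if $A^0=\mathbb{C}\cdot 1$ and $\dim A^i<\infty$ for all $i\le q$. A cdga is *$q$-minimal* if it is of the form $(\bigwedge V,d)$, the free graded-commutative algebra on a graded vector space $V=\bigoplus_{0<i\le q}V^i$, where the differential is the inductive limit of Hirsch extensions of increasing degrees: each $V^n$ is an increasing union of subspaces $0=F_0V^n\subseteq F_1V^n\subseteq\cdots$ such that $d(F_{j+1}V^n)\subseteq \bigwedge(V^{<n}\oplus F_jV^n)$ for all $j\ge 0$. For a topological space $X$, let $\Omega(X)$ be Sullivan's cdga of piecewise polynomial, complex-valued forms on the singular simplices of $X$. For a path-connected space $X$, let $\mathcal{M}_q(X)$ be its $q$-minimal model, that is, the $q$-minimal cdga (unique up to isomorphism) which admits a $q$-equivalence $\mathcal{M}_q(X)\to\Omega(X)$.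 A path-connected space is *$q$-finite* if it is homotopy equivalent to a CW-complex with finite $q$-skeleton. **Theorem.** (1) Let $q\ge 1$ be an integer and let $X$ be a path-connected space. Assume that either $\Omega(X)\simeq_q A$ for some $q$-finite cdga $A$, or $X$ is $(q+1)$-finite. Then $\dim_{\mathbb{C}} H^i(\mathcal{M}_q(X))<\infty$ for all $i\le q+1$. (2) Let $\pi$ be a finitely generated group, and let $X=K(\pi,1)$ be a classifying space of $\pi$, that is, a path-connected space of the homotopy type of a CW-complex with $\pi_1(X)\cong\pi$ and $\pi_n(X)=0$ for $n\ge 2$. Assume that either $\Omega(X)\simeq_1 A$ for some $1$-finite cdga $A$, or $\pi$ is finitely presented. Then $\dim_{\mathbb{C}} H^2(\mathcal{M}_1(X))<\infty$. -/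

import Mathlib

open scoped TensorProduct

universe u w

/-! ### Commutative graded algebras and cdgas -/

/-- A non-negatively graded, graded-commutative, associative, unital algebra
`A = ⨁_{i ≥ 0} A^i` over a field `k` (of characteristic different from `2`).  The product
`A^i ⊗ A^j → A^n` is indexed by a proof of `i + j = n`. -/
structure GCAlg (k : Type w) [Field k] where
  /-- The homogeneous component of degree `n`. -/
  carrier : ℕ → Type u
  [acg : ∀ n, AddCommGroup (carrier n)]
  [mod : ∀ n, Module k (carrier n)]
  /-- The product. -/
  mul : ∀ {i j n : ℕ}, i + j = n → carrier i →ₗ[k] carrier j →ₗ[k] carrier n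
  /-- The unit. -/
  one : carrier 0
  one_mul' : ∀ {n : ℕ} (a : carrier n), mul (Nat.zero_add n) one a = a
  mul_one' : ∀ {n : ℕ} (a : carrier n), mul (Nat.add_zero n) a one = a
  mul_assoc' : ∀ {i j l ij jl n : ℕ} (h₁ : i + j = ij) (h₂ : ij + l = n)
    (h₃ : j + l = jl) (h₄ : i + jl = n) (a : carrier i) (b : carrier j) (c : carrier l),
    mul h₂ (mul h₁ a b) c = mul h₄ a (mul h₃ b c)
  mul_comm' : ∀ {i j n : ℕ} (h : i + j = n) (h' : j + i = n) (a : carrier i) (b : carrier j),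
    mul h a b = (-1 : k) ^ (i * j) • mul h' b a

attribute [instance] GCAlg.acg GCAlg.mod

/-- A commutative differential graded algebra (cdga) over `k`. -/
structure CDGA (k : Type w) [Field k] extends GCAlg.{u, w} k where
  /-- The differential. -/
  d : ∀ n : ℕ, carrier n →ₗ[k] carrier (n + 1)
  d_d : ∀ {n : ℕ} (a : carrier n), d (n + 1) (d n a) = 0
  leibniz : ∀ {i j n : ℕ} (h : i + j = n) (h₁ : i + 1 + j = n + 1) (h₂ : i + (j + 1) = n + 1)
    (a : carrier i) (b : carrier j),
    d n (mul h a b) = mul h₁ (d i a) b + (-1 : k) ^ i • mul h₂ a (d j b)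

section Algebra

variable {k : Type w} [Field k]

/-- Homomorphisms of graded algebras. -/
structure GCAlg.Hom (A B : GCAlg.{u, w} k) where
  /-- The linear map in degree `n`. -/
  toFun : ∀ n : ℕ, A.carrier n →ₗ[k] B.carrier n
  map_one : toFun 0 A.one = B.one
  map_mul : ∀ {i j n : ℕ} (h : i + j = n) (a : A.carrier i) (b : A.carrier j),
    toFun n (A.mul h a b) = B.mul h (toFun i a) (toFun j b)

/-- Homomorphisms of cdgas. -/
structure CDGA.Hom (A B : CDGA.{u, w} k) extends GCAlg.Hom A.toGCAlg B.toGCAlg where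
  map_d : ∀ {n : ℕ} (a : A.carrier n), toFun (n + 1) (A.d n a) = B.d n (toFun n a)

namespace CDGA

/-- The cocycles `Z^i(A) = ker (d : A^i → A^{i+1})`. -/
def cocycles (A : CDGA.{u, w} k) (i : ℕ) : Submodule k (A.carrier i) :=
  LinearMap.ker (A.d i)

/-- The coboundaries `B^i(A) = im (d : A^{i-1} → A^i)`, with `B^0(A) = 0`. -/
def coboundaries (A : CDGA.{u, w} k) : ∀ i : ℕ, Submodule k (A.carrier i)
  | 0 => ⊥
  | i + 1 => LinearMap.range (A.d i)

/-- The cohomology `H^i(A) = Z^i(A) / B^i(A)`. -/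
abbrev Cohomology (A : CDGA.{u, w} k) (i : ℕ) : Type u :=
  A.cocycles i ⧸ (A.coboundaries i).comap (A.cocycles i).subtype

variable {A B : CDGA.{u, w} k}

/-- The map induced on cocycles by a cdga map. -/
def Hom.mapCocycles (f : A.Hom B) (i : ℕ) : A.cocycles i →ₗ[k] B.cocycles i :=
  (f.toFun i).restrict fun a ha => by
    have h : A.d i a = 0 := ha
    change B.d i (f.toFun i a) = 0
    rw [← f.map_d, h, map_zero]

/-- The map induced in cohomology by a cdga map. -/
def Hom.mapCohomology (f : A.Hom B) (i : ℕ) : A.Cohomology i →ₗ[k] B.Cohomology i :=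
  Submodule.mapQ _ _ (f.mapCocycles i) <| by
    rintro ⟨a, ha⟩ h
    cases i with
    | zero =>
      have h0 : a = 0 := h
      subst h0
      change f.toFun 0 0 = 0
      exact map_zero _
    | succ i =>
      obtain ⟨b, hb⟩ := h
      exact ⟨f.toFun i b, by rw [← f.map_d, hb]; rfl⟩

/-- A cdga map is a `q`-equivalence if it induces isomorphisms in cohomology in degrees up to `q`
and a monomorphism in degree `q + 1`. -/
def Hom.IsQEquivalence (q : ℕ) (f : A.Hom B) : Prop :=
  (∀ i ≤ q, Function.Bijective (f.mapCohomology i)) ∧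
    Function.Injective (f.mapCohomology (q + 1))

/-- Two cdgas have the same `q`-type, `A ≃_q B`, if they are connected by a finite zig-zag of
`q`-equivalences. -/
def SameQType (q : ℕ) (A B : CDGA.{u, w} k) : Prop :=
  Relation.EqvGen (fun C D : CDGA.{u, w} k => ∃ f : C.Hom D, f.IsQEquivalence q) A B

/-- A cdga is `q`-finite if it is connected, i.e. `A^0 = k · 1`, and `A^i` is finite-dimensional
for all `i ≤ q`. -/
structure IsQFinite (q : ℕ) (A : CDGA.{u, w} k) : Prop where
  connected : Function.Bijective fun c : k => c • A.one
  finite : ∀ i ≤ q, FiniteDimensional k (A.carrier i)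

end CDGA

/-! ### Minimal cdgas -/

/-- A graded algebra `A` is the free graded-commutative algebra `⋀V` on the graded subspace `V`:
every degree-preserving linear map from `V` to a graded-commutative algebra extends uniquely to a
homomorphism of graded algebras. -/
def GCAlg.IsFreeOn (A : GCAlg.{u, w} k) (V : ∀ n, Submodule k (A.carrier n)) : Prop :=
  ∀ (B : GCAlg.{u, w} k) (f : ∀ n, V n →ₗ[k] B.carrier n),
    ∃! φ : A.Hom B, ∀ (n : ℕ) (v : V n), φ.toFun n v = f n v

/-- A family of subspaces is (the family of homogeneous components of) a graded subalgebra. -/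
structure GCAlg.IsSubalgebra (A : GCAlg.{u, w} k) (S : ∀ n, Submodule k (A.carrier n)) :
    Prop where
  one_mem : A.one ∈ S 0
  mul_mem : ∀ {i j n : ℕ} (h : i + j = n) {a : A.carrier i} {b : A.carrier j},
    a ∈ S i → b ∈ S j → A.mul h a b ∈ S n

/-- The degree `n` component of the graded subalgebra generated by a graded subspace `W`. -/
def GCAlg.adjoin (A : GCAlg.{u, w} k) (W : ∀ n, Submodule k (A.carrier n)) (n : ℕ) :
    Submodule k (A.carrier n) :=
  sInf {T | ∃ S : ∀ m, Submodule k (A.carrier m),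
    A.IsSubalgebra S ∧ (∀ m, W m ≤ S m) ∧ S n = T}

/-- The graded subspace `V^{<n} ⊕ F_j V^n`, where `F` is a filtration of each `V^m`. -/
def GCAlg.stage (A : GCAlg.{u, w} k) (V : ∀ n, Submodule k (A.carrier n))
    (F : ∀ n : ℕ, ℕ → Submodule k (A.carrier n)) (n j m : ℕ) : Submodule k (A.carrier m) :=
  if m < n then V m else if m = n then F m j else ⊥

/-- A cdga is `q`-minimal if it is of the form `(⋀V, d)` with `V = ⨁_{0 < i ≤ q} V^i`, where the
differential is the inductive limit of a sequence of Hirsch extensions of increasing degrees.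

The latter is expressed as follows.  Each `V^n` is an increasing union of subspaces
`0 = F_0 V^n ⊆ F_1 V^n ⊆ ⋯` such that `d` maps `F_{j+1} V^n` into `⋀(V^{<n} ⊕ F_j V^n)`.
Thus `⋀(V^{<n} ⊕ F_{j+1} V^n)` is obtained from its sub-cdga `⋀(V^{<n} ⊕ F_j V^n)` by adjoining
freely a vector space of generators of degree `n` (a complement of `F_j V^n` in `F_{j+1} V^n`)
whose differentials lie in that sub-cdga: a Hirsch extension of degree `n`.  The extensions of
degree `1` come first, followed by those of degree `2`, and so on. -/
def CDGA.IsQMinimal (q : ℕ) (M : CDGA.{u, w} k) : Prop :=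
  ∃ V : ∀ n, Submodule k (M.carrier n),
    V 0 = ⊥ ∧ (∀ n, q < n → V n = ⊥) ∧ M.toGCAlg.IsFreeOn V ∧
    ∃ F : ∀ n : ℕ, ℕ → Submodule k (M.carrier n),
      (∀ n, F n 0 = ⊥) ∧ (∀ n, Monotone (F n)) ∧ (∀ n, ⨆ j, F n j = V n) ∧
      ∀ (n j : ℕ), ∀ x ∈ F n (j + 1),
        M.d n x ∈ M.toGCAlg.adjoin (M.toGCAlg.stage V F n j) (n + 1)

/-- `M` is the `q`-minimal model of `A`: it is `q`-minimal and admits a `q`-equivalence to `A`.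
(This determines `M` up to isomorphism.) -/
def CDGA.IsQMinimalModel (q : ℕ) (M A : CDGA.{u, w} k) : Prop :=
  M.IsQMinimal q ∧ ∃ f : M.Hom A, f.IsQEquivalence q

end Algebra

/-! ### Polynomial differential forms on simplices -/

/-- The algebra `k[t_1, …, t_n] ⊗ ⋀(dt_1, …, dt_n)` of polynomial differential forms on the
standard `n`-simplex, with coordinates the barycentric coordinates `t_1, …, t_n`
(and `t_0 = 1 - t_1 - ⋯ - t_n`). The variable `X j` is `t_{j+1}`, and the basis vector `e_j` is
`dt_{j+1}`. -/
abbrev PolyForm (k : Type w) [Field k] (n : ℕ) : Type w :=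
  MvPolynomial (Fin n) k ⊗[k] ExteriorAlgebra k (Fin n → k)

namespace PolyForm

variable (k : Type w) [Field k]

/-- The forms of degree `p`. -/
noncomputable def deg (n p : ℕ) : Submodule k (PolyForm k n) :=
  Submodule.span k {x | ∃ (f : MvPolynomial (Fin n) k), ∃ a ∈ ⋀[k]^p (Fin n → k), x = f ⊗ₜ[k] a}

/-- The exterior derivative `d(f a) = ∑_i (∂f/∂t_i) dt_i ∧ a`, for `f` a polynomial and `a` a
form with constant coefficients. -/
noncomputable def d (n : ℕ) : PolyForm k n →ₗ[k] PolyForm k n :=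
  ∑ i : Fin n, TensorProduct.map (MvPolynomial.pderiv i).toLinearMap
    (LinearMap.mulLeft k (ExteriorAlgebra.ι k (Pi.single i 1 : Fin n → k)))

/-- The barycentric coordinates `t_0, …, t_n` as polynomials in `t_1, …, t_n`. -/
noncomputable def bary (n : ℕ) : Fin (n + 1) → MvPolynomial (Fin n) k :=
  Fin.cases (1 - ∑ j, MvPolynomial.X j) MvPolynomial.X

/-- The differentials `dt_0, …, dt_n` as combinations of `dt_1, …, dt_n`. -/
def dbary (n : ℕ) : Fin (n + 1) → (Fin n → k) :=
  Fin.cases (fun _ => -1) (fun j => Pi.single j 1)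

/-- The pullback of forms along the affine map of standard simplices `Δ^m → Δ^n` which is given on
vertices by `θ`: it sends `t_j` to `∑_{θ i = j} t_i` and `dt_j` to `∑_{θ i = j} dt_i`. -/
noncomputable def pullback {m n : ℕ} (θ : Fin (m + 1) → Fin (n + 1)) :
    PolyForm k n →ₐ[k] PolyForm k m :=
  Algebra.TensorProduct.map
    (MvPolynomial.aeval fun j : Fin n => ∑ i with θ i = j.succ, bary k m i)
    (ExteriorAlgebra.map
      (Fintype.linearCombination k fun j : Fin n => ∑ i with θ i = j.succ, dbary k m i))

variable {k}

theorem tmul_mem_deg {n p : ℕ} (f : MvPolynomial (Fin n) k) {a : ExteriorAlgebra k (Fin n → k)}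
    (ha : a ∈ ⋀[k]^p (Fin n → k)) : f ⊗ₜ[k] a ∈ deg k n p :=
  Submodule.subset_span ⟨f, a, ha, rfl⟩

theorem one_mem_deg (n : ℕ) : (1 : PolyForm k n) ∈ deg k n 0 :=
  tmul_mem_deg 1 (by simp [ExteriorAlgebra.exteriorPower])

theorem mul_mem_deg {n p p' q : ℕ} (h : p + p' = q) {x y : PolyForm k n}
    (hx : x ∈ deg k n p) (hy : y ∈ deg k n p') : x * y ∈ deg k n q := by
  subst h
  induction hx using Submodule.span_induction with
  | zero => simp
  | add x x' _ _ h h' => rw [add_mul]; exact add_mem h h'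
  | smul c x _ h => rw [smul_mul_assoc]; exact Submodule.smul_mem _ _ h
  | mem x hx =>
    obtain ⟨f, a, ha, rfl⟩ := hx
    induction hy using Submodule.span_induction with
    | zero => simp
    | add x x' _ _ h h' => rw [mul_add]; exact add_mem h h'
    | smul c x _ h => rw [mul_smul_comm]; exact Submodule.smul_mem _ _ h
    | mem y hy =>
      obtain ⟨g, b, hb, rfl⟩ := hy
      rw [Algebra.TensorProduct.tmul_mul_tmul]
      refine tmul_mem_deg _ ?_
      rw [ExteriorAlgebra.exteriorPower, pow_add]
      exact Submodule.mul_mem_mul ha hb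

theorem ι_mul_comm {n p : ℕ} (v : Fin n → k) {a : ExteriorAlgebra k (Fin n → k)}
    (ha : a ∈ ⋀[k]^p (Fin n → k)) :
    ExteriorAlgebra.ι k v * a = (-1 : k) ^ p • (a * ExteriorAlgebra.ι k v) := by
  induction ha using Submodule.pow_induction_on_left' with
  | algebraMap r => simp [Algebra.commutes]
  | add x y i _ _ h h' => rw [mul_add, h, h', add_mul, smul_add]
  | mem_mul x hx i y _ h =>
    obtain ⟨u, rfl⟩ := hx
    have h2 : ExteriorAlgebra.ι k v * ExteriorAlgebra.ι k u =
        -(ExteriorAlgebra.ι k u * ExteriorAlgebra.ι k v) :=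
      eq_neg_of_add_eq_zero_left (ExteriorAlgebra.ι_add_mul_swap v u)
    rw [← mul_assoc, h2, neg_mul, mul_assoc, h, mul_smul_comm, pow_succ, mul_assoc]
    simp

theorem ext_mul_comm {n p q : ℕ} {a b : ExteriorAlgebra k (Fin n → k)}
    (ha : a ∈ ⋀[k]^p (Fin n → k)) (hb : b ∈ ⋀[k]^q (Fin n → k)) :
    a * b = (-1 : k) ^ (p * q) • (b * a) := by
  induction ha using Submodule.pow_induction_on_left' with
  | algebraMap r => simp [Algebra.commutes]
  | add x y i _ _ h h' => rw [mul_add, add_mul, h, h', smul_add]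
  | mem_mul x hx i y _ h =>
    obtain ⟨u, rfl⟩ := hx
    rw [mul_assoc, h, mul_smul_comm, ← mul_assoc, ι_mul_comm u hb, smul_mul_assoc, smul_smul,
      mul_assoc, ← pow_add, Nat.succ_mul]

theorem mul_comm_deg {n p p' : ℕ} {x y : PolyForm k n}
    (hx : x ∈ deg k n p) (hy : y ∈ deg k n p') : x * y = (-1 : k) ^ (p * p') • (y * x) := by
  induction hx using Submodule.span_induction with
  | zero => simp
  | add x x' _ _ h h' => rw [add_mul, h, h', mul_add, smul_add]
  | smul c x _ h => rw [smul_mul_assoc, h, mul_smul_comm, smul_comm]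
  | mem x hx =>
    obtain ⟨f, a, ha, rfl⟩ := hx
    induction hy using Submodule.span_induction with
    | zero => simp
    | add x x' _ _ h h' => rw [mul_add, h, h', add_mul, smul_add]
    | smul c x _ h => rw [mul_smul_comm, h, smul_mul_assoc, smul_comm]
    | mem y hy =>
      obtain ⟨g, b, hb, rfl⟩ := hy
      rw [Algebra.TensorProduct.tmul_mul_tmul, Algebra.TensorProduct.tmul_mul_tmul,
        ext_mul_comm ha hb, mul_comm f g, TensorProduct.tmul_smul]

theorem d_tmul {n : ℕ} (f : MvPolynomial (Fin n) k) (a : ExteriorAlgebra k (Fin n → k)) :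
    d k n (f ⊗ₜ a) = ∑ i, MvPolynomial.pderiv i f ⊗ₜ[k]
      (ExteriorAlgebra.ι k (Pi.single i 1 : Fin n → k) * a) := by
  simp [d, LinearMap.sum_apply]

theorem d_mem_deg {n p : ℕ} {x : PolyForm k n} (hx : x ∈ deg k n p) :
    d k n x ∈ deg k n (p + 1) := by
  induction hx using Submodule.span_induction with
  | zero => simp
  | add x x' _ _ h h' => rw [map_add]; exact add_mem h h'
  | smul c x _ h => rw [map_smul]; exact Submodule.smul_mem _ _ h
  | mem x hx =>
    obtain ⟨f, a, ha, rfl⟩ := hx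
    rw [d_tmul]
    refine sum_mem fun i _ => tmul_mem_deg _ ?_
    rw [ExteriorAlgebra.exteriorPower, pow_succ']
    exact Submodule.mul_mem_mul (LinearMap.mem_range_self _ _) ha

theorem pderiv_comm {n : ℕ} (i j : Fin n) (f : MvPolynomial (Fin n) k) :
    MvPolynomial.pderiv i (MvPolynomial.pderiv j f) =
      MvPolynomial.pderiv j (MvPolynomial.pderiv i f) := by
  have h : ⁅(MvPolynomial.pderiv i : Derivation k (MvPolynomial (Fin n) k) _),
      (MvPolynomial.pderiv j : Derivation k (MvPolynomial (Fin n) k) _)⁆ = 0 := by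
    refine MvPolynomial.derivation_ext fun l => ?_
    classical
    rw [Derivation.commutator_apply]
    simp only [MvPolynomial.pderiv_X, Pi.single_apply]
    split_ifs <;> simp
  have h2 := congrArg (fun D => D f) h
  simpa [Derivation.commutator_apply, sub_eq_zero] using h2

theorem d_d {n : ℕ} (x : PolyForm k n) : d k n (d k n x) = 0 := by
  induction x using TensorProduct.induction_on with
  | zero => simp
  | add x y hx hy => rw [map_add, map_add, hx, hy, add_zero]
  | tmul f a =>
    rw [d_tmul, map_sum]
    simp only [d_tmul]
    set e : Fin n → ExteriorAlgebra k (Fin n → k) :=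
      fun i => ExteriorAlgebra.ι k (Pi.single i 1 : Fin n → k) with he
    have key : ∀ i j : Fin n,
        MvPolynomial.pderiv j (MvPolynomial.pderiv i f) ⊗ₜ[k] (e j * (e i * a)) +
        MvPolynomial.pderiv i (MvPolynomial.pderiv j f) ⊗ₜ[k] (e i * (e j * a)) = 0 := by
      intro i j
      rw [pderiv_comm j i, ← TensorProduct.tmul_add, ← mul_assoc, ← mul_assoc, ← add_mul,
        ExteriorAlgebra.ι_add_mul_swap, zero_mul, TensorProduct.tmul_zero]
    have diag : ∀ i : Fin n, e i * (e i * a) = 0 := by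
      intro i
      rw [← mul_assoc, ExteriorAlgebra.ι_sq_zero, zero_mul]
    rw [← Finset.sum_product' Finset.univ Finset.univ
      (fun i j => MvPolynomial.pderiv j (MvPolynomial.pderiv i f) ⊗ₜ[k] (e j * (e i * a)))]
    refine Finset.sum_involution (fun p _ => (p.2, p.1)) ?_ ?_ ?_ ?_
    · intro p _
      exact key p.1 p.2
    · rintro ⟨i, j⟩ _ hne heq
      apply hne
      have : j = i := congrArg Prod.fst heq
      subst this
      simp only [diag, TensorProduct.tmul_zero]
    · intros; simp
    · intros; rfl

theorem d_mul {n p : ℕ} {x : PolyForm k n} (hx : x ∈ deg k n p) (y : PolyForm k n) :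
    d k n (x * y) = d k n x * y + (-1 : k) ^ p • (x * d k n y) := by
  induction hx using Submodule.span_induction with
  | zero => simp
  | add x x' _ _ h h' =>
    rw [add_mul, map_add, h, h', map_add, add_mul, add_mul, smul_add]; abel
  | smul c x _ h =>
    rw [smul_mul_assoc, map_smul, h, map_smul, smul_mul_assoc, smul_mul_assoc, smul_add,
      smul_comm c]
  | mem x hx =>
    obtain ⟨f, a, ha, rfl⟩ := hx
    induction y using TensorProduct.induction_on with
    | zero => simp
    | add y y' h h' => rw [mul_add, map_add, h, h', map_add, mul_add, mul_add, smul_add]; abel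
    | tmul g b =>
      rw [Algebra.TensorProduct.tmul_mul_tmul, d_tmul, d_tmul, d_tmul, Finset.sum_mul,
        Finset.mul_sum, Finset.smul_sum, ← Finset.sum_add_distrib]
      refine Finset.sum_congr rfl fun i _ => ?_
      rw [Algebra.TensorProduct.tmul_mul_tmul, Algebra.TensorProduct.tmul_mul_tmul,
        MvPolynomial.pderiv_mul, TensorProduct.add_tmul, mul_assoc, ← mul_assoc a,
        ← TensorProduct.tmul_smul, ← smul_mul_assoc, ← ι_mul_comm _ ha, mul_assoc]

theorem pderiv_bary {m : ℕ} (l : Fin m) (i : Fin (m + 1)) :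
    MvPolynomial.pderiv l (bary k m i) = MvPolynomial.C (dbary k m i l) := by
  classical
  refine Fin.cases ?_ (fun j => ?_) i
  · simp [bary, dbary, MvPolynomial.pderiv_X, Pi.single_apply]
  · by_cases h : l = j
    · subst h; simp [bary, dbary]
    · simp [bary, dbary, MvPolynomial.pderiv_X, h, Ne.symm h]

theorem pullback_d {m n : ℕ} (θ : Fin (m + 1) → Fin (n + 1)) (x : PolyForm k n) :
    pullback k θ (d k n x) = d k m (pullback k θ x) := by
  induction x using TensorProduct.induction_on with
  | zero => simp
  | add x y hx hy => simp only [map_add, hx, hy]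
  | tmul f a =>
    set φ : MvPolynomial (Fin n) k →ₐ[k] MvPolynomial (Fin m) k :=
      MvPolynomial.aeval fun j : Fin n => ∑ i with θ i = j.succ, bary k m i with hφ
    set c : Fin n → Fin m → k := fun j => ∑ i with θ i = j.succ, dbary k m i with hc
    have chain : ∀ (l : Fin m) (f : MvPolynomial (Fin n) k),
        MvPolynomial.pderiv l (φ f) = ∑ j, c j l • φ (MvPolynomial.pderiv j f) := by
      intro l f
      classical
      induction f using MvPolynomial.induction_on with
      | C r => simp [MvPolynomial.algebraMap_eq]
      | add f g hf hg => simp only [map_add, hf, hg, smul_add, Finset.sum_add_distrib]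
      | mul_X f j hf =>
        have hX : MvPolynomial.pderiv l (φ (MvPolynomial.X j)) = MvPolynomial.C (c j l) := by
          simp only [hφ, MvPolynomial.aeval_X, map_sum, pderiv_bary, hc, Finset.sum_apply]
        rw [map_mul, MvPolynomial.pderiv_mul, hf, hX]
        simp only [MvPolynomial.pderiv_mul, map_add, map_mul, smul_add, Finset.sum_add_distrib,
          Finset.sum_mul, smul_mul_assoc]
        congr 1
        rw [Finset.sum_eq_single j]
        · simp [MvPolynomial.smul_eq_C_mul, mul_comm]
        · intro b _ hb
          rw [MvPolynomial.pderiv_X_of_ne hb.symm]; simp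
        · simp
    have hp : ∀ (g : MvPolynomial (Fin n) k) (b : ExteriorAlgebra k (Fin n → k)),
        pullback k θ (g ⊗ₜ b) =
          φ g ⊗ₜ ExteriorAlgebra.map (Fintype.linearCombination k c) b := fun g b => rfl
    rw [hp, d_tmul, d_tmul, map_sum]
    simp only [hp, map_mul, ExteriorAlgebra.map_apply_ι, chain, TensorProduct.sum_tmul]
    rw [Finset.sum_comm]
    refine Finset.sum_congr rfl fun j _ => ?_
    have hcj : Fintype.linearCombination k c (Pi.single j 1) =
        ∑ l, c j l • (Pi.single l 1 : Fin m → k) := by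
      classical
      rw [Fintype.linearCombination_apply_single, one_smul]
      ext l
      simp [Finset.sum_apply, Pi.single_apply]
    rw [hcj, map_sum, Finset.sum_mul, TensorProduct.tmul_sum]
    refine Finset.sum_congr rfl fun l _ => ?_
    rw [map_smul, smul_mul_assoc, TensorProduct.tmul_smul, TensorProduct.smul_tmul']

end PolyForm

/-! ### Sullivan's algebra of piecewise polynomial forms -/

section Sullivan

variable (k : Type) [Field k]

open CategoryTheory in
/-- The piecewise polynomial `p`-forms on a simplicial set `K`: the families of polynomial
`p`-forms, one for each simplex of `K`, which are compatible with the faces and degeneracies. -/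
def SSet.plForms (K : SSet.{u}) (p : ℕ) :
    Submodule k (∀ n : ℕ, K.obj (Opposite.op (SimplexCategory.mk n)) → PolyForm k n) where
  carrier := {ω | (∀ n σ, ω n σ ∈ PolyForm.deg k n p) ∧
    ∀ (m n : ℕ) (θ : SimplexCategory.mk m ⟶ SimplexCategory.mk n)
      (σ : K.obj (Opposite.op (SimplexCategory.mk n))),
      ω m (K.map θ.op σ) = PolyForm.pullback k θ.toOrderHom (ω n σ)}
  zero_mem' := ⟨fun _ _ => zero_mem _, fun _ _ _ _ => (map_zero _).symm⟩
  add_mem' := fun {a b} ha hb => ⟨fun n σ => add_mem (ha.1 n σ) (hb.1 n σ), fun m n θ σ => by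
    simp only [Pi.add_apply, map_add, ha.2 m n θ σ, hb.2 m n θ σ]⟩
  smul_mem' := fun c a ha => ⟨fun n σ => Submodule.smul_mem _ _ (ha.1 n σ), fun m n θ σ => by
    simp only [Pi.smul_apply, map_smul, ha.2 m n θ σ]⟩

/-- The cdga of piecewise polynomial forms, with coefficients in `k`, on a simplicial set. -/
noncomputable def SSet.plCDGA (K : SSet.{u}) : CDGA.{u, 0} k where
  carrier p := K.plForms k p
  mul {i j l} h := LinearMap.mk₂ k
    (fun a b => ⟨fun n σ => a.1 n σ * b.1 n σ,
      fun n σ => PolyForm.mul_mem_deg h (a.2.1 n σ) (b.2.1 n σ), fun m n θ σ => by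
        exact (congrArg₂ (· * ·) (a.2.2 m n θ σ) (b.2.2 m n θ σ)).trans (map_mul _ _ _).symm⟩)
    (fun a a' b => Subtype.ext (funext fun n => funext fun σ => add_mul _ _ _))
    (fun c a b => Subtype.ext (funext fun n => funext fun σ =>
      smul_mul_assoc c (a.1 n σ) (b.1 n σ)))
    (fun a b b' => Subtype.ext (funext fun n => funext fun σ => mul_add _ _ _))
    (fun c a b => Subtype.ext (funext fun n => funext fun σ =>
      mul_smul_comm c (a.1 n σ) (b.1 n σ)))
  one := ⟨fun _ _ => 1, fun n _ => PolyForm.one_mem_deg n, fun _ _ _ _ => (map_one _).symm⟩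
  one_mul' a := Subtype.ext (funext fun n => funext fun σ => one_mul _)
  mul_one' a := Subtype.ext (funext fun n => funext fun σ => mul_one _)
  mul_assoc' _ _ _ _ a b c := Subtype.ext (funext fun n => funext fun σ => mul_assoc _ _ _)
  mul_comm' {i j _} _ _ a b := Subtype.ext (funext fun n => funext fun σ => by
    simpa using PolyForm.mul_comm_deg (a.2.1 n σ) (b.2.1 n σ))
  d p :=
    { toFun := fun a => ⟨fun n σ => PolyForm.d k n (a.1 n σ),
        fun n σ => PolyForm.d_mem_deg (a.2.1 n σ), fun m n θ σ => by
          exact (congrArg _ (a.2.2 m n θ σ)).trans (PolyForm.pullback_d _ _).symm⟩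
      map_add' := fun a b => Subtype.ext (funext fun n => funext fun σ => map_add _ _ _)
      map_smul' := fun c a => Subtype.ext (funext fun n => funext fun σ =>
        (PolyForm.d k n).map_smul c (a.1 n σ)) }
  d_d a := Subtype.ext (funext fun n => funext fun σ => PolyForm.d_d _)
  leibniz _ _ _ a b := Subtype.ext (funext fun n => funext fun σ =>
    PolyForm.d_mul (a.2.1 n σ) _)

end Sullivan

/-- Sullivan's algebra `Ω(X)` of piecewise polynomial, complex-valued forms on a topological space:
the piecewise polynomial forms on its singular simplicial set. -/
noncomputable def sullivanForms (X : Type u) [TopologicalSpace X] : CDGA.{u, 0} ℂ :=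
  (TopCat.toSSet.obj (TopCat.of X)).plCDGA ℂ

/-! ### Finiteness properties of spaces and classifying spaces of groups -/

open scoped ContinuousMap Topology in
/-- A path-connected space is `q`-finite if it is homotopy equivalent to a CW-complex with finite
`q`-skeleton. -/
def IsQFiniteSpace (q : ℕ) (X : Type u) [TopologicalSpace X] : Prop :=
  PathConnectedSpace X ∧
    ∃ (Y : Type u) (_ : TopologicalSpace Y) (_ : T2Space Y)
      (_ : Topology.CWComplex (Set.univ : Set Y)),
      (∀ n ≤ q, Finite (Topology.CWComplex.cell (Set.univ : Set Y) n)) ∧ Nonempty (X ≃ₕ Y)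

open scoped ContinuousMap Topology in
/-- A CW-space: a path-connected space with the homotopy type of a CW-complex. -/
def IsCWSpace (X : Type u) [TopologicalSpace X] : Prop :=
  PathConnectedSpace X ∧
    ∃ (Y : Type u) (_ : TopologicalSpace Y) (_ : T2Space Y)
      (_ : Topology.CWComplex (Set.univ : Set Y)), Nonempty (X ≃ₕ Y)

open scoped Topology in
/-- `X` is a classifying space `K(π, 1)` of the group `π`: a CW-space with fundamental group `π`
and vanishing higher homotopy groups. -/
def IsClassifyingSpace (π : Type w) [Group π] (X : Type u) [TopologicalSpace X] : Prop :=
  IsCWSpace X ∧ ∀ x : X, Nonempty (FundamentalGroup X x ≃* π) ∧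
    ∀ n : ℕ, 2 ≤ n → Subsingleton (HomotopyGroup.Pi n X x)

/-!
A `q`-equivalence from the minimal model to `Ω(X)` is injective on cohomology in degrees at most
`q + 1`, so the minimal model inherits finiteness from any algebra into which it maps in this way.
The finiteness hypotheses give two such targets.

*A `q`-finite model `A`.* Maps from a minimal algebra lift, up to homotopy, along `q`-equivalences
(`CDGA.IsQMinimal.exists_lift_of_isQEquivalence`). They are constructed generator by generator
(`CDGA.IsQMinimal.exists_lift`), and the homotopies are strict maps to the algebra of polynomial
paths `D[t, dt]`. Hence a `q`-equivalence from the minimal model travels along the zig-zag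
(`CDGA.SameQType.exists_isQEquivalence_iff`) and ends in `A`. In degree `q + 1`, where `A` need not
be finite-dimensional, a minimal algebra has no generators: all of its elements are sums of products
of elements of degree at most `q` (`CDGA.IsQMinimal.le_span_mul`), and their images lie in the
finite-dimensional space spanned by such products in `A`
(`CDGA.IsQFinite.finiteDimensional_cohomology`).

*Finite-dimensional homology of `X`.* Homology is that of normalized singular cubes, and
`Cubical.FinHom n X` says that it is finite-dimensional in degree `n`. For a complex with finite
`N`-skeleton this holds up to degree `N` (`Cubical.finHom_of_isQFiniteSpace`): Mayer–Vietoris, which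
rests on the subdivision of cubes, is applied to the attachment of one cell at a time, and every
cycle lives on a finite subcomplex. For an aspherical space with finitely presented fundamental
group it holds in degree two (`Cubical.finHom_two_of_isFinitelyPresented`), without a cell structure.
Let `C` and `B` be the spaces of two-chains and of two-boundaries. Paths together with an element of
`C / B`, modulo homotopies and the squares which these sweep out, form a groupoid. As `π₂` vanishes,
its vertex group is an extension of `π₁` by `C / B`. Lifting the generators of a finite presentation
turns each of the finitely many relators into an element of `C / B`, and the extension splits modulo
the span `N` of these elements. The splitting defines a map from one-chains to `(C / B) / N` whose
composite with the boundary map is the projection; hence every two-cycle lies in `N` modulo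
boundaries.

Finiteness passes from homology to `H(Ω(X))` (`Cubical.FinHom.finiteDimensional_cohomology`) because
a closed form whose integrals over cubical cycles vanish is exact
(`Cubical.mem_coboundaries_sullivanForms`). The integrals of the form over singular simplices form a
simplicial cocycle. Its extension to cubes, through their triangulation, is a coboundary on cubical
chains by linear algebra. Composing simplices with the collapse of the cube onto the simplex brings
this back: the simplicial cocycle is the coboundary of a simplicial cochain
(`Cubical.exists_coboundary`), which can be taken to vanish on degenerate simplices
(`SSet.exists_normalized`). Finally, on each simplex a closed form differs from the Whitney form of
its integrals by the differential of a form which depends naturally on the simplex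
(`PolyForm.eq_d_sop_add_whitney`), and Whitney forms turn the simplicial cochain into a primitive of
the remaining term (`SSet.exists_primitive`).
-/

/-! ### Normalized cubical singular chains -/

namespace Cubical

open scoped unitInterval

variable {X Y Z : Type*} [TopologicalSpace X] [TopologicalSpace Y] [TopologicalSpace Z]

/-- A singular cube is degenerate if it does not depend on one of its coordinates. -/
def IsDegenerate {n : ℕ} (s : C(Fin n → I, X)) : Prop :=
  ∃ j, ∀ x y : Fin n → I, (∀ i, i ≠ j → x i = y i) → s x = s y

/-- The span of the degenerate singular cubes. -/
noncomputable def degenerate (n : ℕ) (X : Type*) [TopologicalSpace X] :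
    Submodule ℂ (C(Fin n → I, X) →₀ ℂ) :=
  Submodule.span ℂ ((fun s => Finsupp.single s 1) '' {s | IsDegenerate s})

/-- The normalized cubical singular `n`-chains of `X` with complex coefficients. -/
abbrev Chain (n : ℕ) (X : Type*) [TopologicalSpace X] : Type _ :=
  (C(Fin n → I, X) →₀ ℂ) ⧸ degenerate n X

/-- The chain given by a singular cube. -/
noncomputable def cube {n : ℕ} (s : C(Fin n → I, X)) : Chain n X :=
  (degenerate n X).mkQ (Finsupp.single s 1)

theorem cube_eq_zero {n : ℕ} {s : C(Fin n → I, X)} (h : IsDegenerate s) : cube s = 0 :=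
  (Submodule.Quotient.mk_eq_zero _).2 (Submodule.subset_span ⟨s, h, rfl⟩)

section Lift

variable {M : Type*} [AddCommGroup M] [Module ℂ M]

/-- The linear map on chains with prescribed values on cubes. -/
noncomputable def lift {n : ℕ} (f : C(Fin n → I, X) → M) (hf : ∀ s, IsDegenerate s → f s = 0) :
    Chain n X →ₗ[ℂ] M :=
  (degenerate n X).liftQ (Finsupp.linearCombination ℂ f) <| by
    rw [degenerate, Submodule.span_le]
    rintro _ ⟨s, hs, rfl⟩
    simp [hf s hs]

@[simp]
theorem lift_cube {n : ℕ} (f : C(Fin n → I, X) → M) (hf) (s : C(Fin n → I, X)) :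
    lift f hf (cube s) = f s := by
  simp [lift, cube]

theorem hom_ext {n : ℕ} {f g : Chain n X →ₗ[ℂ] M} (h : ∀ s, f (cube s) = g (cube s)) : f = g := by
  refine Submodule.linearMap_qext _ (Finsupp.lhom_ext' fun s => LinearMap.ext_ring ?_)
  exact h s

end Lift

theorem span_cube (n : ℕ) : Submodule.span ℂ (Set.range (cube : C(Fin n → I, X) → Chain n X)) = ⊤ := by
  rw [eq_top_iff]
  rintro c -
  obtain ⟨c, rfl⟩ := (degenerate n X).mkQ_surjective c
  induction c using Finsupp.induction_linear with
  | zero => simp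
  | add a b ha hb => rw [map_add]; exact add_mem ha hb
  | single s r =>
    have : Finsupp.single s r = r • Finsupp.single s (1 : ℂ) := by simp
    rw [this, map_smul]
    exact Submodule.smul_mem _ _ (Submodule.subset_span ⟨s, rfl⟩)

@[elab_as_elim]
theorem chain_induction {n : ℕ} {p : Chain n X → Prop} (c : Chain n X) (zero : p 0)
    (add : ∀ a b, p a → p b → p (a + b)) (smul : ∀ (r : ℂ) a, p a → p (r • a))
    (cube : ∀ s, p (cube s)) : p c := by
  have hc : c ∈ Submodule.span ℂ (Set.range (Cubical.cube : C(Fin n → I, X) → Chain n X)) := by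
    rw [span_cube]; trivial
  induction hc using Submodule.span_induction with
  | zero => exact zero
  | add a b _ _ ha hb => exact add a b ha hb
  | smul r a _ ha => exact smul r a ha
  | mem x hx => obtain ⟨s, rfl⟩ := hx; exact cube s

/-- The inclusion of the face `x_j = e` of the cube. -/
def face {n : ℕ} (j : Fin (n + 1)) (e : I) : C(Fin n → I, Fin (n + 1) → I) :=
  ⟨fun x => j.insertNth (α := fun _ => I) e x, by fun_prop⟩

@[simp]
theorem face_apply_same {n : ℕ} (j : Fin (n + 1)) (e : I) (x : Fin n → I) : face j e x j = e := by
  simp [face]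

@[simp]
theorem face_apply_succAbove {n : ℕ} (j : Fin (n + 1)) (e : I) (x : Fin n → I) (i : Fin n) :
    face j e x (j.succAbove i) = x i := by
  simp [face]

theorem eq_face_iff {n : ℕ} {j : Fin (n + 1)} {e : I} {x : Fin n → I} {y : Fin (n + 1) → I} :
    y = face j e x ↔ y j = e ∧ ∀ i, y (j.succAbove i) = x i := by
  refine (Fin.eq_insertNth_iff (α := fun _ => I)).trans ?_
  rw [funext_iff]; rfl

theorem face_face {n : ℕ} (j : Fin (n + 2)) (i : Fin (n + 1)) (e f : I) :
    (face j e).comp (face i f) = (face (j.succAbove i) f).comp (face (i.predAbove j) e) := by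
  ext1 x
  simp only [ContinuousMap.comp_apply]
  refine eq_face_iff.2 ⟨by simp, fun k => ?_⟩
  induction k using Fin.succAboveCases (i.predAbove j) with
  | x => rw [Fin.succAbove_succAbove_predAbove]; simp
  | p k => rw [Fin.succAbove_succAbove_succAbove_predAbove]; simp

theorem IsDegenerate.comp_face {n : ℕ} {s : C(Fin (n + 1) → I, X)} {j₀ : Fin (n + 1)}
    (h : ∀ x y : Fin (n + 1) → I, (∀ i, i ≠ j₀ → x i = y i) → s x = s y)
    {j : Fin (n + 1)} (hj : j ≠ j₀) (e : I) : IsDegenerate (s.comp (face j e)) := by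
  obtain ⟨i, rfl⟩ := Fin.exists_succAbove_eq hj.symm
  refine ⟨i, fun x y hxy => h _ _ fun k hk => ?_⟩
  induction k using Fin.succAboveCases j with
  | x => simp
  | p k => simpa using hxy k fun h => hk (h ▸ rfl)

/-- The boundary operator of cubical chains. -/
noncomputable def bd (n : ℕ) : Chain (n + 1) X →ₗ[ℂ] Chain n X :=
  lift (fun s => ∑ j : Fin (n + 1), (-1 : ℂ) ^ (j : ℕ) •
    (cube (s.comp (face j 1)) - cube (s.comp (face j 0)))) <| by
    rintro s ⟨j₀, h⟩
    refine Finset.sum_eq_zero fun j _ => ?_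
    by_cases hj : j = j₀
    · subst hj
      have : s.comp (face j 1) = s.comp (face j 0) := by
        ext x
        refine h _ _ fun i hi => ?_
        obtain ⟨i, rfl⟩ := Fin.exists_succAbove_eq hi
        simp
      simp [this]
    · rw [cube_eq_zero (IsDegenerate.comp_face h hj 1), cube_eq_zero (IsDegenerate.comp_face h hj 0)]
      simp

theorem bd_cube {n : ℕ} (s : C(Fin (n + 1) → I, X)) :
    bd n (cube s) = ∑ j : Fin (n + 1), (-1 : ℂ) ^ (j : ℕ) •
      (cube (s.comp (face j 1)) - cube (s.comp (face j 0))) :=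
  lift_cube _ _ _

theorem bd_bd {n : ℕ} (c : Chain (n + 2) X) : bd n (bd (n + 1) c) = 0 := by
  induction c using chain_induction with
  | zero => simp
  | add a b ha hb => rw [map_add, map_add, ha, hb, add_zero]
  | smul r a ha => rw [map_smul, map_smul, ha, smul_zero]
  | cube s =>
    set F : Fin (n + 2) → Fin (n + 1) → Chain n X := fun j i =>
      (cube (s.comp ((face j 1).comp (face i 1))) - cube (s.comp ((face j 1).comp (face i 0)))) -
      (cube (s.comp ((face j 0).comp (face i 1))) - cube (s.comp ((face j 0).comp (face i 0))))
      with hF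
    have hswap : ∀ j i, F (j.succAbove i) (i.predAbove j) = F j i := by
      intro j i
      simp only [hF, face_face j i]
      abel
    have h : bd n (bd (n + 1) (cube s)) = ∑ p : Fin (n + 2) × Fin (n + 1),
        (-1 : ℂ) ^ (p.1 + p.2 : ℕ) • F p.1 p.2 := by
      rw [bd_cube, map_sum, Fintype.sum_prod_type]
      refine Finset.sum_congr rfl fun j _ => ?_
      rw [map_smul, map_sub, bd_cube, bd_cube, ← Finset.sum_sub_distrib, Finset.smul_sum]
      refine Finset.sum_congr rfl fun i _ => ?_
      rw [← smul_sub, smul_smul, ← pow_add]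
      rfl
    rw [h]
    refine Finset.sum_involution (fun p _ => (p.1.succAbove p.2, p.2.predAbove p.1)) ?_ ?_ ?_ ?_
    · rintro ⟨j, i⟩ -
      simp only [hswap, Fin.neg_one_pow_succAbove_add_predAbove, neg_smul]
      abel
    · rintro ⟨j, i⟩ - _ h
      exact Fin.succAbove_ne j i (congrArg Prod.fst h)
    · intros; exact Finset.mem_univ _
    · rintro ⟨j, i⟩ -
      ext1
      · exact Fin.succAbove_succAbove_predAbove j i
      · simp only
        apply Fin.succAbove_right_injective (p := j)
        have := Fin.succAbove_succAbove_predAbove (j.succAbove i) (i.predAbove j)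
        rwa [Fin.succAbove_succAbove_predAbove j i] at this

/-- The map of chains induced by a continuous map. -/
noncomputable def map {n : ℕ} (f : C(X, Y)) : Chain n X →ₗ[ℂ] Chain n Y :=
  lift (fun s => cube (f.comp s)) fun _ ⟨j, h⟩ =>
    cube_eq_zero ⟨j, fun x y hxy => congrArg f (h x y hxy)⟩

@[simp]
theorem map_cube {n : ℕ} (f : C(X, Y)) (s : C(Fin n → I, X)) : map f (cube s) = cube (f.comp s) :=
  lift_cube _ _ _

theorem map_map {n : ℕ} (g : C(Y, Z)) (f : C(X, Y)) (c : Chain n X) :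
    map g (map f c) = map (g.comp f) c := by
  have : (map g ∘ₗ map f : Chain n X →ₗ[ℂ] _) = map (g.comp f) := hom_ext fun s => by
    simp [ContinuousMap.comp_assoc]
  exact LinearMap.congr_fun this c

theorem map_id {n : ℕ} (c : Chain n X) : map (ContinuousMap.id X) c = c := by
  have : (map (ContinuousMap.id X) : Chain n X →ₗ[ℂ] _) = LinearMap.id := hom_ext fun s => by simp
  exact LinearMap.congr_fun this c

theorem bd_map {n : ℕ} (f : C(X, Y)) (c : Chain (n + 1) X) : bd n (map f c) = map f (bd n c) := by
  have : (bd n ∘ₗ map f : Chain (n + 1) X →ₗ[ℂ] _) = map f ∘ₗ bd n := hom_ext fun s => by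
    simp [bd_cube, ContinuousMap.comp_assoc]
  exact LinearMap.congr_fun this c

/-- The cycles. -/
noncomputable def cycles : ∀ (n : ℕ) (X : Type*) [TopologicalSpace X], Submodule ℂ (Chain n X)
  | 0, _, _ => ⊤
  | n + 1, _, _ => LinearMap.ker (bd n)

/-- The boundaries. -/
noncomputable def boundaries (n : ℕ) (X : Type*) [TopologicalSpace X] : Submodule ℂ (Chain n X) :=
  LinearMap.range (bd n)

theorem mem_cycles_succ {n : ℕ} {c : Chain (n + 1) X} : c ∈ cycles (n + 1) X ↔ bd n c = 0 := Iff.rfl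

theorem bd_mem_cycles {n : ℕ} (c : Chain (n + 1) X) : bd n c ∈ cycles n X := by
  cases n with
  | zero => trivial
  | succ n => exact bd_bd c

theorem boundaries_le_cycles (n : ℕ) : boundaries n X ≤ cycles n X := by
  rintro _ ⟨c, rfl⟩
  exact bd_mem_cycles c

theorem map_mem_cycles {n : ℕ} (f : C(X, Y)) {c : Chain n X} (hc : c ∈ cycles n X) :
    map f c ∈ cycles n Y := by
  cases n with
  | zero => trivial
  | succ n => rw [mem_cycles_succ] at *; rw [bd_map, hc, map_zero]

theorem map_mem_boundaries {n : ℕ} (f : C(X, Y)) {c : Chain n X} (hc : c ∈ boundaries n X) :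
    map f c ∈ boundaries n Y := by
  obtain ⟨b, rfl⟩ := hc
  exact ⟨map f b, bd_map f b⟩

/-! ### Homotopy invariance -/

/-- The value of a homotopy at a fixed time. -/
def slice (H : C(I × X, Y)) (t : I) : C(X, Y) := ⟨fun x => H (t, x), by fun_prop⟩

/-- The prism over a cube, mapped by a homotopy. -/
def prismCube {n : ℕ} (H : C(I × X, Y)) (s : C(Fin n → I, X)) : C(Fin (n + 1) → I, Y) :=
  ⟨fun x => H (x 0, s (fun i => x i.succ)), by fun_prop⟩

/-- The prism operator of a homotopy. -/
noncomputable def prism {n : ℕ} (H : C(I × X, Y)) : Chain n X →ₗ[ℂ] Chain (n + 1) Y :=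
  lift (fun s => cube (prismCube H s)) fun s ⟨j, h⟩ =>
    cube_eq_zero ⟨j.succ, fun x y hxy => by
      have h0 : x 0 = y 0 := hxy 0 (Fin.succ_ne_zero j).symm
      have h1 := h (fun i => x i.succ) (fun i => y i.succ) fun i hi =>
        hxy i.succ fun e => hi (Fin.succ_injective _ e)
      simp [prismCube, h0, h1]⟩

@[simp]
theorem prism_cube {n : ℕ} (H : C(I × X, Y)) (s : C(Fin n → I, X)) :
    prism H (cube s) = cube (prismCube H s) :=
  lift_cube _ _ _

theorem prismCube_comp_face_zero {n : ℕ} (H : C(I × X, Y)) (s : C(Fin n → I, X)) (e : I) :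
    (prismCube H s).comp (face 0 e) = (slice H e).comp s := by
  ext x
  have h0 : face 0 e x 0 = e := face_apply_same _ _ _
  have h1 : ∀ i : Fin n, face 0 e x i.succ = x i := fun i => face_apply_succAbove 0 e x i
  simp [prismCube, slice, h0, h1]

theorem prismCube_comp_face_succ {n : ℕ} (H : C(I × X, Y)) (s : C(Fin (n + 1) → I, X)) (e : I)
    (j : Fin (n + 1)) :
    (prismCube H s).comp (face j.succ e) = prismCube H (s.comp (face j e)) := by
  ext x
  have h0 : face j.succ e x 0 = x 0 := by
    simpa using face_apply_succAbove j.succ e x 0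
  have h1 : (fun i : Fin (n + 1) => face j.succ e x i.succ) = face j e (fun i => x i.succ) := by
    refine eq_face_iff.2 ⟨by simp, fun i => ?_⟩
    rw [← Fin.succ_succAbove_succ, face_apply_succAbove]
  simp [prismCube, h0, h1]

theorem bd_prism_zero (H : C(I × X, Y)) (c : Chain 0 X) :
    bd 0 (prism H c) = map (slice H 1) c - map (slice H 0) c := by
  have : (bd 0 ∘ₗ prism H : Chain 0 X →ₗ[ℂ] _) = map (slice H 1) - map (slice H 0) :=
    hom_ext fun s => by simp [bd_cube, prismCube_comp_face_zero]
  exact LinearMap.congr_fun this c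

theorem bd_prism_succ {n : ℕ} (H : C(I × X, Y)) (c : Chain (n + 1) X) :
    bd (n + 1) (prism H c) = map (slice H 1) c - map (slice H 0) c - prism H (bd n c) := by
  have : (bd (n + 1) ∘ₗ prism H : Chain (n + 1) X →ₗ[ℂ] _) =
      map (slice H 1) - map (slice H 0) - prism H ∘ₗ bd n :=
    hom_ext fun s => by
      simp only [LinearMap.comp_apply, LinearMap.sub_apply, prism_cube, map_cube, bd_cube]
      rw [Fin.sum_univ_succ]
      simp only [prismCube_comp_face_zero, prismCube_comp_face_succ, map_sum, map_smul, map_sub,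
        prism_cube, Fin.val_zero, pow_zero, one_smul, Fin.val_succ, pow_succ, mul_neg, mul_one,
        neg_smul, Finset.sum_neg_distrib]
      abel
  exact LinearMap.congr_fun this c

theorem map_slice_sub_mem_boundaries {n : ℕ} (H : C(I × X, Y)) {c : Chain n X}
    (hc : c ∈ cycles n X) : map (slice H 1) c - map (slice H 0) c ∈ boundaries n Y := by
  refine ⟨prism H c, ?_⟩
  cases n with
  | zero => exact bd_prism_zero H c
  | succ n => rw [bd_prism_succ, mem_cycles_succ.1 hc, map_zero, sub_zero]

theorem map_sub_map_mem_boundaries {n : ℕ} {f g : C(X, Y)} (H : f.Homotopic g) {c : Chain n X}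
    (hc : c ∈ cycles n X) : map g c - map f c ∈ boundaries n Y := by
  obtain ⟨H⟩ := H
  have h0 : slice H.toContinuousMap 0 = f := by ext x; exact H.map_zero_left x
  have h1 : slice H.toContinuousMap 1 = g := by ext x; exact H.map_one_left x
  simpa only [h0, h1] using map_slice_sub_mem_boundaries H.toContinuousMap hc

theorem cube_const {n : ℕ} (x : X) : cube (ContinuousMap.const (Fin (n + 1) → I) x) = 0 :=
  cube_eq_zero ⟨0, fun _ _ _ => rfl⟩

theorem map_const {n : ℕ} (y : Y) (c : Chain (n + 1) X) : map (ContinuousMap.const X y) c = 0 := by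
  have : (map (ContinuousMap.const X y) : Chain (n + 1) X →ₗ[ℂ] _) = 0 := hom_ext fun s => by
    rw [map_cube]; exact cube_const y
  exact LinearMap.congr_fun this c

theorem cycles_le_boundaries_of_contractible [ContractibleSpace X] (n : ℕ) :
    cycles (n + 1) X ≤ boundaries (n + 1) X := by
  intro c hc
  obtain ⟨x, h⟩ := id_nullhomotopic X
  have := map_sub_map_mem_boundaries h.symm hc
  rwa [map_id, map_const, sub_zero] at this

/-- The singular homology of `X` in degree `n` is finite-dimensional. -/
def FinHom (n : ℕ) (X : Type*) [TopologicalSpace X] : Prop :=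
  ∃ W : Submodule ℂ (Chain n X), FiniteDimensional ℂ W ∧ cycles n X ≤ W ⊔ boundaries n X

/-- A space which is dominated by `Y` up to homotopy, in particular a homotopy equivalent one, has
finite-dimensional homology if `Y` does. -/
theorem FinHom.of_dominated {n : ℕ} (f : C(X, Y)) (g : C(Y, X))
    (H : (g.comp f).Homotopic (ContinuousMap.id X)) (h : FinHom n Y) : FinHom n X := by
  obtain ⟨W, hW, hle⟩ := h
  refine ⟨W.map (map g), inferInstance, fun c hc => ?_⟩
  have h1 := map_sub_map_mem_boundaries H hc
  have h2 := hle (map_mem_cycles f hc)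
  rw [map_id, ← map_map] at h1
  obtain ⟨a, ha, b, hb, hab⟩ := Submodule.mem_sup.1 h2
  refine Submodule.mem_sup.2 ⟨map g a, ⟨a, ha, rfl⟩, map g b + (c - map g (map f c)),
    add_mem (map_mem_boundaries g hb) h1, ?_⟩
  rw [← hab, map_add]
  abel

theorem finHom_of_contractible [ContractibleSpace X] (n : ℕ) : FinHom n X := by
  cases n with
  | succ n => exact ⟨⊥, inferInstance, by simpa using cycles_le_boundaries_of_contractible n⟩
  | zero =>
    obtain ⟨x, h⟩ := id_nullhomotopic X
    refine ⟨Submodule.span ℂ {cube (ContinuousMap.const _ x)}, inferInstance, fun c _ => ?_⟩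
    have h1 := map_sub_map_mem_boundaries (n := 0) (c := c) h.symm trivial
    rw [map_id] at h1
    have h2 : map (ContinuousMap.const X x) c ∈
        Submodule.span ℂ {(cube (ContinuousMap.const _ x) : Chain 0 X)} := by
      clear h1
      induction c using chain_induction with
      | zero => simp
      | add a b ha hb => rw [_root_.map_add]; exact add_mem (ha trivial) (hb trivial)
      | smul r a ha => rw [_root_.map_smul]; exact Submodule.smul_mem _ _ (ha trivial)
      | cube s => rw [map_cube]; exact Submodule.subset_span rfl
    exact Submodule.mem_sup.2 ⟨_, h2, _, h1, by abel⟩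

end Cubical

namespace Cubical

open scoped unitInterval

variable {X Y Z : Type*} [TopologicalSpace X] [TopologicalSpace Y] [TopologicalSpace Z]

/-! ### Subdivision -/

/-- A deformation of the unit interval: at time `t`, the interval is mapped affinely onto
`[0, 1 - t / 2]` (for `false`) or onto `[1 - t / 2, 1]` (for `true`). -/
noncomputable def half : Bool → C(I × I, I)
  | false => ⟨fun p => ⟨p.2 * (1 - p.1 / 2), by
      have h1 := p.1.2.1; have h2 := p.1.2.2; have h3 := p.2.2.1; have h4 := p.2.2.2
      constructor <;> nlinarith⟩, by fun_prop⟩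
  | true => ⟨fun p => ⟨(1 - p.1 / 2) + p.2 * (p.1 / 2), by
      have h1 := p.1.2.1; have h2 := p.1.2.2; have h3 := p.2.2.1; have h4 := p.2.2.2
      constructor <;> nlinarith⟩, by fun_prop⟩

theorem half_false_start (x : I) : half false (0, x) = x := by ext; simp [half]

theorem half_true_start (x : I) : half true (0, x) = 1 := by ext; simp [half]

theorem half_false_left (t : I) : half false (t, 0) = 0 := by ext; simp [half]

theorem half_true_right (t : I) : half true (t, 1) = 1 := by ext; simp [half]

theorem half_false_right (t : I) : half false (t, 1) = half true (t, 0) := by ext; simp [half]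

theorem dist_half_end (b : Bool) (x y : I) :
    dist (half b (1, x)) (half b (1, y)) = 2⁻¹ * dist x y := by
  have : |(2⁻¹ : ℝ)| = 2⁻¹ := abs_of_pos (by norm_num)
  rw [Subtype.dist_eq, Subtype.dist_eq, Real.dist_eq, Real.dist_eq, ← this, ← abs_mul]
  cases b <;> (simp only [half, ContinuousMap.coe_mk, Set.Icc.coe_one]; congr 1; ring)

/-- The cylinder of one of the pieces of the subdivision of a cube. -/
noncomputable def cylCube {n : ℕ} (e : Fin n → Bool) (s : C(Fin n → I, X)) :
    C(Fin (n + 1) → I, X) :=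
  ⟨fun x => s fun j => half (e j) (x 0, x j.succ), by fun_prop⟩

/-- The affine map onto one of the `2 ^ n` half-sized subcubes of the `n`-cube. -/
noncomputable def halfMap {n : ℕ} (e : Fin n → Bool) : C(Fin n → I, Fin n → I) :=
  ⟨fun x j => half (e j) (1, x j), by fun_prop⟩

theorem IsDegenerate.comp_halfMap {n : ℕ} {s : C(Fin n → I, X)} (h : IsDegenerate s)
    (e : Fin n → Bool) : IsDegenerate (s.comp (halfMap e)) := by
  obtain ⟨j, h⟩ := h
  refine ⟨j, fun x y hxy => h _ _ fun i hi => ?_⟩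
  simp [halfMap, hxy i hi]

/-- The subdivision operator. -/
noncomputable def subdiv {n : ℕ} : Chain n X →ₗ[ℂ] Chain n X :=
  lift (fun s => ∑ e : Fin n → Bool, cube (s.comp (halfMap e))) fun _ h =>
    Finset.sum_eq_zero fun e _ => cube_eq_zero (h.comp_halfMap e)

/-- The chain homotopy between the identity and the subdivision operator. -/
noncomputable def subdivHomotopy {n : ℕ} : Chain n X →ₗ[ℂ] Chain (n + 1) X :=
  lift (fun s => ∑ e : Fin n → Bool, cube (cylCube e s)) fun s ⟨j, h⟩ =>
    Finset.sum_eq_zero fun e _ => cube_eq_zero ⟨j.succ, fun x y hxy => h _ _ fun i hi => by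
      rw [hxy 0 (Fin.succ_ne_zero j).symm, hxy i.succ fun h => hi (Fin.succ_injective _ h)]⟩

theorem subdiv_cube {n : ℕ} (s : C(Fin n → I, X)) :
    subdiv (cube s) = ∑ e : Fin n → Bool, cube (s.comp (halfMap e)) :=
  lift_cube _ _ _

theorem subdivHomotopy_cube {n : ℕ} (s : C(Fin n → I, X)) :
    subdivHomotopy (cube s) = ∑ e : Fin n → Bool, cube (cylCube e s) :=
  lift_cube _ _ _

theorem cylCube_face_zero {n : ℕ} (e : Fin n → Bool) (s : C(Fin n → I, X)) (t : I) (x : Fin n → I) :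
    (cylCube e s).comp (face 0 t) x = s fun j => half (e j) (t, x j) := by
  have h0 : face 0 t x 0 = t := face_apply_same _ _ _
  have h1 : ∀ i : Fin n, face 0 t x i.succ = x i := fun i => face_apply_succAbove 0 t x i
  simp [cylCube, h0, h1]

/-- At the start of the deformation, all pieces but one are degenerate. -/
theorem sum_cylCube_face_zero_zero {n : ℕ} (s : C(Fin n → I, X)) :
    ∑ e : Fin n → Bool, cube ((cylCube e s).comp (face 0 0)) = cube s := by
  rw [Finset.sum_eq_single fun _ => false]
  · congr 1
    ext x
    rw [cylCube_face_zero]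
    simp [half_false_start]
  · intro e _ he
    obtain ⟨j, hj⟩ : ∃ j, e j = true := by
      by_contra! h
      exact he (funext fun j => by simpa using h j)
    refine cube_eq_zero ⟨j, fun x y hxy => ?_⟩
    rw [cylCube_face_zero, cylCube_face_zero]
    congr 1
    funext i
    by_cases hi : i = j
    · subst hi; rw [hj, half_true_start, half_true_start]
    · rw [hxy i hi]
  · simp

theorem cylCube_face_succ {n : ℕ} (b : Bool) (e : Fin n → Bool) (s : C(Fin (n + 1) → I, X))
    (j : Fin (n + 1)) (c : I) (x : Fin (n + 1) → I) :
    (cylCube (j.insertNth (α := fun _ => Bool) b e) s).comp (face j.succ c) x =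
      s (face j (half b (x 0, c)) fun i => half (e i) (x 0, x i.succ)) := by
  have h0 : face j.succ c x 0 = x 0 := by simpa using face_apply_succAbove j.succ c x 0
  simp only [cylCube, ContinuousMap.comp_apply, ContinuousMap.coe_mk]
  congr 1
  refine eq_face_iff.2 ⟨?_, fun i => ?_⟩
  · simp [h0]
  · rw [← Fin.succ_succAbove_succ, face_apply_succAbove]
    simp [h0]

/-- The inner walls of the subdivided cylinder cancel, and the outer walls are the cylinders over
the faces. -/
theorem sum_cylCube_face_succ {n : ℕ} (s : C(Fin (n + 1) → I, X)) (j : Fin (n + 1)) :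
    ∑ e : Fin (n + 1) → Bool, (cube ((cylCube e s).comp (face j.succ 1)) -
      cube ((cylCube e s).comp (face j.succ 0))) =
    subdivHomotopy (cube (s.comp (face j 1))) - subdivHomotopy (cube (s.comp (face j 0))) := by
  rw [← (Fin.insertNthEquiv (fun _ => Bool) j).sum_comp, Fintype.sum_prod_type, Fintype.sum_bool,
    subdivHomotopy_cube, subdivHomotopy_cube, ← Finset.sum_add_distrib, ← Finset.sum_sub_distrib]
  refine Finset.sum_congr rfl fun e _ => ?_
  have h1 : (cylCube (j.insertNth (α := fun _ => Bool) true e) s).comp (face j.succ 1) =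
      cylCube e (s.comp (face j 1)) := by
    ext x; rw [cylCube_face_succ, half_true_right]; rfl
  have h2 : (cylCube (j.insertNth (α := fun _ => Bool) false e) s).comp (face j.succ 0) =
      cylCube e (s.comp (face j 0)) := by
    ext x; rw [cylCube_face_succ, half_false_left]; rfl
  have h3 : (cylCube (j.insertNth (α := fun _ => Bool) false e) s).comp (face j.succ 1) =
      (cylCube (j.insertNth (α := fun _ => Bool) true e) s).comp (face j.succ 0) := by
    ext x; rw [cylCube_face_succ, cylCube_face_succ, half_false_right]
  change cube ((cylCube (j.insertNth (α := fun _ => Bool) true e) s).comp (face j.succ 1)) -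
    cube ((cylCube (j.insertNth (α := fun _ => Bool) true e) s).comp (face j.succ 0)) +
    (cube ((cylCube (j.insertNth (α := fun _ => Bool) false e) s).comp (face j.succ 1)) -
    cube ((cylCube (j.insertNth (α := fun _ => Bool) false e) s).comp (face j.succ 0))) = _
  rw [h1, h2, h3]
  abel

theorem bd_subdivHomotopy_zero (c : Chain 0 X) : bd 0 (subdivHomotopy c) = subdiv c - c := by
  have : (bd 0 ∘ₗ subdivHomotopy : Chain 0 X →ₗ[ℂ] _) = subdiv - LinearMap.id := hom_ext fun s => by
    simp only [LinearMap.comp_apply, LinearMap.sub_apply, LinearMap.id_apply, subdiv_cube]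
    rw [subdivHomotopy_cube, map_sum]
    simp only [bd_cube, Fin.sum_univ_succ, Fin.sum_univ_zero, add_zero, Fin.val_zero, pow_zero,
      one_smul, Finset.sum_sub_distrib]
    rw [sum_cylCube_face_zero_zero]
    congr 1
  exact LinearMap.congr_fun this c

theorem bd_subdivHomotopy_succ {n : ℕ} (c : Chain (n + 1) X) :
    bd (n + 1) (subdivHomotopy c) = subdiv c - c - subdivHomotopy (bd n c) := by
  have : (bd (n + 1) ∘ₗ subdivHomotopy : Chain (n + 1) X →ₗ[ℂ] _) =
      subdiv - LinearMap.id - subdivHomotopy ∘ₗ bd n := hom_ext fun s => by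
    simp only [LinearMap.comp_apply, LinearMap.sub_apply, LinearMap.id_apply, subdiv_cube]
    rw [subdivHomotopy_cube, map_sum]
    simp only [bd_cube]
    rw [Finset.sum_comm, Fin.sum_univ_succ, map_sum, sub_eq_add_neg _ (∑ j, _),
      ← Finset.sum_neg_distrib]
    congr 1
    · simp only [Fin.val_zero, pow_zero, one_smul, Finset.sum_sub_distrib]
      rw [sum_cylCube_face_zero_zero]
      congr 1
    · refine Finset.sum_congr rfl fun j _ => ?_
      rw [← Finset.smul_sum, sum_cylCube_face_succ, map_smul, map_sub, Fin.val_succ, pow_succ,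
        mul_neg, mul_one, neg_smul]
  exact LinearMap.congr_fun this c

theorem subdiv_sub_mem_boundaries {n : ℕ} {c : Chain n X} (hc : c ∈ cycles n X) :
    subdiv c - c ∈ boundaries n X := by
  refine ⟨subdivHomotopy c, ?_⟩
  cases n with
  | zero => exact bd_subdivHomotopy_zero c
  | succ n => rw [bd_subdivHomotopy_succ, mem_cycles_succ.1 hc, map_zero, sub_zero]

theorem iterate_subdiv_sub_mem_boundaries {n : ℕ} {c : Chain n X} (hc : c ∈ cycles n X) (k : ℕ) :
    (subdiv ^ k) c - c ∈ boundaries n X := by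
  induction k with
  | zero => simp
  | succ k ih =>
    have h1 : (subdiv ^ k) c ∈ cycles n X := by
      have := add_mem (boundaries_le_cycles n ih) hc
      rwa [sub_add_cancel] at this
    have := add_mem (subdiv_sub_mem_boundaries h1) ih
    rw [pow_succ', Module.End.mul_apply]
    simpa using this

/-! ### Small chains and the Mayer–Vietoris decomposition -/

/-- The chains which are sums of cubes each of which lies in `U` or in `V`. -/
noncomputable def small (n : ℕ) (U V : Set X) : Submodule ℂ (Chain n X) :=
  Submodule.span ℂ (cube '' {s | Set.range s ⊆ U ∨ Set.range s ⊆ V})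

theorem subdiv_mem_small {n : ℕ} {U V : Set X} {c : Chain n X} (hc : c ∈ small n U V) :
    subdiv c ∈ small n U V := by
  induction hc using Submodule.span_induction with
  | zero => simp
  | add a b _ _ ha hb => rw [map_add]; exact add_mem ha hb
  | smul r a _ ha => rw [map_smul]; exact Submodule.smul_mem _ _ ha
  | mem x hx =>
    obtain ⟨s, hs, rfl⟩ := hx
    rw [subdiv_cube]
    refine sum_mem fun e _ => Submodule.subset_span ⟨_, ?_, rfl⟩
    have : Set.range (s.comp (halfMap e)) ⊆ Set.range s := by
      rintro _ ⟨x, rfl⟩; exact ⟨_, rfl⟩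
    exact hs.imp this.trans this.trans

theorem dist_halfMap_le {n : ℕ} (e : Fin n → Bool) (x y : Fin n → I) :
    dist (halfMap e x) (halfMap e y) ≤ 2⁻¹ * dist x y := by
  refine (dist_pi_le_iff (by positivity)).2 fun j => ?_
  refine (dist_half_end _ _ _).le.trans ?_
  gcongr
  exact dist_le_pi_dist x y j

/-- The cubes of the `k`-th subdivision of `s` are composites of `s` with maps which shrink
distances by `2 ^ k`. -/
theorem iterate_subdiv_cube_mem {n : ℕ} (s : C(Fin n → I, X)) (k : ℕ) :
    (subdiv ^ k) (cube s) ∈ Submodule.span ℂ ((fun a : C(Fin n → I, Fin n → I) => cube (s.comp a)) ''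
      {a | ∀ x y, dist (a x) (a y) ≤ (2⁻¹ : ℝ) ^ k * dist x y}) := by
  induction k with
  | zero =>
    refine Submodule.subset_span ⟨ContinuousMap.id _, fun x y => by simp, ?_⟩
    simp
  | succ k ih =>
    rw [pow_succ' subdiv, Module.End.mul_apply]
    generalize (subdiv ^ k) (cube s) = c at ih
    induction ih using Submodule.span_induction with
    | zero => simp
    | add a b _ _ ha hb => rw [map_add]; exact add_mem ha hb
    | smul r a _ ha => rw [map_smul]; exact Submodule.smul_mem _ _ ha
    | mem x hx =>
      obtain ⟨a, ha, rfl⟩ := hx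
      simp only [subdiv_cube]
      refine sum_mem fun e _ => Submodule.subset_span ⟨a.comp (halfMap e), fun x y => ?_, rfl⟩
      refine (ha _ _).trans ?_
      rw [pow_succ, mul_assoc]
      gcongr
      exact dist_halfMap_le e x y

/-- Iterated subdivision makes every chain small with respect to an open cover, by the Lebesgue
number lemma. -/
theorem exists_iterate_subdiv_mem_small {n : ℕ} {U V : Set X} (hU : IsOpen U) (hV : IsOpen V)
    (h : U ∪ V = Set.univ) (c : Chain n X) : ∃ k, ∀ m, k ≤ m → (subdiv ^ m) c ∈ small n U V := by
  suffices H : ∃ k, (subdiv ^ k) c ∈ small n U V by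
    obtain ⟨k, hk⟩ := H
    refine ⟨k, fun m hm => ?_⟩
    induction m, hm using Nat.le_induction with
    | base => exact hk
    | succ m _ ih => rw [pow_succ', Module.End.mul_apply]; exact subdiv_mem_small ih
  have mono : ∀ {c : Chain n X} {k m : ℕ}, (subdiv ^ k) c ∈ small n U V → k ≤ m →
      (subdiv ^ m) c ∈ small n U V := by
    intro c k m hk hm
    induction m, hm using Nat.le_induction with
    | base => exact hk
    | succ m _ ih => rw [pow_succ', Module.End.mul_apply]; exact subdiv_mem_small ih
  induction c using chain_induction with
  | zero => exact ⟨0, by simp⟩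
  | add a b ha hb =>
    obtain ⟨k, hk⟩ := ha
    obtain ⟨l, hl⟩ := hb
    refine ⟨max k l, ?_⟩
    rw [map_add]
    exact add_mem (mono hk (le_max_left _ _)) (mono hl (le_max_right _ _))
  | smul r a ha =>
    obtain ⟨k, hk⟩ := ha
    exact ⟨k, by rw [map_smul]; exact Submodule.smul_mem _ _ hk⟩
  | cube s =>
    obtain ⟨δ, hδ, hball⟩ := lebesgue_number_lemma_of_metric (s := Set.univ)
      (c := fun b : Bool => s ⁻¹' (if b then U else V)) isCompact_univ
      (fun b => by cases b <;> [exact hV.preimage s.continuous; exact hU.preimage s.continuous])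
      (fun x _ => by
        have hx : s x ∈ U ∪ V := by rw [h]; trivial
        rcases hx with hx | hx
        · exact Set.mem_iUnion.2 ⟨true, hx⟩
        · exact Set.mem_iUnion.2 ⟨false, hx⟩)
    obtain ⟨k, hk⟩ := exists_pow_lt_of_lt_one hδ (show (2⁻¹ : ℝ) < 1 by norm_num)
    refine ⟨k, ?_⟩
    refine (Submodule.span_le.2 ?_) (iterate_subdiv_cube_mem s k)
    rintro _ ⟨a, ha, rfl⟩
    refine Submodule.subset_span ⟨_, ?_, rfl⟩
    obtain ⟨b, hb⟩ := hball (a 0) trivial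
    have hr : Set.range (s.comp a) ⊆ if b then U else V := by
      rintro _ ⟨x, rfl⟩
      refine hb (Metric.mem_ball.2 ((ha x 0).trans_lt (lt_of_le_of_lt ?_ hk)))
      have : dist x 0 ≤ 1 := (dist_pi_le_iff zero_le_one).2 fun j => by
        rw [Subtype.dist_eq, Real.dist_eq]
        have h1 := (x j).2.1; have h2 := (x j).2.2
        rw [abs_le]
        constructor <;> simp <;> linarith
      nlinarith [pow_pos (show (0 : ℝ) < 2⁻¹ by norm_num) k]
    cases b
    · exact Or.inr hr
    · exact Or.inl hr

/-- The inclusion of a subspace. -/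
def incl (A : Set X) : C(A, X) := ⟨Subtype.val, continuous_subtype_val⟩

/-- The inclusion of a subspace in a larger one. -/
def inclOf {A B : Set X} (h : A ⊆ B) : C(A, B) := ⟨Set.inclusion h, continuous_inclusion h⟩

theorem map_incl_inclOf {n : ℕ} {A B : Set X} (h : A ⊆ B) (c : Chain n A) :
    map (incl B) (map (inclOf h) c) = map (incl A) c := by
  rw [map_map]; rfl

open Classical in
/-- The retraction of the chains of `X` onto the chains of a subspace which forgets the cubes not
contained in the subspace.  It is not a chain map. -/
noncomputable def restrict {n : ℕ} (A : Set X) : Chain n X →ₗ[ℂ] Chain n A :=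
  lift (fun s => if h : ∀ x, s x ∈ A then cube ⟨fun x => ⟨s x, h x⟩, by fun_prop⟩ else 0)
    fun s ⟨j, hs⟩ => by
      split_ifs with h
      · exact cube_eq_zero ⟨j, fun x y hxy => Subtype.ext (hs x y hxy)⟩
      · rfl

theorem restrict_cube_of_forall {n : ℕ} {A : Set X} {s : C(Fin n → I, X)} (h : ∀ x, s x ∈ A) :
    restrict A (cube s) = cube ⟨fun x => ⟨s x, h x⟩, by fun_prop⟩ :=
  (lift_cube _ _ _).trans (dif_pos h)

theorem restrict_cube_of_not {n : ℕ} {A : Set X} {s : C(Fin n → I, X)} (h : ¬∀ x, s x ∈ A) :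
    restrict A (cube s) = 0 :=
  (lift_cube _ _ _).trans (dif_neg h)

theorem restrict_map_incl {n : ℕ} (A : Set X) (c : Chain n A) : restrict A (map (incl A) c) = c := by
  have : (restrict A ∘ₗ map (incl A) : Chain n A →ₗ[ℂ] _) = LinearMap.id := hom_ext fun s => by
    rw [LinearMap.comp_apply, map_cube, restrict_cube_of_forall fun x => (s x).2]
    rfl
  exact LinearMap.congr_fun this c

theorem map_incl_injective {n : ℕ} (A : Set X) :
    Function.Injective (map (incl A) : Chain n A →ₗ[ℂ] Chain n X) :=
  Function.LeftInverse.injective (restrict_map_incl A)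

theorem map_inclOf_injective {n : ℕ} {A B : Set X} (h : A ⊆ B) :
    Function.Injective (map (inclOf h) : Chain n A →ₗ[ℂ] Chain n B) := fun a b hab =>
  map_incl_injective A (by rw [← map_incl_inclOf h, hab, map_incl_inclOf])

theorem restrict_map_incl_mem {n : ℕ} (U V : Set X) (c : Chain n V) :
    ∃ e : Chain n (U ∩ V : Set X),
      restrict U (map (incl V) c) = map (inclOf Set.inter_subset_left) e := by
  induction c using chain_induction with
  | zero => exact ⟨0, by simp⟩
  | add a b ha hb =>
    obtain ⟨e, he⟩ := ha
    obtain ⟨f, hf⟩ := hb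
    exact ⟨e + f, by simp only [map_add, he, hf]⟩
  | smul r a ha =>
    obtain ⟨e, he⟩ := ha
    exact ⟨r • e, by simp only [map_smul, he]⟩
  | cube s =>
    by_cases h : ∀ x, (s x : X) ∈ U
    · refine ⟨cube ⟨fun x => ⟨(s x : X), ⟨h x, (s x).2⟩⟩, by fun_prop⟩, ?_⟩
      rw [map_cube, map_cube, restrict_cube_of_forall h]
      rfl
    · refine ⟨0, ?_⟩
      rw [map_cube, map_zero, restrict_cube_of_not h]

/-- A chain which comes both from `U` and from `V` comes from `U ∩ V`. -/
theorem exists_chain_inter {n : ℕ} {U V : Set X} {a : Chain n U} {b : Chain n V}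
    (h : map (incl U) a = map (incl V) b) : ∃ e : Chain n (U ∩ V : Set X),
      map (inclOf Set.inter_subset_left) e = a ∧ map (inclOf Set.inter_subset_right) e = b := by
  obtain ⟨e, he⟩ := restrict_map_incl_mem U V b
  have ha : map (inclOf Set.inter_subset_left) e = a := by
    rw [← he, ← h, restrict_map_incl]
  refine ⟨e, ha, map_incl_injective V ?_⟩
  rw [← h, ← ha, map_incl_inclOf, map_incl_inclOf]

theorem exists_add_of_mem_small {n : ℕ} {U V : Set X} {c : Chain n X} (hc : c ∈ small n U V) :
    ∃ (a : Chain n U) (b : Chain n V), c = map (incl U) a + map (incl V) b := by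
  induction hc using Submodule.span_induction with
  | zero => exact ⟨0, 0, by simp⟩
  | add x y _ _ hx hy =>
    obtain ⟨a, b, rfl⟩ := hx
    obtain ⟨a', b', rfl⟩ := hy
    exact ⟨a + a', b + b', by simp only [map_add]; abel⟩
  | smul r x _ hx =>
    obtain ⟨a, b, rfl⟩ := hx
    exact ⟨r • a, r • b, by simp only [map_smul, smul_add]⟩
  | mem x hx =>
    obtain ⟨s, hs | hs, rfl⟩ := hx
    · refine ⟨cube ⟨fun x => ⟨s x, hs ⟨x, rfl⟩⟩, by fun_prop⟩, 0, ?_⟩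
      simp only [map_cube, map_zero, add_zero]; rfl
    · refine ⟨0, cube ⟨fun x => ⟨s x, hs ⟨x, rfl⟩⟩, by fun_prop⟩, ?_⟩
      simp only [map_cube, map_zero, zero_add]; rfl

section MayerVietoris

variable {U V : Set X} (hU : IsOpen U) (hV : IsOpen V) (h : U ∪ V = Set.univ)
include hU hV h

theorem exists_small_homologous {n : ℕ} {c : Chain n X} (hc : c ∈ cycles n X) :
    ∃ (a : Chain n U) (b : Chain n V), map (incl U) a + map (incl V) b ∈ cycles n X ∧
      c - (map (incl U) a + map (incl V) b) ∈ boundaries n X := by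
  obtain ⟨k, hk⟩ := exists_iterate_subdiv_mem_small hU hV h c
  obtain ⟨a, b, hab⟩ := exists_add_of_mem_small (hk k le_rfl)
  have h1 := iterate_subdiv_sub_mem_boundaries hc k
  rw [hab] at h1
  refine ⟨a, b, ?_, ?_⟩
  · simpa using add_mem (boundaries_le_cycles n h1) hc
  · simpa using neg_mem h1

/-- The Mayer–Vietoris decomposition of a cycle, with its connecting cycle `e`. -/
theorem exists_mayerVietoris {n : ℕ} {c : Chain (n + 1) X} (hc : c ∈ cycles (n + 1) X) :
    ∃ (a : Chain (n + 1) U) (b : Chain (n + 1) V) (e : Chain n (U ∩ V : Set X)),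
      bd n a = map (inclOf Set.inter_subset_left) e ∧
      bd n b = -map (inclOf Set.inter_subset_right) e ∧ e ∈ cycles n (U ∩ V : Set X) ∧
      c - (map (incl U) a + map (incl V) b) ∈ boundaries (n + 1) X := by
  obtain ⟨a, b, h1, h2⟩ := exists_small_homologous hU hV h hc
  rw [mem_cycles_succ, map_add, bd_map, bd_map, add_eq_zero_iff_eq_neg, ← map_neg] at h1
  obtain ⟨e, he1, he2⟩ := exists_chain_inter h1
  refine ⟨a, b, e, he1.symm, by rw [he2, neg_neg], ?_, h2⟩
  cases n with
  | zero => trivial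
  | succ n =>
    refine mem_cycles_succ.2 (map_inclOf_injective Set.inter_subset_left ?_)
    rw [← bd_map, he1, bd_bd, map_zero]

theorem FinHom.zero_of_cover (h1 : FinHom 0 U) (h2 : FinHom 0 V) : FinHom 0 X := by
  obtain ⟨W₁, hW₁, hle₁⟩ := h1
  obtain ⟨W₂, hW₂, hle₂⟩ := h2
  refine ⟨W₁.map (map (incl U)) ⊔ W₂.map (map (incl V)), inferInstance, fun c hc => ?_⟩
  obtain ⟨a, b, -, hab⟩ := exists_small_homologous hU hV h hc
  have key : ∀ {A : Set X} {W : Submodule ℂ (Chain 0 A)} (a : Chain 0 A),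
      cycles 0 A ≤ W ⊔ boundaries 0 A → map (incl A) a ∈ W.map (map (incl A)) ⊔ boundaries 0 X := by
    intro A W a hle
    obtain ⟨w, hw, v, hv, rfl⟩ := Submodule.mem_sup.1 (hle (show a ∈ cycles 0 A from trivial))
    rw [map_add]
    exact add_mem (Submodule.mem_sup_left ⟨w, hw, rfl⟩)
      (Submodule.mem_sup_right (map_mem_boundaries _ hv))
  have hc' : c = map (incl U) a + map (incl V) b + (c - (map (incl U) a + map (incl V) b)) := by abel
  rw [hc']
  exact add_mem (add_mem (SetLike.le_def.1 (sup_le_sup_right le_sup_left _) (key a hle₁))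
    (SetLike.le_def.1 (sup_le_sup_right le_sup_right _) (key b hle₂))) (Submodule.mem_sup_right hab)

/-- The Mayer–Vietoris sequence bounds the homology of `U ∪ V` in degree `n + 1` by that of `U` and
`V` in the same degree and that of `U ∩ V` in degree `n`. -/
theorem FinHom.succ_of_cover {n : ℕ} (h1 : FinHom (n + 1) U) (h2 : FinHom (n + 1) V)
    (h3 : FinHom n (U ∩ V : Set X)) : FinHom (n + 1) X := by
  obtain ⟨W₁, hW₁, hle₁⟩ := h1
  obtain ⟨W₂, hW₂, hle₂⟩ := h2
  obtain ⟨W₃, hW₃, hle₃⟩ := h3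
  -- the space of Mayer–Vietoris triples and its connecting map to the homology of `U ∩ V`
  let P : Submodule ℂ (Chain (n + 1) U × Chain (n + 1) V × Chain n (U ∩ V : Set X)) :=
    { carrier := {p | bd n p.1 = map (inclOf Set.inter_subset_left) p.2.2 ∧
        bd n p.2.1 = -map (inclOf Set.inter_subset_right) p.2.2 ∧
        p.2.2 ∈ cycles n (U ∩ V : Set X)}
      zero_mem' := by simp
      add_mem' := by
        rintro p q ⟨hp1, hp2, hp3⟩ ⟨hq1, hq2, hq3⟩
        refine ⟨?_, ?_, add_mem hp3 hq3⟩
        · simp only [Prod.fst_add, Prod.snd_add, map_add, hp1, hq1]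
        · simp only [Prod.fst_add, Prod.snd_add, map_add, hp2, hq2]; abel
      smul_mem' := by
        rintro r p ⟨hp1, hp2, hp3⟩
        refine ⟨?_, ?_, Submodule.smul_mem _ _ hp3⟩
        · simp only [Prod.smul_fst, Prod.smul_snd, map_smul, hp1]
        · simp only [Prod.smul_fst, Prod.smul_snd, map_smul, hp2, smul_neg] }
  let δ : P →ₗ[ℂ] Chain n (U ∩ V : Set X) ⧸ boundaries n (U ∩ V : Set X) :=
    (boundaries n (U ∩ V : Set X)).mkQ ∘ₗ LinearMap.snd ℂ _ _ ∘ₗ LinearMap.snd ℂ _ _ ∘ₗ P.subtype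
  have hδ : LinearMap.range δ ≤ W₃.map (boundaries n (U ∩ V : Set X)).mkQ := by
    rintro _ ⟨p, rfl⟩
    obtain ⟨w, hw, v, hv, hwv⟩ := Submodule.mem_sup.1 (hle₃ p.2.2.2)
    refine ⟨w, hw, ?_⟩
    change _ = (boundaries n (U ∩ V : Set X)).mkQ p.1.2.2
    have hv0 : (boundaries n (U ∩ V : Set X)).mkQ v = 0 := (Submodule.Quotient.mk_eq_zero _).2 hv
    rw [← hwv, map_add, hv0, add_zero]
  have hfin : FiniteDimensional ℂ (LinearMap.range δ) := Submodule.finiteDimensional_of_le hδ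
  -- the range of `δ` is finite-dimensional; `g` chooses a triple for each of its elements
  obtain ⟨g, hg⟩ := δ.rangeRestrict.exists_rightInverse_of_surjective δ.range_rangeRestrict
  let T : P →ₗ[ℂ] Chain (n + 1) X :=
    (map (incl U) ∘ₗ LinearMap.fst ℂ _ _ +
      map (incl V) ∘ₗ LinearMap.fst ℂ _ _ ∘ₗ LinearMap.snd ℂ _ _) ∘ₗ P.subtype
  refine ⟨LinearMap.range (T ∘ₗ g) ⊔ (W₁.map (map (incl U)) ⊔ W₂.map (map (incl V))),
    inferInstance, fun c hc => ?_⟩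
  obtain ⟨a, b, e, ha, hb, he, hab⟩ := exists_mayerVietoris hU hV h hc
  let p : P := ⟨(a, b, e), ha, hb, he⟩
  -- subtracting the chosen triple makes the connecting cycle a boundary; the chain `t` which it
  -- bounds corrects both parts to cycles
  let p' : P := p - g (δ.rangeRestrict p)
  have hp' : δ p' = 0 := by
    have := LinearMap.congr_fun hg (δ.rangeRestrict p)
    have h2 := congrArg Subtype.val this
    simp only [LinearMap.comp_apply, LinearMap.id_apply, LinearMap.codRestrict_apply] at h2
    simp only [p', map_sub]
    exact sub_eq_zero.2 h2.symm
  obtain ⟨t, ht⟩ : p'.1.2.2 ∈ boundaries n (U ∩ V : Set X) :=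
    (Submodule.Quotient.mk_eq_zero _).1 hp'
  have key : ∀ {A : Set X} {W : Submodule ℂ (Chain (n + 1) A)} (a : Chain (n + 1) A),
      cycles (n + 1) A ≤ W ⊔ boundaries (n + 1) A → bd n a = 0 →
      map (incl A) a ∈ W.map (map (incl A)) ⊔ boundaries (n + 1) X := by
    intro A W a hle ha
    obtain ⟨w, hw, v, hv, rfl⟩ := Submodule.mem_sup.1 (hle (mem_cycles_succ.2 ha))
    rw [map_add]
    exact add_mem (Submodule.mem_sup_left ⟨w, hw, rfl⟩)
      (Submodule.mem_sup_right (map_mem_boundaries _ hv))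
  have k1 := key (p'.1.1 - map (inclOf Set.inter_subset_left) t) hle₁ (by
    rw [map_sub, bd_map, ht, p'.2.1, sub_self])
  have k2 := key (p'.1.2.1 + map (inclOf Set.inter_subset_right) t) hle₂ (by
    rw [map_add, bd_map, ht, p'.2.2.1, neg_add_cancel])
  rw [map_sub, map_incl_inclOf] at k1
  rw [map_add, map_incl_inclOf] at k2
  have hT : T p' = map (incl U) p'.1.1 + map (incl V) p'.1.2.1 := rfl
  have hTp : T p = map (incl U) a + map (incl V) b := rfl
  have hc' : c = T (g (δ.rangeRestrict p)) + ((map (incl U) p'.1.1 - map (incl (U ∩ V)) t) +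
      (map (incl V) p'.1.2.1 + map (incl (U ∩ V)) t)) +
      (c - (map (incl U) a + map (incl V) b)) := by
    have : T p' = T p - T (g (δ.rangeRestrict p)) := map_sub _ _ _
    rw [hT, hTp] at this
    have h3 : map (incl U) p'.1.1 - map (incl (U ∩ V)) t + (map (incl V) p'.1.2.1 +
      map (incl (U ∩ V)) t) = map (incl U) p'.1.1 + map (incl V) p'.1.2.1 := by abel
    rw [h3, this]
    abel
  rw [hc']
  refine add_mem (add_mem ?_ (add_mem ?_ ?_)) (Submodule.mem_sup_right hab)
  · exact Submodule.mem_sup_left (Submodule.mem_sup_left ⟨_, rfl⟩)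
  · exact SetLike.le_def.1 (sup_le_sup_right (le_sup_left.trans le_sup_right) _) k1
  · exact SetLike.le_def.1 (sup_le_sup_right (le_sup_right.trans le_sup_right) _) k2

end MayerVietoris

end Cubical

namespace Cubical

open scoped unitInterval

variable {X Y Z : Type*} [TopologicalSpace X] [TopologicalSpace Y] [TopologicalSpace Z]

/-! ### Punctured Euclidean spaces -/

/-- The reduced singular homology of `X` vanishes in degree `n`: a cycle bounds as soon as its image
in the one-point space does. -/
def RedAcyclic (n : ℕ) (X : Type*) [TopologicalSpace X] : Prop :=
  ∀ c ∈ cycles n X, map (ContinuousMap.const X PUnit.unit) c ∈ boundaries n PUnit.{1} →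
    c ∈ boundaries n X

theorem RedAcyclic.of_dominated {n : ℕ} (f : C(X, Y)) (g : C(Y, X))
    (H : (g.comp f).Homotopic (ContinuousMap.id X)) (h : RedAcyclic n Y) : RedAcyclic n X := by
  intro c hc hb
  have h1 := map_sub_map_mem_boundaries H hc
  have h2 := h (map f c) (map_mem_cycles f hc) (by rwa [map_map])
  rw [map_id, ← map_map] at h1
  simpa using add_mem h1 (map_mem_boundaries g h2)

theorem sub_map_const_mem_boundaries [PathConnectedSpace X] (x : X) (c : Chain 0 X) :
    c - map (ContinuousMap.const X x) c ∈ boundaries 0 X := by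
  induction c using chain_induction with
  | zero => simp
  | add a b ha hb => rw [map_add, add_sub_add_comm]; exact add_mem ha hb
  | smul r a ha => rw [map_smul, ← smul_sub]; exact Submodule.smul_mem _ _ ha
  | cube s =>
    obtain ⟨p⟩ := PathConnectedSpace.joined x (s 0)
    refine ⟨cube ⟨fun y => p (y 0), by fun_prop⟩, ?_⟩
    simp only [bd_cube, Fin.sum_univ_succ, Fin.sum_univ_zero, Fin.val_zero, pow_zero, one_smul,
      add_zero, map_cube]
    congr 2
    · ext y
      have : face 0 1 y 0 = 1 := face_apply_same _ _ _
      simp [Subsingleton.elim y 0]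
    · ext y
      have : face 0 0 y 0 = 0 := face_apply_same _ _ _
      simp [this]

theorem redAcyclic_zero [PathConnectedSpace X] : RedAcyclic 0 X := by
  intro c _ hb
  obtain ⟨x⟩ := PathConnectedSpace.nonempty (X := X)
  have h1 := sub_map_const_mem_boundaries x c
  have h2 := map_mem_boundaries (ContinuousMap.const PUnit.{1} x) hb
  rw [map_map] at h2
  simpa using add_mem h1 h2

section MayerVietoris

variable {U V : Set X} (hU : IsOpen U) (hV : IsOpen V) (h : U ∪ V = Set.univ)
include hU hV h

/-- If `U ∩ V` has no reduced homology in degree `n`, every `(n + 1)`-cycle of `U ∪ V` is homologous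
to the sum of a cycle of `U` and a cycle of `V`. -/
theorem exists_cycles_of_redAcyclic_inter {n : ℕ} (hI : RedAcyclic n (U ∩ V : Set X))
    {c : Chain (n + 1) X} (hc : c ∈ cycles (n + 1) X) :
    ∃ a ∈ cycles (n + 1) U, ∃ b ∈ cycles (n + 1) V,
      c - (map (incl U) a + map (incl V) b) ∈ boundaries (n + 1) X := by
  obtain ⟨a, b, e, ha, hb, he, hab⟩ := exists_mayerVietoris hU hV h hc
  obtain ⟨t, rfl⟩ := hI e he (by
    have : map (ContinuousMap.const (U ∩ V : Set X) PUnit.unit) e =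
        map (ContinuousMap.const U PUnit.unit) (map (inclOf Set.inter_subset_left) e) := by
      rw [map_map]; rfl
    rw [this, ← ha]
    exact map_mem_boundaries _ ⟨a, rfl⟩)
  refine ⟨a - map (inclOf Set.inter_subset_left) t, ?_, b + map (inclOf Set.inter_subset_right) t,
    ?_, ?_⟩
  · rw [mem_cycles_succ, map_sub, bd_map, ha, sub_self]
  · rw [mem_cycles_succ, map_add, bd_map, hb, neg_add_cancel]
  · rw [map_sub, map_add, map_incl_inclOf, map_incl_inclOf]
    convert! hab using 2
    abel

end MayerVietoris

/-- A subset of a subspace, seen as a subset of the ambient space. -/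
def subtypeHomeo {A : Set Y} (U : Set A) (U' : Set Y) (h1 : ∀ x ∈ U, (x : Y) ∈ U')
    (h2 : ∀ x ∈ U', ∃ hx : x ∈ A, (⟨x, hx⟩ : A) ∈ U) : U ≃ₜ U' where
  toFun x := ⟨x.1, h1 x.1 x.2⟩
  invFun x := ⟨⟨x.1, (h2 x.1 x.2).1⟩, (h2 x.1 x.2).2⟩
  left_inv _ := rfl
  right_inv _ := rfl
  continuous_toFun := by fun_prop
  continuous_invFun := by fun_prop

/-- The complement of the origin in `ℝⁿ`. -/
abbrev Punctured (n : ℕ) : Type := {x : Fin n → ℝ | x ≠ 0}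

/-- The complement in `ℝⁿ⁺¹` of the half-axis `{x | x₀ ≤ 0, xᵢ = 0 for i > 0}` (for `ε = 1`) or of
the opposite one (for `ε = -1`), in the punctured space. -/
def slit (n : ℕ) (ε : ℝ) : Set (Punctured (n + 1)) :=
  {x | (fun i : Fin n => x.1 i.succ) ≠ 0 ∨ 0 < ε * x.1 0}

theorem continuous_coord {n : ℕ} (i : Fin n) : Continuous fun x : Punctured n => x.1 i :=
  (continuous_apply i).comp continuous_subtype_val

theorem isOpen_slit (n : ℕ) (ε : ℝ) : IsOpen (slit n ε) := by
  refine IsOpen.union ?_ ?_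
  · exact isOpen_ne_fun (continuous_pi fun i => continuous_coord i.succ) continuous_const
  · exact isOpen_lt continuous_const (continuous_const.mul (continuous_coord 0))

/-- The slit space is star-shaped with respect to the unit vector on the remaining half-axis. -/
theorem contractibleSpace_slit (n : ℕ) {ε : ℝ} (hε : ε * ε = 1) : ContractibleSpace (slit n ε) := by
  have hε0 : ε ≠ 0 := by rintro rfl; norm_num at hε
  let U : Set (Fin (n + 1) → ℝ) := {x | (fun i : Fin n => x i.succ) ≠ 0 ∨ 0 < ε * x 0}
  have hmem : Fin.cons ε 0 ∈ U := Or.inr (by simp [hε])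
  have hstar : StarConvex ℝ (Fin.cons ε 0 : Fin (n + 1) → ℝ) U := by
    intro y hy a b ha hb hab
    rcases hb.eq_or_lt with rfl | hb'
    · rw [add_zero] at hab
      rw [hab, one_smul, zero_smul, add_zero]; exact hmem
    · rcases hy with hy | hy
      · refine Or.inl fun h => hy (funext fun i => ?_)
        have := congrFun h i
        simp at this
        simpa [hb'.ne'] using this
      · refine Or.inr ?_
        simp only [Pi.add_apply, Pi.smul_apply, Fin.cons_zero, smul_eq_mul]
        have e : ε * (a * ε + b * y 0) = a * (ε * ε) + b * (ε * y 0) := by ring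
        rw [e, hε]
        nlinarith [mul_pos hb' hy]
  have : ContractibleSpace U := hstar.contractibleSpace ⟨_, hmem⟩
  refine (subtypeHomeo (slit n ε) U (fun x hx => hx) fun x hx => ⟨?_, hx⟩).contractibleSpace
  rintro rfl
  rcases hx with hx | hx
  · exact hx (funext fun i => rfl)
  · simp at hx

theorem slit_union (n : ℕ) : slit n 1 ∪ slit n (-1) = Set.univ := by
  refine Set.eq_univ_of_forall fun x => ?_
  by_cases h : (fun i : Fin n => x.1 i.succ) = 0
  · have h0 : x.1 0 ≠ 0 := fun h0 => x.2 (funext fun i => by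
      refine Fin.cases h0 (fun i => congrFun h i) i)
    rcases h0.lt_or_gt with h1 | h1
    · exact Or.inr (Or.inr (by linarith))
    · exact Or.inl (Or.inr (by linarith))
  · exact Or.inl (Or.inl h)

theorem mem_slit_inter {n : ℕ} {x : Punctured (n + 1)} :
    x ∈ slit n 1 ∩ slit n (-1) ↔ (fun i : Fin n => x.1 i.succ) ≠ 0 := by
  refine ⟨?_, fun h => ⟨Or.inl h, Or.inl h⟩⟩
  rintro ⟨h1 | h1, h2 | h2⟩ <;> try assumption
  linarith

/-- The projection of the intersection of the two slit spaces to the punctured space of one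
dimension less. -/
def slitProj (n : ℕ) : C((slit n 1 ∩ slit n (-1) : Set (Punctured (n + 1))), Punctured n) :=
  ⟨fun x => ⟨fun i => x.1.1 i.succ, mem_slit_inter.1 x.2⟩, by
    refine Continuous.subtype_mk (continuous_pi fun i => ?_) _
    exact (continuous_coord i.succ).comp continuous_subtype_val⟩

/-- The inclusion of the punctured space in the intersection of the slit spaces. -/
def slitIncl (n : ℕ) : C(Punctured n, (slit n 1 ∩ slit n (-1) : Set (Punctured (n + 1)))) :=
  ⟨fun x => ⟨⟨Fin.cons 0 x.1, fun h => x.2 (funext fun i => by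
      have := congrFun h i.succ; simpa using this)⟩,
    mem_slit_inter.2 fun h => x.2 (by simpa using h)⟩, by fun_prop⟩

/-- The intersection of the two slit spaces is `ℝ` times the punctured space of one dimension
less. -/
theorem slitIncl_comp_slitProj (n : ℕ) :
    ((slitIncl n).comp (slitProj n)).Homotopic (ContinuousMap.id _) :=
  ⟨{ toFun := fun p => ⟨⟨Fin.cons (p.1 * p.2.1.1 0) fun i => p.2.1.1 i.succ, fun h =>
        mem_slit_inter.1 p.2.2 (funext fun i => by have := congrFun h i.succ; simpa using this)⟩,
        mem_slit_inter.2 (by simpa using mem_slit_inter.1 p.2.2)⟩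
     continuous_toFun := by
       refine Continuous.subtype_mk (Continuous.subtype_mk (continuous_pi fun i => ?_) _) _
       refine Fin.cases ?_ (fun i => ?_) i
       · exact (continuous_subtype_val.comp continuous_fst).mul
           ((continuous_coord 0).comp (continuous_subtype_val.comp continuous_snd))
       · exact (continuous_coord i.succ).comp (continuous_subtype_val.comp continuous_snd)
     map_zero_left := fun x => by
       apply Subtype.ext; apply Subtype.ext
       simp [slitIncl, slitProj]
     map_one_left := fun x => by
       apply Subtype.ext; apply Subtype.ext
       funext i
       refine Fin.cases ?_ (fun i => ?_) i <;> simp }⟩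

theorem finHom_of_isEmpty [IsEmpty X] (n : ℕ) : FinHom n X := by
  refine ⟨⊥, inferInstance, fun c _ => ?_⟩
  have : ∀ c : Chain n X, c = 0 := fun c => by
    induction c using chain_induction with
    | zero => rfl
    | add a b ha hb => rw [ha, hb, add_zero]
    | smul r a ha => rw [ha, smul_zero]
    | cube s => exact isEmptyElim (s 0)
  rw [this c]
  exact zero_mem _

theorem finHom_punctured (n m : ℕ) : FinHom m (Punctured n) := by
  induction n generalizing m with
  | zero =>
    have : IsEmpty (Punctured 0) := ⟨fun x => x.2 (Subsingleton.elim _ _)⟩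
    exact finHom_of_isEmpty m
  | succ n ih =>
    have := contractibleSpace_slit n (ε := 1) (by norm_num)
    have := contractibleSpace_slit n (ε := -1) (by norm_num)
    cases m with
    | zero =>
      exact FinHom.zero_of_cover (isOpen_slit n 1) (isOpen_slit n (-1)) (slit_union n)
        (finHom_of_contractible 0) (finHom_of_contractible 0)
    | succ m =>
      exact FinHom.succ_of_cover (isOpen_slit n 1) (isOpen_slit n (-1)) (slit_union n)
        (finHom_of_contractible _) (finHom_of_contractible _)
        ((ih m).of_dominated _ _ (slitIncl_comp_slitProj n))

theorem redAcyclic_punctured {n m : ℕ} (h : m + 2 ≤ n) : RedAcyclic m (Punctured n) := by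
  induction n generalizing m with
  | zero => omega
  | succ n ih =>
    have := contractibleSpace_slit n (ε := 1) (by norm_num)
    have := contractibleSpace_slit n (ε := -1) (by norm_num)
    cases m with
    | zero =>
      have h1 : 1 < Module.rank ℝ (Fin (n + 1) → ℝ) := by
        rw [rank_fin_fun]; exact_mod_cast h
      have h2 : PathConnectedSpace (Punctured (n + 1)) :=
        isPathConnected_iff_pathConnectedSpace.1 (isPathConnected_compl_singleton_of_one_lt_rank h1 0)
      exact redAcyclic_zero
    | succ m =>
      intro c hc _
      obtain ⟨a, ha, b, hb, hab⟩ := exists_cycles_of_redAcyclic_inter (isOpen_slit n 1)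
        (isOpen_slit n (-1)) (slit_union n)
        ((ih (by omega)).of_dominated _ _ (slitIncl_comp_slitProj n)) hc
      have h1 := map_mem_boundaries (incl _) (cycles_le_boundaries_of_contractible m ha)
      have h2 := map_mem_boundaries (incl _) (cycles_le_boundaries_of_contractible m hb)
      simpa using add_mem hab (add_mem h1 h2)

/-! ### Attaching a cell -/

section Radial

variable {n : ℕ}

theorem shrink_mem_ball (v : Fin n → ℝ) :
    ((1 + ‖v‖)⁻¹ • v) ∈ Metric.ball (0 : Fin n → ℝ) 1 := by
  have : 0 < 1 + ‖v‖ := by positivity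
  rw [mem_ball_zero_iff, norm_smul, norm_inv, Real.norm_of_nonneg this.le, inv_mul_lt_iff₀ this]
  linarith

theorem radial_pos (t : I) (v : Fin n → ℝ) : 0 < (1 - (t : ℝ)) * (1 + ‖v‖)⁻¹ + t := by
  have h1 : 0 < (1 + ‖v‖)⁻¹ := by positivity
  rcases t.2.1.eq_or_lt with h0 | h0
  · rw [← h0]; linarith
  · have := mul_nonneg (sub_nonneg.2 t.2.2) h1.le
    linarith

theorem radial_mem_ball (t : I) {v : Fin n → ℝ} (hv : v ∈ Metric.ball (0 : Fin n → ℝ) 1) :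
    ((1 - (t : ℝ)) * (1 + ‖v‖)⁻¹ + t) • v ∈ Metric.ball (0 : Fin n → ℝ) 1 := by
  rw [mem_ball_zero_iff] at hv ⊢
  rw [norm_smul, Real.norm_of_nonneg (radial_pos t v).le]
  have h1 : (1 + ‖v‖)⁻¹ ≤ 1 := inv_le_one_of_one_le₀ (by linarith [norm_nonneg v])
  have h2 : (1 - (t : ℝ)) * (1 + ‖v‖)⁻¹ + t ≤ 1 := by
    have := mul_le_mul_of_nonneg_left h1 (sub_nonneg.2 t.2.2)
    linarith
  have h3 := mul_le_mul_of_nonneg_right h2 (norm_nonneg v)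
  linarith

theorem continuous_shrink : Continuous fun v : Fin n → ℝ => (1 + ‖v‖)⁻¹ :=
  Continuous.inv₀ (by fun_prop) fun v => by positivity

end Radial

/-- A closed subset `E` of a space such that the rest of the space is an open cell, attached to `E`
along the boundary sphere of the characteristic map `Φ`. -/
structure IsCellAttachment (n : ℕ) (E : Set X) (Φ : (Fin n → ℝ) → X) (ψ : X → Fin n → ℝ) :
    Prop where
  isClosed : IsClosed E
  continuousOn : ContinuousOn Φ (Metric.closedBall 0 1)
  continuousOn_inv : ContinuousOn ψ Eᶜ
  sphere : ∀ v ∈ Metric.sphere 0 1, Φ v ∈ E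
  ball : ∀ v ∈ Metric.ball 0 1, Φ v ∉ E
  left_inv : ∀ v ∈ Metric.ball 0 1, ψ (Φ v) = v
  mem_ball : ∀ x ∉ E, ψ x ∈ Metric.ball 0 1
  right_inv : ∀ x ∉ E, Φ (ψ x) = x

namespace IsCellAttachment

variable {n : ℕ} {E : Set X} {Φ : (Fin n → ℝ) → X} {ψ : X → Fin n → ℝ}
  (h : IsCellAttachment n E Φ ψ)
include h

theorem center_notMem : Φ 0 ∉ E := h.ball 0 (by simp)

theorem cover : ({Φ 0}ᶜ : Set X) ∪ Eᶜ = Set.univ := by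
  refine Set.eq_univ_of_forall fun x => ?_
  by_cases hx : x = Φ 0
  · exact Or.inr (hx ▸ h.center_notMem)
  · exact Or.inl hx

theorem continuousOn_ball : ContinuousOn Φ (Metric.ball 0 1) :=
  h.continuousOn.mono Metric.ball_subset_closedBall

theorem contractibleSpace_compl : ContractibleSpace (Eᶜ : Set X) := by
  let e : (Eᶜ : Set X) ≃ₜ Metric.ball (0 : Fin n → ℝ) 1 :=
    { toFun := fun x => ⟨ψ x, h.mem_ball x x.2⟩
      invFun := fun v => ⟨Φ v, h.ball v v.2⟩
      left_inv := fun x => Subtype.ext (h.right_inv x x.2)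
      right_inv := fun v => Subtype.ext (h.left_inv v v.2)
      continuous_toFun := (continuousOn_iff_continuous_domRestrict.1 h.continuousOn_inv).subtype_mk _
      continuous_invFun := (continuousOn_iff_continuous_domRestrict.1 h.continuousOn_ball).subtype_mk _ }
  have := Metric.contractibleSpace_ball (x := (0 : Fin n → ℝ)) (r := 1) one_pos
  exact e.contractibleSpace

theorem inv_ne_zero {x : X} (hx : x ∈ ({Φ 0}ᶜ ∩ Eᶜ : Set X)) : ψ x ≠ 0 := fun h0 =>
  hx.1 (by rw [Set.mem_singleton_iff, ← h0, h.right_inv x hx.2])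

theorem mem_inter_of_mem_ball {v : Fin n → ℝ} (hv : v ∈ Metric.ball (0 : Fin n → ℝ) 1)
    (h0 : v ≠ 0) : Φ v ∈ ({Φ 0}ᶜ ∩ Eᶜ : Set X) :=
  ⟨fun e => h0 (by
    have e' := congrArg ψ (Set.mem_singleton_iff.1 e)
    rwa [h.left_inv v hv, h.left_inv 0 (by simp)] at e'), h.ball v hv⟩

theorem continuous_inv_inter : Continuous fun x : ({Φ 0}ᶜ ∩ Eᶜ : Set X) => ψ x :=
  continuousOn_iff_continuous_domRestrict.1 (h.continuousOn_inv.mono Set.inter_subset_right)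

/-- The coordinates of the points of the open cell other than its centre. -/
def toPunctured : C(({Φ 0}ᶜ ∩ Eᶜ : Set X), Punctured n) :=
  ⟨fun x => ⟨ψ x, h.inv_ne_zero x.2⟩, h.continuous_inv_inter.subtype_mk _⟩

/-- The punctured space, shrunk into the open cell. -/
noncomputable def ofPunctured : C(Punctured n, ({Φ 0}ᶜ ∩ Eᶜ : Set X)) :=
  ⟨fun v => ⟨Φ ((1 + ‖v.1‖)⁻¹ • v.1), h.mem_inter_of_mem_ball (shrink_mem_ball _)
      (smul_ne_zero (by positivity) v.2)⟩,
    (h.continuousOn_ball.comp_continuous (f := fun v : Punctured n => (1 + ‖v.1‖)⁻¹ • v.1)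
      ((continuous_shrink.comp continuous_subtype_val).smul continuous_subtype_val)
      fun v => shrink_mem_ball v.1).subtype_mk _⟩

theorem continuous_radial : Continuous fun p : I × ({Φ 0}ᶜ ∩ Eᶜ : Set X) =>
    Φ (((1 - (p.1 : ℝ)) * (1 + ‖ψ p.2‖)⁻¹ + p.1) • ψ p.2) := by
  refine h.continuousOn_ball.comp_continuous ?_ fun p => radial_mem_ball p.1 (h.mem_ball _ p.2.2.2)
  have h1 : Continuous fun p : I × ({Φ 0}ᶜ ∩ Eᶜ : Set X) => ψ p.2 :=
    h.continuous_inv_inter.comp continuous_snd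
  have h2 : Continuous fun p : I × ({Φ 0}ᶜ ∩ Eᶜ : Set X) => (1 + ‖ψ p.2‖)⁻¹ :=
    continuous_shrink.comp h1
  have h3 : Continuous fun p : I × ({Φ 0}ᶜ ∩ Eᶜ : Set X) => (p.1 : ℝ) :=
    continuous_subtype_val.comp continuous_fst
  exact (((continuous_const.sub h3).mul h2).add h3).smul h1

theorem ofPunctured_comp_toPunctured :
    (h.ofPunctured.comp h.toPunctured).Homotopic (ContinuousMap.id _) :=
  ⟨{ toFun := fun p => ⟨Φ (((1 - (p.1 : ℝ)) * (1 + ‖ψ p.2‖)⁻¹ + p.1) • ψ p.2),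
        h.mem_inter_of_mem_ball (radial_mem_ball _ (h.mem_ball _ p.2.2.2))
          (smul_ne_zero (radial_pos _ _).ne' (h.inv_ne_zero p.2.2))⟩
     continuous_toFun := h.continuous_radial.subtype_mk _
     map_zero_left := fun x => Subtype.ext (by simp [ofPunctured, toPunctured])
     map_one_left := fun x => Subtype.ext (by simpa using h.right_inv x x.2.2) }⟩

/-- The punctured open cell is dominated by the punctured Euclidean space. -/
theorem exists_dominated : ∃ (f : C(({Φ 0}ᶜ ∩ Eᶜ : Set X), Punctured n))
    (g : C(Punctured n, ({Φ 0}ᶜ ∩ Eᶜ : Set X))), (g.comp f).Homotopic (ContinuousMap.id _) :=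
  ⟨_, _, h.ofPunctured_comp_toPunctured⟩

/-- The radial deformation of the complement of the centre of the cell onto `E`. -/
theorem exists_deformation [T2Space X] : ∃ K : C(I × ({Φ 0}ᶜ : Set X), ({Φ 0}ᶜ : Set X)),
    (∀ x, K (0, x) = x) ∧ (∀ x, (K (1, x) : X) ∈ E) := by
  classical
  -- interpolate linearly between `v` and its radial projection to the unit sphere
  let r : I → (Fin n → ℝ) → Fin n → ℝ := fun t v => ((1 - (t : ℝ)) + t * ‖v‖⁻¹) • v
  have hnorm : ∀ t v, v ≠ 0 → ‖r t v‖ = (1 - (t : ℝ)) * ‖v‖ + t := fun t v hv => by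
    have hv' : 0 < ‖v‖ := norm_pos_iff.2 hv
    have h1 := t.2.1; have h2 := t.2.2
    have : 0 ≤ (1 - (t : ℝ)) + t * ‖v‖⁻¹ := by
      have := mul_nonneg h1 (inv_nonneg.2 hv'.le); linarith
    rw [norm_smul, Real.norm_of_nonneg this, add_mul, mul_assoc, inv_mul_cancel₀ hv'.ne', mul_one]
  have hr_sphere : ∀ t, ∀ v ∈ Metric.sphere (0 : Fin n → ℝ) 1, r t v = v := fun t v hv => by
    rw [mem_sphere_zero_iff_norm] at hv
    simp [r, hv]
  have hr_mem : ∀ t v, v ≠ 0 → v ∈ Metric.closedBall (0 : Fin n → ℝ) 1 →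
      r t v ∈ Metric.closedBall (0 : Fin n → ℝ) 1 := fun t v h0 hv => by
    rw [mem_closedBall_zero_iff] at hv ⊢
    rw [hnorm t v h0]
    have h1 := t.2.1; have h2 := t.2.2
    nlinarith
  have hr_ne : ∀ t v, v ≠ 0 → r t v ≠ 0 := fun t v hv => by
    rw [← norm_pos_iff, hnorm t v hv]
    have hv' : 0 < ‖v‖ := norm_pos_iff.2 hv
    have h1 := t.2.1; have h2 := t.2.2
    rcases h1.eq_or_lt with h0 | h0
    · rw [← h0]; linarith
    · nlinarith [mul_nonneg (sub_nonneg.2 h2) hv'.le]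
  have hΦ_ne : ∀ v ∈ Metric.closedBall (0 : Fin n → ℝ) 1, v ≠ 0 → Φ v ≠ Φ 0 := fun v hv h0 e => by
    rcases (mem_closedBall_zero_iff.1 hv).lt_or_eq with h1 | h1
    · have e' := congrArg ψ e
      rw [h.left_inv v (mem_ball_zero_iff.2 h1), h.left_inv 0 (by simp)] at e'
      exact h0 e'
    · exact h.center_notMem (e ▸ h.sphere v (mem_sphere_zero_iff_norm.2 h1))
  let K : I × X → X := fun p => if p.2 ∈ E then p.2 else Φ (r p.1 (ψ p.2))
  have hK : ∀ t, ∀ v ∈ Metric.closedBall (0 : Fin n → ℝ) 1, K (t, Φ v) = Φ (r t v) := by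
    intro t v hv
    rcases (mem_closedBall_zero_iff.1 hv).lt_or_eq with h1 | h1
    · have hb := mem_ball_zero_iff.2 h1
      simp only [K, if_neg (h.ball v hb), h.left_inv v hb]
    · have hs := mem_sphere_zero_iff_norm.2 h1
      simp only [K, if_pos (h.sphere v hs), hr_sphere t v hs]
  have hψ0 : ∀ x ∈ ({Φ 0}ᶜ : Set X), x ∉ E → ψ x ≠ 0 := fun x hx hE => h.inv_ne_zero ⟨hx, hE⟩
  have hcont : ContinuousOn K {p | p.2 ∈ ({Φ 0}ᶜ : Set X)} := by
    -- away from the centre, the preimage of a closed set `C` is the union of `E ∩ C` and of the image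
    -- of a compact set of pairs of times and points of the ball
    rw [continuousOn_iff_isClosed]
    intro C hC
    let S : Set (I × (Fin n → ℝ)) := {q | q.2 ∈ Metric.closedBall (0 : Fin n → ℝ) 1 ∧ q.2 ≠ 0}
    have hS : ContinuousOn (fun q : I × (Fin n → ℝ) => Φ (r q.1 q.2)) S := by
      refine h.continuousOn.comp ?_ fun q hq => hr_mem q.1 q.2 hq.2 hq.1
      have h1 : ContinuousOn (fun q : I × (Fin n → ℝ) => ‖q.2‖⁻¹) S :=
        ContinuousOn.inv₀ (by fun_prop) fun q hq => norm_ne_zero_iff.2 hq.2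
      have h2 : ContinuousOn (fun q : I × (Fin n → ℝ) => (q.1 : ℝ)) S := by fun_prop
      exact ((continuousOn_const.sub h2).add (h2.mul h1)).smul (by fun_prop)
    obtain ⟨F, hF, hFS⟩ := continuousOn_iff_isClosed.1 hS C hC
    let F' : Set (I × (Fin n → ℝ)) := F ∩ Set.univ ×ˢ Metric.closedBall (0 : Fin n → ℝ) 1
    have hF' : IsCompact F' := (isCompact_univ.prod (isCompact_closedBall 0 1)).inter_left hF
    have him : IsClosed ((fun q : I × (Fin n → ℝ) => (q.1, Φ q.2)) '' F') := by
      refine (hF'.image_of_continuousOn ?_).isClosed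
      refine ContinuousOn.prodMk (by fun_prop) (h.continuousOn.comp (by fun_prop) fun q hq => hq.2.2)
    refine ⟨(fun q : I × (Fin n → ℝ) => (q.1, Φ q.2)) '' F' ∪ {p | p.2 ∈ E ∩ C},
      him.union ((h.isClosed.inter hC).preimage continuous_snd), ?_⟩
    ext ⟨t, x⟩
    simp only [Set.mem_inter_iff, Set.mem_preimage, Set.mem_union, Set.mem_image, Set.mem_ofPred_eq]
    constructor
    · rintro ⟨hKC, hx⟩
      refine ⟨?_, hx⟩
      by_cases hE : x ∈ E
      · right
        exact ⟨hE, by simpa only [K, if_pos hE] using hKC⟩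
      · left
        have hb := h.mem_ball x hE
        have hb' := Metric.ball_subset_closedBall hb
        have hq : (t, ψ x) ∈ (fun q : I × (Fin n → ℝ) => Φ (r q.1 q.2)) ⁻¹' C ∩ S :=
          ⟨by simp only [K, if_neg hE] at hKC; exact hKC, hb', hψ0 x hx hE⟩
        rw [hFS] at hq
        exact ⟨(t, ψ x), ⟨hq.1, trivial, hb'⟩, by simp only [h.right_inv x hE]⟩
    · rintro ⟨⟨⟨t', v⟩, ⟨hvF, -, hv⟩, heq⟩ | ⟨hE, hC'⟩, hx⟩
      · obtain ⟨rfl, rfl⟩ := Prod.mk.inj heq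
        refine ⟨?_, hx⟩
        have hv0 : v ≠ 0 := by rintro rfl; exact hx rfl
        have hq : (t', v) ∈ F ∩ S := ⟨hvF, hv, hv0⟩
        rw [← hFS] at hq
        rw [hK t' v hv]
        exact hq.1
      · exact ⟨by simpa only [K, if_pos hE] using hC', hx⟩
  have hKmem : ∀ p : I × ({Φ 0}ᶜ : Set X), K (p.1, p.2) ∈ ({Φ 0}ᶜ : Set X) := by
    rintro ⟨t, x, hx⟩
    by_cases hE : x ∈ E
    · simp only [K, if_pos hE]; exact hx
    · simp only [K, if_neg hE]
      have h0 := hψ0 x hx hE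
      have hb' := Metric.ball_subset_closedBall (h.mem_ball x hE)
      exact hΦ_ne _ (hr_mem t _ h0 hb') (hr_ne t _ h0)
  refine ⟨⟨fun p => ⟨K (p.1, p.2), hKmem p⟩, (hcont.comp_continuous (by fun_prop)
    fun p => p.2.2).subtype_mk _⟩, fun x => Subtype.ext ?_, fun x => ?_⟩
  · by_cases hE : x.1 ∈ E
    · simp [K, hE]
    · simp [K, hE, r, h.right_inv x hE]
  · by_cases hE : x.1 ∈ E
    · simp [K, hE]
    · have h0 := hψ0 x x.2 hE
      simp only [K, ContinuousMap.coe_mk, if_neg hE]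
      refine h.sphere _ (mem_sphere_zero_iff_norm.2 ?_)
      rw [hnorm _ _ h0]
      simp

/-- The complement of the centre of the cell is homotopy equivalent to `E`. -/
theorem exists_retraction [T2Space X] : ∃ (f : C(({Φ 0}ᶜ : Set X), E)) (g : C(E, ({Φ 0}ᶜ : Set X))),
    (g.comp f).Homotopic (ContinuousMap.id _) ∧ (incl _).comp g = incl E := by
  obtain ⟨K, hK0, hK1⟩ := h.exists_deformation
  let f : C(({Φ 0}ᶜ : Set X), E) := ⟨fun x => ⟨K (1, x), hK1 x⟩, by fun_prop⟩
  let g : C(E, ({Φ 0}ᶜ : Set X)) := inclOf fun x hx e =>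
    h.center_notMem (Set.mem_singleton_iff.1 e ▸ hx)
  refine ⟨f, g, ContinuousMap.Homotopic.symm ⟨?_⟩, rfl⟩
  exact { toContinuousMap := K, map_zero_left := hK0, map_one_left := fun x => rfl }

/-- Attaching a cell preserves finite-dimensional homology: the complement of its centre and the
open cell cover the space, and meet in a punctured cell. -/
theorem finHom [T2Space X] (hE : ∀ m, FinHom m E) (m : ℕ) : FinHom m X := by
  obtain ⟨f, g, H, -⟩ := h.exists_retraction
  obtain ⟨f', g', H'⟩ := h.exists_dominated
  have := h.contractibleSpace_compl
  cases m with
  | zero =>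
    exact FinHom.zero_of_cover isOpen_compl_singleton h.isClosed.isOpen_compl h.cover
      ((hE 0).of_dominated f g H) (finHom_of_contractible _)
  | succ m =>
    exact FinHom.succ_of_cover isOpen_compl_singleton h.isClosed.isOpen_compl h.cover
      ((hE _).of_dominated f g H) (finHom_of_contractible _)
      ((finHom_punctured n m).of_dominated f' g' H')

/-- Attaching a cell of dimension at least `m + 2` creates no new homology in degree `m + 1`. -/
theorem exists_homologous [T2Space X] {m : ℕ} (hm : m + 2 ≤ n) {c : Chain (m + 1) X}
    (hc : c ∈ cycles (m + 1) X) :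
    ∃ c' ∈ cycles (m + 1) E, c - map (incl E) c' ∈ boundaries (m + 1) X := by
  obtain ⟨f, g, H, hg⟩ := h.exists_retraction
  obtain ⟨f', g', H'⟩ := h.exists_dominated
  have := h.contractibleSpace_compl
  obtain ⟨a, ha, b, hb, hab⟩ := exists_cycles_of_redAcyclic_inter isOpen_compl_singleton
    h.isClosed.isOpen_compl h.cover ((redAcyclic_punctured hm).of_dominated f' g' H') hc
  have h1 := map_mem_boundaries (incl _) (cycles_le_boundaries_of_contractible m hb)
  have h2 := map_mem_boundaries (incl _) (map_sub_map_mem_boundaries H ha)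
  refine ⟨map f a, map_mem_cycles f ha, ?_⟩
  rw [map_id, map_sub, ← map_map, map_map (incl _) g, hg] at h2
  have := add_mem (add_mem hab h1) h2
  convert! this using 1
  abel

end IsCellAttachment

end Cubical

/-! ### Cell complexes with finite skeleta -/

namespace Cubical

open scoped unitInterval ContinuousMap
open Topology Topology.CWComplex

theorem finHom_zero {X : Type*} [TopologicalSpace X] [PathConnectedSpace X] : FinHom 0 X := by
  obtain ⟨x⟩ := PathConnectedSpace.nonempty (X := X)
  refine ⟨Submodule.span ℂ {cube (ContinuousMap.const _ x)}, inferInstance, ?_⟩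
  rintro c -
  have h : map (ContinuousMap.const X x) c ∈
      Submodule.span ℂ {cube (n := 0) (ContinuousMap.const _ x)} := by
    induction c using chain_induction with
    | zero => rw [map_zero]; exact zero_mem _
    | add a b ha hb => rw [map_add]; exact add_mem ha hb
    | smul r a ha => rw [map_smul]; exact Submodule.smul_mem _ _ ha
    | cube s => rw [map_cube]; exact Submodule.mem_span_singleton_self _
  simpa using add_mem (SetLike.le_def.1 le_sup_left h)
    (SetLike.le_def.1 (le_sup_right (a := Submodule.span ℂ {cube (n := 0) (ContinuousMap.const _ x)}))
      (sub_map_const_mem_boundaries x c))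

variable {Y : Type u} [TopologicalSpace Y] [CWComplex (Set.univ : Set Y)]

variable (Y) in
/-- The cells of a CW-complex, of all dimensions. -/
abbrev Cell : Type u := Σ n, cell (Set.univ : Set Y) n

/-- The open cell indexed by `k`. -/
def Cell.op (k : Cell Y) : Set Y := openCell k.1 k.2

/-- The union of a set of open cells. -/
def carrier (J : Set (Cell Y)) : Set Y := ⋃ k ∈ J, k.op

theorem mem_carrier {J : Set (Cell Y)} {y : Y} : y ∈ carrier J ↔ ∃ k ∈ J, y ∈ k.op := by
  simp [carrier]

theorem carrier_mono {J J' : Set (Cell Y)} (h : J ⊆ J') : carrier J ⊆ carrier J' := fun y hy => by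
  obtain ⟨k, hk, hy⟩ := mem_carrier.1 hy
  exact mem_carrier.2 ⟨k, h hk, hy⟩

theorem Cell.eq_of_mem {k l : Cell Y} {y : Y} (hk : y ∈ k.op) (hl : y ∈ l.op) : k = l :=
  eq_of_not_disjoint_openCell (C := (Set.univ : Set Y)) (fun h => Set.disjoint_left.1 h hk hl)

/-- A set of cells such that the boundary of each of them is covered by cells of the set which are
of smaller dimension: the cells of a subcomplex. -/
def IsLowerCells (J : Set (Cell Y)) : Prop :=
  ∀ k ∈ J, cellFrontier k.1 k.2 ⊆ carrier {l ∈ J | l.1 < k.1}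

theorem IsLowerCells.union {J J' : Set (Cell Y)} (h : IsLowerCells J) (h' : IsLowerCells J') :
    IsLowerCells (J ∪ J') := by
  rintro k (hk | hk)
  · exact (h k hk).trans (carrier_mono fun l hl => ⟨Or.inl hl.1, hl.2⟩)
  · exact (h' k hk).trans (carrier_mono fun l hl => ⟨Or.inr hl.1, hl.2⟩)

theorem isLowerCells_dim_le (N : ℕ) : IsLowerCells {k : Cell Y | k.1 ≤ N} := by
  rintro ⟨n, k⟩ hk y hy
  obtain ⟨S, hS⟩ := cellFrontier_subset_finite_openCell n k
  have := hS hy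
  simp only [Set.mem_iUnion] at this
  obtain ⟨m, hm, j, -, hj⟩ := this
  exact mem_carrier.2 ⟨⟨m, j⟩, ⟨hm.le.trans hk, hm⟩, hj⟩

/-- Every cell lies in a finite subcomplex. -/
theorem exists_isLowerCells_singleton (n : ℕ) (k : cell (Set.univ : Set Y) n) :
    ∃ J : Set (Cell Y), J.Finite ∧ IsLowerCells J ∧ ⟨n, k⟩ ∈ J := by
  induction n using Nat.strong_induction_on with
  | _ n ih =>
    obtain ⟨S, hS⟩ := cellFrontier_subset_finite_openCell n k
    choose! J hJ using ih
    have hfin : (⋃ m ∈ Set.Iio n, ⋃ j ∈ (S m : Set (cell (Set.univ : Set Y) m)), J m j).Finite := by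
      refine Set.Finite.biUnion (Set.finite_Iio n) fun m hm => ?_
      refine Set.Finite.biUnion (Finset.finite_toSet _) fun j _ => ?_
      exact (hJ m hm j).1
    refine ⟨insert ⟨n, k⟩ (⋃ m ∈ Set.Iio n, ⋃ j ∈ (S m : Set (cell (Set.univ : Set Y) m)), J m j), hfin.insert _, ?_,
      Set.mem_insert _ _⟩
    rintro l (rfl | hl)
    · intro y hy
      have := hS hy
      simp only [Set.mem_iUnion] at this
      obtain ⟨m, hm, j, hj, hy⟩ := this
      refine mem_carrier.2 ⟨⟨m, j⟩, ⟨Or.inr ?_, hm⟩, hy⟩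
      simp only [Set.mem_iUnion]
      exact ⟨m, hm, j, hj, (hJ m hm j).2.2⟩
    · simp only [Set.mem_iUnion] at hl
      obtain ⟨m, hm, j, hj, hl⟩ := hl
      refine ((hJ m hm j).2.1 l hl).trans (carrier_mono fun l' hl' => ⟨Or.inr ?_, hl'.2⟩)
      simp only [Set.mem_iUnion]
      exact ⟨m, hm, j, hj, hl'.1⟩

theorem exists_isLowerCells {S : Set (Cell Y)} (hS : S.Finite) :
    ∃ J : Set (Cell Y), J.Finite ∧ IsLowerCells J ∧ S ⊆ J := by
  induction S, hS using Set.Finite.induction_on with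
  | empty => exact ⟨∅, Set.finite_empty, fun k hk => hk.elim, le_rfl⟩
  | insert _ _ ih =>
    rename_i k S _ _
    obtain ⟨J, h1, h2, h3⟩ := ih
    obtain ⟨J', h1', h2', h3'⟩ := exists_isLowerCells_singleton k.1 k.2
    exact ⟨J' ∪ J, h1'.union h1, h2'.union h2, Set.insert_subset (Or.inl h3')
      (h3.trans Set.subset_union_right)⟩

theorem IsLowerCells.closedCell_subset {J : Set (Cell Y)} (h : IsLowerCells J) {k : Cell Y}
    (hk : k ∈ J) : closedCell k.1 k.2 ⊆ carrier J := by
  rw [← cellFrontier_union_openCell_eq_closedCell]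
  exact Set.union_subset ((h k hk).trans (carrier_mono fun l hl => hl.1))
    fun y hy => mem_carrier.2 ⟨k, hk, hy⟩

theorem exists_finite_closedCell_subset (k : Cell Y) :
    ∃ J : Set (Cell Y), J.Finite ∧ closedCell k.1 k.2 ⊆ carrier J := by
  obtain ⟨J, h1, h2, h3⟩ := exists_isLowerCells_singleton k.1 k.2
  exact ⟨J, h1, h2.closedCell_subset h3⟩

theorem exists_mem_op (y : Y) : ∃ k : Cell Y, y ∈ k.op := by
  have h : y ∈ ⋃ (n : ℕ) (j : cell (Set.univ : Set Y) n), openCell n j := by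
    rw [iUnion_openCell_eq_complex]; trivial
  simp only [Set.mem_iUnion] at h
  obtain ⟨n, j, h⟩ := h
  exact ⟨⟨n, j⟩, h⟩

/-- Removing a cell which is not in the boundary of any other. -/
theorem IsLowerCells.diff {J : Set (Cell Y)} (h : IsLowerCells J) {k : Cell Y}
    (hmax : ∀ l ∈ J, l.1 ≤ k.1) : IsLowerCells (J \ {k}) := fun l hl =>
  (h l hl.1).trans (carrier_mono fun l' hl' => ⟨⟨hl'.1, by
    rintro rfl
    exact absurd (hmax l hl.1) (not_le.2 hl'.2)⟩, hl'.2⟩)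

theorem carrier_diff_homeo (J : Set (Cell Y)) (k : Cell Y) :
    Nonempty ({x : carrier J | (x : Y) ∈ carrier (J \ {k})} ≃ₜ carrier (J \ {k})) :=
  ⟨subtypeHomeo _ _ (fun _ hx => hx) fun _ hx => ⟨carrier_mono Set.sdiff_subset hx, hx⟩⟩

variable [T2Space Y]

theorem IsLowerCells.isClosed_carrier {J : Set (Cell Y)} (h : IsLowerCells J) (hJ : J.Finite) :
    IsClosed (carrier J) := by
  have : carrier J = ⋃ k ∈ J, closedCell k.1 k.2 :=
    Set.Subset.antisymm (Set.iUnion₂_mono fun k _ => openCell_subset_closedCell k.1 k.2)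
      (Set.iUnion₂_subset fun k hk => h.closedCell_subset hk)
  rw [this]
  exact hJ.isClosed_biUnion fun k _ => isClosed_closedCell

/-- A set with at most one point in each open cell is closed, since every closed cell meets finitely
many open cells. -/
theorem isClosed_of_subsingleton_inter {A : Set Y}
    (hA : ∀ k : Cell Y, (A ∩ k.op).Subsingleton) : IsClosed A := by
  rw [CWComplex.closed (Set.univ : Set Y) A (Set.subset_univ A)]
  intro n j
  obtain ⟨J, hJ, hsub⟩ := exists_finite_closedCell_subset (⟨n, j⟩ : Cell Y)
  refine Set.Finite.isClosed (Set.Finite.subset (hJ.biUnion fun k _ => (hA k).finite) ?_)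
  rintro y ⟨hy, hy'⟩
  obtain ⟨k, hk, hk'⟩ := mem_carrier.1 (hsub hy')
  exact Set.mem_biUnion hk ⟨hy, hk'⟩

/-- A compact subset of a CW-complex meets only finitely many open cells. -/
theorem finite_cells_of_isCompact {K : Set Y} (hK : IsCompact K) :
    {k : Cell Y | (K ∩ k.op).Nonempty}.Finite := by
  rcases isEmpty_or_nonempty Y with hY | hY
  · exact Set.finite_empty.subset fun k hk => isEmptyElim hk.some
  choose! x hx using fun (k : Cell Y) (h : (K ∩ k.op).Nonempty) => h
  -- choose a point in each cell met by the compact set: every set of these points is closed, so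
  -- they form a discrete compact set
  have hsub : ∀ A ⊆ x '' {k : Cell Y | (K ∩ k.op).Nonempty}, IsClosed A := by
    intro A hA
    refine isClosed_of_subsingleton_inter fun k => ?_
    rintro y ⟨hy, hyk⟩ y' ⟨hy', hyk'⟩
    obtain ⟨l, hl, rfl⟩ := hA hy
    obtain ⟨l', hl', rfl⟩ := hA hy'
    rw [Cell.eq_of_mem (hx l hl).2 hyk, Cell.eq_of_mem (hx l' hl').2 hyk']
  have hcomp : IsCompact (x '' {k : Cell Y | (K ∩ k.op).Nonempty}) :=
    hK.of_isClosed_subset (hsub _ le_rfl) (by rintro _ ⟨k, hk, rfl⟩; exact (hx k hk).1)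
  have hdisc : DiscreteTopology (x '' {k : Cell Y | (K ∩ k.op).Nonempty}) := by
    refine discreteTopology_iff_isOpen_singleton.2 fun s => ?_
    rw [← isClosed_compl_iff]
    have := (hsub (Subtype.val '' {s}ᶜ) (by rintro _ ⟨y, -, rfl⟩; exact y.2)).preimage
      (continuous_subtype_val (p := (· ∈ x '' {k : Cell Y | (K ∩ k.op).Nonempty})))
    rwa [Set.preimage_image_eq _ Subtype.val_injective] at this
  refine Set.Finite.of_finite_image (hcomp.finite ⟨hdisc⟩) ?_
  intro k hk l hl hkl
  have h1 := (hx k hk).2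
  rw [hkl] at h1
  exact Cell.eq_of_mem h1 (hx l hl).2

/-- Every chain is carried by a finite subcomplex. -/
theorem exists_carrier_of_chain {n : ℕ} (c : Chain n Y) :
    ∃ J : Set (Cell Y), J.Finite ∧ IsLowerCells J ∧
      ∃ c' : Chain n (carrier J), map (incl _) c' = c := by
  induction c using chain_induction with
  | zero => exact ⟨∅, Set.finite_empty, fun k hk => hk.elim, 0, map_zero _⟩
  | add a b ha hb =>
    obtain ⟨J, h1, h2, a', rfl⟩ := ha
    obtain ⟨J', h1', h2', b', rfl⟩ := hb
    refine ⟨J ∪ J', h1.union h1', h2.union h2',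
      map (inclOf (carrier_mono Set.subset_union_left)) a' +
        map (inclOf (carrier_mono Set.subset_union_right)) b', ?_⟩
    rw [map_add, map_incl_inclOf, map_incl_inclOf]
  | smul r a ha =>
    obtain ⟨J, h1, h2, a', rfl⟩ := ha
    exact ⟨J, h1, h2, r • a', map_smul _ _ _⟩
  | cube s =>
    obtain ⟨J, h1, h2, h3⟩ := exists_isLowerCells
      (finite_cells_of_isCompact (isCompact_range s.continuous))
    have hs : ∀ y, s y ∈ carrier J := fun y => by
      obtain ⟨k, hk⟩ := exists_mem_op (s y)
      exact mem_carrier.2 ⟨k, h3 ⟨s y, ⟨y, rfl⟩, hk⟩, hk⟩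
    refine ⟨J, h1, h2, cube ⟨fun y => ⟨s y, hs y⟩, by fun_prop⟩, ?_⟩
    rw [map_cube]
    rfl

/-- A maximal cell of a finite complex is attached to the union of the other cells. -/
theorem IsLowerCells.exists_isCellAttachment {J : Set (Cell Y)} (h : IsLowerCells J)
    (hJ : J.Finite) {k : Cell Y} (hk : k ∈ J) (h' : IsLowerCells (J \ {k})) :
    ∃ Φ ψ, IsCellAttachment (X := carrier J) k.1 {x | (x : Y) ∈ carrier (J \ {k})} Φ ψ := by
  classical
  have hΦ : ∀ v ∈ Metric.closedBall (0 : Fin k.1 → ℝ) 1, RelCWComplex.map k.1 k.2 v ∈ carrier J := fun v hv =>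
    h.closedCell_subset hk ⟨v, hv, rfl⟩
  have h0 : (0 : Fin k.1 → ℝ) ∈ Metric.closedBall (0 : Fin k.1 → ℝ) 1 := by simp
  let Φ : (Fin k.1 → ℝ) → carrier J := fun v =>
    if hv : v ∈ Metric.closedBall (0 : Fin k.1 → ℝ) 1 then ⟨_, hΦ v hv⟩ else ⟨_, hΦ 0 h0⟩
  have hval : ∀ v ∈ Metric.closedBall (0 : Fin k.1 → ℝ) 1, (Φ v : Y) = RelCWComplex.map k.1 k.2 v := fun v hv => by
    simp only [Φ, dif_pos hv]
  have hb := Metric.ball_subset_closedBall (x := (0 : Fin k.1 → ℝ)) (ε := 1)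
  have hsrc := RelCWComplex.source_eq (C := (Set.univ : Set Y)) k.1 k.2
  have hop : ∀ x : carrier J, (x : Y) ∉ carrier (J \ {k}) → (x : Y) ∈ k.op := fun x hx => by
    obtain ⟨l, hl, hxl⟩ := mem_carrier.1 x.2
    by_cases e : l = k
    · exact e ▸ hxl
    · exact (hx (mem_carrier.2 ⟨l, ⟨hl, e⟩, hxl⟩)).elim
  have htgt : ∀ y ∈ k.op, y ∈ (RelCWComplex.map k.1 k.2).target := by
    rintro _ ⟨v, hv, rfl⟩
    exact (RelCWComplex.map k.1 k.2).map_source (hsrc ▸ hv)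
  have hinv : ∀ y ∈ k.op,
      (RelCWComplex.map k.1 k.2).symm y ∈ Metric.ball (0 : Fin k.1 → ℝ) 1 ∧
      RelCWComplex.map k.1 k.2 ((RelCWComplex.map k.1 k.2).symm y) = y := fun y hy =>
    ⟨hsrc ▸ (RelCWComplex.map k.1 k.2).map_target (htgt y hy),
      (RelCWComplex.map k.1 k.2).right_inv (htgt y hy)⟩
  refine ⟨Φ, fun x => (RelCWComplex.map k.1 k.2).symm x, ?_, ?_, ?_, ?_, ?_, ?_, ?_, ?_⟩
  · exact (h'.isClosed_carrier (hJ.subset Set.sdiff_subset)).preimage continuous_subtype_val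
  · rw [Topology.IsInducing.subtypeVal.continuousOn_iff]
    exact (RelCWComplex.continuousOn k.1 k.2).congr hval
  · exact (RelCWComplex.continuousOn_symm k.1 k.2).comp continuous_subtype_val.continuousOn
      fun x hx => htgt _ (hop x hx)
  · intro v hv
    have hv' := Metric.sphere_subset_closedBall hv
    change (Φ v : Y) ∈ carrier (J \ {k})
    rw [hval v hv']
    refine carrier_mono (J' := J \ {k}) (fun l hl => ⟨hl.1, fun e => ?_⟩) (h k hk ⟨v, hv, rfl⟩)
    have e' : l = k := e
    exact lt_irrefl _ (e' ▸ hl.2)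
  · intro v hv hmem
    change (Φ v : Y) ∈ carrier (J \ {k}) at hmem
    rw [hval v (hb hv)] at hmem
    obtain ⟨l, hl, hvl⟩ := mem_carrier.1 hmem
    exact hl.2 (Cell.eq_of_mem hvl ⟨v, hv, rfl⟩)
  · intro v hv
    rw [hval v (hb hv)]
    exact (RelCWComplex.map k.1 k.2).left_inv (hsrc ▸ hv)
  · exact fun x hx => (hinv x (hop x hx)).1
  · intro x hx
    have := hinv x (hop x hx)
    exact Subtype.ext ((hval _ (hb this.1)).trans this.2)

theorem FinHom.of_homeomorph {X Z : Type*} [TopologicalSpace X] [TopologicalSpace Z] (e : X ≃ₜ Z)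
    {n : ℕ} (h : FinHom n Z) : FinHom n X :=
  h.of_dominated (e : C(X, Z)) (e.symm : C(Z, X)) (by
    have : (e.symm : C(Z, X)).comp (e : C(X, Z)) = ContinuousMap.id X := by ext; simp
    rw [this])

/-- Finite CW-complexes have finite-dimensional homology. -/
theorem IsLowerCells.finHom {J : Set (Cell Y)} (h : IsLowerCells J) (hJ : J.Finite) (m : ℕ) :
    FinHom m (carrier J) := by
  induction hn : J.ncard generalizing J m with
  | zero =>
    rw [Set.ncard_eq_zero hJ] at hn
    subst hn
    have : IsEmpty (carrier (∅ : Set (Cell Y))) := ⟨fun x => by simpa [carrier] using x.2⟩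
    exact finHom_of_isEmpty m
  | succ n ih =>
    have hne : J.Nonempty := by
      rw [← Set.ncard_pos hJ]; omega
    obtain ⟨k, hk, hmax⟩ := Set.exists_max_image J (fun k => k.1) hJ hne
    have h' := h.diff hmax
    obtain ⟨Φ, ψ, hatt⟩ := h.exists_isCellAttachment hJ hk h'
    refine hatt.finHom (fun m => ?_) m
    obtain ⟨e⟩ := carrier_diff_homeo J k
    refine FinHom.of_homeomorph e (ih h' (hJ.subset Set.sdiff_subset) m ?_)
    rw [Set.ncard_sdiff_singleton_of_mem hk, hn]
    rfl

/-- In degrees up to `N`, all homology of a finite complex comes from its `N`-skeleton. -/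
theorem IsLowerCells.exists_homologous {N m : ℕ} (hm : m + 1 ≤ N) {J₀ J : Set (Cell Y)}
    (hJ₀ : ∀ k ∈ J₀, k.1 ≤ N) (hsub : J₀ ⊆ J) (hdiff : ∀ k ∈ J \ J₀, N < k.1)
    (h : IsLowerCells J) (hJ : J.Finite) {c : Chain (m + 1) (carrier J)}
    (hc : c ∈ cycles (m + 1) (carrier J)) :
    ∃ c' ∈ cycles (m + 1) (carrier J₀),
      c - map (inclOf (carrier_mono hsub)) c' ∈ boundaries (m + 1) (carrier J) := by
  induction hn : (J \ J₀).ncard generalizing J with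
  | zero =>
    rw [Set.ncard_eq_zero (hJ.subset Set.sdiff_subset), Set.sdiff_eq_empty] at hn
    obtain rfl := Set.Subset.antisymm hsub hn
    refine ⟨c, hc, ?_⟩
    have : inclOf (carrier_mono hsub) = ContinuousMap.id _ := rfl
    rw [this, map_id, sub_self]
    exact zero_mem _
  | succ n ih =>
    have hne : (J \ J₀).Nonempty := by
      rw [← Set.ncard_pos (hJ.subset Set.sdiff_subset)]; omega
    -- remove a cell outside of `J₀` of maximal dimension, which exceeds `N`
    obtain ⟨k, hk, hmax⟩ := Set.exists_max_image (J \ J₀) (fun k => k.1)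
      (hJ.subset Set.sdiff_subset) hne
    have h' : IsLowerCells (J \ {k}) := h.diff fun l hl => by
      by_cases hl0 : l ∈ J₀
      · exact (hJ₀ l hl0).trans (hdiff k hk).le
      · exact hmax l ⟨hl, hl0⟩
    obtain ⟨Φ, ψ, hatt⟩ := h.exists_isCellAttachment hJ hk.1 h'
    obtain ⟨a, ha, hab⟩ := hatt.exists_homologous (m := m)
      (by have := hdiff k hk; omega) hc
    have hsub' : J₀ ⊆ J \ {k} := fun l hl => ⟨hsub hl, by rintro rfl; exact hk.2 hl⟩
    let e : C({x : carrier J | (x : Y) ∈ carrier (J \ {k})}, carrier (J \ {k})) :=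
      ⟨fun x => ⟨x.1.1, x.2⟩, by fun_prop⟩
    obtain ⟨c', hc', hcc⟩ := ih hsub' (fun l hl => hdiff l ⟨hl.1.1, hl.2⟩) h'
      (hJ.subset Set.sdiff_subset) (map_mem_cycles e ha) (by
        have : (J \ {k}) \ J₀ = (J \ J₀) \ {k} := by ext; simp; tauto
        rw [this, Set.ncard_sdiff_singleton_of_mem hk, hn]
        rfl)
    refine ⟨c', hc', ?_⟩
    have h1 := map_mem_boundaries (inclOf (carrier_mono (Set.sdiff_subset (s := J) (t := {k})))) hcc
    rw [map_sub, map_map, map_map] at h1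
    have := add_mem hab h1
    rw [← sub_add_sub_cancel c (map (incl _) a)]
    exact this

/-- A path-connected CW-complex with finite `N`-skeleton has finite-dimensional homology in degrees
up to `N`. -/
theorem finHom_of_finite_skeleton [PathConnectedSpace Y] {N : ℕ}
    (hN : ∀ n ≤ N, Finite (cell (Set.univ : Set Y) n)) {i : ℕ} (hi : i ≤ N) : FinHom i Y := by
  cases i with
  | zero => exact finHom_zero
  | succ m =>
    have hfin : {k : Cell Y | k.1 ≤ N}.Finite := by
      have : {k : Cell Y | k.1 ≤ N} = ⋃ n ∈ Set.Iic N, Set.range (Sigma.mk n) := by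
        ext ⟨n, k⟩
        simp only [Set.mem_ofPred_eq, Set.mem_iUnion, Set.mem_Iic, Set.mem_range]
        constructor
        · exact fun h => ⟨n, h, k, rfl⟩
        · rintro ⟨n', h, k', e⟩
          cases e
          exact h
      rw [this]
      refine (Set.finite_Iic N).biUnion fun n hn => ?_
      have := hN n hn
      exact Set.finite_range _
    obtain ⟨W, hW, hW'⟩ := (isLowerCells_dim_le (Y := Y) N).finHom hfin (m + 1)
    refine ⟨W.map (map (incl _)), inferInstance, fun c hc => ?_⟩
    -- a cycle lives on a finite subcomplex, and there it comes from the skeleton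
    obtain ⟨J, hJ, hl, c', rfl⟩ := exists_carrier_of_chain c
    have hc' : c' ∈ cycles (m + 1) (carrier J) := by
      rw [mem_cycles_succ, bd_map] at hc
      exact mem_cycles_succ.2 (map_incl_injective _ (hc.trans (map_zero _).symm))
    have hsub : J ⊆ {k : Cell Y | k.1 ≤ N} ∪ J := Set.subset_union_right
    obtain ⟨a, ha, hab⟩ := IsLowerCells.exists_homologous hi (J₀ := {k : Cell Y | k.1 ≤ N})
      (fun k hk => hk) Set.subset_union_left (fun k hk => not_le.1 hk.2)
      ((isLowerCells_dim_le N).union hl) (hfin.union hJ)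
      (map_mem_cycles (inclOf (carrier_mono hsub)) hc')
    have h1 := map_mem_boundaries (incl _) hab
    rw [map_sub, map_incl_inclOf, map_incl_inclOf] at h1
    obtain ⟨w, hw, b, hb, hwb⟩ := Submodule.mem_sup.1 (hW' ha)
    rw [← hwb, map_add] at h1
    refine Submodule.mem_sup.2 ⟨map (incl _) w, Submodule.mem_map_of_mem hw, _,
      add_mem h1 (map_mem_boundaries (incl _) hb), ?_⟩
    abel

omit [TopologicalSpace Y] [CWComplex (Set.univ : Set Y)] [T2Space Y] in
theorem finHom_of_isQFiniteSpace {N : ℕ} {X : Type u} [TopologicalSpace X]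
    (h : IsQFiniteSpace N X) {i : ℕ} (hi : i ≤ N) : FinHom i X := by
  obtain ⟨hX, Y, _, _, _, hN, ⟨e⟩⟩ := h
  have : PathConnectedSpace Y := by
    obtain ⟨x⟩ := PathConnectedSpace.nonempty (X := X)
    refine ⟨⟨e x⟩, ?_⟩
    have hj : ∀ y, Joined (e (e.symm y)) y := fun y => by
      obtain ⟨H⟩ := e.right_inv
      exact ⟨H.evalAt y⟩
    exact fun y z => (hj y).symm.trans
      (((PathConnectedSpace.joined (e.symm y) (e.symm z)).map e.toFun.continuous).trans (hj z))
  exact (finHom_of_finite_skeleton hN hi).of_dominated e.toFun e.invFun e.left_inv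

end Cubical

/-! ### Subalgebras and generators -/

namespace GCAlg

variable {k : Type w} [Field k]

theorem isSubalgebra_adjoin (A : GCAlg.{u, w} k) (W : ∀ n, Submodule k (A.carrier n)) :
    A.IsSubalgebra (A.adjoin W) where
  one_mem := by
    simp only [adjoin, Submodule.mem_sInf]
    rintro _ ⟨S, hS, -, rfl⟩
    exact hS.one_mem
  mul_mem := by
    intro i j n h a b ha hb
    simp only [adjoin, Submodule.mem_sInf] at ha hb ⊢
    rintro _ ⟨S, hS, hW, rfl⟩
    exact hS.mul_mem h (ha _ ⟨S, hS, hW, rfl⟩) (hb _ ⟨S, hS, hW, rfl⟩)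

theorem le_adjoin (A : GCAlg.{u, w} k) (W : ∀ n, Submodule k (A.carrier n)) (n : ℕ) :
    W n ≤ A.adjoin W n := by
  refine le_sInf ?_
  rintro _ ⟨S, -, hW, rfl⟩
  exact hW n

theorem adjoin_le {A : GCAlg.{u, w} k} {W S : ∀ n, Submodule k (A.carrier n)}
    (hS : A.IsSubalgebra S) (h : ∀ n, W n ≤ S n) (n : ℕ) : A.adjoin W n ≤ S n :=
  sInf_le ⟨S, hS, h, rfl⟩

theorem adjoin_mono {A : GCAlg.{u, w} k} {W W' : ∀ n, Submodule k (A.carrier n)}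
    (h : ∀ n, W n ≤ W' n) (n : ℕ) : A.adjoin W n ≤ A.adjoin W' n :=
  adjoin_le (A.isSubalgebra_adjoin W') (fun m => (h m).trans (A.le_adjoin W' m)) n

/-- A graded subalgebra, as an algebra of its own. -/
def sub (A : GCAlg.{u, w} k) (S : ∀ n, Submodule k (A.carrier n)) (hS : A.IsSubalgebra S) :
    GCAlg.{u, w} k where
  carrier n := S n
  mul {i j n} h := LinearMap.mk₂ k (fun a b => ⟨A.mul h a b, hS.mul_mem h a.2 b.2⟩)
    (fun a a' b => Subtype.ext (by simp)) (fun c a b => Subtype.ext (by simp))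
    (fun a b b' => Subtype.ext (by simp)) (fun c a b => Subtype.ext (by simp))
  one := ⟨A.one, hS.one_mem⟩
  one_mul' a := Subtype.ext (A.one_mul' a.1)
  mul_one' a := Subtype.ext (A.mul_one' a.1)
  mul_assoc' h₁ h₂ h₃ h₄ a b c := Subtype.ext (A.mul_assoc' h₁ h₂ h₃ h₄ a.1 b.1 c.1)
  mul_comm' h h' a b := Subtype.ext (A.mul_comm' h h' a.1 b.1)

/-- The free algebra on `V` is generated by `V`. -/
theorem IsFreeOn.mem_adjoin {A : GCAlg.{u, w} k} {V : ∀ n, Submodule k (A.carrier n)}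
    (h : A.IsFreeOn V) {n : ℕ} (x : A.carrier n) : x ∈ A.adjoin V n := by
  obtain ⟨φ, hφ, -⟩ := h (A.sub _ (A.isSubalgebra_adjoin V))
    (fun n => Submodule.inclusion (A.le_adjoin V n))
  obtain ⟨χ, -, huniq⟩ := h A (fun n => (V n).subtype)
  let φ' : A.Hom A :=
    { toFun := fun n => (A.adjoin V n).subtype ∘ₗ φ.toFun n
      map_one := congrArg Subtype.val φ.map_one
      map_mul := fun h a b => congrArg Subtype.val (φ.map_mul h a b) }
  let id' : A.Hom A :=
    { toFun := fun n => LinearMap.id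
      map_one := rfl
      map_mul := fun h a b => rfl }
  have h1 : φ' = χ := huniq φ' fun n v => congrArg Subtype.val (hφ n v)
  have h2 : id' = χ := huniq id' fun n v => rfl
  have h3 : φ'.toFun n x = id'.toFun n x := by rw [h1, h2]
  have h4 : φ'.toFun n x = x := h3
  rw [← h4]
  exact (φ.toFun n x).2

/-- The subspace where two homomorphisms agree is a subalgebra. -/
theorem isSubalgebra_eqLocus {A B : GCAlg.{u, w} k} (f g : A.Hom B) :
    A.IsSubalgebra fun n => LinearMap.eqLocus (f.toFun n) (g.toFun n) where
  one_mem := f.map_one.trans g.map_one.symm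
  mul_mem := by
    intro i j n h a b ha hb
    have ha' : f.toFun i a = g.toFun i a := ha
    have hb' : f.toFun j b = g.toFun j b := hb
    change f.toFun n _ = g.toFun n _
    rw [f.map_mul, g.map_mul, ha', hb']

theorem Hom.eq_on_adjoin {A B : GCAlg.{u, w} k} {f g : A.Hom B}
    {W : ∀ n, Submodule k (A.carrier n)} (h : ∀ n, ∀ x ∈ W n, f.toFun n x = g.toFun n x) {n : ℕ}
    {x : A.carrier n} (hx : x ∈ A.adjoin W n) : f.toFun n x = g.toFun n x :=
  adjoin_le (isSubalgebra_eqLocus f g) (fun n x hx => h n x hx) n hx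

/-- The algebra generated by an increasing union is the union of the algebras generated. -/
theorem exists_mem_adjoin {A : GCAlg.{u, w} k} {G : ℕ → ∀ n, Submodule k (A.carrier n)}
    (hG : ∀ n, Monotone fun s => G s n) {W : ∀ n, Submodule k (A.carrier n)}
    (h : ∀ n, ∀ x ∈ W n, ∃ s, x ∈ G s n) {n : ℕ} {x : A.carrier n} (hx : x ∈ A.adjoin W n) :
    ∃ s, x ∈ A.adjoin (G s) n := by
  have hmono : ∀ n, Monotone fun s => A.adjoin (G s) n := fun n s t hst =>
    adjoin_mono (fun m => hG m hst) n
  let S : ∀ n, Submodule k (A.carrier n) := fun n => ⨆ s, A.adjoin (G s) n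
  have hmem : ∀ n (x : A.carrier n), x ∈ S n ↔ ∃ s, x ∈ A.adjoin (G s) n := fun n x =>
    Submodule.mem_iSup_of_directed _ (hmono n).directed_le
  have hS : A.IsSubalgebra S :=
    { one_mem := (hmem _ _).2 ⟨0, (A.isSubalgebra_adjoin _).one_mem⟩
      mul_mem := by
        intro i j n h a b ha hb
        obtain ⟨s, hs⟩ := (hmem _ _).1 ha
        obtain ⟨t, ht⟩ := (hmem _ _).1 hb
        exact (hmem _ _).2 ⟨max s t, (A.isSubalgebra_adjoin _).mul_mem h
          (hmono i (le_max_left s t) hs) (hmono j (le_max_right s t) ht)⟩ }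
  exact (hmem n x).1 (adjoin_le hS (fun n x hx => by
    obtain ⟨s, hs⟩ := h n x hx
    exact (hmem n x).2 ⟨s, A.le_adjoin _ n hs⟩) n hx)

end GCAlg

namespace CDGA

variable {k : Type w} [Field k] {A B C D M : CDGA.{u, w} k}

/-- The composition of cdga maps. -/
def Hom.comp (g : B.Hom C) (f : A.Hom B) : A.Hom C where
  toFun n := g.toFun n ∘ₗ f.toFun n
  map_one := by
    change g.toFun 0 (f.toFun 0 A.one) = C.one
    rw [f.map_one, g.map_one]
  map_mul h a b := by
    change g.toFun _ (f.toFun _ _) = _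
    rw [f.map_mul, g.map_mul]; rfl
  map_d a := by
    change g.toFun _ (f.toFun _ _) = _
    rw [f.map_d, g.map_d]; rfl

theorem Hom.mapCohomology_comp (g : B.Hom C) (f : A.Hom B) (i : ℕ) (x : A.Cohomology i) :
    (g.comp f).mapCohomology i x = g.mapCohomology i (f.mapCohomology i x) := by
  obtain ⟨x, rfl⟩ := Submodule.Quotient.mk_surjective _ x
  rfl

theorem Hom.IsQEquivalence.comp {q : ℕ} {g : B.Hom C} {f : A.Hom B} (hg : g.IsQEquivalence q)
    (hf : f.IsQEquivalence q) : (g.comp f).IsQEquivalence q := by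
  have h : ∀ i, ⇑((g.comp f).mapCohomology i) = g.mapCohomology i ∘ f.mapCohomology i := fun i =>
    funext (g.mapCohomology_comp f i)
  refine ⟨fun i hi => ?_, ?_⟩
  · rw [h]; exact (hg.1 i hi).comp (hf.1 i hi)
  · rw [h]; exact hg.2.comp hf.2

theorem Hom.IsQEquivalence.of_comp {q : ℕ} {g : B.Hom C} {f : A.Hom B} {h : A.Hom C}
    (hg : g.IsQEquivalence q) (hh : h.IsQEquivalence q)
    (e : ∀ i x, g.mapCohomology i (f.mapCohomology i x) = h.mapCohomology i x) :
    f.IsQEquivalence q := by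
  have e' : ∀ i, g.mapCohomology i ∘ f.mapCohomology i = h.mapCohomology i := fun i =>
    funext (e i)
  refine ⟨fun i hi => ?_, ?_⟩
  · refine (Function.Bijective.of_comp_iff' (hg.1 i hi) _).1 ?_
    rw [e']; exact hh.1 i hi
  · refine Function.Injective.of_comp (f := g.mapCohomology (q + 1)) ?_
    rw [e']; exact hh.2

theorem Hom.IsQEquivalence.injective {q : ℕ} {f : A.Hom B} (hf : f.IsQEquivalence q) {i : ℕ}
    (hi : i ≤ q + 1) : Function.Injective (f.mapCohomology i) := by
  rcases hi.lt_or_eq with h | rfl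
  · exact (hf.1 i (Nat.lt_succ_iff.1 h)).1
  · exact hf.2

theorem mapCohomology_mk (f : A.Hom B) (i : ℕ) (x : A.cocycles i) :
    f.mapCohomology i (Submodule.Quotient.mk x) = Submodule.Quotient.mk (f.mapCocycles i x) := rfl

/-- Injectivity in cohomology, on the level of cocycles. -/
theorem exists_of_injective {f : A.Hom B} {n : ℕ} (hf : Function.Injective (f.mapCohomology (n + 1)))
    {c : A.carrier (n + 1)} (hc : A.d _ c = 0) {y : B.carrier n} (hy : f.toFun _ c = B.d n y) :
    ∃ a, A.d n a = c := by
  have h0 : f.mapCohomology (n + 1) (Submodule.Quotient.mk ⟨c, hc⟩) = 0 := by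
    rw [mapCohomology_mk, Submodule.Quotient.mk_eq_zero]
    exact ⟨y, hy.symm⟩
  rw [← map_zero (f.mapCohomology (n + 1))] at h0
  have := hf h0
  rw [Submodule.Quotient.mk_eq_zero] at this
  exact this

/-- Surjectivity in cohomology, on the level of cocycles. -/
theorem exists_of_surjective {f : A.Hom B} {n : ℕ} (hf : Function.Surjective (f.mapCohomology n))
    {y : B.carrier n} (hy : B.d _ y = 0) :
    ∃ z, A.d n z = 0 ∧ f.toFun n z - y ∈ B.coboundaries n := by
  obtain ⟨x, hx⟩ := hf (Submodule.Quotient.mk ⟨y, hy⟩)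
  obtain ⟨z, rfl⟩ := Submodule.Quotient.mk_surjective _ x
  rw [mapCohomology_mk, Submodule.Quotient.eq] at hx
  exact ⟨z.1, z.2, hx⟩

/-- The product of two cdgas. -/
def prod (A B : CDGA.{u, w} k) : CDGA.{u, w} k where
  carrier n := A.carrier n × B.carrier n
  mul {i j n} h := LinearMap.mk₂ k (fun a b => (A.mul h a.1 b.1, B.mul h a.2 b.2))
    (fun a a' b => by simp) (fun c a b => by simp) (fun a b b' => by simp) (fun c a b => by simp)
  one := (A.one, B.one)
  one_mul' a := Prod.ext (A.one_mul' a.1) (B.one_mul' a.2)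
  mul_one' a := Prod.ext (A.mul_one' a.1) (B.mul_one' a.2)
  mul_assoc' h₁ h₂ h₃ h₄ a b c := Prod.ext (A.mul_assoc' h₁ h₂ h₃ h₄ a.1 b.1 c.1)
    (B.mul_assoc' h₁ h₂ h₃ h₄ a.2 b.2 c.2)
  mul_comm' h h' a b := Prod.ext (A.mul_comm' h h' a.1 b.1) (B.mul_comm' h h' a.2 b.2)
  d n := (A.d n).prodMap (B.d n)
  d_d a := Prod.ext (A.d_d a.1) (B.d_d a.2)
  leibniz h h₁ h₂ a b := Prod.ext (A.leibniz h h₁ h₂ a.1 b.1) (B.leibniz h h₁ h₂ a.2 b.2)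

/-- A graded subalgebra closed under the differential, as a cdga. -/
def sub (A : CDGA.{u, w} k) (S : ∀ n, Submodule k (A.carrier n)) (hS : A.IsSubalgebra S)
    (hd : ∀ n, ∀ x ∈ S n, A.d n x ∈ S (n + 1)) : CDGA.{u, w} k where
  toGCAlg := A.toGCAlg.sub S hS
  d n := (A.d n).restrict (hd n)
  d_d a := Subtype.ext (A.d_d a.1)
  leibniz h h₁ h₂ a b := Subtype.ext (A.leibniz h h₁ h₂ a.1 b.1)

/-- The pairs with equal images form a subalgebra of the product. -/
theorem isSubalgebra_pullback (f : A.Hom C) (g : B.Hom C) : (A.prod B).IsSubalgebra fun n =>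
    LinearMap.ker (f.toFun n ∘ₗ LinearMap.fst k _ _ - g.toFun n ∘ₗ LinearMap.snd k _ _) where
  one_mem := sub_eq_zero.2 (f.map_one.trans g.map_one.symm)
  mul_mem := by
    intro i j n h a b ha hb
    have ha' : f.toFun i a.1 = g.toFun i a.2 := sub_eq_zero.1 ha
    have hb' : f.toFun j b.1 = g.toFun j b.2 := sub_eq_zero.1 hb
    refine sub_eq_zero.2 ?_
    change f.toFun n (A.mul h a.1 b.1) = g.toFun n (B.mul h a.2 b.2)
    rw [f.map_mul, g.map_mul, ha', hb']

/-- The fibre product of two cdgas over a third. -/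
def pullback (f : A.Hom C) (g : B.Hom C) : CDGA.{u, w} k :=
  (A.prod B).sub _ (isSubalgebra_pullback f g) fun n x hx => by
    have hx' : f.toFun n x.1 = g.toFun n x.2 := sub_eq_zero.1 hx
    refine sub_eq_zero.2 ?_
    change f.toFun (n + 1) (A.d n x.1) = g.toFun (n + 1) (B.d n x.2)
    rw [f.map_d, g.map_d, hx']

end CDGA

/-! ### Lifting maps out of minimal cdgas -/

namespace CDGA

variable {k : Type w} [Field k] {A B C D M : CDGA.{u, w} k} {q : ℕ}

/-- A cdga is generated by the union of a sequence of graded subspaces such that the differential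
of each is in the algebra generated by the preceding one. -/
theorem IsQMinimal.exists_filtration (hM : M.IsQMinimal q) :
    ∃ V : ∀ n, Submodule k (M.carrier n), (∀ n, q < n → V n = ⊥) ∧ M.toGCAlg.IsFreeOn V ∧
    ∃ G : ℕ → ∀ n, Submodule k (M.carrier n), (∀ n, G 0 n = ⊥) ∧ (∀ n, Monotone fun s => G s n) ∧
      (∀ s n, G s n ≤ V n) ∧ (∀ n, ∀ x ∈ V n, ∃ s, x ∈ G s n) ∧
      ∀ s n, ∀ x ∈ G (s + 1) n, M.d n x ∈ M.toGCAlg.adjoin (G s) (n + 1) := by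
  obtain ⟨V, -, hV, hfree, F, hF0, hFm, hFV, hd⟩ := hM
  refine ⟨V, hV, hfree, ?_⟩
  -- `G` collects, from all degrees at once, the generators whose differential is expressed by the
  -- preceding ones; thus one sequence replaces the filtrations of the single degrees
  let G : ℕ → ∀ n, Submodule k (M.carrier n) := fun s => Nat.rec (fun _ => ⊥)
    (fun _ W n => V n ⊓ (M.toGCAlg.adjoin W (n + 1)).comap (M.d n)) s
  have hG : ∀ s n, G (s + 1) n = V n ⊓ (M.toGCAlg.adjoin (G s) (n + 1)).comap (M.d n) :=
    fun s n => rfl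
  have hmono : ∀ n, Monotone fun s => G s n := by
    have : ∀ s n, G s n ≤ G (s + 1) n := by
      intro s
      induction s with
      | zero => exact fun n => bot_le
      | succ s ih =>
        intro n
        rw [hG, hG (s + 1)]
        exact inf_le_inf_left _ (Submodule.comap_mono (GCAlg.adjoin_mono ih _))
    exact fun n => monotone_nat_of_le_succ fun s => this s n
  have hle : ∀ s n, G s n ≤ V n := by
    intro s n
    cases s with
    | zero => exact bot_le
    | succ s => rw [hG]; exact inf_le_left
  refine ⟨G, fun n => rfl, hmono, hle, ?_, fun s n x hx => by rw [hG] at hx; exact hx.2⟩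
  intro n
  induction n using Nat.strong_induction_on with
  | _ n ih =>
    have key : ∀ j, ∀ x ∈ F n j, ∃ s, x ∈ G s n := by
      intro j
      induction j with
      | zero =>
        intro x hx
        rw [hF0] at hx
        exact ⟨0, hx⟩
      | succ j ihj =>
        intro x hx
        have hxV : x ∈ V n := by
          rw [← hFV]; exact Submodule.mem_iSup_of_mem _ hx
        obtain ⟨s, hs⟩ := GCAlg.exists_mem_adjoin (G := G) hmono (fun m y hy => by
          unfold GCAlg.stage at hy
          split_ifs at hy with h1 h2
          · exact ih m h1 y hy
          · subst h2; exact ihj y hy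
          · exact ⟨0, hy⟩) (hd n j x hx)
        exact ⟨s + 1, by rw [hG]; exact ⟨hxV, hs⟩⟩
    intro x hx
    rw [← hFV, Submodule.mem_iSup_of_directed _ (hFm n).directed_le] at hx
    obtain ⟨j, hj⟩ := hx
    exact key j x hj

/-- Maps out of a `q`-minimal cdga lift, strictly, along a map `p` with the following lifting
property: any cocycle `x` in the source of `p` and any `y` of degree at most `q` such that
`p x = d y` are the differential and the image of a common element. -/
theorem IsQMinimal.exists_lift (hM : M.IsQMinimal q) (p : C.Hom D) (g : M.Hom D)
    (hp : ∀ n ≤ q, ∀ (x : C.carrier (n + 1)) (y : D.carrier n), C.d _ x = 0 →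
      p.toFun _ x = D.d _ y → ∃ c, C.d n c = x ∧ p.toFun n c = y) :
    ∃ f : M.Hom C, ∀ n x, p.toFun n (f.toFun n x) = g.toFun n x := by
  obtain ⟨V, hV, hfree, G, hG0, hmono, hGV, hex, hd⟩ := hM.exists_filtration
  -- a linear choice of solutions of the lifting problem
  have hL : ∀ n, ∃ L : C.carrier (n + 1) × D.carrier n →ₗ[k] C.carrier n, n ≤ q →
      ∀ x y, C.d _ x = 0 → p.toFun _ x = D.d _ y → C.d n (L (x, y)) = x ∧
        p.toFun n (L (x, y)) = y := by
    intro n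
    let P : C.carrier n →ₗ[k] C.carrier (n + 1) × D.carrier n := (C.d n).prod (p.toFun n)
    obtain ⟨s, hs⟩ := P.rangeRestrict.exists_rightInverse_of_surjective P.range_rangeRestrict
    obtain ⟨L, hL⟩ := LinearMap.exists_extend s
    refine ⟨L, fun hn x y hx hxy => ?_⟩
    obtain ⟨c, hc, hc'⟩ := hp n hn x y hx hxy
    have hmem : (x, y) ∈ LinearMap.range P := ⟨c, Prod.ext hc hc'⟩
    have h1 : L (x, y) = s ⟨(x, y), hmem⟩ := LinearMap.congr_fun hL ⟨(x, y), hmem⟩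
    have h2 : P (s ⟨(x, y), hmem⟩) = (x, y) :=
      congrArg Subtype.val (LinearMap.congr_fun hs ⟨(x, y), hmem⟩)
    rw [h1]
    exact ⟨congrArg Prod.fst h2, congrArg Prod.snd h2⟩
  choose L hL using hL
  choose ext hext _ using hfree C.toGCAlg
  let T : M.toGCAlg.Hom C.toGCAlg → M.toGCAlg.Hom C.toGCAlg := fun ψ => ext fun n =>
    L n ∘ₗ ((ψ.toFun (n + 1) ∘ₗ M.d n).prod (g.toFun n)) ∘ₗ (V n).subtype
  have hT : ∀ ψ n, ∀ v ∈ V n,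
      (T ψ).toFun n v = L n (ψ.toFun (n + 1) (M.d n v), g.toFun n v) := fun ψ n v hv =>
    hext _ n ⟨v, hv⟩
  let ψ : ℕ → M.toGCAlg.Hom C.toGCAlg := fun s => Nat.rec (ext fun _ => 0) (fun _ χ => T χ) s
  have hψ : ∀ s, ψ (s + 1) = T (ψ s) := fun s => rfl
  -- the locus where a homomorphism lifts `g` and commutes with the differentials
  have hsub : ∀ χ : M.toGCAlg.Hom C.toGCAlg, M.toGCAlg.IsSubalgebra fun n =>
      LinearMap.eqLocus (p.toFun n ∘ₗ χ.toFun n) (g.toFun n) ⊓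
      LinearMap.eqLocus (C.d n ∘ₗ χ.toFun n) (χ.toFun (n + 1) ∘ₗ M.d n) := by
    intro χ
    constructor
    · have hd1 : ∀ A : CDGA.{u, w} k, A.d 0 A.one = 0 := fun A => by
        have := A.leibniz (Nat.zero_add 0) rfl rfl A.one A.one
        rw [A.one_mul', pow_zero, one_smul, A.mul_one'] at this
        have h2 : A.mul (rfl : 0 + (0 + 1) = 0 + 1) A.one (A.d 0 A.one) = A.d 0 A.one :=
          A.one_mul' _
        rw [h2] at this
        simpa using this
      refine ⟨?_, ?_⟩
      · change p.toFun 0 (χ.toFun 0 M.one) = g.toFun 0 M.one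
        rw [χ.map_one, p.map_one, g.map_one]
      · change C.d 0 (χ.toFun 0 M.one) = χ.toFun 1 (M.d 0 M.one)
        rw [χ.map_one, hd1, hd1, map_zero]
    · intro i j n h a b ha hb
      have ha1 : p.toFun i (χ.toFun i a) = g.toFun i a := ha.1
      have ha2 : C.d i (χ.toFun i a) = χ.toFun (i + 1) (M.d i a) := ha.2
      have hb1 : p.toFun j (χ.toFun j b) = g.toFun j b := hb.1
      have hb2 : C.d j (χ.toFun j b) = χ.toFun (j + 1) (M.d j b) := hb.2
      refine ⟨?_, ?_⟩
      · change p.toFun n (χ.toFun n (M.mul h a b)) = g.toFun n (M.mul h a b)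
        rw [χ.map_mul, p.map_mul, g.map_mul, ha1, hb1]
      · change C.d n (χ.toFun n (M.mul h a b)) = χ.toFun (n + 1) (M.d n (M.mul h a b))
        have h₁ : i + 1 + j = n + 1 := by omega
        have h₂ : i + (j + 1) = n + 1 := by omega
        rw [χ.map_mul, C.leibniz h h₁ h₂, M.leibniz h h₁ h₂, map_add, map_smul, χ.map_mul,
          χ.map_mul, ha2, hb2]
  have hgood : ∀ (χ : M.toGCAlg.Hom C.toGCAlg) (W : ∀ n, Submodule k (M.carrier n)),
      (∀ n, ∀ v ∈ W n, p.toFun n (χ.toFun n v) = g.toFun n v ∧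
        C.d n (χ.toFun n v) = χ.toFun (n + 1) (M.d n v)) →
      ∀ n, ∀ x ∈ M.toGCAlg.adjoin W n, p.toFun n (χ.toFun n x) = g.toFun n x ∧
        C.d n (χ.toFun n x) = χ.toFun (n + 1) (M.d n x) := fun χ W h n x hx =>
    GCAlg.adjoin_le (hsub χ) (fun n v hv => h n v hv) n hx
  have hmain : ∀ s, (∀ n, ∀ v ∈ G s n, (ψ (s + 1)).toFun n v = (ψ s).toFun n v) ∧
      ∀ n, ∀ v ∈ G s n, p.toFun n ((ψ s).toFun n v) = g.toFun n v ∧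
        C.d n ((ψ s).toFun n v) = (ψ s).toFun (n + 1) (M.d n v) := by
    intro s
    induction s with
    | zero =>
      refine ⟨fun n v hv => ?_, fun n v hv => ?_⟩ <;>
      · rw [hG0, Submodule.mem_bot] at hv
        simp [hv]
    | succ s ih =>
      have h1 : ∀ n, ∀ v ∈ G (s + 1) n,
          (ψ (s + 1)).toFun (n + 1) (M.d n v) = (ψ s).toFun (n + 1) (M.d n v) := fun n v hv =>
        GCAlg.Hom.eq_on_adjoin ih.1 (hd s n v hv)
      refine ⟨fun n v hv => ?_, fun n v hv => ?_⟩
      · rw [hψ (s + 1), hT _ _ _ (hGV _ _ hv), h1 n v hv, hψ s, hT _ _ _ (hGV _ _ hv)]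
      · rw [h1 n v hv]
        rw [hψ, hT _ _ _ (hGV _ _ hv)]
        by_cases hn : n ≤ q
        · have h2 := hgood _ _ ih.2 _ _ (hd s n v hv)
          have h3 := hL n hn ((ψ s).toFun (n + 1) (M.d n v)) (g.toFun n v)
            (by rw [h2.2, M.d_d, map_zero]) (by rw [h2.1, g.map_d])
          exact ⟨h3.2, h3.1⟩
        · have h0 := hGV _ _ hv
          rw [hV n (not_le.1 hn), Submodule.mem_bot] at h0
          subst h0
          have e : L n ((ψ s).toFun (n + 1) (M.d n 0), g.toFun n 0) = 0 := by
            simp only [map_zero]; exact map_zero (L n)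
          rw [e]; simp
  -- the limit of the sequence of approximate lifts
  have hstab : ∀ n (v : M.carrier n) s t, s ≤ t → v ∈ G s n →
      (ψ t).toFun n v = (ψ s).toFun n v := by
    intro n v s t hst hv
    induction t, hst using Nat.le_induction with
    | base => rfl
    | succ t hst ih => rw [(hmain t).1 n v (hmono n hst hv), ih]
  choose N hN using fun (n : ℕ) (v : V n) => hex n v.1 v.2
  have hlim : ∀ n (v : V n) s, v.1 ∈ G s n →
      (ψ (N n v)).toFun n v = (ψ s).toFun n v := by
    intro n v s hs
    rcases le_total s (N n v) with h | h
    · exact hstab n v _ _ h hs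
    · exact (hstab n v _ _ h (hN n v)).symm
  let f : ∀ n, V n →ₗ[k] C.carrier n := fun n =>
    { toFun := fun v => (ψ (N n v)).toFun n v
      map_add' := fun v v' => by
        have h1 : v.1 ∈ G (max (N n v) (N n v')) n := hmono n (le_max_left _ _) (hN n v)
        have h2 : v'.1 ∈ G (max (N n v) (N n v')) n := hmono n (le_max_right _ _) (hN n v')
        rw [hlim n v _ h1, hlim n v' _ h2, hlim n (v + v') _ (add_mem h1 h2)]
        exact map_add _ _ _
      map_smul' := fun c v => by
        rw [hlim n (c • v) _ (Submodule.smul_mem _ c (hN n v))]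
        exact map_smul _ _ _ }
  have hf : ∀ s n, ∀ x ∈ M.toGCAlg.adjoin (G s) n, (ext f).toFun n x = (ψ s).toFun n x :=
    fun s n x hx => GCAlg.Hom.eq_on_adjoin
      (fun n v hv => (hext f n ⟨v, hGV _ _ hv⟩).trans (hlim n ⟨v, hGV _ _ hv⟩ s hv)) hx
  have hfin : ∀ n, ∀ x : M.carrier n, p.toFun n ((ext f).toFun n x) = g.toFun n x ∧
        C.d n ((ext f).toFun n x) = (ext f).toFun (n + 1) (M.d n x) := by
    refine fun n x => hgood _ V (fun n v hv => ?_) n x (hfree.mem_adjoin x)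
    obtain ⟨s, hs⟩ := hex n v hv
    have hs' : v ∈ G (s + 1) n := hmono n (Nat.le_succ s) hs
    rw [hf _ n v (GCAlg.le_adjoin _ _ _ hs'),
      hf (s + 1) (n + 1) _ (GCAlg.adjoin_mono (fun m => hmono m (Nat.le_succ s)) _ (hd s n v hs'))]
    exact (hmain (s + 1)).2 n v hs'
  exact ⟨{ toHom := ext f, map_d := fun x => (hfin _ x).2.symm }, fun n x => (hfin n x).1⟩

end CDGA

/-! ### Polynomial paths in a cdga -/

namespace GCAlg

section Shift

variable {k : Type w} [Field k] (B : GCAlg.{u, w} k)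

/-- The shift of a graded vector space: the component of degree `n` is that of degree `n - 1`, or
zero if `n = 0`. -/
def Shift : ℕ → Type u
  | 0 => PUnit
  | n + 1 => B.carrier n

instance : ∀ n, AddCommGroup (B.Shift n)
  | 0 => inferInstanceAs (AddCommGroup PUnit)
  | n + 1 => B.acg n

instance : ∀ n, Module k (B.Shift n)
  | 0 =>
    { smul := fun _ b => b
      one_smul := fun _ => rfl
      mul_smul := fun _ _ _ => rfl
      smul_zero := fun _ => rfl
      smul_add := fun _ _ _ => rfl
      add_smul := fun _ _ _ => rfl
      zero_smul := fun _ => rfl }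
  | n + 1 => B.mod n

/-- The product of an element of the algebra and one of its shift. -/
def mulShift : ∀ {i j n : ℕ}, i + j = n → B.carrier i →ₗ[k] B.Shift j →ₗ[k] B.Shift n
  | _, 0, _, _ => 0
  | _, _ + 1, 0, h => absurd h (by omega)
  | _, _ + 1, _ + 1, h => B.mul (Nat.succ.inj h)

/-- The product of an element of the shift and one of the algebra, without signs. -/
def shiftMul : ∀ {i j n : ℕ}, i + j = n → B.Shift i →ₗ[k] B.carrier j →ₗ[k] B.Shift n
  | 0, _, _, _ => 0
  | _ + 1, _, 0, h => absurd h (by omega)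
  | _ + 1, _, _ + 1, h => B.mul (by omega)

theorem one_mulShift {n : ℕ} (b : B.Shift n) : B.mulShift (Nat.zero_add n) B.one b = b := by
  cases n with
  | zero => rfl
  | succ n => exact B.one_mul' _

theorem shiftMul_one {n : ℕ} (b : B.Shift n) : B.shiftMul (Nat.add_zero n) b B.one = b := by
  cases n with
  | zero => rfl
  | succ n => exact B.mul_one' _

variable {B}

theorem mul_mulShift {i j l ij jl n : ℕ} (h₁ : i + j = ij) (h₂ : ij + l = n)
    (h₃ : j + l = jl) (h₄ : i + jl = n) (a : B.carrier i) (b : B.carrier j) (c : B.Shift l) :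
    B.mulShift h₂ (B.mul h₁ a b) c = B.mulShift h₄ a (B.mulShift h₃ b c) := by
  cases l with
  | zero =>
    have e : c = 0 := rfl
    rw [e]; simp
  | succ l =>
    obtain ⟨n, rfl⟩ : ∃ m, n = m + 1 := ⟨n - 1, by omega⟩
    obtain ⟨jl, rfl⟩ : ∃ m, jl = m + 1 := ⟨jl - 1, by omega⟩
    exact B.mul_assoc' _ _ _ _ _ _ _

theorem mulShift_shiftMul {i j l ij jl n : ℕ} (h₁ : i + j = ij) (h₂ : ij + l = n)
    (h₃ : j + l = jl) (h₄ : i + jl = n) (a : B.carrier i) (b : B.Shift j) (c : B.carrier l) :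
    B.shiftMul h₂ (B.mulShift h₁ a b) c = B.mulShift h₄ a (B.shiftMul h₃ b c) := by
  cases j with
  | zero =>
    have e : b = 0 := rfl
    rw [e]; simp
  | succ j =>
    obtain ⟨n, rfl⟩ : ∃ m, n = m + 1 := ⟨n - 1, by omega⟩
    obtain ⟨jl, rfl⟩ : ∃ m, jl = m + 1 := ⟨jl - 1, by omega⟩
    obtain ⟨ij, rfl⟩ : ∃ m, ij = m + 1 := ⟨ij - 1, by omega⟩
    exact B.mul_assoc' _ _ _ _ _ _ _

theorem shiftMul_mul {i j l ij jl n : ℕ} (h₁ : i + j = ij) (h₂ : ij + l = n)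
    (h₃ : j + l = jl) (h₄ : i + jl = n) (a : B.Shift i) (b : B.carrier j) (c : B.carrier l) :
    B.shiftMul h₂ (B.shiftMul h₁ a b) c = B.shiftMul h₄ a (B.mul h₃ b c) := by
  cases i with
  | zero =>
    have e : a = 0 := rfl
    rw [e]; simp
  | succ i =>
    obtain ⟨n, rfl⟩ : ∃ m, n = m + 1 := ⟨n - 1, by omega⟩
    obtain ⟨ij, rfl⟩ : ∃ m, ij = m + 1 := ⟨ij - 1, by omega⟩
    exact B.mul_assoc' _ _ _ _ _ _ _

theorem mulShift_comm {i j n : ℕ} (h : i + j = n) (h' : j + i = n) (a : B.carrier i)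
    (b : B.Shift j) : B.mulShift h a b = (-1 : k) ^ (i * (j + 1)) • B.shiftMul h' b a := by
  cases j with
  | zero =>
    have e : b = 0 := rfl
    rw [e]; simp
  | succ j =>
    obtain ⟨n, rfl⟩ : ∃ m, n = m + 1 := ⟨n - 1, by omega⟩
    have e : (-1 : k) ^ (i * (j + 1 + 1)) = (-1) ^ (i * j) := by
      rw [show i * (j + 1 + 1) = i * j + 2 * i by ring, pow_add, pow_mul (-1 : k) 2,
        neg_one_sq, one_pow, mul_one]
    rw [e]
    exact B.mul_comm' _ _ _ _

theorem shiftMul_comm {i j n : ℕ} (h : i + j = n) (h' : j + i = n) (a : B.Shift i)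
    (b : B.carrier j) : B.shiftMul h a b = (-1 : k) ^ (j * (i + 1)) • B.mulShift h' b a := by
  rw [mulShift_comm h' h, smul_smul, ← pow_add, ← two_mul, pow_mul, neg_one_sq, one_pow, one_smul]

variable (B) in
/-- The algebra `B[ε]`, where `ε` has degree `1` and square zero; the pair `(a, b)` stands for
`a + b ε`. -/
def dual : GCAlg.{u, w} k where
  carrier n := B.carrier n × B.Shift n
  mul {i j n} h := LinearMap.mk₂ k
    (fun x y => (B.mul h x.1 y.1, B.mulShift h x.1 y.2 + (-1 : k) ^ j • B.shiftMul h x.2 y.1))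
    (fun x x' y => Prod.ext (by simp) (by simp; abel))
    (fun c x y => Prod.ext (by simp) (by simp [smul_comm c]))
    (fun x y y' => Prod.ext (by simp) (by simp; abel))
    (fun c x y => Prod.ext (by simp) (by simp [smul_comm c]))
  one := (B.one, 0)
  one_mul' x := Prod.ext (B.one_mul' x.1) (by simp [one_mulShift])
  mul_one' x := Prod.ext (B.mul_one' x.1) (by simp [shiftMul_one])
  mul_assoc' {i j l ij jl n} h₁ h₂ h₃ h₄ x y z := Prod.ext (B.mul_assoc' h₁ h₂ h₃ h₄ _ _ _) (by
    subst h₃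
    simp only [LinearMap.mk₂_apply, map_add, map_smul, LinearMap.add_apply, LinearMap.smul_apply,
      smul_add, smul_smul, mul_mulShift h₁ h₂ rfl h₄, mulShift_shiftMul h₁ h₂ rfl h₄,
      shiftMul_mul h₁ h₂ rfl h₄, pow_add, mul_comm ((-1 : k) ^ l)]
    abel)
  mul_comm' {i j n} h h' x y := Prod.ext (B.mul_comm' h h' x.1 y.1) (by
    simp only [LinearMap.mk₂_apply, Prod.smul_mk, mulShift_comm h h', shiftMul_comm h h', smul_add,
      smul_smul]
    rw [add_comm, ← pow_add, ← pow_add]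
    congr 2
    · rw [show j + j * (i + 1) = i * j + 2 * j by ring, pow_add, pow_mul _ 2, neg_one_sq, one_pow,
        mul_one])

end Shift

section BaseChange

variable {k : Type} [Field k] (R : Type) [CommRing R] [Algebra k R]

/-- The extension of scalars of a graded algebra along a commutative algebra. -/
noncomputable def baseChange (D : GCAlg.{u, 0} k) : GCAlg.{u, 0} k where
  carrier n := R ⊗[k] D.carrier n
  mul h := TensorProduct.map₂ (LinearMap.mul k R) (D.mul h)
  one := 1 ⊗ₜ D.one
  one_mul' {n} a := by
    induction a using TensorProduct.induction_on with
    | zero => simp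
    | add x y hx hy => rw [map_add, hx, hy]
    | tmul r x => simp [D.one_mul']
  mul_one' {n} a := by
    induction a using TensorProduct.induction_on with
    | zero => simp
    | add x y hx hy => rw [map_add, LinearMap.add_apply, hx, hy]
    | tmul r x => simp [D.mul_one']
  mul_assoc' h₁ h₂ h₃ h₄ a b c := by
    induction a using TensorProduct.induction_on with
    | zero => simp
    | add x y hx hy => simp only [map_add, LinearMap.add_apply, hx, hy]
    | tmul r x =>
      induction b using TensorProduct.induction_on with
      | zero => simp
      | add x y hx hy => simp only [map_add, LinearMap.add_apply, hx, hy]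
      | tmul s y =>
        induction c using TensorProduct.induction_on with
        | zero => simp
        | add x y hx hy => simp only [map_add, hx, hy]
        | tmul t z =>
          simp only [TensorProduct.map₂_apply_tmul, TensorProduct.map_tmul, LinearMap.mul_apply', mul_assoc,
            D.mul_assoc' h₁ h₂ h₃ h₄]
  mul_comm' h h' a b := by
    induction a using TensorProduct.induction_on with
    | zero => simp
    | add x y hx hy => simp only [map_add, LinearMap.add_apply, hx, hy, smul_add]
    | tmul r x =>
      induction b using TensorProduct.induction_on with
      | zero => simp
      | add x y hx hy => simp only [map_add, LinearMap.add_apply, hx, hy, smul_add]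
      | tmul s y =>
        simp only [TensorProduct.map₂_apply_tmul, TensorProduct.map_tmul, LinearMap.mul_apply', D.mul_comm' h h',
          TensorProduct.tmul_smul, mul_comm r s]

end BaseChange

end GCAlg

namespace GCAlg

variable {k : Type w} [Field k] {B : GCAlg.{u, w} k}

variable (B) in
/-- The identification of an algebra with its shift, of degree one. -/
def toShift (n : ℕ) : B.carrier n →ₗ[k] B.Shift (n + 1) := LinearMap.id

/-- The differential of the shift, without sign. -/
def dShift (d : ∀ n, B.carrier n →ₗ[k] B.carrier (n + 1)) : ∀ n, B.Shift n →ₗ[k] B.Shift (n + 1)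
  | 0 => 0
  | n + 1 => d n

end GCAlg

namespace CDGA

section Dual

variable {k : Type w} [Field k] (B : CDGA.{u, w} k)

theorem dShift_dShift {n : ℕ} (b : B.toGCAlg.Shift n) :
    GCAlg.dShift B.d (n + 1) (GCAlg.dShift B.d n b) = 0 := by
  cases n with
  | zero => exact map_zero (B.d 0)
  | succ n => exact B.d_d _

theorem dShift_mulShift {i j n : ℕ} (h : i + j = n) (h₁ : i + 1 + j = n + 1)
    (h₂ : i + (j + 1) = n + 1) (a : B.carrier i) (b : B.toGCAlg.Shift j) :
    GCAlg.dShift B.d n (B.mulShift h a b) =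
      B.mulShift h₁ (B.d i a) b + (-1 : k) ^ i • B.mulShift h₂ a (GCAlg.dShift B.d j b) := by
  cases j with
  | zero =>
    have e : b = 0 := rfl
    rw [e]; simp
  | succ j =>
    obtain ⟨n, rfl⟩ : ∃ m, n = m + 1 := ⟨n - 1, by omega⟩
    exact B.leibniz _ _ _ _ _

theorem dShift_shiftMul {i j n : ℕ} (h : i + j = n) (h₁ : i + 1 + j = n + 1)
    (h₂ : i + (j + 1) = n + 1) (b : B.toGCAlg.Shift i) (a : B.carrier j) :
    GCAlg.dShift B.d n (B.shiftMul h b a) =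
      B.shiftMul h₁ (GCAlg.dShift B.d i b) a + (-1 : k) ^ (i + 1) • B.shiftMul h₂ b (B.d j a) := by
  cases i with
  | zero =>
    have e : b = 0 := rfl
    rw [e]; simp
  | succ i =>
    obtain ⟨n, rfl⟩ : ∃ m, n = m + 1 := ⟨n - 1, by omega⟩
    have e : (-1 : k) ^ (i + 1 + 1) = (-1) ^ i := by rw [pow_succ, pow_succ]; simp
    rw [e]
    exact B.leibniz _ _ _ _ _

/-- The cdga `B[ε]` obtained from a derivation `D` of degree zero: the differential of an element
`a` of `B` is `d a + (-1)^|a| D(a) ε`. -/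
def dual (D : ∀ n, B.carrier n →ₗ[k] B.carrier n)
    (hD : ∀ {i j n : ℕ} (h : i + j = n) (a : B.carrier i) (b : B.carrier j),
      D n (B.mul h a b) = B.mul h (D i a) b + B.mul h a (D j b))
    (hd : ∀ n (a : B.carrier n), D (n + 1) (B.d n a) = B.d n (D n a)) : CDGA.{u, w} k where
  toGCAlg := B.toGCAlg.dual
  d n := LinearMap.prod (B.d n ∘ₗ LinearMap.fst k _ _)
    ((-1 : k) ^ n • (B.toShift n ∘ₗ D n) ∘ₗ LinearMap.fst k _ _ + GCAlg.dShift B.d n ∘ₗ LinearMap.snd k _ _)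
  d_d {n} x := by
    refine Prod.ext (B.d_d x.1) ?_
    change (-1 : k) ^ (n + 1) • D (n + 1) (B.d n x.1) +
      B.d n ((-1 : k) ^ n • D n x.1 + (show B.carrier n from GCAlg.dShift B.d n x.2)) = 0
    have := B.dShift_dShift x.2
    change B.d n (GCAlg.dShift B.d n x.2) = 0 at this
    rw [hd, map_add, map_smul, this, pow_succ]
    simp
  leibniz {i j n} h h₁ h₂ x y := by
    refine Prod.ext (B.leibniz h h₁ h₂ x.1 y.1) ?_
    have e1 : ∀ (a : B.carrier i) (c : B.carrier j),
        B.toGCAlg.shiftMul h₁ (B.toShift i a) c = B.toShift n (B.mul h a c) :=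
      fun a c => rfl
    have e2 : ∀ (a : B.carrier i) (c : B.carrier j),
        B.toGCAlg.mulShift h₂ a (B.toShift j c) = B.toShift n (B.mul h a c) :=
      fun a c => rfl
    change (-1 : k) ^ n • B.toShift n (D n (B.mul h x.1 y.1)) + GCAlg.dShift B.d n
        (B.mulShift h x.1 y.2 + (-1 : k) ^ j • B.shiftMul h x.2 y.1) =
      (B.mulShift h₁ (B.d i x.1) y.2 + (-1 : k) ^ j • B.toGCAlg.shiftMul h₁
        ((-1 : k) ^ i • B.toShift i (D i x.1) + GCAlg.dShift B.d i x.2) y.1) +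
      (-1 : k) ^ i • (B.toGCAlg.mulShift h₂ x.1
          ((-1 : k) ^ j • B.toShift j (D j y.1) + GCAlg.dShift B.d j y.2) +
        (-1 : k) ^ (j + 1) • B.shiftMul h₂ x.2 (B.d j y.1))
    have s1 : (-1 : k) ^ n = (-1) ^ i * (-1) ^ j := by rw [← pow_add, h]
    simp only [map_add, map_smul, LinearMap.add_apply, LinearMap.smul_apply, e1, e2, hD,
      B.dShift_mulShift h h₁ h₂, B.dShift_shiftMul h h₁ h₂, s1, pow_succ, smul_add, smul_smul,
      mul_comm ((-1 : k) ^ j), mul_neg, neg_mul, mul_one, one_mul, neg_smul, smul_neg]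
    abel

end Dual

variable {k : Type} [Field k]

open Polynomial

section Tensor

variable {R : Type} [CommRing R] [Algebra k R] {U V W U' V' W' : Type*}
  [AddCommGroup U] [Module k U] [AddCommGroup V] [Module k V] [AddCommGroup W] [Module k W]
  [AddCommGroup U'] [Module k U'] [AddCommGroup V'] [Module k V'] [AddCommGroup W'] [Module k W']

theorem lTensor_map₂ {F : W →ₗ[k] W'} {f : U →ₗ[k] U'} {g : V →ₗ[k] V'} {μ : U →ₗ[k] V →ₗ[k] W}
    {μ₁ : U' →ₗ[k] V →ₗ[k] W'} {μ₂ : U →ₗ[k] V' →ₗ[k] W'} {c : k}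
    (h : ∀ u v, F (μ u v) = μ₁ (f u) v + c • μ₂ u (g v)) (a : R ⊗[k] U) (b : R ⊗[k] V) :
    LinearMap.lTensor R F (TensorProduct.map₂ (LinearMap.mul k R) μ a b) =
      TensorProduct.map₂ (LinearMap.mul k R) μ₁ (LinearMap.lTensor R f a) b +
        c • TensorProduct.map₂ (LinearMap.mul k R) μ₂ a (LinearMap.lTensor R g b) := by
  induction a using TensorProduct.induction_on with
  | zero => simp
  | add x y hx hy => simp only [map_add, LinearMap.add_apply, hx, hy, smul_add]; abel
  | tmul r x =>
    induction b using TensorProduct.induction_on with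
    | zero => simp
    | add x y hx hy => simp only [map_add, hx, hy, smul_add]; abel
    | tmul s y =>
      simp only [TensorProduct.map₂_apply_tmul, TensorProduct.map_tmul,
        LinearMap.lTensor_tmul, h, TensorProduct.tmul_add, TensorProduct.tmul_smul]

theorem rTensor_map₂ {δ : R →ₗ[k] R} (h : ∀ r s, δ (r * s) = δ r * s + r * δ s)
    (μ : U →ₗ[k] V →ₗ[k] W) (a : R ⊗[k] U) (b : R ⊗[k] V) :
    LinearMap.rTensor W δ (TensorProduct.map₂ (LinearMap.mul k R) μ a b) =
      TensorProduct.map₂ (LinearMap.mul k R) μ (LinearMap.rTensor U δ a) b +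
        TensorProduct.map₂ (LinearMap.mul k R) μ a (LinearMap.rTensor V δ b) := by
  induction a using TensorProduct.induction_on with
  | zero => simp
  | add x y hx hy => simp only [map_add, LinearMap.add_apply, hx, hy]; abel
  | tmul r x =>
    induction b using TensorProduct.induction_on with
    | zero => simp
    | add x y hx hy => simp only [map_add, hx, hy]; abel
    | tmul s y =>
      simp only [TensorProduct.map₂_apply_tmul, TensorProduct.map_tmul, LinearMap.mul_apply',
        LinearMap.rTensor_tmul, h, TensorProduct.add_tmul]

theorem lTensor_rTensor (δ : R →ₗ[k] R) (f : U →ₗ[k] V) (a : R ⊗[k] U) :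
    LinearMap.lTensor R f (LinearMap.rTensor U δ a) =
      LinearMap.rTensor V δ (LinearMap.lTensor R f a) := by
  induction a using TensorProduct.induction_on with
  | zero => simp
  | add x y hx hy => simp only [map_add, hx, hy]
  | tmul r x => simp

/-- The evaluation of a polynomial with coefficients in a vector space. -/
noncomputable def evalPoly (c : k) : k[X] ⊗[k] U →ₗ[k] U :=
  (TensorProduct.lid k U).toLinearMap ∘ₗ LinearMap.rTensor U (Polynomial.aeval c).toLinearMap

theorem evalPoly_tmul (c : k) (r : k[X]) (x : U) : evalPoly c (r ⊗ₜ[k] x) = r.eval c • x := by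
  simp [evalPoly, Polynomial.coe_aeval_eq_eval]

theorem evalPoly_lTensor (c : k) (f : U →ₗ[k] V) (a : k[X] ⊗[k] U) :
    evalPoly c (LinearMap.lTensor k[X] f a) = f (evalPoly c a) := by
  induction a using TensorProduct.induction_on with
  | zero => simp
  | add x y hx hy => simp only [map_add, hx, hy]
  | tmul r x => simp [evalPoly_tmul]

theorem evalPoly_map₂ (c : k) (μ : U →ₗ[k] V →ₗ[k] W) (a : k[X] ⊗[k] U) (b : k[X] ⊗[k] V) :
    evalPoly c (TensorProduct.map₂ (LinearMap.mul k k[X]) μ a b) =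
      μ (evalPoly c a) (evalPoly c b) := by
  induction a using TensorProduct.induction_on with
  | zero => simp
  | add x y hx hy => simp only [map_add, LinearMap.add_apply, hx, hy]
  | tmul r x =>
    induction b using TensorProduct.induction_on with
    | zero => simp
    | add x y hx hy => simp only [map_add, hx, hy]
    | tmul s y =>
      simp [evalPoly_tmul, smul_smul, mul_comm]

/-- The formal derivative, as a linear map. -/
noncomputable def polyDeriv : k[X] →ₗ[k] k[X] := Polynomial.derivative

/-- The formal antiderivative without constant term. -/
noncomputable def polyInt : k[X] →ₗ[k] k[X] :=
  Polynomial.lsum fun n => ((n : k) + 1)⁻¹ • Polynomial.monomial (n + 1)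

theorem polyInt_monomial (n : ℕ) (a : k) :
    polyInt (Polynomial.monomial n a) = Polynomial.monomial (n + 1) (((n : k) + 1)⁻¹ * a) := by
  simp [polyInt, Polynomial.lsum_apply, Polynomial.smul_monomial]

theorem polyInt_eval_zero (r : k[X]) : (polyInt r).eval 0 = 0 := by
  induction r using Polynomial.induction_on' with
  | add p q hp hq => rw [map_add, Polynomial.eval_add, hp, hq, add_zero]
  | monomial n a => rw [polyInt_monomial]; simp [Polynomial.eval_monomial]

theorem evalPoly_int (a : k[X] ⊗[k] U) : evalPoly 0 (LinearMap.rTensor U polyInt a) = 0 := by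
  induction a using TensorProduct.induction_on with
  | zero => simp
  | add x y hx hy => simp only [map_add, hx, hy, add_zero]
  | tmul r x => simp [evalPoly_tmul, polyInt_eval_zero]

theorem polyDeriv_mul (r s : k[X]) : polyDeriv (r * s) = polyDeriv r * s + r * polyDeriv s :=
  Polynomial.derivative_mul

variable [CharZero k]

theorem polyDeriv_polyInt (r : k[X]) : polyDeriv (polyInt r) = r := by
  induction r using Polynomial.induction_on' with
  | add p q hp hq => rw [map_add, map_add, hp, hq]
  | monomial n a =>
    have : (n : k) + 1 ≠ 0 := Nat.cast_add_one_ne_zero n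
    rw [polyInt_monomial, polyDeriv, Polynomial.derivative_monomial]
    congr 1
    push_cast
    field_simp

theorem polyInt_polyDeriv (r : k[X]) : polyInt (polyDeriv r) = r - Polynomial.C (r.eval 0) := by
  induction r using Polynomial.induction_on' with
  | add p q hp hq => rw [map_add, map_add, hp, hq, Polynomial.eval_add, map_add]; abel
  | monomial n a =>
    rw [polyDeriv, Polynomial.derivative_monomial, polyInt_monomial]
    cases n with
    | zero => simp
    | succ n =>
      have : (n : k) + 1 ≠ 0 := Nat.cast_add_one_ne_zero n
      have e : ((n : k) + 1)⁻¹ * (a * ((n + 1 : ℕ) : k)) = a := by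
        push_cast
        field_simp
      simp [Polynomial.eval_monomial] at e ⊢
      rw [e]

theorem rTensor_deriv_int (a : k[X] ⊗[k] U) :
    LinearMap.rTensor U polyDeriv (LinearMap.rTensor U polyInt a) = a := by
  induction a using TensorProduct.induction_on with
  | zero => simp
  | add x y hx hy => simp only [map_add, hx, hy]
  | tmul r x => simp [polyDeriv_polyInt]

theorem rTensor_int_deriv (a : k[X] ⊗[k] U) :
    LinearMap.rTensor U polyInt (LinearMap.rTensor U polyDeriv a) = a - 1 ⊗ₜ evalPoly 0 a := by
  induction a using TensorProduct.induction_on with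
  | zero => simp
  | add x y hx hy => simp only [map_add, hx, hy, TensorProduct.tmul_add]; abel
  | tmul r x =>
    rw [LinearMap.rTensor_tmul, LinearMap.rTensor_tmul, polyInt_polyDeriv, evalPoly_tmul,
      TensorProduct.sub_tmul, ← TensorProduct.smul_tmul, Polynomial.smul_eq_C_mul, mul_one]

end Tensor

section Path

variable (D : CDGA.{u, 0} k)

/-- The cdga `D[t]` over the polynomial ring, with `dt = 0`. -/
noncomputable def poly : CDGA.{u, 0} k where
  toGCAlg := D.toGCAlg.baseChange k[X]
  d n := LinearMap.lTensor k[X] (D.d n)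
  d_d {n} a := by
    have e : D.d (n + 1) ∘ₗ D.d n = 0 := LinearMap.ext D.d_d
    have := LinearMap.lTensor_comp_apply k[X] (D.d (n + 1)) (D.d n) a
    rw [e, LinearMap.lTensor_zero] at this
    exact this.symm
  leibniz h h₁ h₂ a b := lTensor_map₂ (D.leibniz h h₁ h₂) a b

/-- The derivation `d/dt` of `D[t]`. -/
noncomputable def polyDerivation (n : ℕ) : D.poly.carrier n →ₗ[k] D.poly.carrier n :=
  LinearMap.rTensor (D.carrier n) polyDeriv

theorem polyDerivation_mul {i j n : ℕ} (h : i + j = n) (a : D.poly.carrier i)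
    (b : D.poly.carrier j) : D.polyDerivation n (D.poly.mul h a b) =
      D.poly.mul h (D.polyDerivation i a) b + D.poly.mul h a (D.polyDerivation j b) :=
  rTensor_map₂ polyDeriv_mul (D.mul h) a b

theorem polyDerivation_d (n : ℕ) (a : D.poly.carrier n) :
    D.polyDerivation (n + 1) (D.poly.d n a) = D.poly.d n (D.polyDerivation n a) := by
  have h := lTensor_rTensor (R := k[X]) polyDeriv (D.d n) (show k[X] ⊗[k] D.carrier n from a)
  exact h.symm

/-- The cdga `D[t, dt]` of polynomial paths in `D`. -/
noncomputable def path : CDGA.{u, 0} k :=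
  D.poly.dual D.polyDerivation D.polyDerivation_mul D.polyDerivation_d

/-- The value of a path at a point. -/
noncomputable def pathEval (c : k) : D.path.Hom D where
  toFun n := evalPoly c ∘ₗ LinearMap.fst k (k[X] ⊗[k] D.carrier n) (D.poly.toGCAlg.Shift n)
  map_one := by
    change evalPoly c ((1 : k[X]) ⊗ₜ[k] D.one) = D.one
    simp [evalPoly_tmul]
  map_mul h a b := evalPoly_map₂ c (D.mul h) a.1 b.1
  map_d a := evalPoly_lTensor c (D.d _) a.1

variable {D} [CharZero k]

/-- A closed path of positive degree differs from a constant path by the differential of a path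
which vanishes at `0`. -/
theorem exists_path_primitive {n : ℕ} {a : k[X] ⊗[k] D.carrier (n + 1)} {b : k[X] ⊗[k] D.carrier n}
    (h : D.path.d (n + 1) (show D.path.carrier (n + 1) from (a, b)) = 0) :
    ∃ η : k[X] ⊗[k] D.carrier n, evalPoly 0 η = 0 ∧
      LinearMap.lTensor k[X] (D.d n) η = a - 1 ⊗ₜ evalPoly 0 a ∧
      (-1 : k) ^ n • LinearMap.rTensor (D.carrier n) polyDeriv η = b := by
  have h2 : (-1 : k) ^ (n + 1) • LinearMap.rTensor (D.carrier (n + 1)) polyDeriv a +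
      LinearMap.lTensor k[X] (D.d n) b = 0 := congrArg Prod.snd h
  have s : (-1 : k) ^ n * (-1) ^ n = 1 := by rw [← mul_pow]; simp
  refine ⟨(-1 : k) ^ n • LinearMap.rTensor (D.carrier n) polyInt b, ?_, ?_, ?_⟩
  · rw [map_smul, evalPoly_int, smul_zero]
  · rw [← rTensor_int_deriv, map_smul, lTensor_rTensor, eq_neg_of_add_eq_zero_right h2, map_neg,
      map_smul, pow_succ, smul_neg, smul_smul, mul_neg_one, mul_neg, s, neg_smul, neg_neg, one_smul]
  · rw [map_smul, smul_smul, s, one_smul, rTensor_deriv_int]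

/-- The end points of a closed path of positive degree are cohomologous, by an explicit primitive of
the difference. -/
theorem eval_one_sub_eval_zero_mem {n : ℕ} {w : D.path.carrier n} (h : D.path.d n w = 0) :
    (D.pathEval 1).toFun n w - (D.pathEval 0).toFun n w ∈ D.coboundaries n := by
  cases n with
  | zero =>
    obtain ⟨a, b, rfl⟩ : ∃ (a : k[X] ⊗[k] D.carrier 0) (b : D.poly.toGCAlg.Shift 0),
      w = (show D.path.carrier 0 from (a, b)) := ⟨w.1, w.2, rfl⟩
    have h2 : (-1 : k) ^ 0 • LinearMap.rTensor (D.carrier 0) polyDeriv a + 0 = 0 :=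
      congrArg Prod.snd h
    rw [pow_zero, one_smul, add_zero] at h2
    have h3 := rTensor_int_deriv a
    rw [h2, map_zero] at h3
    have h4 : evalPoly (1 : k) a = evalPoly 0 a := by
      conv_lhs => rw [sub_eq_zero.1 h3.symm]
      rw [evalPoly_tmul]; simp
    change evalPoly (1 : k) a - evalPoly 0 a ∈ _
    rw [h4, sub_self]
    exact zero_mem _
  | succ n =>
    obtain ⟨a, b, rfl⟩ : ∃ (a : k[X] ⊗[k] D.carrier (n + 1)) (b : k[X] ⊗[k] D.carrier n),
      w = (show D.path.carrier (n + 1) from (a, b)) := ⟨w.1, w.2, rfl⟩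
    obtain ⟨η, h0, h1, -⟩ := exists_path_primitive h
    refine ⟨evalPoly 1 η, ?_⟩
    change D.d n _ = evalPoly 1 a - evalPoly 0 a
    rw [← evalPoly_lTensor, h1, map_sub, evalPoly_tmul]
    simp

end Path

/-- A map from a `q`-minimal cdga lifts along a `q`-equivalence, up to homotopy and in particular
in cohomology. -/
theorem IsQMinimal.exists_lift_of_isQEquivalence [CharZero k] {q : ℕ} {M C D : CDGA.{u, 0} k}
    (hM : M.IsQMinimal q) {φ : C.Hom D} (hφ : φ.IsQEquivalence q) (g : M.Hom D) :
    ∃ f : M.Hom C, ∀ i x, φ.mapCohomology i (f.mapCohomology i x) = g.mapCohomology i x := by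
  let P := pullback φ (D.pathEval 0)
  let p : P.Hom D :=
    { toFun := fun n => (D.pathEval 1).toFun n ∘ₗ LinearMap.snd k _ _ ∘ₗ Submodule.subtype _
      map_one := (D.pathEval 1).map_one
      map_mul := fun h a b => (D.pathEval 1).map_mul h a.1.2 b.1.2
      map_d := fun a => (D.pathEval 1).map_d a.1.2 }
  let π : P.Hom C :=
    { toFun := fun n => LinearMap.fst k _ _ ∘ₗ Submodule.subtype _
      map_one := rfl
      map_mul := fun h a b => rfl
      map_d := fun a => rfl }
  obtain ⟨f, hf⟩ := hM.exists_lift p g (by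
    rintro n hn ⟨⟨c, w⟩, hcw⟩ y hd hy
    obtain ⟨a, b, rfl⟩ : ∃ (a : k[X] ⊗[k] D.carrier (n + 1)) (b : k[X] ⊗[k] D.carrier n),
      w = (show D.path.carrier (n + 1) from (a, b)) := ⟨w.1, w.2, rfl⟩
    replace hcw : φ.toFun (n + 1) c = evalPoly 0 a := sub_eq_zero.1 hcw
    have hdc : C.d _ c = 0 := congrArg (fun x => x.1.1) hd
    have hdw : D.path.d _ (show D.path.carrier (n + 1) from (a, b)) = 0 :=
      congrArg (fun x => x.1.2) hd
    replace hy : evalPoly 1 a = D.d n y := hy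
    obtain ⟨η, h0, h1, h2⟩ := exists_path_primitive hdw
    have h3 : φ.toFun _ c = D.d n (y - evalPoly 1 η) := by
      rw [map_sub, ← hy, ← evalPoly_lTensor, h1, map_sub, evalPoly_tmul, hcw]
      simp
    obtain ⟨c₁, hc₁⟩ := exists_of_injective (hφ.injective (by omega)) hdc h3
    have h4 : D.d n (φ.toFun n c₁ - (y - evalPoly 1 η)) = 0 := by
      rw [map_sub, ← φ.map_d, hc₁, h3, sub_self]
    obtain ⟨z, hz, hze⟩ := exists_of_surjective (hφ.1 n hn).2 h4
    -- a path from zero to the coboundary by which the two solutions differ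
    have hτ : ∃ τ : D.path.carrier n, D.path.d n τ = 0 ∧ (D.pathEval 0).toFun n τ = 0 ∧
        (D.pathEval 1).toFun n τ = φ.toFun n z - (φ.toFun n c₁ - (y - evalPoly 1 η)) := by
      cases n with
      | zero =>
        have : φ.toFun 0 z - (φ.toFun 0 c₁ - (y - evalPoly 1 η)) = 0 := hze
        exact ⟨0, map_zero _, map_zero _, by rw [this, map_zero]⟩
      | succ n =>
        obtain ⟨e, he⟩ := hze
        have hmap : ∀ c : k, (D.pathEval c).toFun (n + 1) (D.path.d n
            (show D.path.carrier n from ((X : k[X]) ⊗ₜ[k] e, 0))) = D.d n (c • e) := fun c => by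
          rw [(D.pathEval c).map_d]
          congr 1
          change evalPoly c (X ⊗ₜ[k] e) = _
          simp [evalPoly_tmul]
        refine ⟨D.path.d n (show D.path.carrier n from ((X : k[X]) ⊗ₜ[k] e, 0)), D.path.d_d _, ?_, ?_⟩
        · rw [hmap, zero_smul, map_zero]
        · rw [hmap, one_smul, he]
    obtain ⟨τ, hτd, hτ0, hτ1⟩ := hτ
    let κ : D.path.carrier n :=
      (show D.path.carrier n from ((1 : k[X]) ⊗ₜ[k] φ.toFun n (c₁ - z) + η, 0)) + τ
    have hκ : ∀ s : k, (D.pathEval s).toFun n κ =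
        φ.toFun n (c₁ - z) + evalPoly s η + (D.pathEval s).toFun n τ := fun s => by
      rw [map_add]
      congr 1
      change evalPoly s ((1 : k[X]) ⊗ₜ[k] φ.toFun n (c₁ - z) + η) = _
      rw [map_add, evalPoly_tmul]
      simp
    have hκd : D.path.d n κ = (show D.path.carrier (n + 1) from (a, b)) := by
      rw [map_add, hτd, add_zero]
      refine Prod.ext ?_ ?_
      · change LinearMap.lTensor k[X] (D.d n) ((1 : k[X]) ⊗ₜ[k] φ.toFun n (c₁ - z) + η) = a
        rw [map_add, h1, LinearMap.lTensor_tmul, ← φ.map_d, map_sub, hc₁, hz, sub_zero, hcw]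
        abel
      · change (-1 : k) ^ n • LinearMap.rTensor (D.carrier n) polyDeriv
          ((1 : k[X]) ⊗ₜ[k] φ.toFun n (c₁ - z) + η) +
            (show k[X] ⊗[k] D.carrier n from GCAlg.dShift D.poly.d n 0) = b
        rw [map_add, LinearMap.rTensor_tmul]
        have : polyDeriv (1 : k[X]) = 0 := Polynomial.derivative_one
        rw [this, TensorProduct.zero_tmul, zero_add, map_zero]
        exact (add_zero _).trans h2
    refine ⟨⟨(c₁ - z, κ), sub_eq_zero.2 ?_⟩, Subtype.ext (Prod.ext ?_ hκd), ?_⟩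
    · change φ.toFun n (c₁ - z) = (D.pathEval 0).toFun n κ
      rw [hκ, h0, hτ0, add_zero, add_zero]
    · change C.d n (c₁ - z) = c
      rw [map_sub, hz, hc₁, sub_zero]
    · change (D.pathEval 1).toFun n κ = y
      rw [hκ, hτ1, map_sub]
      abel)
  refine ⟨π.comp f, fun i x => ?_⟩
  obtain ⟨⟨x, hx⟩, rfl⟩ := Submodule.Quotient.mk_surjective _ x
  rw [mapCohomology_mk, mapCohomology_mk, mapCohomology_mk, Submodule.Quotient.eq]
  change φ.toFun i (f.toFun i x).1.1 - g.toFun i x ∈ D.coboundaries i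
  have h1 : φ.toFun i (f.toFun i x).1.1 = (D.pathEval 0).toFun i (f.toFun i x).1.2 :=
    sub_eq_zero.1 (f.toFun i x).2
  have h2 : D.path.d i (f.toFun i x).1.2 = 0 := by
    have h3 : P.d i (f.toFun i x) = 0 := by
      rw [← f.map_d, show M.d i x = 0 from hx, map_zero]
    exact congrArg (fun x => x.1.2) h3
  rw [← hf, h1, ← neg_sub]
  exact neg_mem (eval_one_sub_eval_zero_mem h2)

/-- Minimal models only depend on the `q`-type. -/
theorem SameQType.exists_isQEquivalence_iff [CharZero k] {q : ℕ} {M C D : CDGA.{u, 0} k}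
    (hM : M.IsQMinimal q) (h : SameQType q C D) :
    (∃ f : M.Hom C, f.IsQEquivalence q) ↔ ∃ f : M.Hom D, f.IsQEquivalence q := by
  induction h with
  | rel C D h =>
    obtain ⟨φ, hφ⟩ := h
    refine ⟨fun ⟨f, hf⟩ => ⟨φ.comp f, hφ.comp hf⟩, fun ⟨g, hg⟩ => ?_⟩
    obtain ⟨f, hf⟩ := hM.exists_lift_of_isQEquivalence hφ g
    exact ⟨f, hφ.of_comp hg hf⟩
  | refl => exact Iff.rfl
  | symm _ _ _ ih => exact ih.symm
  | trans _ _ _ _ _ ih ih' => exact ih.trans ih'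

end CDGA

/-! ### Cohomology of minimal cdgas -/

namespace CDGA

variable {k : Type w} [Field k] {A M : CDGA.{u, w} k} {q : ℕ}

/-- A cohomology group is finite-dimensional if it is mapped injectively by a map whose image,
before the passage to cohomology, lies in a finite-dimensional space. -/
theorem finiteDimensional_cohomology_of_injective {f : M.Hom A} {i : ℕ}
    (hf : Function.Injective (f.mapCohomology i)) {T : Submodule k (A.carrier i)}
    [FiniteDimensional k T] (hT : ∀ x, f.toFun i x ∈ T) : FiniteDimensional k (M.Cohomology i) := by
  let T' : Submodule k (A.cocycles i) := T.comap (A.cocycles i).subtype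
  have hT' : FiniteDimensional k T' :=
    FiniteDimensional.of_injective
      (((A.cocycles i).subtype ∘ₗ T'.subtype).codRestrict T fun x => x.2)
      fun x y h => Subtype.ext (Subtype.ext (congrArg (fun z : T => (z : A.carrier i)) h))
  let W : Submodule k (A.Cohomology i) := T'.map (Submodule.mkQ _)
  have hW : FiniteDimensional k W := inferInstance
  refine FiniteDimensional.of_injective ((f.mapCohomology i).codRestrict W fun x => ?_)
    fun x y h => hf (congrArg Subtype.val h)
  obtain ⟨x, rfl⟩ := Submodule.Quotient.mk_surjective _ x
  exact ⟨f.mapCocycles i x, hT _, rfl⟩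

/-- A minimal cdga with generators of degree at most `q` is decomposable in degree `q + 1`. -/
theorem IsQMinimal.le_span_mul (hM : M.IsQMinimal q) (T : Submodule k (M.carrier (q + 1)))
    (hT : ∀ (i j : ℕ) (h : i + j = q + 1) (a : M.carrier i) (b : M.carrier j), i ≤ q → j ≤ q →
      M.mul h a b ∈ T) (x : M.carrier (q + 1)) : x ∈ T := by
  obtain ⟨V, -, hV, hfree, -⟩ := hM
  let T₀ : Submodule k (M.carrier (q + 1)) := Submodule.span k
    {x | ∃ (i j : ℕ) (h : i + j = q + 1) (a : M.carrier i) (b : M.carrier j), i ≤ q ∧ j ≤ q ∧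
      M.mul h a b = x}
  have hT₀ : T₀ ≤ T := by
    refine Submodule.span_le.2 ?_
    rintro _ ⟨i, j, h, a, b, hi, hj, rfl⟩
    exact hT i j h a b hi hj
  let S : ∀ n, Submodule k (M.carrier n) := fun n =>
    if h : n = q + 1 then h ▸ T₀ else ⊤
  have hSq : S (q + 1) = T₀ := by simp [S]
  have hSn : ∀ n, n ≠ q + 1 → S n = ⊤ := fun n hn => by simp [S, hn]
  have hS : M.toGCAlg.IsSubalgebra S := by
    refine ⟨by rw [hSn 0 (by omega)]; trivial, ?_⟩
    intro i j n h a b ha hb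
    by_cases hn : n = q + 1
    · subst hn
      rw [hSq]
      rcases Nat.lt_or_ge q i with hi | hi
      · obtain rfl : i = q + 1 := by omega
        obtain rfl : j = 0 := by omega
        rw [hSq] at ha
        refine Submodule.span_induction (p := fun a _ => M.mul h a b ∈ T₀) ?_ ?_ ?_ ?_ ha
        · rintro _ ⟨i, j, h', a, c, hi, hj, rfl⟩
          rw [M.mul_assoc' h' h (Nat.add_zero j) h']
          exact Submodule.subset_span ⟨i, j, h', a, _, hi, hj, rfl⟩
        · simp
        · intro x y _ _ hx hy
          rw [map_add]; exact add_mem hx hy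
        · intro c x _ hx
          rw [map_smul]; exact Submodule.smul_mem _ _ hx
      · rcases Nat.lt_or_ge q j with hj | hj
        · obtain rfl : j = q + 1 := by omega
          obtain rfl : i = 0 := by omega
          rw [hSq] at hb
          refine Submodule.span_induction (p := fun b _ => M.mul h a b ∈ T₀) ?_ ?_ ?_ ?_ hb
          · rintro _ ⟨i, j, h', c, b, hi, hj, rfl⟩
            rw [← M.mul_assoc' (Nat.zero_add i) h' h' h]
            exact Submodule.subset_span ⟨i, j, h', _, b, hi, hj, rfl⟩
          · simp
          · intro x y _ _ hx hy
            rw [map_add]; exact add_mem hx hy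
          · intro c x _ hx
            rw [map_smul]; exact Submodule.smul_mem _ _ hx
        · exact Submodule.subset_span ⟨i, j, h, a, b, hi, hj, rfl⟩
    · rw [hSn n hn]; trivial
  have := GCAlg.adjoin_le hS (fun n => by
    by_cases hn : n = q + 1
    · subst hn
      rw [hV _ (Nat.lt_succ_self q)]; exact bot_le
    · rw [hSn n hn]; exact le_top) (q + 1) (hfree.mem_adjoin x)
  rw [hSq] at this
  exact hT₀ this

/-- The minimal model of a `q`-finite cdga has finite-dimensional cohomology up to degree
`q + 1`. -/
theorem IsQFinite.finiteDimensional_cohomology (hA : A.IsQFinite q) (hM : M.IsQMinimal q)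
    {f : M.Hom A} (hf : f.IsQEquivalence q) {i : ℕ} (hi : i ≤ q + 1) :
    FiniteDimensional k (M.Cohomology i) := by
  rcases hi.lt_or_eq with h | rfl
  · have := hA.finite i (Nat.lt_succ_iff.1 h)
    exact finiteDimensional_cohomology_of_injective (hf.injective hi) (T := ⊤) fun _ => trivial
  · let T : Submodule k (A.carrier (q + 1)) :=
      ⨆ i : Fin (q + 1), ⨆ j : Fin (q + 1), ⨆ h : (i : ℕ) + j = q + 1,
        Submodule.map₂ (A.mul h) ⊤ ⊤
    have hfin : ∀ i : Fin (q + 1), FiniteDimensional k (A.carrier i) := fun i =>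
      hA.finite i (Nat.lt_succ_iff.1 i.2)
    have hmap : ∀ (i j : Fin (q + 1)) (h : (i : ℕ) + j = q + 1),
        FiniteDimensional k (Submodule.map₂ (A.mul h) ⊤ ⊤) := fun i j h =>
      Module.Finite.iff_fg.2 (Submodule.FG.map₂ _ Module.Finite.fg_top Module.Finite.fg_top)
    have hTfin : FiniteDimensional k T := inferInstance
    refine finiteDimensional_cohomology_of_injective hf.2 (T := T) fun x => ?_
    refine hM.le_span_mul (T.comap (f.toFun (q + 1))) (fun i j h a b hi hj => ?_) x
    rw [Submodule.mem_comap, f.map_mul]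
    refine Submodule.mem_iSup_of_mem ⟨i, Nat.lt_succ_iff.2 hi⟩
      (Submodule.mem_iSup_of_mem ⟨j, Nat.lt_succ_iff.2 hj⟩ (Submodule.mem_iSup_of_mem h ?_))
    exact Submodule.apply_mem_map₂ _ trivial trivial

end CDGA

/-! ### Singular squares and the path groupoid extended by two-chains modulo boundaries -/

namespace Cubical

open scoped unitInterval
open CategoryTheory

section Squares

variable {X Y : Type*} [TopologicalSpace X] [TopologicalSpace Y]

/-- The one-chain given by a path. -/
noncomputable def lineChain (p : C(I, Y)) : Chain 1 Y :=
  cube ⟨fun y => p (y 0), by fun_prop⟩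

/-- The two-chain given by a square. -/
noncomputable def squareChain (G : C(I × I, Y)) : Chain 2 Y :=
  cube ⟨fun y => G (y 0, y 1), by fun_prop⟩

theorem bd_squareChain (G : C(I × I, Y)) {a b c d : C(I, Y)} (ha : ∀ t, G (1, t) = a t)
    (hb : ∀ t, G (0, t) = b t) (hc : ∀ t, G (t, 1) = c t) (hd : ∀ t, G (t, 0) = d t) :
    bd 1 (squareChain G) = lineChain a - lineChain b - lineChain c + lineChain d := by
  rw [squareChain, bd_cube, Fin.sum_univ_two]
  have e : ∀ (j : Fin 2) (e : I) (p : C(I, Y)),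
      (∀ t : Fin 1 → I, G (face j e t 0, face j e t 1) = p (t 0)) →
      cube (ContinuousMap.comp ⟨fun y : Fin 2 → I => G (y 0, y 1), by fun_prop⟩ (face j e)) =
        lineChain p := by
    intro j e p h
    rw [lineChain]
    congr 1
    ext t
    exact h t
  rw [e 0 1 a fun t => ?_, e 0 0 b fun t => ?_, e 1 1 c fun t => ?_, e 1 0 d fun t => ?_]
  · simp only [Fin.val_zero, Fin.val_one, pow_zero, pow_one, one_smul, neg_smul]
    abel
  · exact hd (t 0)
  · exact hc (t 0)
  · exact hb (t 0)
  · exact ha (t 0)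

theorem lineChain_const {p : C(I, Y)} (y : Y) (h : ∀ t, p t = y) : lineChain p = 0 := by
  rw [lineChain, cube_eq_zero]
  exact ⟨0, fun _ _ _ => by simp [h]⟩

theorem squareChain_eq_zero {G : C(I × I, Y)} (g : I → Y) (h : ∀ s t, G (s, t) = g t) :
    squareChain G = 0 := by
  rw [squareChain, cube_eq_zero]
  exact ⟨0, fun x y hxy => by simp [h, hxy 1 (by decide)]⟩

theorem map_squareChain (f : C(Y, X)) (G : C(I × I, Y)) :
    map f (squareChain G) = squareChain (f.comp G) := by
  rw [squareChain, map_cube]; rfl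

/-- The quotient of the two-chains by the boundaries. -/
abbrev TwoClass (X : Type*) [TopologicalSpace X] : Type _ := Chain 2 X ⧸ boundaries 2 X

/-- The class of a square modulo boundaries. -/
noncomputable def sq (G : C(I × I, X)) : TwoClass X := (boundaries 2 X).mkQ (squareChain G)

theorem sq_eq_zero {G : C(I × I, X)} (g : I → X) (h : ∀ s t, G (s, t) = g t) : sq G = 0 := by
  rw [sq, squareChain_eq_zero g h, map_zero]

/-- The class of the image of a square of a contractible space depends only on the boundary of the
square. -/
theorem exists_sq_comp [ContractibleSpace Y] (f : C(Y, X)) :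
    ∃ c : Chain 1 Y →ₗ[ℂ] TwoClass X,
      ∀ G : C(I × I, Y), sq (f.comp G) = c (bd 1 (squareChain G)) := by
  let g : Chain 2 Y →ₗ[ℂ] TwoClass X := (boundaries 2 X).mkQ ∘ₗ map f
  have hker : LinearMap.ker (bd 1 : Chain 2 Y →ₗ[ℂ] _) ≤ LinearMap.ker g := fun z hz => by
    have h1 := cycles_le_boundaries_of_contractible (X := Y) 1 hz
    have h2 := map_mem_boundaries f h1
    exact (Submodule.Quotient.mk_eq_zero _).2 h2
  obtain ⟨c, hc⟩ := LinearMap.exists_extend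
    (((LinearMap.ker (bd 1)).liftQ g hker) ∘ₗ
      ((bd 1 : Chain 2 Y →ₗ[ℂ] _).quotKerEquivRange.symm.toLinearMap))
  refine ⟨c, fun G => ?_⟩
  have h := LinearMap.congr_fun hc ⟨bd 1 (squareChain G), LinearMap.mem_range_self _ _⟩
  simp only [LinearMap.comp_apply, Submodule.subtype_apply, LinearEquiv.coe_coe] at h
  have e : (bd 1 : Chain 2 Y →ₗ[ℂ] _).quotKerEquivRange.symm
      ⟨bd 1 (squareChain G), LinearMap.mem_range_self _ _⟩ = Submodule.Quotient.mk (squareChain G) :=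
    (LinearEquiv.symm_apply_eq _).2 rfl
  rw [h, e, Submodule.liftQ_apply]
  change _ = (boundaries 2 X).mkQ (map f _)
  rw [map_squareChain]
  rfl

instance contractibleSpace_unitInterval : ContractibleSpace I :=
  (convex_Icc (0 : ℝ) 1).contractibleSpace ⟨0, by simp⟩

/-- A function on paths whose difference along the boundary of squares in `Y` is the class of
their image in `X`. -/
theorem exists_edge_function [ContractibleSpace Y] (f : C(Y, X)) :
    ∃ c : C(I, Y) → TwoClass X, (∀ (p : C(I, Y)) (y : Y), (∀ t, p t = y) → c p = 0) ∧
      ∀ (S : C(I × I, X)) (G : C(I × I, Y)) (a b c' d : C(I, Y)), (∀ s, f (G s) = S s) →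
        (∀ t, G (1, t) = a t) →
        (∀ t, G (0, t) = b t) → (∀ t, G (t, 1) = c' t) → (∀ t, G (t, 0) = d t) →
        sq S = c a - c b - c c' + c d := by
  obtain ⟨c, hc⟩ := exists_sq_comp f
  refine ⟨fun p => c (lineChain p), fun p y h => by simp [lineChain_const y h], ?_⟩
  intro S G a b c' d hS h1 h2 h3 h4
  have : S = f.comp G := by ext s; exact (hS s).symm
  rw [this, hc, bd_squareChain G h1 h2 h3 h4]
  simp

/-- The map `t ↦ a + t (b - a)` of the interval. -/
def seg (a b : I) : C(I, I) where
  toFun t := ⟨(1 - t) * a + t * b, by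
    have := t.2.1; have := t.2.2; have := a.2.1; have := a.2.2; have := b.2.1; have := b.2.2
    constructor <;> nlinarith⟩

theorem coe_seg (a b t : I) : (seg a b t : ℝ) = (1 - t) * a + t * b := rfl

/-- The midpoint of the interval. -/
noncomputable def mid : I := ⟨1 / 2, by norm_num, by norm_num⟩

theorem coe_mid : (mid : ℝ) = 1 / 2 := rfl

/-- The square `(s, t) ↦ s (1 + t) / 2`, with boundary
`[0, 1/2] + [1/2, 1] - [0, 1]`. -/
noncomputable def triangle : C(I × I, I) where
  toFun s := ⟨s.1 * (1 + s.2) / 2, by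
    have := s.1.2.1; have := s.1.2.2; have := s.2.2.1; have := s.2.2.2
    constructor <;> nlinarith⟩

theorem coe_triangle (s : I × I) : (triangle s : ℝ) = s.1 * (1 + s.2) / 2 := rfl

theorem trans_seg_left {x y z : X} (p : Path x y) (q : Path y z) (t : I) :
    (p.trans q) (seg 0 mid t) = p t := by
  have h : ((seg 0 mid t : I) : ℝ) = t / 2 := by rw [coe_seg, coe_mid]; simp; ring
  rw [Path.trans_apply, dif_pos (by rw [h]; linarith [t.2.2])]
  congr 1
  ext
  simp [h]
  ring

theorem trans_seg_right {x y z : X} (p : Path x y) (q : Path y z) (t : I) :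
    (p.trans q) (seg mid 1 t) = q t := by
  have h : ((seg mid 1 t : I) : ℝ) = (1 + t) / 2 := by rw [coe_seg, coe_mid]; simp; ring
  rw [Path.trans_apply]
  split_ifs with h'
  · have ht : t = 0 := by
      rw [h] at h'
      exact Subtype.ext (le_antisymm (by simp; linarith) t.2.1)
    subst ht
    rw [Path.source]
    convert p.target
    simp [h]
  · congr 1
    ext
    simp [h]
    ring

/-- The defect of additivity of concatenation. -/
noncomputable def triSq (g : C(I, X)) : TwoClass X := sq (g.comp triangle)

/-- The function of `exists_edge_function`, with its behaviour on concatenations and on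
reversals of paths whose image is constant. -/
theorem exists_edge_function' [ContractibleSpace Y] (f : C(Y, X)) :
    ∃ c : C(I, Y) → TwoClass X, (∀ (p : C(I, Y)) (y : Y), (∀ t, p t = y) → c p = 0) ∧
      (∀ (S : C(I × I, X)) (G : C(I × I, Y)) (a b c' d : C(I, Y)), (∀ s, f (G s) = S s) →
        (∀ t, G (1, t) = a t) →
        (∀ t, G (0, t) = b t) → (∀ t, G (t, 1) = c' t) → (∀ t, G (t, 0) = d t) →
        sq S = c a - c b - c c' + c d) ∧
      (∀ (g : C(I, Y)) (g' : C(I, X)), (∀ t, f (g t) = g' t) →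
        triSq g' = c (g.comp (seg 0 mid)) + c (g.comp (seg mid 1)) - c g) ∧
      ∀ (g : C(I, Y)) (x : X), (∀ t, f (g t) = x) → c (g.comp (seg 1 0)) = - c g := by
  obtain ⟨c, h0, hc⟩ := exists_edge_function f
  refine ⟨c, h0, hc, fun g g' hg => ?_, fun g x hg => ?_⟩
  · rw [triSq, hc _ (g.comp triangle) (g.comp (seg mid 1)) (ContinuousMap.const _ (g 0)) g
      (g.comp (seg 0 mid))]
    · rw [h0 (ContinuousMap.const _ (g 0)) (g 0) fun t => rfl]; abel
    · intro s; exact hg _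
    · intro t
      simp only [ContinuousMap.comp_apply]
      congr 1; ext; rw [coe_triangle, coe_seg, coe_mid]; simp; ring
    · intro t
      simp only [ContinuousMap.comp_apply, ContinuousMap.const_apply]
      congr 1; ext; rw [coe_triangle]; simp
    · intro t
      simp only [ContinuousMap.comp_apply]
      congr 1; ext; rw [coe_triangle]; simp; ring
    · intro t
      simp only [ContinuousMap.comp_apply]
      congr 1; ext; rw [coe_triangle, coe_seg, coe_mid]; simp; ring
  · have h := hc (ContinuousMap.const _ x)
      (g.comp ⟨fun s : I × I => min s.1 (unitInterval.symm s.2), by fun_prop⟩)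
      (g.comp (seg 1 0)) (ContinuousMap.const _ (g 0)) (ContinuousMap.const _ (g 0)) g
      (fun s => hg _) ?_ ?_ ?_ ?_
    · rw [h0 (ContinuousMap.const _ (g 0)) (g 0) fun t => rfl, sq_eq_zero (fun _ => x) fun _ _ => rfl] at h
      rw [eq_neg_iff_add_eq_zero, h]; abel
    · intro t
      simp only [ContinuousMap.comp_apply, ContinuousMap.coe_mk]
      congr 1
      rw [min_eq_right unitInterval.le_one']
      ext; rw [coe_seg]; simp
    · intro t
      simp
    · intro t
      simp
    · intro t
      simp only [ContinuousMap.comp_apply, ContinuousMap.coe_mk]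
      congr 1
      simp [unitInterval.le_one']

/-- The class of a homotopy of paths. -/
noncomputable def htpy {x y : X} {p q : Path x y} (H : p.Homotopy q) : TwoClass X :=
  sq H.toContinuousMap

theorem htpy_refl {x y : X} (p : Path x y) : htpy (Path.Homotopy.refl p) = 0 :=
  sq_eq_zero p fun _ _ => rfl

theorem htpy_symm {x y : X} {p q : Path x y} (H : p.Homotopy q) : htpy H.symm = - htpy H := by
  obtain ⟨c, h0, hc, -, hr⟩ := exists_edge_function' H.toContinuousMap
  have h1 := hc H.toContinuousMap (ContinuousMap.id _) ⟨fun t => (1, t), by fun_prop⟩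
    ⟨fun t => (0, t), by fun_prop⟩ ⟨fun t => (t, 1), by fun_prop⟩ ⟨fun t => (t, 0), by fun_prop⟩
    (fun s => rfl) (fun t => rfl) (fun t => rfl) (fun t => rfl) (fun t => rfl)
  have h2 := hc H.symm.toContinuousMap ⟨fun s => (unitInterval.symm s.1, s.2), by fun_prop⟩
    ⟨fun t => (0, t), by fun_prop⟩ ⟨fun t => (1, t), by fun_prop⟩
    (.comp ⟨fun t => (t, 1), by fun_prop⟩ (seg 1 0))
    (.comp ⟨fun t => (t, 0), by fun_prop⟩ (seg 1 0)) (fun s => rfl)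
    (fun t => by simp) (fun t => by simp)
    (fun t => by ext <;> simp [coe_seg])
    (fun t => by ext <;> simp [coe_seg])
  rw [hr _ y (fun t => by exact H.target t), hr _ x (fun t => by exact H.source t)] at h2
  rw [htpy, htpy, h1, h2]
  abel

theorem htpy_trans {x y : X} {p q r : Path x y} (H : p.Homotopy q) (K : q.Homotopy r) :
    htpy (H.trans K) = htpy H + htpy K := by
  obtain ⟨c, h0, hc, ht, -⟩ := exists_edge_function' (H.trans K).toContinuousMap
  let v (b : I) : C(I, I × I) := ⟨fun t => (b, t), by fun_prop⟩
  let e (b : I) : C(I, I × I) := ⟨fun t => (t, b), by fun_prop⟩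
  have h1 := hc (H.trans K).toContinuousMap (ContinuousMap.id _) (v 1) (v 0) (e 1) (e 0)
    (fun s => rfl) (fun t => rfl) (fun t => rfl) (fun t => rfl) (fun t => rfl)
  have h2 := hc H.toContinuousMap ⟨fun s => (seg 0 mid s.1, s.2), by fun_prop⟩
    (v mid) (v 0) ((e 1).comp (seg 0 mid)) ((e 0).comp (seg 0 mid))
    (fun s => by
      have h : ((seg 0 mid s.1 : I) : ℝ) = s.1 / 2 := by rw [coe_seg, coe_mid]; simp; ring
      change (H.trans K) _ = H _
      rw [Path.Homotopy.trans_apply, dif_pos (by simp only [ContinuousMap.coe_mk, h]; linarith [s.1.2.2])]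
      congr 1
      ext <;> simp [h]
      ring)
    (fun t => by ext <;> simp [coe_seg, v])
    (fun t => by ext <;> simp [coe_seg, v])
    (fun t => rfl) (fun t => rfl)
  have h3 := hc K.toContinuousMap ⟨fun s => (seg mid 1 s.1, s.2), by fun_prop⟩
    (v 1) (v mid) ((e 1).comp (seg mid 1)) ((e 0).comp (seg mid 1))
    (fun s => by
      have h : ((seg mid 1 s.1 : I) : ℝ) = (1 + s.1) / 2 := by
        rw [coe_seg, coe_mid]; simp; ring
      change (H.trans K) _ = K _
      rw [Path.Homotopy.trans_apply]
      split_ifs with h'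
      · have hs : s.1 = 0 := by
          simp only [ContinuousMap.coe_mk, h] at h'
          exact Subtype.ext (le_antisymm (by simp; linarith) s.1.2.1)
        obtain ⟨s, t⟩ := s
        simp only at hs
        subst hs
        rw [K.apply_zero]
        convert H.apply_one t
        · simp [h]
        · rfl
      · congr 1
        ext <;> simp [h]
        ring)
    (fun t => by ext <;> simp [coe_seg, v])
    (fun t => by ext <;> simp [coe_seg, v])
    (fun t => rfl) (fun t => rfl)
  have h4 := ht (e 1) (ContinuousMap.const _ y) (fun t => (H.trans K).target t)
  have h5 := ht (e 0) (ContinuousMap.const _ x) (fun t => (H.trans K).source t)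
  rw [triSq, sq_eq_zero (fun _ => y) (fun _ _ => rfl)] at h4
  rw [triSq, sq_eq_zero (fun _ => x) (fun _ _ => rfl)] at h5
  rw [eq_comm, sub_eq_zero, ← eq_sub_iff_add_eq] at h4 h5
  rw [htpy, htpy, htpy, h1, h2, h3, h4, h5]
  abel

/-- Classes of homotopies are additive under horizontal composition, up to the defects of the two
concatenations. -/
theorem htpy_hcomp {x y z : X} {p p' : Path x y} {q q' : Path y z} (H : p.Homotopy p')
    (K : q.Homotopy q') :
    htpy H + htpy K + triSq (p.trans q).toContinuousMap =
      htpy (H.hcomp K) + triSq (p'.trans q').toContinuousMap := by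
  obtain ⟨c, h0, hc, ht, -⟩ := exists_edge_function' (H.hcomp K).toContinuousMap
  let v (b : I) : C(I, I × I) := ⟨fun t => (b, t), by fun_prop⟩
  let e (b : I) : C(I, I × I) := ⟨fun t => (t, b), by fun_prop⟩
  have h1 := hc (H.hcomp K).toContinuousMap (ContinuousMap.id _) (v 1) (v 0) (e 1) (e 0)
    (fun s => rfl) (fun t => rfl) (fun t => rfl) (fun t => rfl) (fun t => rfl)
  have h2 := hc H.toContinuousMap ⟨fun s => (s.1, seg 0 mid s.2), by fun_prop⟩
    ((v 1).comp (seg 0 mid)) ((v 0).comp (seg 0 mid)) (e mid) (e 0)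
    (fun s => trans_seg_left (H.eval s.1) (K.eval s.1) s.2)
    (fun t => rfl) (fun t => rfl)
    (fun t => by ext <;> simp [coe_seg, e])
    (fun t => by ext <;> simp [coe_seg, e])
  have h3 := hc K.toContinuousMap ⟨fun s => (s.1, seg mid 1 s.2), by fun_prop⟩
    ((v 1).comp (seg mid 1)) ((v 0).comp (seg mid 1)) (e 1) (e mid)
    (fun s => trans_seg_right (H.eval s.1) (K.eval s.1) s.2)
    (fun t => rfl) (fun t => rfl)
    (fun t => by ext <;> simp [coe_seg, e])
    (fun t => by ext <;> simp [coe_seg, e])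
  have h4 := ht (v 0) (p.trans q).toContinuousMap (fun t => (H.hcomp K).apply_zero t)
  have h5 := ht (v 1) (p'.trans q').toContinuousMap (fun t => (H.hcomp K).apply_one t)
  rw [htpy, htpy, htpy, h1, h2, h3, h4, h5]
  abel

end Squares

section Groupoid

variable {X : Type u} {Y : Type*} [TopologicalSpace X] [TopologicalSpace Y]

/-- Paths with an added two-chain class, up to homotopies: a homotopy from `α` to `β` identifies
`(α, a)` with `(β, b)`, where `a - b` is the class of the homotopy. -/
def extSetoid (x y : X) : Setoid (Path x y × TwoClass X) where
  r p q := ∃ H : p.1.Homotopy q.1, p.2 = q.2 + htpy H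
  iseqv :=
    { refl := fun p => ⟨Path.Homotopy.refl _, by rw [htpy_refl, add_zero]⟩
      symm := fun ⟨H, h⟩ => ⟨H.symm, by rw [htpy_symm, h]; abel⟩
      trans := fun ⟨H, h⟩ ⟨K, h'⟩ => ⟨H.trans K, by rw [htpy_trans, h, h']; abel⟩ }

/-- The objects of the extended path groupoid: the points of `X`. -/
structure Pt (X : Type u) where
  /-- The underlying point. -/
  pt : X

/-- The morphisms of the extended path groupoid. -/
def Ext (x y : X) : Type u := Quotient (extSetoid x y)

namespace Ext

/-- The morphism given by a path and a two-chain class. -/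
def mk {x y : X} (p : Path x y) (a : TwoClass X) : Ext x y := Quotient.mk (extSetoid x y) (p, a)

theorem mk_eq_mk {x y : X} {p q : Path x y} {a b : TwoClass X} :
    mk p a = mk q b ↔ ∃ H : p.Homotopy q, a = b + htpy H :=
  Quotient.eq (r := extSetoid x y)

theorem ind {x y : X} {P : Ext x y → Prop} (h : ∀ p a, P (mk p a)) (e : Ext x y) : P e :=
  Quotient.ind (fun q => h q.1 q.2) e

/-- Composition: concatenation of paths, corrected by the defect of its additivity. -/
noncomputable def comp {x y z : X} : Ext x y → Ext y z → Ext x z :=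
  Quotient.map₂ (fun p q => (p.1.trans q.1, p.2 + q.2 + triSq (p.1.trans q.1).toContinuousMap)) <| by
    rintro ⟨p, a⟩ ⟨p', a'⟩ ⟨H, h⟩ ⟨q, b⟩ ⟨q', b'⟩ ⟨K, h'⟩
    refine ⟨H.hcomp K, ?_⟩
    have := htpy_hcomp H K
    simp only at h h' ⊢
    rw [h, h', ← sub_eq_zero]
    rw [← sub_eq_zero] at this
    rw [← this]
    abel

theorem comp_mk {x y z : X} (p : Path x y) (q : Path y z) (a b : TwoClass X) :
    comp (mk p a) (mk q b) = mk (p.trans q) (a + b + triSq (p.trans q).toContinuousMap) := rfl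

/-- The action of the two-chain classes on morphisms. -/
noncomputable def shift (c : TwoClass X) {x y : X} : Ext x y → Ext x y :=
  Quotient.map (fun p => (p.1, c + p.2)) <| by
    rintro ⟨p, a⟩ ⟨p', a'⟩ ⟨H, h⟩
    exact ⟨H, by simp only at h ⊢; rw [h]; abel⟩

theorem shift_mk (c : TwoClass X) {x y : X} (p : Path x y) (a : TwoClass X) :
    shift c (mk p a) = mk p (c + a) := rfl

theorem shift_comp (c : TwoClass X) {x y z : X} (e : Ext x y) (f : Ext y z) :
    comp (shift c e) f = shift c (comp e f) := by
  induction e using ind with | _ p a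
  induction f using ind with | _ q b
  rw [shift_mk, comp_mk, comp_mk, shift_mk]
  congr 1
  abel

theorem comp_shift (c : TwoClass X) {x y z : X} (e : Ext x y) (f : Ext y z) :
    comp e (shift c f) = shift c (comp e f) := by
  induction e using ind with | _ p a
  induction f using ind with | _ q b
  rw [shift_mk, comp_mk, comp_mk, shift_mk]
  congr 1
  abel

theorem shift_shift (c d : TwoClass X) {x y : X} (e : Ext x y) :
    shift c (shift d e) = shift (c + d) e := by
  induction e using ind with | _ p a
  rw [shift_mk, shift_mk, shift_mk, add_assoc]

theorem shift_zero {x y : X} (e : Ext x y) : shift 0 e = e := by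
  induction e using ind with | _ p a
  rw [shift_mk, zero_add]

theorem mk_eq_shift {x y : X} (p : Path x y) (a : TwoClass X) : mk p a = shift a (mk p 0) := by
  rw [shift_mk, add_zero]

/-- The image of a path in a contractible space depends only on the endpoints, after a
correction. -/
theorem exists_image [ContractibleSpace Y] (f : C(Y, X)) :
    ∃ c : C(I, Y) → TwoClass X,
      (∀ (S : C(I × I, X)) (G : C(I × I, Y)) (a b c' d : C(I, Y)), (∀ s, f (G s) = S s) →
        (∀ t, G (1, t) = a t) →
        (∀ t, G (0, t) = b t) → (∀ t, G (t, 1) = c' t) → (∀ t, G (t, 0) = d t) →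
        sq S = c a - c b - c c' + c d) ∧
      ∃ ε : ∀ x y : Y, Ext (f x) (f y),
        (∀ x y (p : Path x y), mk (p.map f.continuous) (-c p.toContinuousMap) = ε x y) ∧
        (∀ x y z, comp (ε x y) (ε y z) = ε x z) ∧
        ∀ x, ε x x = mk (Path.refl (f x)) 0 := by
  obtain ⟨c, h0, hc, ht, -⟩ := exists_edge_function' f
  have ind : ∀ (x y : Y) (p q : Path x y), mk (p.map f.continuous) (-c p.toContinuousMap) =
      mk (q.map f.continuous) (-c q.toContinuousMap) := by
    intro x y p q
    obtain ⟨H⟩ := SimplyConnectedSpace.paths_homotopic p q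
    rw [mk_eq_mk]
    refine ⟨H.map f, ?_⟩
    rw [htpy, hc (H.map f).toContinuousMap H.toContinuousMap q.toContinuousMap p.toContinuousMap
      (ContinuousMap.const _ y) (ContinuousMap.const _ x) (fun s => rfl) (fun t => by simp)
      (fun t => by simp) (fun t => by simp) (fun t => by simp), h0 (.const _ y) y fun _ => rfl,
      h0 (.const _ x) x fun _ => rfl]
    abel
  refine ⟨c, hc, fun x y => mk ((PathConnectedSpace.somePath x y).map f.continuous)
    (-c (PathConnectedSpace.somePath x y).toContinuousMap), fun x y p => ind x y _ _, ?_, ?_⟩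
  · intro x y z
    beta_reduce
    rw [← ind x z ((PathConnectedSpace.somePath x y).trans (PathConnectedSpace.somePath y z)),
      comp_mk, Path.map_trans]
    congr 1
    rw [ht ((PathConnectedSpace.somePath x y).trans (PathConnectedSpace.somePath y z)).toContinuousMap
      _ (fun t => by rw [← Path.map_trans]; rfl)]
    have e1 : ((PathConnectedSpace.somePath x y).trans
        (PathConnectedSpace.somePath y z)).toContinuousMap.comp (seg 0 mid) =
        (PathConnectedSpace.somePath x y).toContinuousMap := by
      ext t; exact trans_seg_left _ _ t
    have e2 : ((PathConnectedSpace.somePath x y).trans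
        (PathConnectedSpace.somePath y z)).toContinuousMap.comp (seg mid 1) =
        (PathConnectedSpace.somePath y z).toContinuousMap := by
      ext t; exact trans_seg_right _ _ t
    rw [e1, e2]
    abel
  · intro x
    beta_reduce
    rw [ind x x _ (Path.refl x), h0 (Path.refl x).toContinuousMap x fun _ => rfl, neg_zero]
    rfl

/-- The segment as a path. -/
def segPath (a b : I) : Path a b where
  toContinuousMap := seg a b
  source' := by ext; simp [coe_seg]
  target' := by ext; simp [coe_seg]

/-- Every path is an image of the unit interval, so identities about it can be proved there. -/
theorem exists_eq_map {x y : X} (p : Path x y) :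
    ∃ (f : C(I, X)) (hx : x = f 0) (hy : y = f 1),
      p = ((segPath 0 1).map f.continuous).cast hx hy := by
  refine ⟨p.toContinuousMap, p.source.symm, p.target.symm, ?_⟩
  ext t
  change _ = p _
  congr 1
  ext
  exact (by simp [coe_seg] : (t : ℝ) = seg 0 1 t)

/-- Three composable paths are the images of adjacent segments of the unit interval. Thus
associativity can be proved in a contractible space. -/
theorem exists_eq_map_three {x y z v : X} (p : Path x y) (q : Path y z) (r : Path z v) :
    ∃ (f : C(I, X)) (a b c d : I) (hx : x = f a) (hy : y = f b) (hz : z = f c) (hv : v = f d),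
      p = ((segPath a b).map f.continuous).cast hx hy ∧
      q = ((segPath b c).map f.continuous).cast hy hz ∧
      r = ((segPath c d).map f.continuous).cast hz hv := by
  have e1 : ∀ a b : I, seg 0 mid (seg a b 0) = seg 0 mid a := fun a b => by
    congr 1; ext; simp [coe_seg]
  have h1 : ∀ t, ((p.trans q).trans r) (seg 0 mid (seg 0 mid t)) = p t := fun t => by
    rw [trans_seg_left, trans_seg_left]
  have h2 : ∀ t, ((p.trans q).trans r) (seg 0 mid (seg mid 1 t)) = q t := fun t => by
    rw [trans_seg_left, trans_seg_right]
  have h3 : ∀ t, ((p.trans q).trans r) (seg mid 1 t) = r t := fun t => by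
    rw [trans_seg_right]
  have s1 : ∀ t, seg 0 mid (seg 0 mid t) = seg 0 (seg 0 mid mid) t := fun t => by
    ext; simp only [coe_seg, coe_mid]; simp; ring
  have s2 : ∀ t, seg 0 mid (seg mid 1 t) = seg (seg 0 mid mid) mid t := fun t => by
    ext; simp only [coe_seg, coe_mid]; simp; ring
  have k1 : seg 0 mid (seg 0 mid 0) = 0 := by ext; simp [coe_seg]
  have k2 : seg 0 mid (seg mid 1 0) = seg 0 mid mid := by ext; simp [coe_seg]
  have k3 : seg mid 1 0 = mid := by ext; simp [coe_seg]
  have k4 : seg mid 1 1 = 1 := by ext; simp [coe_seg]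
  refine ⟨((p.trans q).trans r).toContinuousMap, 0, seg 0 mid mid, mid, 1, ?_, ?_, ?_, ?_, ?_, ?_, ?_⟩
  · exact ((p.trans q).trans r).source.symm
  · have := h2 0; rw [k2, q.source] at this; exact this.symm
  · have := h3 0; rw [k3, r.source] at this; exact this.symm
  · exact ((p.trans q).trans r).target.symm
  · ext t; rw [← h1, s1]; rfl
  · ext t; rw [← h2, s2]; rfl
  · ext t; rw [← h3]; rfl

theorem comp_assoc {x y z v : X} (e : Ext x y) (f : Ext y z) (g : Ext z v) :
    comp (comp e f) g = comp e (comp f g) := by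
  induction e using ind with | _ p a
  induction f using ind with | _ q b
  induction g using ind with | _ r c
  obtain ⟨f, i, j, k, l, rfl, rfl, rfl, rfl, rfl, rfl, rfl⟩ := exists_eq_map_three p q r
  obtain ⟨c, -, ε, hε, hcomp, -⟩ := exists_image f
  have key : ∀ (i j : I) (a : TwoClass X), mk (((segPath i j).map f.continuous).cast rfl rfl) a =
      shift (a + c (segPath i j).toContinuousMap) (ε i j) := fun i j a => by
    rw [← hε i j (segPath i j), shift_mk, add_neg_cancel_right]; rfl
  simp only [key, shift_comp, comp_shift, hcomp]

theorem mk_refl_comp {x y : X} (e : Ext x y) : comp (mk (Path.refl x) 0) e = e := by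
  induction e using ind with | _ p a
  obtain ⟨f, rfl, rfl, rfl⟩ := exists_eq_map p
  obtain ⟨c, -, ε, hε, hcomp, h1⟩ := exists_image f
  rw [← h1, mk_eq_shift, comp_shift]
  have key := hε 0 1 (segPath 0 1)
  rw [mk_eq_shift] at key
  have : mk (((segPath 0 1).map f.continuous).cast rfl rfl) 0 =
      shift (c (segPath 0 1).toContinuousMap) (ε 0 1) := by
    rw [← key, shift_shift, add_neg_cancel, shift_zero]; rfl
  rw [this, comp_shift, hcomp]

theorem comp_mk_refl {x y : X} (e : Ext x y) : comp e (mk (Path.refl y) 0) = e := by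
  induction e using ind with | _ p a
  obtain ⟨f, rfl, rfl, rfl⟩ := exists_eq_map p
  obtain ⟨c, -, ε, hε, hcomp, h1⟩ := exists_image f
  rw [← h1, mk_eq_shift, shift_comp]
  have key := hε 0 1 (segPath 0 1)
  rw [mk_eq_shift] at key
  have : mk (((segPath 0 1).map f.continuous).cast rfl rfl) 0 =
      shift (c (segPath 0 1).toContinuousMap) (ε 0 1) := by
    rw [← key, shift_shift, add_neg_cancel, shift_zero]; rfl
  rw [this, shift_comp, hcomp]

theorem exists_inverse {x y : X} (e : Ext x y) : ∃ e' : Ext y x,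
    comp e' e = mk (Path.refl y) 0 ∧ comp e e' = mk (Path.refl x) 0 := by
  induction e using ind with | _ p a
  obtain ⟨f, rfl, rfl, rfl⟩ := exists_eq_map p
  obtain ⟨c, -, ε, hε, hcomp, h1⟩ := exists_image f
  have key : mk (((segPath 0 1).map f.continuous).cast rfl rfl) a =
      shift (a + c (segPath 0 1).toContinuousMap) (ε 0 1) := by
    rw [← hε 0 1 (segPath 0 1), shift_mk, add_neg_cancel_right]; rfl
  refine ⟨shift (-(a + c (segPath 0 1).toContinuousMap)) (ε 1 0), ?_, ?_⟩
  · rw [key, shift_comp, comp_shift, shift_shift, neg_add_cancel, shift_zero, hcomp, h1]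
  · rw [key, shift_comp, comp_shift, shift_shift, add_neg_cancel, shift_zero, hcomp, h1]

end Ext

/-- The extended path groupoid. -/
noncomputable instance : Groupoid (Pt X) where
  Hom x y := Ext x.pt y.pt
  id x := Ext.mk (Path.refl x.pt) 0
  comp e f := Ext.comp e f
  id_comp := Ext.mk_refl_comp
  comp_id := Ext.comp_mk_refl
  assoc := Ext.comp_assoc
  inv e := (Ext.exists_inverse e).choose
  inv_comp e := (Ext.exists_inverse e).choose_spec.1
  comp_inv e := (Ext.exists_inverse e).choose_spec.2

/-- If `π₂` vanishes, the class of a self-homotopy of a constant path vanishes. -/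
theorem htpy_self_eq_zero {x : X} (hx : Subsingleton (HomotopyGroup.Pi 2 X x))
    (H : (Path.refl x).Homotopy (Path.refl x)) : htpy H = 0 := by
  let g : GenLoop (Fin 2) X x := ⟨⟨fun y => H (y 0, y 1), by fun_prop⟩, by
    rintro y ⟨i, hi⟩
    fin_cases i <;> rcases hi with hi | hi <;> simp at hi <;> simp [hi]⟩
  have hg : GenLoop.Homotopic g GenLoop.const :=
    Quotient.exact (s := GenLoop.Homotopic.setoid (Fin 2) x) (hx.elim _ _)
  obtain ⟨K⟩ := hg
  -- the null-homotopy is a three-cube all of whose faces but one are constant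
  let k : C(Fin 3 → I, X) := ⟨fun y => K (y 0, ![y 1, y 2]), by fun_prop⟩
  have hK : ∀ (s : I) (y : Fin 2 → I), y ∈ Cube.boundary (Fin 2) → K (s, y) = x := fun s y hy => by
    rw [K.eq_fst s hy]; exact g.2 y hy
  have hb : bd 2 (cube k) = - squareChain H.toContinuousMap := by
    rw [bd_cube, Fin.sum_univ_three]
    have f0 : k.comp (face 0 0) = ⟨fun y => H (y 0, y 1), by fun_prop⟩ := by
      ext y; exact K.apply_zero _
    have f1 : k.comp (face 0 1) = ContinuousMap.const _ x := by
      ext y; exact K.apply_one _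
    have f2 : ∀ e : I, e = 0 ∨ e = 1 → k.comp (face 1 e) = ContinuousMap.const _ x := fun e he => by
      ext y; exact hK _ _ ⟨0, he⟩
    have f3 : ∀ e : I, e = 0 ∨ e = 1 → k.comp (face 2 e) = ContinuousMap.const _ x := fun e he => by
      ext y; exact hK _ _ ⟨1, he⟩
    rw [f0, f1, f2 0 (Or.inl rfl), f2 1 (Or.inr rfl), f3 0 (Or.inl rfl), f3 1 (Or.inr rfl),
      cube_const]
    simp [squareChain]
  refine (Submodule.Quotient.mk_eq_zero _).2 ?_
  refine ⟨-cube k, ?_⟩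
  rw [map_neg, hb, neg_neg]

/-- If `π₂` vanishes, the two-chain classes embed in the vertex group. -/
theorem shift_id_injective {x : X} (hx : Subsingleton (HomotopyGroup.Pi 2 X x)) {a b : TwoClass X}
    (h : Ext.shift a (Ext.mk (Path.refl x) 0) = Ext.shift b (Ext.mk (Path.refl x) 0)) : a = b := by
  rw [Ext.shift_mk, Ext.shift_mk, Ext.mk_eq_mk] at h
  obtain ⟨H, h⟩ := h
  simpa [htpy_self_eq_zero hx H] using h

/-- The relation between the four edges of a square. -/
theorem edge_relation (S : C(I × I, X)) {p : Path (S (0, 0)) (S (1, 0))}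
    {q : Path (S (1, 0)) (S (1, 1))} {p' : Path (S (0, 0)) (S (0, 1))}
    {q' : Path (S (0, 1)) (S (1, 1))} (hp : ∀ t, p t = S (t, 0)) (hq : ∀ t, q t = S (1, t))
    (hp' : ∀ t, p' t = S (0, t)) (hq' : ∀ t, q' t = S (t, 1)) :
    Ext.comp (Ext.mk p 0) (Ext.mk q 0) =
      Ext.shift (sq S) (Ext.comp (Ext.mk p' 0) (Ext.mk q' 0)) := by
  obtain ⟨c, hc, ε, hε, hcomp, -⟩ := Ext.exists_image S
  let P : Path ((0, 0) : I × I) (1, 0) := ⟨⟨fun t => (t, 0), by fun_prop⟩, rfl, rfl⟩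
  let Q : Path ((1, 0) : I × I) (1, 1) := ⟨⟨fun t => (1, t), by fun_prop⟩, rfl, rfl⟩
  let P' : Path ((0, 0) : I × I) (0, 1) := ⟨⟨fun t => (0, t), by fun_prop⟩, rfl, rfl⟩
  let Q' : Path ((0, 1) : I × I) (1, 1) := ⟨⟨fun t => (t, 1), by fun_prop⟩, rfl, rfl⟩
  have key : ∀ {x y : I × I} (p : Path (S x) (S y)) (P : Path x y), (∀ t, p t = S (P t)) →
      Ext.mk p 0 = Ext.shift (c P.toContinuousMap) (ε x y) := fun {x y} p P h => by
    rw [← hε _ _ P, Ext.shift_mk, add_neg_cancel]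
    congr 1
    ext t
    exact h t
  rw [key p P hp, key q Q hq, key p' P' hp', key q' Q' hq']
  simp only [Ext.shift_comp, Ext.comp_shift, Ext.shift_shift, hcomp]
  congr 1
  rw [hc S (ContinuousMap.id _) Q.toContinuousMap P'.toContinuousMap Q'.toContinuousMap
    P.toContinuousMap (fun _ => rfl) (fun _ => rfl) (fun _ => rfl) (fun _ => rfl) (fun _ => rfl)]
  abel

/-- The projection from loops with a two-chain class to the fundamental group. -/
noncomputable def extProj (x : X) : End (Pt.mk x) →* FundamentalGroup X x where
  toFun := fun e => Quotient.map' (s₁ := extSetoid x x) (s₂ := Path.Homotopic.setoid x x)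
    (fun p => p.1) (fun _ _ h => ⟨h.choose⟩) e
  map_one' := rfl
  map_mul' e f := by
    change Ext x x at e f
    induction e using Ext.ind with | _ p a
    induction f using Ext.ind with | _ q b
    rfl

theorem extProj_surjective (x : X) : Function.Surjective (extProj x) := by
  intro g
  obtain ⟨p, rfl⟩ := Quotient.exists_rep g
  exact ⟨Ext.mk p 0, rfl⟩

/-- The kernel of the projection to the fundamental group consists of the two-chain classes. -/
theorem exists_shift_of_extProj_eq_one {x : X} (e : End (Pt.mk x)) (h : extProj x e = 1) :
    ∃ a, e = Ext.shift a (Ext.mk (Path.refl x) 0) := by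
  change Ext x x at e
  induction e using Ext.ind with | _ p a
  have h' : (Quotient.mk (Path.Homotopic.setoid x x) p) = Quotient.mk _ (Path.refl x) := h
  obtain ⟨H⟩ := Quotient.exact h'
  refine ⟨a - htpy H, ?_⟩
  rw [Ext.shift_mk, Ext.mk_eq_mk]
  exact ⟨H, by abel⟩

end Groupoid

end Cubical

/-! ### Second homology of aspherical spaces with finitely presented fundamental group -/

namespace Cubical

open scoped unitInterval
open CategoryTheory

variable {X : Type u} [TopologicalSpace X]

namespace Ext

/-- The action of the two-chain classes on loops. -/
noncomputable def act {x : X} (a : TwoClass X) (e : End (Pt.mk x)) : End (Pt.mk x) := shift a e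

theorem act_mul {x : X} (a : TwoClass X) (e f : End (Pt.mk x)) : act a e * f = act a (e * f) :=
  comp_shift a f e

theorem mul_act {x : X} (a : TwoClass X) (e f : End (Pt.mk x)) : e * act a f = act a (e * f) :=
  shift_comp a f e

theorem act_act {x : X} (a b : TwoClass X) (e : End (Pt.mk x)) :
    act a (act b e) = act (a + b) e :=
  shift_shift a b e

theorem act_zero {x : X} (e : End (Pt.mk x)) : act 0 e = e := shift_zero e

theorem act_eq_mul {x : X} (a : TwoClass X) (e : End (Pt.mk x)) : act a e = act a 1 * e := by
  rw [act_mul, one_mul]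

theorem extProj_act {x : X} (a : TwoClass X) (e : End (Pt.mk x)) :
    extProj x (act a e) = extProj x e := by
  change Ext x x at e
  induction e using ind with | _ p b
  rfl

/-- The central subgroup of the loops given by a subspace of the two-chain classes. -/
def centralSubgroup (x : X) (N : Submodule ℂ (TwoClass X)) : Subgroup (End (Pt.mk x)) where
  carrier := {e | ∃ a ∈ N, e = act a 1}
  one_mem' := ⟨0, N.zero_mem, (act_zero _).symm⟩
  mul_mem' := by
    rintro _ _ ⟨a, ha, rfl⟩ ⟨b, hb, rfl⟩
    exact ⟨a + b, N.add_mem ha hb, by rw [act_mul, one_mul, act_act]⟩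
  inv_mem' := by
    rintro _ ⟨a, ha, rfl⟩
    refine ⟨-a, N.neg_mem ha, ?_⟩
    rw [inv_eq_iff_mul_eq_one, act_mul, one_mul, act_act, add_neg_cancel, act_zero]

instance (x : X) (N : Submodule ℂ (TwoClass X)) : (centralSubgroup x N).Normal where
  conj_mem := by
    rintro _ ⟨a, ha, rfl⟩ g
    refine ⟨a, ha, ?_⟩
    rw [mul_act, act_mul, mul_one, mul_inv_cancel]

end Ext

open Ext

/-- If the fundamental group is finitely presented and `π₂` vanishes, the extension of the
fundamental group by the two-chain classes splits modulo a finite-dimensional subspace. -/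
theorem exists_retraction {x : X} (hx : Subsingleton (HomotopyGroup.Pi 2 X x))
    (hfp : Group.IsFinitelyPresented (FundamentalGroup X x)) :
    ∃ (s : Set (TwoClass X)) (κ : End (Pt.mk x) → TwoClass X ⧸ Submodule.span ℂ s), s.Finite ∧
      κ 1 = 0 ∧ (∀ g h, κ (g * h) = κ g + κ h) ∧
      ∀ a g, κ (act a g) = (Submodule.span ℂ s).mkQ a + κ g := by
  obtain ⟨n, φ, hφ, S, hS, hker⟩ := hfp.out
  choose t ht using fun i : Fin n => extProj_surjective x (φ (FreeGroup.of i))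
  let Φ : FreeGroup (Fin n) →* End (Pt.mk x) := FreeGroup.lift t
  have hΦ : ∀ w, extProj x (Φ w) = φ w := by
    have : (extProj x).comp Φ = φ := FreeGroup.ext_hom _ _ fun i => by
      rw [MonoidHom.comp_apply, FreeGroup.lift_apply_of, ht]
    exact fun w => DFunLike.congr_fun this w
  have hl : ∀ w : FreeGroup (Fin n), ∃ a : TwoClass X, φ w = 1 →
      Φ w = act a 1 := fun w => by
    by_cases h : φ w = 1
    · obtain ⟨a, ha⟩ := exists_shift_of_extProj_eq_one (Φ w) ((hΦ w).trans h)
      exact ⟨a, fun _ => ha⟩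
    · exact ⟨0, fun h' => absurd h' h⟩
  -- `l w` is the two-chain class of the relator `w`
  choose l hl using hl
  set N := Submodule.span ℂ (l '' S) with hN
  -- all relations hold modulo the relators in the presentation, which span a central subgroup
  have hle : φ.ker ≤ (centralSubgroup x N).comap Φ := by
    rw [← hker]
    refine Subgroup.normalClosure_le_normal fun w hw => ?_
    exact ⟨l w, Submodule.subset_span ⟨w, hw, rfl⟩,
      hl w (MonoidHom.mem_ker.1 (hker ▸ Subgroup.subset_normalClosure hw))⟩
  have hex : ∀ g : End (Pt.mk x), ∃ (a : TwoClass X) (w : FreeGroup (Fin n)),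
      g = act a (Φ w) := fun g => by
    obtain ⟨w, hw⟩ := hφ (extProj x g)
    obtain ⟨a, ha⟩ := exists_shift_of_extProj_eq_one (g * (Φ w)⁻¹) (by
      rw [map_mul, map_inv, hΦ, hw, mul_inv_cancel])
    refine ⟨a, w, ?_⟩
    rw [mul_inv_eq_iff_eq_mul] at ha
    rw [act_eq_mul]
    exact ha
  -- an element of the extension is the lift `Φ` of a word, acted on by a two-chain class; the class
  -- is unique modulo `N`, because `π₂` vanishes
  choose k v hkv using hex
  have uniq : ∀ (a b : TwoClass X) (w w' : FreeGroup (Fin n)),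
      act a (Φ w) = act b (Φ w') → N.mkQ a = N.mkQ b := fun a b w w' h => by
    have h1 : w * w'⁻¹ ∈ φ.ker := by
      have := congrArg (extProj x) h
      rw [extProj_act, extProj_act, hΦ, hΦ] at this
      rw [MonoidHom.mem_ker, map_mul, map_inv, this, mul_inv_cancel]
    obtain ⟨c, hc, hc'⟩ := hle h1
    rw [map_mul, map_inv, mul_inv_eq_iff_eq_mul] at hc'
    have h2 : act (a + c) 1 * Φ w' =
        act b 1 * Φ w' := by
      rw [act_mul, act_mul, one_mul, ← h, hc', ← act_act, act_mul, one_mul]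
    have h3 := shift_id_injective hx (mul_right_cancel h2 : act (a + c) 1 = act b 1)
    have h4 : N.mkQ c = 0 := (Submodule.Quotient.mk_eq_zero N).2 hc
    rw [← h3, map_add, h4, add_zero]
  refine ⟨l '' S, fun g => N.mkQ (k g), hS.image _, ?_, ?_, ?_⟩
  · have := uniq (k 1) 0 (v 1) 1 (by rw [← hkv, map_one, act_zero])
    exact this.trans (map_zero _)
  · intro g h
    beta_reduce
    rw [← map_add]
    refine uniq _ _ (v (g * h)) (v g * v h) ?_
    rw [← hkv, ← act_act, map_mul]
    conv_lhs => rw [hkv g, hkv h]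
    rw [act_mul, mul_act]
  · intro a g
    beta_reduce
    rw [← map_add]
    refine uniq _ _ (v (act a g)) (v g) ?_
    rw [← hkv, ← act_act, ← hkv g]

/-- The class of a singular one-cube in the extended fundamental group, by means of paths from
the base point. -/
noncomputable def loopOf {x : X} (e : ∀ y : X, Pt.mk x ⟶ Pt.mk y) (s : C(I, X)) :
    End (Pt.mk x) :=
  e (s 0) ≫ (Ext.mk (⟨s, rfl, rfl⟩ : Path (s 0) (s 1)) 0 : Pt.mk (s 0) ⟶ Pt.mk (s 1)) ≫
    Groupoid.inv (e (s 1))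

theorem loopOf_const {x : X} (e : ∀ y : X, Pt.mk x ⟶ Pt.mk y) (y : X) :
    loopOf e (ContinuousMap.const _ y) = 1 := by
  have : (Ext.mk (⟨ContinuousMap.const _ y, rfl, rfl⟩ : Path y y) 0 : Pt.mk y ⟶ Pt.mk y) =
      𝟙 (Pt.mk y) := rfl
  rw [loopOf]
  simp only [ContinuousMap.const_apply]
  rw [this, Category.id_comp, Groupoid.comp_inv]
  rfl

/-- The class of a square measures the failure of its boundary to be the identity in the extended
fundamental group. -/
theorem loopOf_square {x : X} (e : ∀ y : X, Pt.mk x ⟶ Pt.mk y) (S : C(I × I, X))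
    {a b c d : C(I, X)} (ha : ∀ t, S (1, t) = a t)
    (hb : ∀ t, S (0, t) = b t) (hc : ∀ t, S (t, 1) = c t) (hd : ∀ t, S (t, 0) = d t) :
    loopOf e a * loopOf e d = act (sq S) (loopOf e c * loopOf e b) := by
  obtain rfl : a = ⟨fun t => S (1, t), by fun_prop⟩ := by ext t; exact (ha t).symm
  obtain rfl : b = ⟨fun t => S (0, t), by fun_prop⟩ := by ext t; exact (hb t).symm
  obtain rfl : c = ⟨fun t => S (t, 1), by fun_prop⟩ := by ext t; exact (hc t).symm
  obtain rfl : d = ⟨fun t => S (t, 0), by fun_prop⟩ := by ext t; exact (hd t).symm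
  have key := edge_relation S (p := ⟨⟨fun t => S (t, 0), by fun_prop⟩, rfl, rfl⟩)
    (q := ⟨⟨fun t => S (1, t), by fun_prop⟩, rfl, rfl⟩)
    (p' := ⟨⟨fun t => S (0, t), by fun_prop⟩, rfl, rfl⟩)
    (q' := ⟨⟨fun t => S (t, 1), by fun_prop⟩, rfl, rfl⟩)
    (fun _ => rfl) (fun _ => rfl) (fun _ => rfl) (fun _ => rfl)
  have gen : ∀ {y z z' v : X} (p : Ext y z) (q : Ext z v) (p' : Ext y z') (q' : Ext z' v),
      Ext.comp p q = shift (sq S) (Ext.comp p' q') →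
      (e y ≫ (p : Pt.mk y ⟶ Pt.mk z) ≫ Groupoid.inv (e z)) ≫
        (e z ≫ (q : Pt.mk z ⟶ Pt.mk v) ≫ Groupoid.inv (e v)) =
      (shift (sq S) ((e y ≫ (p' : Pt.mk y ⟶ Pt.mk z') ≫ Groupoid.inv (e z')) ≫
        (e z' ≫ (q' : Pt.mk z' ⟶ Pt.mk v) ≫ Groupoid.inv (e v)) : Pt.mk x ⟶ Pt.mk x) :
          Ext x x) := by
    intro y z z' v p q p' q' h
    have cancel : ∀ {z : X} (p : Pt.mk y ⟶ Pt.mk z) (q : Pt.mk z ⟶ Pt.mk v),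
        (e y ≫ p ≫ Groupoid.inv (e z)) ≫ (e z ≫ q ≫ Groupoid.inv (e v)) =
        e y ≫ (p ≫ q) ≫ Groupoid.inv (e v) := fun p q => by simp
    rw [cancel, cancel]
    change Ext.comp (e y) (Ext.comp (Ext.comp p q) _) = shift _ (Ext.comp (e y)
      (Ext.comp (Ext.comp p' q') _))
    rw [h, shift_comp, comp_shift]
  exact gen _ _ _ _ key

/-- The second homology of a path-connected space with finitely presented fundamental group and
vanishing second homotopy group is finite-dimensional. -/
theorem finHom_two_of_isFinitelyPresented [PathConnectedSpace X] {x : X}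
    (hx : Subsingleton (HomotopyGroup.Pi 2 X x))
    (hfp : Group.IsFinitelyPresented (FundamentalGroup X x)) : FinHom 2 X := by
  obtain ⟨s, κ, hs, h1, hmul, hshift⟩ := exists_retraction hx hfp
  let e : ∀ y : X, Pt.mk x ⟶ Pt.mk y := fun y => Ext.mk (PathConnectedSpace.somePath x y) 0
  let C : Chain 1 X →ₗ[ℂ] TwoClass X ⧸ Submodule.span ℂ s :=
    lift (fun c => κ (loopOf e (c.comp ⟨fun t _ => t, by fun_prop⟩))) fun c ⟨j, hj⟩ => by
      have : c.comp ⟨fun t _ => t, by fun_prop⟩ = ContinuousMap.const I (c fun _ => 0) := by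
        ext t
        exact hj _ _ fun i hi => absurd (Subsingleton.elim i j) hi
      rw [this, loopOf_const, h1]
  have hline : ∀ p : C(I, X), C (lineChain p) = κ (loopOf e p) := fun p => by
    rw [lineChain, lift_cube]
    rfl
  -- the map `C` retracts two-chains modulo `N` and boundaries, by way of their boundaries
  have hC : C ∘ₗ bd 1 = (Submodule.span ℂ s).mkQ ∘ₗ (boundaries 2 X).mkQ := hom_ext fun c => by
    have e2 : ∀ y : Fin 2 → I, ![y 0, y 1] = y := fun y => by
      ext i; fin_cases i <;> rfl
    have hc : squareChain (⟨fun y : I × I => c ![y.1, y.2], by fun_prop⟩ : C(I × I, X)) =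
        cube c := by
      rw [squareChain]
      congr 1
      ext y
      simp [e2]
    rw [← hc, LinearMap.comp_apply, bd_squareChain _ (a := ⟨fun t => c ![1, t], by fun_prop⟩)
      (b := ⟨fun t => c ![0, t], by fun_prop⟩) (c := ⟨fun t => c ![t, 1], by fun_prop⟩)
      (d := ⟨fun t => c ![t, 0], by fun_prop⟩) (fun _ => rfl) (fun _ => rfl) (fun _ => rfl)
      (fun _ => rfl)]
    have h := congrArg κ (loopOf_square e
      (⟨fun y : I × I => c ![y.1, y.2], by fun_prop⟩ : C(I × I, X))
      (a := ⟨fun t => c ![1, t], by fun_prop⟩)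
      (b := ⟨fun t => c ![0, t], by fun_prop⟩) (c := ⟨fun t => c ![t, 1], by fun_prop⟩)
      (d := ⟨fun t => c ![t, 0], by fun_prop⟩) (fun _ => rfl) (fun _ => rfl) (fun _ => rfl)
      (fun _ => rfl))
    rw [hshift, hmul, hmul] at h
    simp only [map_add, map_sub, hline]
    change _ = (Submodule.span ℂ s).mkQ (sq _)
    rw [eq_comm, ← eq_sub_iff_add_eq] at h
    rw [h]
    abel
  have hlift : ∀ a : TwoClass X, ∃ c : Chain 2 X, (boundaries 2 X).mkQ c = a :=
    (boundaries 2 X).mkQ_surjective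
  choose r hr using hlift
  refine ⟨Submodule.span ℂ (r '' s), FiniteDimensional.span_of_finite ℂ (hs.image r), fun z hz => ?_⟩
  -- so the class of a cycle lies in `N`
  have hz' : (Submodule.span ℂ s).mkQ ((boundaries 2 X).mkQ z) = 0 := by
    have := LinearMap.congr_fun hC z
    rw [LinearMap.comp_apply, show bd 1 z = 0 from hz, map_zero] at this
    exact this.symm
  have hz2 : (boundaries 2 X).mkQ z ∈ Submodule.span ℂ s := (Submodule.Quotient.mk_eq_zero _).1 hz'
  have hmap : Submodule.span ℂ s = (Submodule.span ℂ (r '' s)).map (boundaries 2 X).mkQ := by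
    rw [Submodule.map_span, ← Set.image_comp]
    congr 1
    ext a
    simp [hr]
  rw [hmap] at hz2
  obtain ⟨w, hw, hwz⟩ := hz2
  have : z - w ∈ boundaries 2 X := by
    rw [← Submodule.ker_mkQ (boundaries 2 X), LinearMap.mem_ker, map_sub, hwz, sub_self]
  exact Submodule.mem_sup.2 ⟨w, hw, z - w, this, add_sub_cancel w z⟩

end Cubical

/-! ### The homotopy operators of polynomial forms at the vertices of a simplex -/

namespace PolyForm

variable {k : Type w} [Field k] {n m : ℕ}

/-- The general lemma for `PolyForm`, with its instances already found. -/
theorem neg_one_smul' (η : PolyForm k n) : (-1 : k) • η = -η := neg_one_smul k η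

/-- The barycentric coordinate `t_l` as a form. -/
noncomputable def x (l : Fin (n + 1)) : PolyForm k n := bary k n l ⊗ₜ 1

/-- The differential `dt_l` of a barycentric coordinate. -/
noncomputable def dx (l : Fin (n + 1)) : PolyForm k n := 1 ⊗ₜ ExteriorAlgebra.ι k (dbary k n l)

theorem x_mem_deg (l : Fin (n + 1)) : (x l : PolyForm k n) ∈ deg k n 0 :=
  tmul_mem_deg _ (by simp [ExteriorAlgebra.exteriorPower])

theorem dx_mem_deg (l : Fin (n + 1)) : (dx l : PolyForm k n) ∈ deg k n 1 :=
  tmul_mem_deg _ (by rw [ExteriorAlgebra.exteriorPower, pow_one]; exact LinearMap.mem_range_self _ _)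

theorem sum_bary : ∑ l, bary k n l = 1 := by
  rw [Fin.sum_univ_succ]
  simp [bary]

theorem sum_dbary : ∑ l, dbary k n l = 0 := by
  rw [Fin.sum_univ_succ]
  ext i
  simp [dbary, Pi.single_apply]

theorem sum_x : ∑ l, (x l : PolyForm k n) = 1 := by
  simp only [x]
  rw [← TensorProduct.sum_tmul, sum_bary]
  rfl

theorem sum_dx : ∑ l, (dx l : PolyForm k n) = 0 := by
  simp only [dx]
  rw [← TensorProduct.tmul_sum, ← map_sum, sum_dbary, map_zero, TensorProduct.tmul_zero]

theorem d_x (l : Fin (n + 1)) : d k n (x l) = dx l := by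
  rw [x, d_tmul, dx]
  simp only [pderiv_bary, mul_one]
  have : ∀ i : Fin n, (MvPolynomial.C (dbary k n l i) : MvPolynomial (Fin n) k) ⊗ₜ[k]
      (ExteriorAlgebra.ι k (Pi.single i 1 : Fin n → k)) =
      (1 : MvPolynomial (Fin n) k) ⊗ₜ[k]
        (ExteriorAlgebra.ι k (dbary k n l i • Pi.single i 1 : Fin n → k)) := fun i => by
    rw [map_smul, TensorProduct.tmul_smul, TensorProduct.smul_tmul', MvPolynomial.smul_eq_C_mul,
      mul_one]
  simp only [this]
  rw [← TensorProduct.tmul_sum, ← map_sum]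
  congr 2
  ext i
  simp [Finset.sum_apply, Pi.single_apply]

theorem d_dx (l : Fin (n + 1)) : d k n (dx l) = 0 := by rw [← d_x, d_d]

theorem d_x_mul (l : Fin (n + 1)) (η : PolyForm k n) :
    d k n (x l * η) = dx l * η + x l * d k n η := by
  rw [d_mul (x_mem_deg l), d_x, pow_zero, one_smul]

theorem d_dx_mul (l : Fin (n + 1)) (η : PolyForm k n) :
    d k n (dx l * η) = -(dx l * d k n η) := by
  rw [d_mul (dx_mem_deg l), d_dx, zero_mul, zero_add, pow_one, neg_one_smul']

variable (k) in
/-- The value of a form of degree zero at a vertex, extended by zero to forms of positive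
degree. -/
noncomputable def ev (i : Fin (n + 1)) : PolyForm k n →ₐ[k] k :=
  Algebra.TensorProduct.lift (MvPolynomial.aeval fun l : Fin n => if l.succ = i then 1 else 0)
    ExteriorAlgebra.algebraMapInv fun _ _ => Commute.all _ _

theorem ev_tmul (i : Fin (n + 1)) (f : MvPolynomial (Fin n) k)
    (a : ExteriorAlgebra k (Fin n → k)) :
    ev k i (f ⊗ₜ a) = MvPolynomial.aeval (fun l : Fin n => if l.succ = i then (1 : k) else 0) f *
      ExteriorAlgebra.algebraMapInv a :=
  Algebra.TensorProduct.lift_tmul _ _ _ _ _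

theorem ev_x (i l : Fin (n + 1)) : ev k i (x l : PolyForm k n) = if l = i then 1 else 0 := by
  have hs : ∀ l : Fin n, ev k i (x l.succ : PolyForm k n) = if l.succ = i then 1 else 0 := fun l => by
    rw [x, ev_tmul]; simp [bary]
  refine Fin.cases ?_ hs l
  have h := congrArg (ev k i) (sum_x (k := k) (n := n))
  rw [map_sum, map_one, Fin.sum_univ_succ] at h
  simp only [hs] at h
  have h2 : ∑ l : Fin (n + 1), (if l = i then (1 : k) else 0) = 1 := by simp
  rw [Fin.sum_univ_succ] at h2
  exact add_right_cancel (h.trans h2.symm)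

theorem ev_dx (i l : Fin (n + 1)) : ev k i (dx l : PolyForm k n) = 0 := by
  rw [dx, ev_tmul]
  simp [ExteriorAlgebra.algebraMapInv]

/-- The contraction with the Euler vector field centred at the vertex `i`, which maps `dt_l` to
`t_l - δ_{il}`. -/
noncomputable def contr (i : Fin (n + 1)) : PolyForm k n →ₗ[k] PolyForm k n :=
  ∑ l : Fin n, TensorProduct.map
    (LinearMap.mulLeft k (MvPolynomial.X l - if l.succ = i then 1 else 0))
    (CliffordAlgebra.contractLeft (LinearMap.proj l))

theorem contr_tmul (i : Fin (n + 1)) (f : MvPolynomial (Fin n) k)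
    (a : ExteriorAlgebra k (Fin n → k)) :
    contr i (f ⊗ₜ a) = ∑ l : Fin n, ((MvPolynomial.X l - if l.succ = i then 1 else 0) * f) ⊗ₜ[k]
      (CliffordAlgebra.contractLeft (LinearMap.proj l : (Fin n → k) →ₗ[k] k) a :
        ExteriorAlgebra k (Fin n → k)) := by
  simp [contr, LinearMap.sum_apply]

theorem contr_poly_mul (i : Fin (n + 1)) (g : MvPolynomial (Fin n) k) (η : PolyForm k n) :
    contr i (g ⊗ₜ 1 * η) = g ⊗ₜ 1 * contr i η := by
  induction η using TensorProduct.induction_on with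
  | zero => simp
  | add a b ha hb => rw [mul_add, map_add, ha, hb, map_add, mul_add]
  | tmul f a =>
    rw [Algebra.TensorProduct.tmul_mul_tmul, one_mul, contr_tmul, contr_tmul, Finset.mul_sum]
    refine Finset.sum_congr rfl fun l _ => ?_
    rw [Algebra.TensorProduct.tmul_mul_tmul, one_mul, mul_left_comm]

theorem contr_x_mul (i l : Fin (n + 1)) (η : PolyForm k n) :
    contr i (x l * η) = x l * contr i η := contr_poly_mul i _ η

theorem contr_ι_mul (i : Fin (n + 1)) (v : Fin n → k) (η : PolyForm k n) :
    contr i (1 ⊗ₜ ExteriorAlgebra.ι k v * η) =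
      (∑ l : Fin n, v l • (x l.succ - if l.succ = i then 1 else 0)) * η -
        1 ⊗ₜ ExteriorAlgebra.ι k v * contr i η := by
  induction η using TensorProduct.induction_on with
  | zero => simp
  | add a b ha hb => rw [mul_add, map_add, ha, hb, map_add, mul_add, mul_add]; abel
  | tmul f a =>
    rw [Algebra.TensorProduct.tmul_mul_tmul, one_mul, contr_tmul, contr_tmul, Finset.mul_sum,
      Finset.sum_mul, ← Finset.sum_sub_distrib]
    refine Finset.sum_congr rfl fun l _ => ?_
    have h : (CliffordAlgebra.contractLeft (LinearMap.proj l : (Fin n → k) →ₗ[k] k)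
        (ExteriorAlgebra.ι k v * a) : ExteriorAlgebra k (Fin n → k)) =
        v l • a - ExteriorAlgebra.ι k v *
          (CliffordAlgebra.contractLeft (LinearMap.proj l : (Fin n → k) →ₗ[k] k) a :
            ExteriorAlgebra k (Fin n → k)) :=
      CliffordAlgebra.contractLeft_ι_mul _ v a
    have hx : (x l.succ - if l.succ = i then 1 else 0 : PolyForm k n) =
        (MvPolynomial.X l - if l.succ = i then 1 else 0) ⊗ₜ 1 := by
      rw [x, TensorProduct.sub_tmul]
      congr 1
      split_ifs
      · rfl
      · rw [TensorProduct.zero_tmul]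
    rw [h, hx, Algebra.TensorProduct.tmul_mul_tmul, one_mul, TensorProduct.tmul_sub, smul_mul_assoc,
      Algebra.TensorProduct.tmul_mul_tmul, one_mul, TensorProduct.tmul_smul]

theorem contr_dx_mul (i l : Fin (n + 1)) (η : PolyForm k n) :
    contr i (dx l * η) = (x l - if l = i then 1 else 0) * η - dx l * contr i η := by
  rw [dx, contr_ι_mul]
  congr 2
  refine Fin.cases ?_ (fun l => ?_) l
  · have h := sum_x (k := k) (n := n)
    have h2 : ∑ l : Fin (n + 1), (if l = i then (1 : PolyForm k n) else 0) = 1 := by simp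
    rw [Fin.sum_univ_succ] at h h2
    have e : ∀ l : Fin n, dbary k n 0 l = -1 := fun _ => rfl
    simp only [e, neg_one_smul', Finset.sum_neg_distrib, Finset.sum_sub_distrib]
    rw [eq_sub_of_add_eq' h, eq_sub_of_add_eq' h2]
    abel
  · simp [dbary, Pi.single_apply]

/-- To prove a linear property of forms, it suffices to multiply by the coordinates and their
differentials. -/
theorem mem_of_generators (S : ℕ → Submodule k (PolyForm k n)) (h1 : 1 ∈ S 0)
    (hx : ∀ p (l : Fin n), ∀ η ∈ S p, x l.succ * η ∈ S p)
    (hdx : ∀ p (l : Fin n), ∀ η ∈ S p, dx l.succ * η ∈ S (p + 1)) {p : ℕ} {η : PolyForm k n}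
    (hη : η ∈ deg k n p) : η ∈ S p := by
  have hf : ∀ p (f : MvPolynomial (Fin n) k), ∀ η ∈ S p, f ⊗ₜ 1 * η ∈ S p := fun p f => by
    induction f using MvPolynomial.induction_on with
    | C r =>
      intro η hη
      have : (MvPolynomial.C r ⊗ₜ 1 : PolyForm k n) = r • 1 := by
        rw [Algebra.TensorProduct.one_def, TensorProduct.smul_tmul', MvPolynomial.smul_eq_C_mul,
          mul_one]
      rw [this, smul_mul_assoc, one_mul]
      exact Submodule.smul_mem _ _ hη
    | add f g hf hg =>
      intro η hη
      rw [TensorProduct.add_tmul, add_mul]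
      exact add_mem (hf η hη) (hg η hη)
    | mul_X f j hf =>
      intro η hη
      have : ((f * MvPolynomial.X j) ⊗ₜ 1 : PolyForm k n) = f ⊗ₜ 1 * x j.succ := by
        rw [x, Algebra.TensorProduct.tmul_mul_tmul, one_mul]; rfl
      rw [this, mul_assoc]
      exact hf _ (hx p j η hη)
  have ha : ∀ p, ∀ a ∈ ⋀[k]^p (Fin n → k), (1 ⊗ₜ a : PolyForm k n) ∈ S p := fun p a ha => by
    induction ha using Submodule.pow_induction_on_left' with
    | algebraMap r =>
      rw [Algebra.algebraMap_eq_smul_one, TensorProduct.tmul_smul]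
      exact Submodule.smul_mem _ _ h1
    | add x y i _ _ h h' => rw [TensorProduct.tmul_add]; exact add_mem h h'
    | mem_mul v hv i y _ h =>
      obtain ⟨v, rfl⟩ := hv
      have e : (1 ⊗ₜ (ExteriorAlgebra.ι k v * y) : PolyForm k n) =
          ∑ l, v l • (dx l.succ * 1 ⊗ₜ y) := by
        simp only [dx, Algebra.TensorProduct.tmul_mul_tmul, one_mul, ← TensorProduct.tmul_smul]
        rw [← TensorProduct.tmul_sum]
        simp only [← smul_mul_assoc, ← map_smul]
        rw [← Finset.sum_mul, ← map_sum]
        congr 3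
        ext i
        simp [dbary, Finset.sum_apply, Pi.single_apply]
      rw [e]
      exact sum_mem fun l _ => Submodule.smul_mem _ _ (hdx i l _ h)
  induction hη using Submodule.span_induction with
  | zero => exact zero_mem _
  | add a b _ _ h h' => exact add_mem h h'
  | smul c a _ h => exact Submodule.smul_mem _ _ h
  | mem a ha' =>
    obtain ⟨f, a, h, rfl⟩ := ha'
    have : (f ⊗ₜ a : PolyForm k n) = f ⊗ₜ 1 * 1 ⊗ₜ a := by
      rw [Algebra.TensorProduct.tmul_mul_tmul, one_mul, mul_one]
    rw [this]
    exact hf p f _ (ha p a h)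

theorem iSup_deg : ⨆ p, deg k n p = ⊤ := by
  rw [eq_top_iff]
  rintro η -
  induction η using TensorProduct.induction_on with
  | zero => exact zero_mem _
  | add a b ha hb => exact add_mem ha hb
  | tmul f a =>
    have h : a ∈ ⨆ p, ⋀[k]^p (Fin n → k) := by
      have := (DirectSum.Decomposition.isInternal
        fun p => ⋀[k]^p (Fin n → k)).submodule_iSup_eq_top
      rw [this]; trivial
    induction h using Submodule.iSup_induction' with
    | mem p a ha => exact Submodule.mem_iSup_of_mem p (tmul_mem_deg f ha)
    | zero => rw [TensorProduct.tmul_zero]; exact zero_mem _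
    | add a b _ _ h h' => rw [TensorProduct.tmul_add]; exact add_mem h h'

theorem eq_top_of_generators (S : Submodule k (PolyForm k n)) (h1 : 1 ∈ S)
    (hx : ∀ l : Fin n, ∀ η ∈ S, x l.succ * η ∈ S)
    (hdx : ∀ l : Fin n, ∀ η ∈ S, dx l.succ * η ∈ S) : S = ⊤ := by
  rw [eq_top_iff, ← iSup_deg, iSup_le_iff]
  exact fun p η hη => mem_of_generators (fun _ => S) h1 (fun _ => hx) (fun _ => hdx) hη

theorem ev_eq_zero (i : Fin (n + 1)) {p : ℕ} {η : PolyForm k n} (hη : η ∈ deg k n (p + 1)) :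
    ev k i η = 0 := by
  have := mem_of_generators (fun p => if p = 0 then ⊤ else LinearMap.ker (ev k i).toLinearMap)
    (by simp) (fun p l η hη => by
      by_cases hp : p = 0
      · simp [hp]
      · simp only [hp, if_false, LinearMap.mem_ker, AlgHom.toLinearMap_apply, map_mul] at hη ⊢
        rw [hη, mul_zero])
    (fun p l η hη => by simp [ev_dx]) hη
  simpa using this

theorem contr_one (i : Fin (n + 1)) : contr i (1 : PolyForm k n) = 0 := by
  rw [Algebra.TensorProduct.one_def, contr_tmul]
  exact Finset.sum_eq_zero fun l _ => by
    rw [CliffordAlgebra.contractLeft_one, TensorProduct.tmul_zero]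

theorem contr_eq_zero (i : Fin (n + 1)) {η : PolyForm k n} (hη : η ∈ deg k n 0) :
    contr i η = 0 := by
  have := mem_of_generators (fun p => if p = 0 then LinearMap.ker (contr i) else ⊤)
    (by simp [contr_one]) (fun p l η hη => by
      by_cases hp : p = 0
      · simp only [hp, if_true, LinearMap.mem_ker] at hη ⊢
        rw [contr_x_mul, hη, mul_zero]
      · simp [hp])
    (fun p l η hη => by simp) hη
  simpa using this

theorem contr_mem_deg (i : Fin (n + 1)) {p : ℕ} {η : PolyForm k n} (hη : η ∈ deg k n (p + 1)) :
    contr i η ∈ deg k n p := by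
  have h : ∀ q, ∀ η ∈ deg k n q, contr i η ∈ deg k n (q - 1) ∧ (q = 0 → contr i η = 0) := by
    intro q η hη
    let S : ℕ → Submodule k (PolyForm k n) := fun q => deg k n q ⊓
      ((deg k n (q - 1)).comap (contr i) ⊓ if q = 0 then LinearMap.ker (contr i) else ⊤)
    suffices main : η ∈ S q from ⟨main.2.1, fun hq => contr_eq_zero i (hq ▸ hη)⟩
    refine mem_of_generators S ?_ ?_ ?_ hη
    · exact ⟨one_mem_deg n, by simp [contr_one], by simp [contr_one]⟩
    · rintro p l η ⟨h0, h1, h2⟩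
      refine ⟨mul_mem_deg (zero_add p) (x_mem_deg _) h0, ?_, ?_⟩
      · change contr i (x l.succ * η) ∈ deg k n (p - 1)
        rw [contr_x_mul]
        exact mul_mem_deg (zero_add _) (x_mem_deg _) h1
      · split_ifs with hp
        · subst hp
          exact contr_eq_zero i (mul_mem_deg (zero_add 0) (x_mem_deg l.succ) h0)
        · trivial
    · rintro p l η ⟨h0, h1, h2⟩
      refine ⟨mul_mem_deg (add_comm 1 p) (dx_mem_deg _) h0, ?_, by simp⟩
      change contr i (dx l.succ * η) ∈ deg k n p
      rw [contr_dx_mul]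
      refine sub_mem (mul_mem_deg (zero_add p) (sub_mem (x_mem_deg _) ?_) h0) ?_
      · split_ifs
        · exact one_mem_deg n
        · exact zero_mem _
      · cases p with
        | zero => rw [contr_eq_zero i h0, mul_zero]; exact zero_mem _
        | succ p => exact mul_mem_deg (add_comm 1 p) (dx_mem_deg _) h1
  exact (h (p + 1) η hη).1

/-- The Lie derivative along the Euler vector field centred at the vertex `i`. -/
noncomputable def lie (i : Fin (n + 1)) : PolyForm k n →ₗ[k] PolyForm k n :=
  d k n ∘ₗ contr i + contr i ∘ₗ d k n

theorem lie_apply (i : Fin (n + 1)) (η : PolyForm k n) :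
    lie i η = d k n (contr i η) + contr i (d k n η) := rfl

theorem d_one : d k n 1 = 0 := by
  rw [Algebra.TensorProduct.one_def, d_tmul]
  simp

theorem lie_one (i : Fin (n + 1)) : lie i (1 : PolyForm k n) = 0 := by
  rw [lie_apply, contr_one, d_one, map_zero, map_zero, add_zero]

theorem d_delta_mul (c : Prop) [Decidable c] (η : PolyForm k n) :
    d k n ((if c then 1 else 0) * η) = (if c then 1 else 0) * d k n η := by
  split_ifs <;> simp

theorem lie_x_mul (i l : Fin (n + 1)) (η : PolyForm k n) :
    lie i (x l * η) = (x l - if l = i then 1 else 0) * η + x l * lie i η := by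
  rw [lie_apply, lie_apply, contr_x_mul, d_x_mul, d_x_mul, map_add, contr_dx_mul, contr_x_mul,
    mul_add]
  abel

theorem lie_dx_mul (i l : Fin (n + 1)) (η : PolyForm k n) :
    lie i (dx l * η) = dx l * η + dx l * lie i η := by
  rw [lie_apply, lie_apply, contr_dx_mul, d_dx_mul, map_neg, contr_dx_mul, map_sub, sub_mul,
    map_sub, d_x_mul, d_dx_mul, d_delta_mul, mul_add, sub_mul]
  abel

/-- The operator `L + ev`, where `L` is the Lie derivative along the Euler vector field. -/
noncomputable def eul (i : Fin (n + 1)) : PolyForm k n →ₗ[k] PolyForm k n :=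
  lie i + (Algebra.linearMap k (PolyForm k n)) ∘ₗ (ev k i).toLinearMap

theorem eul_apply (i : Fin (n + 1)) (η : PolyForm k n) :
    eul i η = lie i η + algebraMap k _ (ev k i η) := rfl

section CharZero

variable [CharZero k]

/-- The forms of degree `p` are spanned by eigenvectors of `L + ev` with non-zero eigenvalues. -/
theorem deg_le_span_eigenvectors (i : Fin (n + 1)) (p : ℕ) :
    deg k n p ≤ Submodule.span k {η | η ∈ deg k n p ∧ ∃ c : k, c ≠ 0 ∧ eul i η = c • η} := by
  -- The Lie derivative acts on monomials in the `t_l - δ_{il}` and the `dt_l` by their total degree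
  -- `m`. The evaluation at `i` changes the eigenvalue on constants from `0` to `1`.
  let good (p : ℕ) : Set (PolyForm k n) := {η | η ∈ deg k n p ∧ ∃ m : ℕ, lie i η = (m : k) • η ∧
    (m ≠ 0 → ev k i η = 0) ∧ (m = 0 → η = algebraMap k _ (ev k i η))}
  have key : deg k n p ≤ Submodule.span k (good p) := by
    intro η hη
    refine mem_of_generators (fun p => Submodule.span k (good p)) ?_ ?_ ?_ hη
    · exact Submodule.subset_span ⟨one_mem_deg n, 0, by simp [lie_one], by simp, by rw [map_one, map_one]; simp⟩
    · intro p l η hη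
      induction hη using Submodule.span_induction with
      | zero => rw [mul_zero]; exact zero_mem _
      | add a b _ _ h h' => rw [mul_add]; exact add_mem h h'
      | smul c a _ h => rw [mul_smul_comm]; exact Submodule.smul_mem _ _ h
      | mem η hη =>
        have e : x l.succ * η = (x l.succ - if l.succ = i then 1 else 0) * η +
            (if l.succ = i then (1 : k) else 0) • η := by
          rw [sub_mul]; split_ifs <;> simp
        rw [e]
        refine add_mem (Submodule.subset_span ?_) (Submodule.smul_mem _ _ (Submodule.subset_span hη))
        obtain ⟨h0, m, h1, h2, h3⟩ := hη
        refine ⟨mul_mem_deg (zero_add p) (sub_mem (x_mem_deg _) ?_) h0, m + 1, ?_, fun _ => ?_,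
          by simp⟩
        · split_ifs
          · exact one_mem_deg n
          · exact zero_mem _
        · have hd : ∀ η : PolyForm k n, lie i ((if l.succ = i then 1 else 0) * η) =
              (if l.succ = i then 1 else 0) * lie i η := fun η => by split_ifs <;> simp
          rw [sub_mul, map_sub, lie_x_mul, hd, h1, ← sub_mul, mul_smul_comm, mul_smul_comm]
          push_cast
          rw [add_smul, one_smul, sub_mul, smul_sub]
          abel
        · rw [map_mul, map_sub, ev_x]
          split_ifs <;> simp
    · intro p l η hη
      induction hη using Submodule.span_induction with
      | zero => rw [mul_zero]; exact zero_mem _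
      | add a b _ _ h h' => rw [mul_add]; exact add_mem h h'
      | smul c a _ h => rw [mul_smul_comm]; exact Submodule.smul_mem _ _ h
      | mem η hη =>
        obtain ⟨h0, m, h1, h2, h3⟩ := hη
        refine Submodule.subset_span ⟨mul_mem_deg (add_comm 1 p) (dx_mem_deg _) h0, m + 1, ?_,
          fun _ => ?_, by simp⟩
        · rw [lie_dx_mul, h1, mul_smul_comm]
          push_cast
          rw [add_smul, one_smul, add_comm]
        · rw [map_mul, ev_dx, zero_mul]
  refine key.trans (Submodule.span_mono ?_)
  rintro η ⟨h0, m, h1, h2, h3⟩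
  refine ⟨h0, ?_⟩
  rcases eq_or_ne m 0 with rfl | hm
  · exact ⟨1, one_ne_zero, by rw [eul_apply, h1, ← h3 rfl]; simp⟩
  · exact ⟨m, Nat.cast_ne_zero.2 hm, by rw [eul_apply, h1, h2 hm, map_zero, add_zero]⟩

/-- The operator is diagonalizable with non-zero eigenvalues. -/
theorem eul_bijective (i : Fin (n + 1)) : Function.Bijective (eul i : PolyForm k n →ₗ[k] _) := by
  have top : ⨆ c ≠ (0 : k), Module.End.eigenspace (eul i : Module.End k (PolyForm k n)) c = ⊤ := by
    rw [eq_top_iff, ← iSup_deg, iSup_le_iff]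
    intro p
    refine (deg_le_span_eigenvectors i p).trans (Submodule.span_le.2 ?_)
    rintro η ⟨-, c, hc, h⟩
    exact Submodule.mem_iSup_of_mem c (Submodule.mem_iSup_of_mem hc
      (Module.End.mem_eigenspace_iff.2 h))
  constructor
  · have hd := (Module.End.eigenspaces_iSupIndep (eul i : Module.End k (PolyForm k n))) 0
    rw [top, disjoint_top, Module.End.eigenspace_zero] at hd
    exact LinearMap.ker_eq_bot.1 hd
  · rw [← LinearMap.range_eq_top, eq_top_iff, ← top]
    refine iSup_le fun c => iSup_le fun hc η hη => ?_
    rw [Module.End.mem_eigenspace_iff] at hη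
    exact ⟨c⁻¹ • η, by rw [map_smul, hη, smul_smul, inv_mul_cancel₀ hc, one_smul]⟩

/-- The inverse of `L + ev`. -/
noncomputable def eulInv (i : Fin (n + 1)) : PolyForm k n →ₗ[k] PolyForm k n :=
  (LinearEquiv.ofBijective (eul i) (eul_bijective i)).symm.toLinearMap

theorem eul_eulInv (i : Fin (n + 1)) (η : PolyForm k n) : eul i (eulInv i η) = η :=
  (LinearEquiv.ofBijective (eul i) (eul_bijective i)).apply_symm_apply η

theorem eulInv_eul (i : Fin (n + 1)) (η : PolyForm k n) : eulInv i (eul i η) = η :=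
  (LinearEquiv.ofBijective (eul i) (eul_bijective i)).symm_apply_apply η

theorem eulInv_mem_deg (i : Fin (n + 1)) {p : ℕ} {η : PolyForm k n} (hη : η ∈ deg k n p) :
    eulInv i η ∈ deg k n p := by
  have h := deg_le_span_eigenvectors i p hη
  induction h using Submodule.span_induction with
  | zero => rw [map_zero]; exact zero_mem _
  | add a b ha hb h h' =>
    have hle : Submodule.span k {η | η ∈ deg k n p ∧ ∃ c : k, c ≠ 0 ∧ eul i η = c • η} ≤
      deg k n p := Submodule.span_le.2 fun η h => h.1
    rw [map_add]; exact add_mem (h (hle ha)) (h' (hle hb))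
  | smul c a ha h =>
    have hle : Submodule.span k {η | η ∈ deg k n p ∧ ∃ c : k, c ≠ 0 ∧ eul i η = c • η} ≤
      deg k n p := Submodule.span_le.2 fun η h => h.1
    rw [map_smul]; exact Submodule.smul_mem _ _ (h (hle ha))
  | mem η h =>
    obtain ⟨h0, c, hc, h⟩ := h
    have : eulInv i η = c⁻¹ • η := by
      have h2 : η = c⁻¹ • eul i η := by rw [h, smul_smul, inv_mul_cancel₀ hc, one_smul]
      conv_lhs => rw [h2]
      rw [map_smul, eulInv_eul]
    rw [this]
    exact Submodule.smul_mem _ _ h0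

/-- The homotopy operator contracting the simplex to its vertex `i`. -/
noncomputable def hop (i : Fin (n + 1)) : PolyForm k n →ₗ[k] PolyForm k n := contr i ∘ₗ eulInv i

theorem hop_apply (i : Fin (n + 1)) (η : PolyForm k n) : hop i η = contr i (eulInv i η) := rfl

theorem hop_mem_deg (i : Fin (n + 1)) {p : ℕ} {η : PolyForm k n} (hη : η ∈ deg k n (p + 1)) :
    hop i η ∈ deg k n p :=
  contr_mem_deg i (eulInv_mem_deg i hη)

theorem hop_eq_zero (i : Fin (n + 1)) {η : PolyForm k n} (hη : η ∈ deg k n 0) : hop i η = 0 :=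
  contr_eq_zero i (eulInv_mem_deg i hη)

omit [CharZero k] in
theorem ev_d (i : Fin (n + 1)) (η : PolyForm k n) : ev k i (d k n η) = 0 := by
  have h : η ∈ ⨆ p, deg k n p := by rw [iSup_deg]; trivial
  induction h using Submodule.iSup_induction' with
  | mem p a ha => exact ev_eq_zero i (d_mem_deg ha)
  | zero => simp
  | add a b _ _ h h' => rw [map_add, map_add, h, h', add_zero]

omit [CharZero k] in
theorem d_algebraMap (c : k) : d k n (algebraMap k _ c) = 0 := by
  rw [Algebra.algebraMap_eq_smul_one, map_smul, d_one, smul_zero]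

theorem eulInv_d (i : Fin (n + 1)) (η : PolyForm k n) :
    eulInv i (d k n η) = d k n (eulInv i η) := by
  rw [← eulInv_eul i (d k n (eulInv i η))]
  congr 1
  conv_lhs => rw [← eul_eulInv i η]
  rw [eul_apply, eul_apply, ev_d, map_zero, map_add, d_algebraMap, lie_apply, lie_apply]
  simp [d_d]

omit [CharZero k] in
theorem ev_contr (i : Fin (n + 1)) (η : PolyForm k n) : ev k i (contr i η) = 0 := by
  have : LinearMap.ker ((ev k i).toLinearMap ∘ₗ contr i : PolyForm k n →ₗ[k] k) = ⊤ := by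
    refine eq_top_of_generators _ ?_ ?_ ?_
    · simp [contr_one]
    · intro l η hη
      simp only [LinearMap.mem_ker, LinearMap.comp_apply, AlgHom.toLinearMap_apply] at hη ⊢
      rw [contr_x_mul, map_mul, hη, mul_zero]
    · intro l η hη
      simp only [LinearMap.mem_ker, LinearMap.comp_apply, AlgHom.toLinearMap_apply] at hη ⊢
      rw [contr_dx_mul, map_sub, map_mul, map_mul, ev_dx, map_sub, ev_x]
      split_ifs <;> simp
  have h := (this ▸ Submodule.mem_top : η ∈ LinearMap.ker ((ev k i).toLinearMap ∘ₗ contr i))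
  exact h

omit [CharZero k] in
theorem ev_lie (i : Fin (n + 1)) (η : PolyForm k n) : ev k i (lie i η) = 0 := by
  rw [lie_apply, map_add, ev_d, ev_contr, add_zero]

theorem ev_eulInv (i : Fin (n + 1)) (η : PolyForm k n) : ev k i (eulInv i η) = ev k i η := by
  conv_rhs => rw [← eul_eulInv i η]
  rw [eul_apply, map_add, ev_lie, zero_add, AlgHom.commutes]
  rfl

/-- The homotopy formula `d h + h d = 1 - ev`. -/
theorem d_hop_add_hop_d (i : Fin (n + 1)) (η : PolyForm k n) :
    d k n (hop i η) + hop i (d k n η) = η - algebraMap k _ (ev k i η) := by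
  rw [hop_apply, hop_apply, eulInv_d, ← lie_apply, eq_sub_iff_add_eq, ← ev_eulInv, ← eul_apply,
    eul_eulInv]

end CharZero

section Naturality

theorem pullback_x (θ : Fin (m + 1) → Fin (n + 1)) (l : Fin (n + 1)) :
    pullback k θ (x l) = ∑ i with θ i = l, x i := by
  have hs : ∀ l : Fin n, pullback k θ (x l.succ) = ∑ i with θ i = l.succ, x i := fun l => by
    simp only [x]
    rw [← TensorProduct.sum_tmul, pullback, Algebra.TensorProduct.map_tmul, map_one]
    simp [bary]
  refine Fin.cases ?_ hs l
  have h := congrArg (pullback k θ) (sum_x (k := k) (n := n))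
  rw [map_sum, map_one, Fin.sum_univ_succ] at h
  have h2 : ∑ l : Fin (n + 1), ∑ i with θ i = l, (x i : PolyForm k m) = 1 := by
    rw [Finset.sum_fiberwise, sum_x]
  rw [Fin.sum_univ_succ] at h2
  simp only [hs] at h
  exact add_right_cancel (h.trans h2.symm)

theorem pullback_dx (θ : Fin (m + 1) → Fin (n + 1)) (l : Fin (n + 1)) :
    pullback k θ (dx l) = ∑ i with θ i = l, dx i := by
  rw [← d_x, pullback_d, pullback_x, map_sum]
  simp only [d_x]

theorem ev_pullback (θ : Fin (m + 1) → Fin (n + 1)) (i : Fin (m + 1)) (η : PolyForm k n) :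
    ev k i (pullback k θ η) = ev k (θ i) η := by
  have : LinearMap.ker ((ev k i).toLinearMap ∘ₗ (pullback k θ).toLinearMap -
      (ev k (θ i)).toLinearMap : PolyForm k n →ₗ[k] k) = ⊤ := by
    refine eq_top_of_generators _ ?_ ?_ ?_
    · simp
    · intro l η hη
      simp only [LinearMap.mem_ker, LinearMap.comp_apply, LinearMap.sub_apply,
        AlgHom.toLinearMap_apply, map_mul] at hη ⊢
      rw [sub_eq_zero] at hη ⊢
      rw [hη, pullback_x, map_sum, ev_x]
      simp only [ev_x]
      congr 1
      simp [eq_comm]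
    · intro l η hη
      simp only [LinearMap.mem_ker, LinearMap.comp_apply, LinearMap.sub_apply,
        AlgHom.toLinearMap_apply, map_mul, pullback_dx, map_sum, ev_dx]
      simp
  have h : η ∈ LinearMap.ker ((ev k i).toLinearMap ∘ₗ (pullback k θ).toLinearMap -
      (ev k (θ i)).toLinearMap : PolyForm k n →ₗ[k] k) := this ▸ Submodule.mem_top
  exact sub_eq_zero.1 h

/-- Affine maps respect the Euler vector fields centred at vertices, so contraction with them is
natural. -/
theorem contr_pullback (θ : Fin (m + 1) → Fin (n + 1)) (i : Fin (m + 1)) (η : PolyForm k n) :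
    contr i (pullback k θ η) = pullback k θ (contr (θ i) η) := by
  have : LinearMap.ker (contr i ∘ₗ (pullback k θ).toLinearMap -
      (pullback k θ).toLinearMap ∘ₗ contr (θ i)) = ⊤ := by
    refine eq_top_of_generators _ ?_ ?_ ?_
    · simp [contr_one]
    · intro l η hη
      simp only [LinearMap.mem_ker, LinearMap.comp_apply, LinearMap.sub_apply,
        AlgHom.toLinearMap_apply] at hη ⊢
      rw [sub_eq_zero] at hη ⊢
      rw [map_mul (pullback k θ), contr_x_mul, map_mul (pullback k θ), ← hη, pullback_x, Finset.sum_mul, map_sum, Finset.sum_mul]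
      simp only [contr_x_mul]
    · intro l η hη
      simp only [LinearMap.mem_ker, LinearMap.comp_apply, LinearMap.sub_apply,
        AlgHom.toLinearMap_apply, map_mul] at hη ⊢
      rw [sub_eq_zero] at hη ⊢
      have hδ : pullback k θ (if l.succ = θ i then 1 else 0) =
          ∑ a with θ a = l.succ, if a = i then 1 else 0 := by
        rw [Finset.sum_ite_eq']
        by_cases h : l.succ = θ i <;> simp [h, eq_comm]
        simp [Ne.symm h]
      rw [contr_dx_mul, map_sub, map_mul (pullback k θ), map_mul (pullback k θ), ← hη, map_sub, pullback_x, pullback_dx, hδ,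
        Finset.sum_mul, map_sum, ← Finset.sum_sub_distrib, Finset.sum_mul, Finset.sum_mul,
        ← Finset.sum_sub_distrib]
      simp only [contr_dx_mul]
  have h : η ∈ LinearMap.ker (contr i ∘ₗ (pullback k θ).toLinearMap -
      (pullback k θ).toLinearMap ∘ₗ contr (θ i)) := this ▸ Submodule.mem_top
  exact sub_eq_zero.1 h

/-- The homotopy operators are natural in the simplex with its chosen vertex. -/
theorem hop_pullback [CharZero k] (θ : Fin (m + 1) → Fin (n + 1)) (i : Fin (m + 1))
    (η : PolyForm k n) : hop i (pullback k θ η) = pullback k θ (hop (θ i) η) := by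
  have h : ∀ η : PolyForm k n, eul i (pullback k θ η) = pullback k θ (eul (θ i) η) := fun η => by
    rw [eul_apply, eul_apply, lie_apply, lie_apply, contr_pullback, ← pullback_d, ← pullback_d,
      contr_pullback, map_add, map_add, ev_pullback, AlgHom.commutes]
  have h2 : eulInv i (pullback k θ η) = pullback k θ (eulInv (θ i) η) := by
    rw [← eulInv_eul i (pullback k θ (eulInv (θ i) η)), h, eul_eulInv]
  rw [hop_apply, hop_apply, h2, contr_pullback]

end Naturality

end PolyForm

/-! ### Cochains on tuples of vertices -/

namespace TupleCochain

open Matrix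

section Delta

variable {k : Type w} [Field k] {V V' : Type*}

/-- The coboundary of a function on `n`-tuples. -/
def delta {n : ℕ} (c : (Fin n → V) → k) (t : Fin (n + 1) → V) : k :=
  ∑ j : Fin (n + 1), (-1 : k) ^ (j : ℕ) * c (t ∘ j.succAbove)

theorem cons_comp_succ_succAbove {n : ℕ} (v : V) (t : Fin (n + 1) → V) (j : Fin (n + 1)) :
    vecCons v t ∘ j.succ.succAbove = vecCons v (t ∘ j.succAbove) := by
  ext i
  refine Fin.cases ?_ (fun i => ?_) i <;> simp

theorem cons_comp_zero_succAbove {n : ℕ} (v : V) (t : Fin n → V) :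
    vecCons v t ∘ (0 : Fin (n + 1)).succAbove = t := by
  ext i
  simp

theorem delta_zero_cons (c : (Fin 0 → V) → k) (v : V) (t : Fin 0 → V) :
    delta c (vecCons v t) = c t := by
  rw [delta, Fin.sum_univ_one]
  simp [Subsingleton.elim _ t]

theorem delta_cons {n : ℕ} (c : (Fin (n + 1) → V) → k) (v : V) (t : Fin (n + 1) → V) :
    delta c (vecCons v t) = c t - delta (fun s => c (vecCons v s)) t := by
  rw [delta, Fin.sum_univ_succ, cons_comp_zero_succAbove, delta, sub_eq_add_neg,
    ← Finset.sum_neg_distrib]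
  simp [cons_comp_succ_succAbove, pow_succ]

theorem vecCons_eta {n : ℕ} (t : Fin (n + 1) → V) : vecCons (t 0) (fun i => t i.succ) = t := by
  ext i
  refine Fin.cases ?_ (fun i => ?_) i <;> simp

theorem comp_vecCons {n : ℕ} (f : V → V') (v : V) (t : Fin n → V) :
    f ∘ vecCons v t = vecCons (f v) (f ∘ t) := by
  ext i
  refine Fin.cases ?_ (fun i => ?_) i <;> simp

/-- A function on tuples is alternating if it changes sign when two adjacent entries are
exchanged. -/
def IsAlt {n : ℕ} (c : (Fin n → V) → k) : Prop :=
  ∀ (t : Fin n → V) (i j : Fin n), (j : ℕ) = i + 1 → c (t ∘ Equiv.swap i j) = -c t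

/-- The coboundary of an alternating function is alternating. -/
theorem IsAlt.delta {n : ℕ} {c : (Fin n → V) → k} (hc : IsAlt c) : IsAlt (delta c) := by
  intro t i j hij
  simp only [TupleCochain.delta]
  rw [← Equiv.sum_comp (Equiv.swap i j) (fun l => (-1 : k) ^ (l : ℕ) * c (t ∘ l.succAbove)),
    ← Finset.sum_neg_distrib]
  refine Finset.sum_congr rfl fun l _ => ?_
  -- deleting one of the two exchanged entries
  have adj : ∀ l l' : Fin (n + 1), ((l = i ∧ l' = j) ∨ (l = j ∧ l' = i)) →
      (Equiv.swap i j : Fin (n + 1) → Fin (n + 1)) ∘ l.succAbove = l'.succAbove := by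
    intro l l' h
    ext a
    simp only [Function.comp_apply, Equiv.swap_apply_def]
    rcases h with ⟨rfl, rfl⟩ | ⟨rfl, rfl⟩ <;>
    · simp only [Fin.succAbove, Fin.lt_def, Fin.ext_iff, Fin.val_castSucc]
      split_ifs <;> simp_all <;> omega
  by_cases hli : l = i
  · subst hli
    rw [Equiv.swap_apply_left, Function.comp_assoc, adj l j (Or.inl ⟨rfl, rfl⟩), hij, pow_succ]
    ring
  by_cases hlj : l = j
  · subst hlj
    rw [Equiv.swap_apply_right, Function.comp_assoc, adj l i (Or.inr ⟨rfl, rfl⟩), hij, pow_succ]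
    ring
  obtain ⟨i', hi'⟩ := Fin.exists_succAbove_eq (Ne.symm hli)
  obtain ⟨j', hj'⟩ := Fin.exists_succAbove_eq (Ne.symm hlj)
  have hij' : (j' : ℕ) = i' + 1 := by
    subst hi' hj'
    simp only [Fin.succAbove, Fin.lt_def, Fin.val_castSucc] at hij hli hlj
    simp only [Fin.ext_iff] at hli hlj
    split_ifs at hij hli hlj <;> simp_all <;> omega
  have hcomp : (Equiv.swap i j : Fin (n + 1) → Fin (n + 1)) ∘ l.succAbove =
      l.succAbove ∘ Equiv.swap i' j' := by
    ext a
    rw [Function.comp_apply, Function.comp_apply, ← hi', ← hj',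
      (Fin.succAbove_right_injective (p := l)).swap_apply]
  rw [Equiv.swap_apply_of_ne_of_ne hli hlj, Function.comp_assoc, hcomp, ← Function.comp_assoc,
    hc _ _ _ hij']
  ring

end Delta

end TupleCochain

/-! ### Integration over tuples of vertices and the homotopy formula -/

namespace PolyForm

open Matrix TupleCochain

variable {k : Type w} [Field k] {n m : ℕ}

/-- The general lemma for `PolyForm`, with its instances already found. -/
theorem neg_smul' (c : k) (η : PolyForm k n) : (-c) • η = -(c • η) := neg_smul c η

section Forms

/-- The form `∑ c_J dt_{j_1} ⋯ dt_{j_p}`. -/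
noncomputable def dform : ∀ p : ℕ, ((Fin p → Fin (n + 1)) → k) → PolyForm k n
  | 0, c => algebraMap k _ (c ![])
  | p + 1, c => ∑ i, dx i * dform p fun J => c (vecCons i J)

/-- The Whitney form `∑ c_J t_{j_0} dt_{j_1} ⋯ dt_{j_p}`. -/
noncomputable def whitney (p : ℕ) (c : (Fin (p + 1) → Fin (n + 1)) → k) : PolyForm k n :=
  ∑ i, x i * dform p fun J => c (vecCons i J)

theorem dform_sub (p : ℕ) (c c' : (Fin p → Fin (n + 1)) → k) :
    dform p (fun J => c J - c' J) = dform p c - dform p c' := by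
  induction p with
  | zero => exact map_sub _ _ _
  | succ p ih =>
    simp only [dform, ← Finset.sum_sub_distrib, ← mul_sub]
    refine Finset.sum_congr rfl fun i _ => ?_
    rw [ih]

theorem dform_zero (p : ℕ) : dform p (fun _ => 0 : (Fin p → Fin (n + 1)) → k) = 0 := by
  have h := dform_sub p (fun _ => 0 : (Fin p → Fin (n + 1)) → k) (fun _ => 0)
  simpa using h

theorem d_dform (p : ℕ) (c : (Fin p → Fin (n + 1)) → k) : d k n (dform p c) = 0 := by
  induction p with
  | zero => exact d_algebraMap _
  | succ p ih => simp [dform, map_sum, d_dx_mul, ih]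

theorem d_whitney (p : ℕ) (c : (Fin (p + 1) → Fin (n + 1)) → k) :
    d k n (whitney p c) = dform (p + 1) c := by
  simp [whitney, dform, map_sum, d_x_mul, d_dform]

/-- The forms `dt_i` sum to zero, so coboundaries give the zero form. -/
theorem dform_delta (p : ℕ) (c : (Fin p → Fin (n + 1)) → k) : dform (p + 1) (delta c) = 0 := by
  induction p with
  | zero =>
    simp only [dform, delta_zero_cons]
    rw [← Finset.sum_mul, sum_dx, zero_mul]
  | succ p ih =>
    rw [dform]
    simp only [delta_cons, dform_sub, ih, sub_zero]
    rw [← Finset.sum_mul, sum_dx, zero_mul]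

/-- The coordinates `t_i` sum to one and their differentials to zero. -/
theorem whitney_delta (p : ℕ) (c : (Fin p → Fin (n + 1)) → k) :
    whitney p (delta c) = dform p c := by
  cases p with
  | zero =>
    simp only [whitney, delta_zero_cons]
    rw [← Finset.sum_mul, sum_x, one_mul]
  | succ p =>
    rw [whitney]
    simp only [delta_cons, dform_sub, dform_delta, sub_zero]
    rw [← Finset.sum_mul, sum_x, one_mul]

theorem dform_mem_deg (p : ℕ) (c : (Fin p → Fin (n + 1)) → k) : dform p c ∈ deg k n p := by
  induction p with
  | zero =>
    rw [dform, Algebra.algebraMap_eq_smul_one]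
    exact Submodule.smul_mem _ _ (one_mem_deg n)
  | succ p ih => exact sum_mem fun i _ => mul_mem_deg (add_comm 1 p) (dx_mem_deg i) (ih _)

theorem whitney_mem_deg (p : ℕ) (c : (Fin (p + 1) → Fin (n + 1)) → k) :
    whitney p c ∈ deg k n p :=
  sum_mem fun i _ => mul_mem_deg (zero_add p) (x_mem_deg i) (dform_mem_deg p _)

theorem pullback_dform (θ : Fin (m + 1) → Fin (n + 1)) (p : ℕ) (c : (Fin p → Fin (n + 1)) → k) :
    pullback k θ (dform p c) = dform p fun J => c (θ ∘ J) := by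
  induction p with
  | zero =>
    rw [dform, dform, AlgHom.commutes]
    congr 2
    exact Subsingleton.elim _ _
  | succ p ih =>
    simp only [dform, map_sum, map_mul, pullback_dx, ih, Finset.sum_mul, comp_vecCons]
    rw [← Finset.sum_fiberwise (g := θ)]
    refine Finset.sum_congr rfl fun l _ => Finset.sum_congr rfl fun i hi => ?_
    rw [(Finset.mem_filter.1 hi).2]

theorem pullback_whitney (θ : Fin (m + 1) → Fin (n + 1)) (p : ℕ)
    (c : (Fin (p + 1) → Fin (n + 1)) → k) :
    pullback k θ (whitney p c) = whitney p fun J => c (θ ∘ J) := by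
  simp only [whitney, map_sum, map_mul, pullback_x, pullback_dform, Finset.sum_mul, comp_vecCons]
  rw [← Finset.sum_fiberwise (g := θ)]
  refine Finset.sum_congr rfl fun l _ => Finset.sum_congr rfl fun i hi => ?_
  rw [(Finset.mem_filter.1 hi).2]

/-- There are no forms of degree larger than the dimension. -/
theorem deg_succ_eq_bot (n : ℕ) : deg k n (n + 1) = ⊥ := by
  have h : ⋀[k]^(n + 1) (Fin n → k) = ⊥ := by
    rw [← Submodule.finrank_eq_zero (R := k), exteriorPower.finrank_eq, Module.finrank_fin_fun,
      Nat.choose_succ_self]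
  rw [deg, Submodule.span_eq_bot]
  rintro _ ⟨f, a, ha, rfl⟩
  rw [h, Submodule.mem_bot] at ha
  rw [ha, TensorProduct.tmul_zero]

end Forms

section Res

variable [CharZero k]

/-- The (normalized) integral of a `p`-form over the affine simplex spanned by a tuple of vertices,
computed by the iterated homotopy operators. -/
noncomputable def res : ∀ p : ℕ, (Fin (p + 1) → Fin (n + 1)) → PolyForm k n →ₗ[k] k
  | 0, I => (ev k (I 0)).toLinearMap
  | p + 1, I => res p (fun j => I j.succ) ∘ₗ hop (I 0)

theorem res_zero (I : Fin 1 → Fin (n + 1)) (η : PolyForm k n) : res 0 I η = ev k (I 0) η := rfl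

theorem res_succ (p : ℕ) (I : Fin (p + 2) → Fin (n + 1)) (η : PolyForm k n) :
    res (p + 1) I η = res p (fun j => I j.succ) (hop (I 0) η) := rfl

theorem res_cons (p : ℕ) (i : Fin (n + 1)) (I : Fin (p + 1) → Fin (n + 1)) (η : PolyForm k n) :
    res (p + 1) (vecCons i I) η = res p I (hop i η) := rfl

theorem res_pullback (θ : Fin (m + 1) → Fin (n + 1)) (p : ℕ) (I : Fin (p + 1) → Fin (m + 1))
    (η : PolyForm k n) : res p I (pullback k θ η) = res p (θ ∘ I) η := by
  induction p generalizing η with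
  | zero => exact ev_pullback _ _ _
  | succ p ih =>
    rw [res_succ, res_succ, hop_pullback, ih]
    rfl

theorem res_eq_zero {p q : ℕ} (h : q ≠ p) (I : Fin (p + 1) → Fin (n + 1)) {η : PolyForm k n}
    (hη : η ∈ deg k n q) : res p I η = 0 := by
  induction p generalizing q η with
  | zero =>
    obtain ⟨q, rfl⟩ := Nat.exists_eq_succ_of_ne_zero h
    exact ev_eq_zero _ hη
  | succ p ih =>
    rw [res_succ]
    cases q with
    | zero => rw [hop_eq_zero _ hη, map_zero]
    | succ q => exact ih (fun h' => h (by rw [h'])) _ (hop_mem_deg _ hη)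

theorem hop_algebraMap (i : Fin (n + 1)) (c : k) : hop i (algebraMap k (PolyForm k n) c) = 0 := by
  rw [Algebra.algebraMap_eq_smul_one, map_smul, hop_eq_zero i (one_mem_deg n), smul_zero]

theorem hop_d (i : Fin (n + 1)) (η : PolyForm k n) :
    hop i (d k n η) = η - algebraMap k _ (ev k i η) - d k n (hop i η) := by
  rw [← d_hop_add_hop_d, add_sub_cancel_left]

/-- Stokes' theorem. -/
theorem res_d (p : ℕ) (I : Fin (p + 2) → Fin (n + 1)) (η : PolyForm k n) :
    res (p + 1) I (d k n η) = delta (fun J => res p J η) I := by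
  induction p generalizing η with
  | zero =>
    rw [← vecCons_eta I, delta_cons, res_cons, hop_d, map_sub, map_sub, res_zero, res_zero,
      res_zero, ev_d, sub_zero, AlgHom.commutes, ← vecCons_eta fun i => I i.succ, delta]
    simp [res_zero]
  | succ p ih =>
    rw [← vecCons_eta I, delta_cons, res_cons, hop_d, map_sub, map_sub, ih]
    simp only [res_cons]
    rw [res_succ _ _ (algebraMap k _ _), hop_algebraMap, map_zero, sub_zero]

/-- Integration is alternating in the vertices. -/
theorem isAlt_res (p : ℕ) (η : PolyForm k n) : IsAlt fun I => res p I η := by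
  induction p generalizing n with
  | zero =>
    intro I i j hij
    omega
  | succ p ih =>
    intro I i j hij
    -- by naturality, only forms on a simplex of dimension `p + 1` have to be considered
    suffices h : ∀ ζ : PolyForm k (p + 1),
        res (p + 1) (Equiv.swap i j) ζ = -res (p + 1) id ζ by
      have h' := h (pullback k I η)
      rw [res_pullback, res_pullback] at h'
      exact h'
    intro ζ
    have hζ : ζ ∈ ⨆ q, deg k (p + 1) q := by rw [iSup_deg]; trivial
    induction hζ using Submodule.iSup_induction' with
    | zero => simp
    | add a b _ _ h h' => rw [map_add, map_add, h, h', neg_add]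
    | mem q ζ hζ =>
      rcases eq_or_ne q (p + 1) with rfl | hq
      · -- a form of top degree is exact
        have hd : d k (p + 1) ζ = 0 := by
          have := d_mem_deg hζ
          rwa [deg_succ_eq_bot, Submodule.mem_bot] at this
        have e := d_hop_add_hop_d 0 ζ
        rw [hd, map_zero, add_zero, ev_eq_zero 0 hζ, map_zero, sub_zero] at e
        rw [← e, res_d, res_d]
        exact (ih (hop 0 ζ)).delta id i j hij
      · rw [res_eq_zero hq _ hζ, res_eq_zero hq _ hζ, neg_zero]

/-- The iterated operator `η ↦ ∑ dt_{i_1} ⋯ dt_{i_k} h_{i_k} ⋯ h_{i_1} η`. -/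
noncomputable def giter : ∀ _ : ℕ, PolyForm k n →ₗ[k] PolyForm k n
  | 0 => LinearMap.id
  | r + 1 => ∑ i, LinearMap.mulLeft k (dx i) ∘ₗ giter r ∘ₗ hop i

/-- The operator `η ↦ ∑ t_{i_0} dt_{i_1} ⋯ dt_{i_k} h_{i_k} ⋯ h_{i_0} η`. -/
noncomputable def biter (r : ℕ) : PolyForm k n →ₗ[k] PolyForm k n :=
  ∑ i, LinearMap.mulLeft k (x i) ∘ₗ giter r ∘ₗ hop i

theorem giter_zero (η : PolyForm k n) : giter 0 η = η := rfl

theorem giter_succ (r : ℕ) (η : PolyForm k n) :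
    giter (r + 1) η = ∑ i, dx i * giter r (hop i η) := by
  simp [giter, LinearMap.sum_apply]

theorem biter_apply (r : ℕ) (η : PolyForm k n) : biter r η = ∑ i, x i * giter r (hop i η) := by
  simp [biter, LinearMap.sum_apply]

theorem giter_pullback (θ : Fin (m + 1) → Fin (n + 1)) (r : ℕ) (η : PolyForm k n) :
    pullback k θ (giter r η) = giter r (pullback k θ η) := by
  induction r generalizing η with
  | zero => rfl
  | succ r ih =>
    simp only [giter_succ, map_sum, map_mul, pullback_dx, ih, Finset.sum_mul, hop_pullback]
    rw [← Finset.sum_fiberwise (g := θ)]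
    refine Finset.sum_congr rfl fun l _ => Finset.sum_congr rfl fun i hi => ?_
    rw [(Finset.mem_filter.1 hi).2]

theorem biter_pullback (θ : Fin (m + 1) → Fin (n + 1)) (r : ℕ) (η : PolyForm k n) :
    pullback k θ (biter r η) = biter r (pullback k θ η) := by
  simp only [biter_apply, map_sum, map_mul, pullback_x, giter_pullback, Finset.sum_mul,
    hop_pullback]
  rw [← Finset.sum_fiberwise (g := θ)]
  refine Finset.sum_congr rfl fun l _ => Finset.sum_congr rfl fun i hi => ?_
  rw [(Finset.mem_filter.1 hi).2]

theorem giter_mem_deg (r : ℕ) {p : ℕ} {η : PolyForm k n} (hη : η ∈ deg k n p) :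
    giter r η ∈ deg k n p := by
  induction r generalizing p η with
  | zero => exact hη
  | succ r ih =>
    rw [giter_succ]
    refine sum_mem fun i _ => ?_
    cases p with
    | zero => rw [hop_eq_zero i hη, map_zero, mul_zero]; exact zero_mem _
    | succ p => exact mul_mem_deg (add_comm 1 p) (dx_mem_deg i) (ih (hop_mem_deg i hη))

theorem biter_mem_deg (r : ℕ) {p : ℕ} {η : PolyForm k n} (hη : η ∈ deg k n (p + 1)) :
    biter r η ∈ deg k n p := by
  rw [biter_apply]
  exact sum_mem fun i _ => mul_mem_deg (zero_add p) (x_mem_deg i)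
    (giter_mem_deg r (hop_mem_deg i hη))

theorem giter_eq_zero {r p : ℕ} (h : p < r) {η : PolyForm k n} (hη : η ∈ deg k n p) :
    giter r η = 0 := by
  induction r generalizing p η with
  | zero => omega
  | succ r ih =>
    rw [giter_succ]
    refine Finset.sum_eq_zero fun i _ => ?_
    cases p with
    | zero => rw [hop_eq_zero i hη, map_zero, mul_zero]
    | succ p => rw [ih (by omega) (hop_mem_deg i hη), mul_zero]

theorem giter_succ_algebraMap (r : ℕ) (c : k) :
    giter (r + 1) (algebraMap k (PolyForm k n) c) = 0 := by
  rw [giter_succ]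
  exact Finset.sum_eq_zero fun i _ => by rw [hop_algebraMap, map_zero, mul_zero]

/-- The commutator of `giter` with the differential: the homotopy formulas of the vertices are
combined, and the terms without a homotopy operator vanish as the `dt_i` sum to zero. -/
theorem giter_succ_d (r : ℕ) (η : PolyForm k n) :
    giter (r + 1) (d k n η) =
      d k n (giter (r + 1) η) - (-1 : k) ^ r • dform (r + 1) fun I => res r I η := by
  induction r generalizing η with
  | zero =>
    rw [giter_succ, giter_succ, map_sum, pow_zero, one_smul, dform, ← Finset.sum_sub_distrib,
      ← sub_eq_zero, ← Finset.sum_sub_distrib]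
    have e : ∀ i : Fin (n + 1), dx i * giter 0 (hop i (d k n η)) - (d k n (dx i * giter 0 (hop i η)) -
        dx i * dform 0 fun J => res 0 (vecCons i J) η) = dx i * η := fun i => by
      rw [giter_zero, giter_zero, hop_d, d_dx_mul, dform, res_zero, cons_val_zero]
      rw [mul_sub, mul_sub]
      abel
    simp only [e]
    rw [← Finset.sum_mul, sum_dx, zero_mul]
  | succ r ih =>
    rw [giter_succ, giter_succ, map_sum, dform, Finset.smul_sum, ← Finset.sum_sub_distrib,
      ← sub_eq_zero, ← Finset.sum_sub_distrib]
    have e : ∀ i : Fin (n + 1), dx i * giter (r + 1) (hop i (d k n η)) -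
        (d k n (dx i * giter (r + 1) (hop i η)) -
        (-1 : k) ^ (r + 1) • (dx i * dform (r + 1) fun J => res (r + 1) (vecCons i J) η)) =
        dx i * giter (r + 1) η := fun i => by
      simp only [res_cons]
      rw [hop_d, map_sub, map_sub, giter_succ_algebraMap, d_dx_mul, ih, mul_sub, mul_sub, mul_sub,
        mul_smul_comm, pow_succ, mul_neg_one, neg_smul', mul_zero]
      abel
    simp only [e]
    rw [← Finset.sum_mul, sum_dx, zero_mul]

/-- One step of the homotopy formula. The sum over `r` with alternating signs telescopes. -/
theorem d_biter_add_biter_d (r : ℕ) (η : PolyForm k n) :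
    d k n (biter r η) + biter r (d k n η) =
      giter r η + giter (r + 1) η - (-1 : k) ^ r • whitney r fun I => res r I η := by
  cases r with
  | zero =>
    rw [biter_apply, biter_apply, giter_succ, pow_zero, one_smul, whitney, map_sum,
      ← Finset.sum_add_distrib]
    have e : ∀ i : Fin (n + 1), d k n (x i * giter 0 (hop i η)) + x i * giter 0 (hop i (d k n η)) =
        x i * η + dx i * giter 0 (hop i η) - x i * dform 0 fun J => res 0 (vecCons i J) η :=
      fun i => by
        rw [giter_zero, giter_zero, hop_d, d_x_mul, dform, res_zero, cons_val_zero, mul_sub, mul_sub]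
        abel
    simp only [e]
    rw [Finset.sum_sub_distrib, Finset.sum_add_distrib, ← Finset.sum_mul, sum_x, one_mul, giter_zero]
  | succ r =>
    rw [biter_apply, biter_apply, giter_succ (r + 1), whitney, map_sum, ← Finset.sum_add_distrib,
      Finset.smul_sum]
    have e : ∀ i : Fin (n + 1), d k n (x i * giter (r + 1) (hop i η)) +
        x i * giter (r + 1) (hop i (d k n η)) =
        x i * giter (r + 1) η + dx i * giter (r + 1) (hop i η) -
          (-1 : k) ^ (r + 1) • (x i * dform (r + 1) fun J => res (r + 1) (vecCons i J) η) :=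
      fun i => by
        simp only [res_cons]
        rw [hop_d, map_sub, map_sub, giter_succ_algebraMap, d_x_mul, giter_succ_d, mul_sub, mul_sub,
          mul_sub, mul_smul_comm, pow_succ, mul_neg_one, neg_smul', mul_zero]
        abel
    simp only [e]
    rw [Finset.sum_sub_distrib, Finset.sum_add_distrib, ← Finset.sum_mul, sum_x, one_mul]

/-- The homotopy operator between a form and the Whitney form of its integrals. -/
noncomputable def sop (p : ℕ) : PolyForm k n →ₗ[k] PolyForm k n :=
  ∑ r ∈ Finset.range p, (-1 : k) ^ r • biter r

theorem sop_apply (p : ℕ) (η : PolyForm k n) :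
    sop p η = ∑ r ∈ Finset.range p, (-1 : k) ^ r • biter r η := by
  simp [sop, LinearMap.sum_apply]

theorem sop_pullback (θ : Fin (m + 1) → Fin (n + 1)) (p : ℕ) (η : PolyForm k n) :
    pullback k θ (sop p η) = sop p (pullback k θ η) := by
  simp only [sop_apply, map_sum, map_smul, biter_pullback]

theorem sop_mem_deg (q : ℕ) {p : ℕ} {η : PolyForm k n} (hη : η ∈ deg k n (p + 1)) :
    sop q η ∈ deg k n p := by
  rw [sop_apply]
  exact sum_mem fun r _ => Submodule.smul_mem _ _ (biter_mem_deg r hη)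

theorem d_sop_add_sop_d (p : ℕ) (η : PolyForm k n) :
    d k n (sop p η) + sop p (d k n η) =
      η - (-1 : k) ^ p • giter p η - ∑ r ∈ Finset.range p, whitney r fun I => res r I η := by
  induction p with
  | zero => simp [sop, giter_zero]
  | succ p ih =>
    have e : ∀ η : PolyForm k n, sop (p + 1) η = sop p η + (-1 : k) ^ p • biter p η := fun η => by
      rw [sop_apply, sop_apply, Finset.sum_range_succ]
    rw [e, e, map_add, add_add_add_comm, ih, map_smul, ← smul_add, d_biter_add_biter_d, smul_sub,
      smul_smul, ← mul_pow, neg_one_mul, neg_neg, one_pow, one_smul, smul_add, pow_succ,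
      mul_neg_one, neg_smul', Finset.sum_range_succ]
    abel

/-- A closed form is cohomologous to the Whitney form of its integrals. -/
theorem eq_d_sop_add_whitney {p : ℕ} {η : PolyForm k n} (hη : η ∈ deg k n p)
    (hd : d k n η = 0) : η = d k n (sop (p + 1) η) + whitney p fun I => res p I η := by
  have h := d_sop_add_sop_d (p + 1) η
  rw [hd, map_zero, add_zero, giter_eq_zero (Nat.lt_succ_self p) hη, smul_zero, sub_zero,
    Finset.sum_range_succ, Finset.sum_eq_zero, zero_add] at h
  · rw [h, sub_add_cancel]
  · intro r hr
    have : (fun I => res r I η) = fun _ => 0 := by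
      ext I
      exact res_eq_zero (by have := Finset.mem_range.1 hr; omega) I hη
    rw [this, whitney]
    exact Finset.sum_eq_zero fun i _ => by rw [dform_zero, mul_zero]

end Res

end PolyForm

/-! ### The triangulation of the cube, dually on cochains -/

namespace TupleCochain

open Matrix

variable {k : Type w} [Field k] {V V' W W' : Type*}

theorem delta_comp {n : ℕ} (c : (Fin n → W) → k) (f : V → W) (t : Fin (n + 1) → V) :
    delta (fun s => c (f ∘ s)) t = delta c (f ∘ t) := rfl

theorem delta_sub {n : ℕ} (c c' : (Fin n → V) → k) (t : Fin (n + 1) → V) :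
    delta (fun s => c s - c' s) t = delta c t - delta c' t := by
  simp only [delta, mul_sub, Finset.sum_sub_distrib]

/-- The dual prism operator for two maps `i₀, i₁ : V → W` on vertices: the value on
`(v_0, …, v_{n-1})` is `∑ (-1)^j U(i₀ v_0, …, i₀ v_j, i₁ v_j, …, i₁ v_{n-1})`. -/
def prism (i₀ i₁ : V → W) : ∀ {n : ℕ}, ((Fin (n + 1) → W) → k) → (Fin n → V) → k
  | 0, _, _ => 0
  | _ + 1, U, t => U (vecCons (i₀ (t 0)) (i₁ ∘ t)) -
      prism i₀ i₁ (fun s => U (vecCons (i₀ (t 0)) s)) fun j => t j.succ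

theorem prism_zero (i₀ i₁ : V → W) (U : (Fin 1 → W) → k) (t : Fin 0 → V) :
    prism i₀ i₁ U t = 0 := rfl

theorem prism_cons (i₀ i₁ : V → W) {n : ℕ} (U : (Fin (n + 2) → W) → k) (v : V) (t : Fin n → V) :
    prism i₀ i₁ U (vecCons v t) = U (vecCons (i₀ v) (vecCons (i₁ v) (i₁ ∘ t))) -
      prism i₀ i₁ (fun s => U (vecCons (i₀ v) s)) t := by
  rw [← comp_vecCons]
  rfl

theorem prism_add_mul (i₀ i₁ : V → W) {n : ℕ} (r : k) (U U' : (Fin (n + 1) → W) → k)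
    (t : Fin n → V) :
    prism i₀ i₁ (fun s => U s + r * U' s) t = prism i₀ i₁ U t + r * prism i₀ i₁ U' t := by
  induction n with
  | zero => simp [prism_zero]
  | succ n ih =>
    rw [← vecCons_eta t, prism_cons, prism_cons, prism_cons, ih]
    ring

theorem prism_sub (i₀ i₁ : V → W) {n : ℕ} (U U' : (Fin (n + 1) → W) → k) (t : Fin n → V) :
    prism i₀ i₁ (fun s => U s - U' s) t = prism i₀ i₁ U t - prism i₀ i₁ U' t := by
  simpa [sub_eq_add_neg] using prism_add_mul i₀ i₁ (-1) U U' t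

theorem prism_fun_zero (i₀ i₁ : V → W) {n : ℕ} (t : Fin n → V) :
    prism i₀ i₁ (fun _ => 0 : (Fin (n + 1) → W) → k) t = 0 := by
  have h := prism_sub i₀ i₁ (fun _ => 0 : (Fin (n + 1) → W) → k) (fun _ => 0) t
  simpa using h

theorem prism_comp_left (i₀ i₁ : V → W) (f : W → W') {n : ℕ} (U : (Fin (n + 1) → W') → k)
    (t : Fin n → V) : prism i₀ i₁ (fun s => U (f ∘ s)) t = prism (f ∘ i₀) (f ∘ i₁) U t := by
  induction n with
  | zero => rfl
  | succ n ih =>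
    rw [← vecCons_eta t, prism_cons, prism_cons]
    simp only [comp_vecCons]
    rw [ih fun s => U (vecCons (f (i₀ (t 0))) s)]
    rfl

theorem prism_comp_right (i₀ i₁ : V → W) (f : V' → V) {n : ℕ} (U : (Fin (n + 1) → W) → k)
    (t : Fin n → V') : prism i₀ i₁ U (f ∘ t) = prism (i₀ ∘ f) (i₁ ∘ f) U t := by
  induction n with
  | zero => rfl
  | succ n ih =>
    rw [← vecCons_eta t, comp_vecCons, prism_cons, prism_cons, ih]
    rfl

/-- The homotopy formula for the prism operator. -/
theorem prism_delta (i₀ i₁ : V → W) {n : ℕ} (U : (Fin (n + 1) → W) → k) (t : Fin (n + 1) → V) :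
    prism i₀ i₁ (delta U) t = U (i₁ ∘ t) - U (i₀ ∘ t) - delta (prism i₀ i₁ U) t := by
  induction n with
  | zero =>
    have h : delta (prism i₀ i₁ U) t = 0 := by simp [delta, prism_zero]
    rw [h, ← vecCons_eta t, prism_cons, prism_zero, delta_cons, comp_vecCons, comp_vecCons,
      delta_zero_cons]
    have e : ∀ s s' : Fin 0 → W, s = s' := fun s s' => Subsingleton.elim _ _
    rw [e (i₁ ∘ fun i => t i.succ) (i₀ ∘ fun i => t i.succ)]
  | succ n ih =>
    rw [← vecCons_eta t]
    set v := t 0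
    set τ : Fin (n + 1) → V := fun j => t j.succ
    rw [prism_cons, delta_cons, delta_cons, delta_cons]
    simp only [delta_cons, prism_cons]
    rw [prism_sub, ih, delta_sub, comp_vecCons, comp_vecCons,
      delta_comp (fun s => U (vecCons (i₀ v) (vecCons (i₁ v) s)))]
    ring

/-- A function on tuples is normalized if it vanishes on the tuples with two equal adjacent
entries. -/
def IsNormalized {n : ℕ} (U : (Fin n → V) → k) : Prop :=
  ∀ (t : Fin n → V) (i j : Fin n), (j : ℕ) = i + 1 → t i = t j → U t = 0

theorem IsNormalized.cons {n : ℕ} {U : (Fin (n + 1) → V) → k} (hU : IsNormalized U) (v : V) :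
    IsNormalized fun s => U (vecCons v s) := fun t i j hij h =>
  hU _ i.succ j.succ (by simp [hij]) (by simpa using h)

theorem IsNormalized.cons_cons {n : ℕ} {U : (Fin (n + 2) → V) → k} (hU : IsNormalized U) (v : V)
    (s : Fin n → V) : U (vecCons v (vecCons v s)) = 0 :=
  hU _ 0 1 rfl rfl

/-- The prism operator preserves normalized functions. -/
theorem IsNormalized.prism {n : ℕ} {U : (Fin (n + 1) → W) → k} (hU : IsNormalized U)
    (i₀ i₁ : V → W) : IsNormalized (prism i₀ i₁ U) := by
  induction n with
  | zero => exact fun t i => i.elim0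
  | succ n ih =>
    intro t i j hij h
    rw [← vecCons_eta t, prism_cons, ← comp_vecCons, vecCons_eta]
    have h1 : U (vecCons (i₀ (t 0)) (i₁ ∘ t)) = 0 :=
      hU _ i.succ j.succ (by simp [hij]) (by simp [h])
    rw [h1, zero_sub, neg_eq_zero]
    rcases Fin.eq_zero_or_eq_succ i with rfl | ⟨i, rfl⟩
    · -- the tuple starts with two equal entries
      obtain ⟨n, rfl⟩ : ∃ m, n = m + 1 := ⟨n - 1, by have := j.2; simp at hij; omega⟩
      obtain rfl : j = 1 := Fin.ext (by simpa using hij)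
      rw [← vecCons_eta (fun j : Fin (n + 1) => t j.succ), prism_cons]
      have e : t (Fin.succ 0) = t 0 := h.symm
      simp only [e]
      rw [hU.cons_cons]
      have : (fun s => U (vecCons (i₀ (t 0)) (vecCons (i₀ (t 0)) s))) = fun _ => 0 := by
        ext s; exact hU.cons_cons _ _
      rw [this, prism_fun_zero, sub_zero]
    · obtain ⟨j, rfl⟩ : ∃ j', j = Fin.succ j' := by
        rcases Fin.eq_zero_or_eq_succ j with rfl | h
        · simp at hij
        · exact h
      exact ih (hU.cons _) _ i j (by simpa using hij) h

/-- The prism of a constant homotopy is degenerate. -/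
theorem IsNormalized.prism_self {n : ℕ} {U : (Fin (n + 1) → W) → k} (hU : IsNormalized U)
    (f : V → W) (t : Fin n → V) : TupleCochain.prism f f U t = 0 := by
  induction n with
  | zero => rfl
  | succ n ih => rw [← vecCons_eta t, prism_cons, hU.cons_cons, ih (hU.cons _), sub_zero]

/-- For monotone maps, the prism operator on monotone tuples only evaluates functions at monotone
tuples. The lower bound `w` carries the entries already consumed through the recursion. -/
theorem prism_congr [PartialOrder V] [PartialOrder W] {i₀ i₁ : V → W} (h0 : Monotone i₀)
    (h1 : Monotone i₁) (h01 : ∀ v, i₀ v ≤ i₁ v) {n : ℕ} {U U' : (Fin (n + 1) → W) → k} (w : W)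
    (hU : ∀ s, Monotone s → (∀ i, w ≤ s i) → U s = U' s) (t : Fin n → V) (ht : Monotone t)
    (hw : ∀ i, w ≤ i₀ (t i)) : prism i₀ i₁ U t = prism i₀ i₁ U' t := by
  have mono : ∀ {n : ℕ} {w : W} {s : Fin n → W}, Monotone s → (∀ i, w ≤ s i) →
      Monotone (vecCons w s) := fun {n w s} hs hw i j hij => by
    rcases Fin.eq_zero_or_eq_succ i with rfl | ⟨i, rfl⟩
    · rcases Fin.eq_zero_or_eq_succ j with rfl | ⟨j, rfl⟩
      · exact le_rfl
      · simpa using hw j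
    · rcases Fin.eq_zero_or_eq_succ j with rfl | ⟨j, rfl⟩
      · exact absurd hij (by simp)
      · simpa using hs (Fin.succ_le_succ_iff.1 hij)
  induction n generalizing w with
  | zero => rfl
  | succ n ih =>
    have ht0 : ∀ i, i₀ (t 0) ≤ i₀ (t i) := fun i => h0 (ht (Fin.zero_le i))
    rw [← vecCons_eta t, prism_cons, prism_cons, ← comp_vecCons, vecCons_eta]
    congr 1
    · refine hU _ (mono (h1.comp ht) fun i => (ht0 i).trans (h01 _)) fun i => ?_
      refine Fin.cases (hw 0) (fun i => ?_) i
      exact (hw i).trans (h01 _)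
    · refine ih (i₀ (t 0)) (fun s hs hs' => hU _ (mono hs hs') fun i => ?_) _
        (fun i j hij => ht (Fin.succ_le_succ_iff.2 hij)) fun i => ht0 _
      refine Fin.cases (hw 0) (fun i => ?_) i
      exact (hw 0).trans (hs' i)

/-- Evaluation of a cochain on the fundamental chain of the triangulated cube, whose simplices are
the maximal chains of vertices in `{0, 1}^N`, with signs. -/
def cubeInt : ∀ N : ℕ, ((Fin (N + 1) → Fin N → Bool) → k) → k
  | 0, U => U fun _ => ![]
  | N + 1, U => cubeInt N (prism (vecCons false) (vecCons true) U)

theorem cubeInt_add_mul (N : ℕ) (r : k) (U U' : (Fin (N + 1) → Fin N → Bool) → k) :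
    cubeInt N (fun s => U s + r * U' s) = cubeInt N U + r * cubeInt N U' := by
  induction N with
  | zero => rfl
  | succ N ih =>
    simp only [cubeInt, ← ih]
    congr 1
    ext t
    exact prism_add_mul _ _ _ _ _ _

theorem cubeInt_sub (N : ℕ) (U U' : (Fin (N + 1) → Fin N → Bool) → k) :
    cubeInt N (fun s => U s - U' s) = cubeInt N U - cubeInt N U' := by
  simpa [sub_eq_add_neg] using cubeInt_add_mul N (-1) U U'

theorem cubeInt_zero (N : ℕ) : cubeInt N (fun _ => 0 : (Fin (N + 1) → Fin N → Bool) → k) = 0 := by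
  have h := cubeInt_sub N (fun _ => 0 : (Fin (N + 1) → Fin N → Bool) → k) (fun _ => 0)
  simpa using h

theorem insertNth_zero_eq {N : ℕ} (b : Bool) :
    (fun v : Fin N → Bool => (Fin.insertNth (0 : Fin (N + 1)) b v : Fin (N + 1) → Bool)) =
      vecCons b := by
  ext v i
  refine Fin.cases ?_ (fun i => ?_) i <;> simp

theorem insertNth_succ_cons {N : ℕ} (j : Fin (N + 1)) (b c : Bool) (v : Fin N → Bool) :
    (Fin.insertNth j.succ b (vecCons c v) : Fin (N + 2) → Bool) =
      vecCons c (Fin.insertNth j b v : Fin (N + 1) → Bool) := by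
  rw [Fin.insertNth_eq_iff]
  refine ⟨by simp, ?_⟩
  ext i
  refine Fin.cases ?_ (fun i => ?_) i <;> simp [Fin.removeNth]

/-- The boundary of the fundamental chain of the cube. -/
theorem cubeInt_delta (N : ℕ) (U : (Fin (N + 1) → Fin (N + 1) → Bool) → k) :
    cubeInt (N + 1) (delta U) = ∑ j : Fin (N + 1), (-1 : k) ^ (j : ℕ) *
      (cubeInt N (fun t => U ((fun v => Fin.insertNth j true v) ∘ t)) -
        cubeInt N (fun t => U ((fun v => Fin.insertNth j false v) ∘ t))) := by
  induction N with
  | zero =>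
    rw [Fin.sum_univ_one, insertNth_zero_eq, insertNth_zero_eq]
    simp only [cubeInt]
    rw [prism_delta, delta]
    simp [prism_zero]
  | succ N ih =>
    have e : cubeInt (N + 2) (delta U) =
        cubeInt (N + 1) (fun t => U (vecCons true ∘ t)) -
          cubeInt (N + 1) (fun t => U (vecCons false ∘ t)) -
          cubeInt (N + 1) (delta (prism (vecCons false) (vecCons true) U)) := by
      rw [← cubeInt_sub, ← cubeInt_sub]
      conv_lhs => rw [cubeInt]
      congr 1
      ext t
      exact prism_delta _ _ _ _
    conv_rhs => rw [Fin.sum_univ_succ, insertNth_zero_eq, insertNth_zero_eq]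
    rw [e, ih, sub_eq_add_neg, ← Finset.sum_neg_distrib]
    simp only [Fin.val_zero, pow_zero, one_mul]
    congr 1
    refine Finset.sum_congr rfl fun j _ => ?_
    have e2 : ∀ b : Bool, cubeInt (N + 1)
        (fun t => U ((fun v => (Fin.insertNth j.succ b v : Fin (N + 2) → Bool)) ∘ t)) =
        cubeInt N (fun t => prism (vecCons false) (vecCons true) U
          ((fun v => (Fin.insertNth j b v : Fin (N + 1) → Bool)) ∘ t)) := fun b => by
      conv_lhs => rw [cubeInt]
      congr 1
      ext t
      rw [prism_comp_left, prism_comp_right]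
      congr 1 <;> ext v : 1 <;> exact insertNth_succ_cons j b _ v
    rw [e2, e2, Fin.val_succ, pow_succ]
    ring

/-- Normalized cochains which do not depend on one coordinate vanish on the fundamental chain. -/
theorem cubeInt_comp_removeNth (N : ℕ) (j : Fin (N + 1)) {U : (Fin (N + 2) → Fin N → Bool) → k}
    (hU : IsNormalized U) :
    cubeInt (N + 1) (fun t => U ((fun v : Fin (N + 1) → Bool => v ∘ j.succAbove) ∘ t)) = 0 := by
  induction N with
  | zero =>
    conv_lhs => rw [cubeInt]
    rw [← cubeInt_zero (k := k) 0]
    congr 1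
    ext t
    rw [prism_comp_left]
    convert hU.prism_self _ t using 2
  | succ N ih =>
    rcases Fin.eq_zero_or_eq_succ j with rfl | ⟨j, rfl⟩
    · conv_lhs => rw [cubeInt]
      rw [← cubeInt_zero (k := k) (N + 1)]
      congr 1
      ext t
      rw [prism_comp_left]
      convert hU.prism_self id t using 2 <;> ext v : 1 <;> exact cons_comp_zero_succAbove _ v
    · rw [← ih j (hU.prism (vecCons false) (vecCons true))]
      conv_lhs => rw [cubeInt]
      congr 1
      ext t
      rw [prism_comp_left, prism_comp_right]
      congr 1 <;> ext v : 1 <;> exact cons_comp_succ_succAbove _ v j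

/-- All simplices of the triangulated cube have monotone vertices. -/
theorem cubeInt_congr (N : ℕ) {U U' : (Fin (N + 1) → Fin N → Bool) → k}
    (h : ∀ t, Monotone t → U t = U' t) : cubeInt N U = cubeInt N U' := by
  have hcons : ∀ {N : ℕ} (b : Bool), Monotone (vecCons b : (Fin N → Bool) → Fin (N + 1) → Bool) :=
    fun b v v' hv i => by
      refine Fin.cases le_rfl (fun i => ?_) i
      simpa using hv i
  induction N with
  | zero => exact h _ fun _ _ _ => le_rfl
  | succ N ih =>
    refine ih fun t ht => prism_congr (hcons false) (hcons true) (fun v i => ?_)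
      (fun _ => false) (fun s hs _ => h s hs) t ht fun i j => Bool.false_le _
    refine Fin.cases ?_ (fun i => ?_) i
    · exact Bool.false_le _
    · exact le_rfl

/-- The number of leading ones of a vertex of the cube. -/
def lead : ∀ {N : ℕ}, (Fin N → Bool) → Fin (N + 1)
  | 0, _ => 0
  | _ + 1, v => if v 0 then (lead fun i => v i.succ).succ else 0

theorem lead_cons_false {N : ℕ} (v : Fin N → Bool) : lead (vecCons false v) = 0 := by
  simp [lead]

/-- On vertices, the collapse of the cube onto the simplex counts leading ones. It maps one simplex
of the triangulation onto the standard simplex and all others to degenerate simplices. -/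
theorem cubeInt_lead (N : ℕ) (e : Fin (N + 1) → W) {c : (Fin (N + 1) → W) → k}
    (hc : IsNormalized c) : cubeInt N (fun t => c (e ∘ lead ∘ t)) = c e := by
  induction N with
  | zero =>
    rw [cubeInt]
    congr 1
    ext i
    rw [Subsingleton.elim (α := Fin 1) i 0]
    rfl
  | succ N ih =>
    have h := ih (fun i => e i.succ) (hc.cons (e 0))
    rw [vecCons_eta] at h
    rw [← h]
    conv_lhs => rw [cubeInt]
    congr 1
    ext t
    rw [← vecCons_eta t, prism_cons]
    have h0 : (fun s => c (e ∘ lead ∘ vecCons (vecCons false (t 0)) s)) =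
        fun s => c (vecCons (e 0) (e ∘ lead ∘ s)) := by
      ext s
      rw [comp_vecCons, comp_vecCons, lead_cons_false]
    have h2 : (prism (vecCons false) (vecCons true) (fun s => c (vecCons (e 0) (e ∘ lead ∘ s)))
        fun j => t j.succ) = prism ((e ∘ lead) ∘ vecCons false) ((e ∘ lead) ∘ vecCons true)
          (fun s => c (vecCons (e 0) s)) fun j => t j.succ :=
      prism_comp_left (vecCons false) (vecCons true) (e ∘ lead) (fun s => c (vecCons (e 0) s)) _
    rw [h0, h2]
    have h1 : ∀ (n : ℕ) (U : (Fin (n + 1) → W) → k), (∀ s, U (vecCons (e 0) s) = 0) →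
        ∀ t : Fin n → Fin N → Bool,
        prism ((e ∘ lead) ∘ vecCons false) ((e ∘ lead) ∘ vecCons true) U t = 0 := by
      intro n U hU t
      cases n with
      | zero => rfl
      | succ n =>
        have e0 : ∀ v : Fin N → Bool, ((e ∘ lead) ∘ vecCons false) v = e 0 := fun v => by
          simp only [Function.comp_apply, lead_cons_false]
        rw [← vecCons_eta t, prism_cons, e0, hU]
        simp only [hU]
        rw [prism_fun_zero, sub_zero]
    rw [h1 _ _ (fun s => hc.cons_cons _ _), sub_zero, ← comp_vecCons, vecCons_eta, comp_vecCons,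
      comp_vecCons, lead_cons_false]
    congr 2

theorem le_lead_iff {N : ℕ} (v : Fin N → Bool) (r : ℕ) (hr : r ≤ N) :
    r ≤ (lead v : ℕ) ↔ ∀ i : Fin N, (i : ℕ) < r → v i = true := by
  induction N generalizing r with
  | zero => simp [Nat.le_zero.1 hr]
  | succ N ih =>
    cases r with
    | zero => simp
    | succ r =>
      rw [lead, Fin.forall_fin_succ]
      by_cases h : v 0 = true
      · simp [h, ih (fun i => v i.succ) r (by omega)]
      · simp [h]

end TupleCochain

/-! ### Simplices in cubes and cubes in simplices -/

namespace Cubical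

open scoped unitInterval
open TupleCochain

theorem val_succAbove {n : ℕ} (j : Fin (n + 1)) (a : Fin n) :
    (j.succAbove a : ℕ) = if (a : ℕ) < j then (a : ℕ) else a + 1 := by
  rw [Fin.succAbove]
  by_cases h : (a : ℕ) < j
  · rw [if_pos (by exact h), if_pos h]; rfl
  · rw [if_neg (by exact h), if_neg h]; rfl

section Maps

variable {ι κ : Type} [Fintype ι] [Fintype κ]

/-- The map of standard simplices which is affine and given by a map on the vertices. -/
noncomputable def smap (θ : ι → κ) : C(stdSimplex ℝ ι, stdSimplex ℝ κ) :=
  ⟨stdSimplex.map θ, stdSimplex.continuous_map θ⟩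

theorem smap_apply [DecidableEq κ] (θ : ι → κ) (y : stdSimplex ℝ ι) (b : κ) :
    smap θ y b = ∑ a, if θ a = b then y a else 0 := by
  change stdSimplex.map θ y b = _
  rw [stdSimplex.map_coe, FunOnFinite.linearMap_apply_apply, Finset.sum_filter]

theorem smap_comp {ι' : Type} [Fintype ι'] (θ : κ → ι') (θ' : ι → κ) :
    (smap θ).comp (smap θ') = smap (θ ∘ θ') := by
  ext1 y
  exact (stdSimplex.map_comp_apply θ' θ y)

theorem sum_smap (θ : ι → κ) (y : stdSimplex ℝ ι) (p : κ → Prop) [DecidablePred p] :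
    ∑ b, (if p b then smap θ y b else 0) = ∑ a, if p (θ a) then y a else 0 := by
  classical
  simp only [smap_apply, ← Finset.sum_filter]
  rw [Finset.sum_comm' (t' := Finset.univ.filter fun a => p (θ a)) (s' := fun a => {θ a})]
  · simp
  · intro b a
    simp only [Finset.mem_filter, Finset.mem_univ, true_and, Finset.mem_singleton]
    constructor
    · rintro ⟨h, rfl⟩; exact ⟨rfl, h⟩
    · rintro ⟨rfl, h⟩; exact ⟨h, rfl⟩

theorem sum_ite_nonneg (y : stdSimplex ℝ ι) (p : ι → Prop) [DecidablePred p] :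
    0 ≤ ∑ a, if p a then y a else 0 :=
  Finset.sum_nonneg fun a _ => by split_ifs; exacts [stdSimplex.zero_le y a, le_rfl]

theorem sum_ite_le (y : stdSimplex ℝ ι) {p q : ι → Prop} [DecidablePred p] [DecidablePred q]
    (h : ∀ a, p a → q a) :
    (∑ a, if p a then y a else 0) ≤ ∑ a, if q a then y a else 0 :=
  Finset.sum_le_sum fun a _ => by
    have := stdSimplex.zero_le y a
    split_ifs with h1 h2
    · exact le_rfl
    · exact absurd (h a h1) h2
    · exact this
    · exact le_rfl

theorem sum_ite_le_one (y : stdSimplex ℝ ι) (p : ι → Prop) [DecidablePred p] :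
    (∑ a, if p a then y a else 0) ≤ 1 := by
  rw [← stdSimplex.sum_eq_one y]
  exact Finset.sum_le_sum fun a _ => by
    split_ifs; exacts [le_rfl, stdSimplex.zero_le y a]

theorem continuous_sum_ite (p : ι → Prop) [DecidablePred p] :
    Continuous fun y : stdSimplex ℝ ι => ∑ a, if p a then y a else 0 := by
  refine continuous_finsetSum _ fun a _ => ?_
  split_ifs
  · exact (continuous_apply a).comp continuous_subtype_val
  · exact continuous_const

/-- The affine map from the standard simplex to the cube which is given by a tuple of vertices of
the cube. -/
noncomputable def aff {N : ℕ} (t : ι → Fin N → Bool) : C(stdSimplex ℝ ι, Fin N → I) :=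
  ⟨fun y i => ⟨∑ a, if t a i = true then y a else 0, sum_ite_nonneg y _, sum_ite_le_one y _⟩,
    continuous_pi fun _ => (continuous_sum_ite _).subtype_mk _⟩

theorem coe_aff {N : ℕ} (t : ι → Fin N → Bool) (y : stdSimplex ℝ ι) (i : Fin N) :
    (aff t y i : ℝ) = ∑ a, if t a i = true then y a else 0 := rfl

theorem aff_comp_smap {N : ℕ} (t : κ → Fin N → Bool) (θ : ι → κ) :
    (aff t).comp (smap θ) = aff (t ∘ θ) := by
  ext y i
  exact sum_smap θ y fun b => t b i = true

theorem face_comp_aff {N : ℕ} (j : Fin (N + 1)) (t : ι → Fin N → Bool) (b : Bool) :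
    (face j (if b then 1 else 0)).comp (aff t) = aff ((fun v => Fin.insertNth j b v) ∘ t) := by
  ext1 y
  symm
  refine eq_face_iff.2 ⟨?_, fun i => ?_⟩
  · ext
    rw [coe_aff]
    cases b
    · simp
    · simp only [Function.comp_apply, Fin.insertNth_apply_same, if_true]
      exact stdSimplex.sum_eq_one y
  · ext
    rw [coe_aff]
    simp [coe_aff]

end Maps

/-- The sum of the barycentric coordinates of index at least `r`. -/
noncomputable def tail {N : ℕ} (y : stdSimplex ℝ (Fin N)) (r : ℕ) : ℝ :=
  ∑ a : Fin N, if r ≤ (a : ℕ) then y a else 0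

theorem tail_zero {N : ℕ} (y : stdSimplex ℝ (Fin N)) : tail y 0 = 1 := by
  simp [tail, stdSimplex.sum_eq_one y]

theorem tail_of_le {N : ℕ} (y : stdSimplex ℝ (Fin N)) {r : ℕ} (hr : N ≤ r) : tail y r = 0 :=
  Finset.sum_eq_zero fun a _ => if_neg (by omega)

theorem tail_sub_tail {N : ℕ} (y : stdSimplex ℝ (Fin N)) (i : Fin N) :
    tail y i - tail y (i + 1) = y i := by
  rw [tail, tail, ← Finset.sum_sub_distrib, Finset.sum_eq_single i]
  · simp
  · intro a _ ha
    have : (a : ℕ) ≠ i := fun h => ha (Fin.ext h)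
    by_cases h : (i : ℕ) ≤ a
    · rw [if_pos h, if_pos (by omega), sub_self]
    · rw [if_neg h, if_neg (by omega), sub_self]
  · simp

/-- A point of the simplex is determined by the sums of its last coordinates. -/
theorem ext_tail {N : ℕ} {y y' : stdSimplex ℝ (Fin N)} (h : ∀ r, tail y r = tail y' r) :
    y = y' := by
  refine stdSimplex.ext (funext fun i => ?_)
  rw [← tail_sub_tail, ← tail_sub_tail, h, h]

theorem tail_smap {N N' : ℕ} (θ : Fin N → Fin N') (y : stdSimplex ℝ (Fin N)) (r : ℕ) :
    tail (smap θ y) r = ∑ a, if r ≤ (θ a : ℕ) then y a else 0 :=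
  sum_smap θ y fun b => r ≤ (b : ℕ)

/-- The coordinates of a point of the cube, extended by zero. -/
noncomputable def coord {N : ℕ} (x : Fin N → I) (r : ℕ) : ℝ := if h : r < N then x ⟨r, h⟩ else 0

theorem coord_nonneg {N : ℕ} (x : Fin N → I) (r : ℕ) : 0 ≤ coord x r := by
  rw [coord]; split_ifs; exacts [(x _).2.1, le_rfl]

theorem coord_face {N : ℕ} (j : Fin (N + 1)) (e : I) (x : Fin N → I) (r : ℕ) :
    coord (face j e x) r = if r < j then coord x r else if r = j then (e : ℝ) else
      coord x (r - 1) := by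
  by_cases hr : r < N + 1
  · rw [coord, dif_pos hr]
    have key : ∀ i : Fin (N + 1), ((face j e x i : I) : ℝ) = if (i : ℕ) < j then coord x i else
        if (i : ℕ) = j then (e : ℝ) else coord x (i - 1) := fun i => by
      induction i using Fin.succAboveCases j with
      | x => simp
      | p i =>
        rw [face_apply_succAbove]
        rcases lt_or_ge i.castSucc j with h | h
        · rw [Fin.succAbove_of_castSucc_lt _ _ h]
          rw [if_pos (by simpa [Fin.lt_def] using h), coord, dif_pos (by simp)]
          simp
        · rw [Fin.succAbove_of_le_castSucc _ _ h]
          have h' : (j : ℕ) ≤ i := h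
          rw [if_neg (by simp; omega), if_neg (by simp; omega), coord, dif_pos (by simp)]
          simp
    exact key ⟨r, hr⟩
  · rw [coord, dif_neg hr, if_neg (by omega), if_neg (by omega), coord, dif_neg (by omega)]

/-- The minimum of `1` and of the first `r` coordinates. -/
noncomputable def runMin {N : ℕ} (x : Fin N → I) : ℕ → ℝ
  | 0 => 1
  | r + 1 => min (runMin x r) (coord x r)

theorem runMin_nonneg {N : ℕ} (x : Fin N → I) : ∀ r, 0 ≤ runMin x r
  | 0 => zero_le_one
  | r + 1 => le_min (runMin_nonneg x r) (coord_nonneg x r)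

theorem runMin_le_one {N : ℕ} (x : Fin N → I) : ∀ r, runMin x r ≤ 1
  | 0 => le_rfl
  | r + 1 => (min_le_left _ _).trans (runMin_le_one x r)

theorem runMin_of_lt {N : ℕ} (x : Fin N → I) {r : ℕ} (hr : N < r) : runMin x r = 0 := by
  obtain ⟨r, rfl⟩ : ∃ s, r = s + 1 := ⟨r - 1, by omega⟩
  have : coord x r = 0 := dif_neg (by omega)
  rw [runMin, this, min_eq_right (runMin_nonneg x r)]

theorem continuous_runMin {N : ℕ} (r : ℕ) : Continuous fun x : Fin N → I => runMin x r := by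
  induction r with
  | zero => exact continuous_const
  | succ r ih =>
    refine ih.min ?_
    unfold coord
    split_ifs
    · fun_prop
    · exact continuous_const

theorem runMin_congr {N N' : ℕ} {x : Fin N → I} {x' : Fin N' → I} {r : ℕ}
    (h : ∀ i < r, coord x i = coord x' i) : runMin x r = runMin x' r := by
  induction r with
  | zero => rfl
  | succ r ih => rw [runMin, runMin, ih fun i hi => h i (by omega), h r (by omega)]

/-- The map from the cube to the simplex which collapses the faces `x_j = 0`: the sums of the last
barycentric coordinates are the running minima of the coordinates of the cube. -/
noncomputable def collapse (N : ℕ) : C(Fin N → I, stdSimplex ℝ (Fin (N + 1))) :=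
  ⟨fun x => ⟨fun i => runMin x i - runMin x (i + 1),
      fun i => sub_nonneg.2 (min_le_left _ _), by
        rw [Fin.sum_univ_eq_sum_range (fun r => runMin x r - runMin x (r + 1)),
          Finset.sum_range_sub', runMin_of_lt x (Nat.lt_succ_self N), sub_zero]
        rfl⟩,
    (continuous_pi fun i => (continuous_runMin _).sub (continuous_runMin _)).subtype_mk _⟩

theorem tail_collapse {N : ℕ} (x : Fin N → I) (r : ℕ) : tail (collapse N x) r = runMin x r := by
  induction r with
  | zero => rw [tail_zero]; rfl
  | succ r ih =>
    by_cases hr : r < N + 1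
    · have h := tail_sub_tail (collapse N x) ⟨r, hr⟩
      have h' : collapse N x ⟨r, hr⟩ = runMin x r - runMin x (r + 1) := rfl
      rw [h', ← ih] at h
      simp only at h
      linarith
    · rw [tail_of_le _ (by omega), runMin_of_lt _ (by omega)]

/-- The collapse is affine on each simplex of the triangulated cube, where the order of the
coordinates is fixed. -/
theorem collapse_comp_aff {n N : ℕ} {t : Fin (n + 1) → Fin N → Bool} (ht : Monotone t) :
    (collapse N).comp (aff t) = smap (lead ∘ t) := by
  ext1 y
  refine ext_tail fun r => ?_
  rw [ContinuousMap.comp_apply, tail_collapse, tail_smap]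
  induction r with
  | zero => simp [runMin, stdSimplex.sum_eq_one y]
  | succ r ih =>
    by_cases hr : r < N
    · have hc : coord (aff t y) r = ∑ a, if t a ⟨r, hr⟩ = true then y a else 0 := by
        rw [coord, dif_pos hr, coe_aff]
      have hiff : ∀ a, r + 1 ≤ ((lead ∘ t) a : ℕ) ↔ r ≤ ((lead ∘ t) a : ℕ) ∧
          t a ⟨r, hr⟩ = true := fun a => by
        simp only [Function.comp_apply]
        rw [le_lead_iff _ _ hr, le_lead_iff _ _ hr.le]
        constructor
        · exact fun h => ⟨fun i hi => h i (by omega), h _ (Nat.lt_succ_self r)⟩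
        · rintro ⟨h, h'⟩ i hi
          rcases Nat.lt_succ_iff_lt_or_eq.1 hi with hi | rfl
          exacts [h i hi, h']
      have hQ : ∀ a b, a ≤ b → t a ⟨r, hr⟩ = true → t b ⟨r, hr⟩ = true := fun a b hab h => by
        have := ht hab ⟨r, hr⟩
        rw [h] at this
        exact top_le_iff.1 this
      have hP : ∀ a b, a ≤ b → r ≤ ((lead ∘ t) a : ℕ) → r ≤ ((lead ∘ t) b : ℕ) :=
        fun a b hab h => by
          simp only [Function.comp_apply] at *
          rw [le_lead_iff _ _ hr.le] at *
          intro i hi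
          have := ht hab i
          rw [h i hi] at this
          exact top_le_iff.1 this
      rw [runMin, ih, hc]
      simp only [hiff]
      -- upper sets of a chain are nested
      by_cases h : ∀ a, r ≤ ((lead ∘ t) a : ℕ) → t a ⟨r, hr⟩ = true
      · rw [min_eq_left (sum_ite_le y h)]
        exact Finset.sum_congr rfl fun a _ => if_congr ⟨fun ha => ⟨ha, h a ha⟩, And.left⟩ rfl rfl
      · push Not at h
        obtain ⟨a, ha, ha'⟩ := h
        have h' : ∀ b, t b ⟨r, hr⟩ = true → r ≤ ((lead ∘ t) b : ℕ) := fun b hb => by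
          rcases le_total a b with hab | hab
          · exact hP a b hab ha
          · exact absurd (hQ b a hab hb) ha'
        rw [min_eq_right (sum_ite_le y h')]
        exact Finset.sum_congr rfl fun a _ => if_congr ⟨fun ha => ⟨h' a ha, ha⟩, And.right⟩ rfl rfl
    · rw [runMin_of_lt _ (by omega)]
      refine (Finset.sum_eq_zero fun a _ => if_neg ?_).symm
      have := ((lead ∘ t) a).2
      omega

/-- On the face `x_j = 1` of the cube, the collapse is that onto the `j`-th face of the simplex. -/
theorem collapse_comp_face_one {N : ℕ} (j : Fin (N + 1)) :
    (collapse (N + 1)).comp (face j 1) = (smap j.castSucc.succAbove).comp (collapse N) := by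
  ext1 x
  refine ext_tail fun r => ?_
  rw [ContinuousMap.comp_apply, ContinuousMap.comp_apply, tail_collapse, tail_smap]
  have h1 : ∀ r ≤ (j : ℕ), runMin (face j 1 x) r = runMin x r := fun r hr =>
    runMin_congr fun i hi => by rw [coord_face, if_pos (by omega)]
  by_cases hr : r ≤ (j : ℕ)
  · rw [h1 r hr, ← tail_collapse, tail]
    refine Finset.sum_congr rfl fun a _ => if_congr ?_ rfl rfl
    rw [val_succAbove, Fin.val_castSucc]
    split_ifs <;> omega
  · have h2 : ∀ s, runMin (face j 1 x) (j + 1 + s) = runMin x (j + s) := fun s => by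
      induction s with
      | zero =>
        change runMin (face j 1 x) (j + 1) = runMin x j
        rw [runMin, h1 _ le_rfl, coord_face, if_neg (lt_irrefl _), if_pos rfl]
        exact min_eq_left (runMin_le_one x _)
      | succ s ih =>
        rw [← Nat.add_assoc, ← Nat.add_assoc, runMin, runMin, ih, coord_face, if_neg (by omega),
          if_neg (by omega)]
        congr 2
        omega
    obtain ⟨s, rfl⟩ := Nat.exists_eq_add_of_le (show (j : ℕ) + 1 ≤ r by omega)
    rw [h2, ← tail_collapse, tail]
    refine Finset.sum_congr rfl fun a _ => if_congr ?_ rfl rfl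
    rw [val_succAbove, Fin.val_castSucc]
    split_ifs <;> omega

/-- On the face where the last coordinate vanishes, the collapse is that onto the last face of the
simplex. -/
theorem collapse_comp_face_last (N : ℕ) :
    (collapse (N + 1)).comp (face (Fin.last N) 0) =
      (smap (Fin.last (N + 1)).succAbove).comp (collapse N) := by
  ext1 x
  refine ext_tail fun r => ?_
  rw [ContinuousMap.comp_apply, ContinuousMap.comp_apply, tail_collapse, tail_smap]
  have : runMin (face (Fin.last N) 0 x) r = runMin x r := runMin_congr fun i _ => by
    rw [coord_face]
    split_ifs with h h'
    · rfl
    · rw [coord, dif_neg (by simp at h'; omega)]; rfl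
    · rw [coord, coord, dif_neg (by simp at h h'; omega), dif_neg (by simp at h h'; omega)]
  rw [this, ← tail_collapse, tail]
  refine Finset.sum_congr rfl fun a _ => if_congr ?_ rfl rfl
  simp

/-- On a face `x_j = 0`, the collapse forgets all later coordinates, so it is degenerate unless
`j` is the last index. -/
theorem isDegenerate_collapse_comp_face {X : Type*} [TopologicalSpace X] {N : ℕ}
    (ρ : C(stdSimplex ℝ (Fin (N + 3)), X)) (j : Fin (N + 1)) :
    IsDegenerate ((ρ.comp (collapse (N + 2))).comp (face j.castSucc 0)) := by
  refine ⟨j, fun x x' h => congrArg ρ (ext_tail fun r => ?_)⟩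
  rw [tail_collapse, tail_collapse]
  have h0 : ∀ x : Fin (N + 1) → I, ∀ s, runMin (face j.castSucc 0 x) (j + 1 + s) = 0 :=
    fun x s => by
      induction s with
      | zero =>
        change runMin (face j.castSucc 0 x) (j + 1) = 0
        rw [runMin, coord_face, if_neg (by simp), if_pos (by simp)]
        exact min_eq_right (runMin_nonneg _ _)
      | succ s ih => rw [← Nat.add_assoc, runMin, ih, min_eq_left (coord_nonneg _ _)]
  by_cases hr : r ≤ (j : ℕ)
  · refine runMin_congr fun i hi => ?_
    have hj := j.2
    rw [coord_face, coord_face, if_pos (by simp; omega), if_pos (by simp; omega), coord, coord,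
      dif_pos (by omega), dif_pos (by omega), h _ fun e => ?_]
    have := congrArg Fin.val e
    simp at this
    omega
  · obtain ⟨s, rfl⟩ := Nat.exists_eq_add_of_le (show (j : ℕ) + 1 ≤ r by omega)
    rw [h0, h0]

variable {X : Type*} [TopologicalSpace X]

/-- The collapse turns the boundary of simplices into the boundary of cubes. -/
theorem bd_cube_collapse {N : ℕ} (ρ : C(stdSimplex ℝ (Fin (N + 2)), X)) :
    bd N (cube (ρ.comp (collapse (N + 1)))) = ∑ l : Fin (N + 2), (-1 : ℂ) ^ (l : ℕ) •
      cube ((ρ.comp (smap l.succAbove)).comp (collapse N)) := by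
  have e1 : ∀ j : Fin (N + 1), (ρ.comp (collapse (N + 1))).comp (face j 1) =
      (ρ.comp (smap j.castSucc.succAbove)).comp (collapse N) := fun j => by
    rw [ContinuousMap.comp_assoc, collapse_comp_face_one, ContinuousMap.comp_assoc]
  have e2 : (ρ.comp (collapse (N + 1))).comp (face (Fin.last N) 0) =
      (ρ.comp (smap (Fin.last (N + 1)).succAbove)).comp (collapse N) := by
    rw [ContinuousMap.comp_assoc, collapse_comp_face_last, ContinuousMap.comp_assoc]
  have e3 : ∑ j : Fin (N + 1), (-1 : ℂ) ^ (j : ℕ) •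
      cube ((ρ.comp (collapse (N + 1))).comp (face j 0)) =
      (-1 : ℂ) ^ N • cube ((ρ.comp (smap (Fin.last (N + 1)).succAbove)).comp (collapse N)) := by
    rw [Fin.sum_univ_castSucc, e2, Finset.sum_eq_zero, zero_add, Fin.val_last]
    intro j _
    cases N with
    | zero => exact j.elim0
    | succ N => rw [cube_eq_zero (isDegenerate_collapse_comp_face ρ j), smul_zero]
  rw [bd_cube]
  simp only [smul_sub, Finset.sum_sub_distrib, e1]
  conv_rhs => rw [Fin.sum_univ_castSucc]
  rw [e3, Fin.val_last, pow_succ, mul_neg_one, neg_smul, sub_eq_add_neg]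
  rfl

/-! ### Integration of cochains over cubes -/

variable (X) in
/-- The singular simplicial cochains which vanish on degenerate simplices. -/
def normalizedCochains (m : ℕ) : Submodule ℂ (C(stdSimplex ℝ (Fin (m + 2)), X) → ℂ) where
  carrier := {u | ∀ (τ : C(stdSimplex ℝ (Fin (m + 1)), X)) (i : Fin (m + 1)),
    u (τ.comp (smap i.predAbove)) = 0}
  zero_mem' := fun _ _ => rfl
  add_mem' := fun {u v} hu hv τ i => by rw [Pi.add_apply, hu, hv, add_zero]
  smul_mem' := fun c u hu τ i => by rw [Pi.smul_apply, hu, smul_zero]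

/-- A tuple with two equal adjacent entries factors through a degeneracy map. -/
theorem exists_eq_comp_predAbove {m : ℕ} {V : Type*} {t : Fin (m + 2) → V} {i j : Fin (m + 2)}
    (hij : (j : ℕ) = i + 1) (h : t i = t j) :
    ∃ l : Fin (m + 1), t = (t ∘ j.succAbove) ∘ l.predAbove := by
  have hi : (i : ℕ) < m + 1 := by have := j.2; omega
  refine ⟨⟨i, hi⟩, funext fun a => ?_⟩
  have hpred : (Fin.predAbove ⟨i, hi⟩ a : ℕ) = if (i : ℕ) < a then (a : ℕ) - 1 else a := by
    rw [Fin.predAbove]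
    by_cases hlt : (i : ℕ) < a
    · rw [dif_pos (by exact hlt), if_pos hlt]; rfl
    · rw [dif_neg (by exact hlt), if_neg hlt]; rfl
  by_cases ha : a = j
  · have : j.succAbove (Fin.predAbove ⟨i, hi⟩ a) = i := by
      ext
      rw [val_succAbove, hpred, ha]
      split_ifs <;> omega
    rw [Function.comp_apply, Function.comp_apply, this, ha, h]
  · have ha' : (a : ℕ) ≠ j := fun h => ha (Fin.ext h)
    have : j.succAbove (Fin.predAbove ⟨i, hi⟩ a) = a := by
      ext
      rw [val_succAbove, hpred]
      split_ifs <;> omega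
    rw [Function.comp_apply, Function.comp_apply, this]

theorem isNormalized_comp_smap {m : ℕ} {ι : Type} [Fintype ι]
    {u : C(stdSimplex ℝ (Fin (m + 2)), X) → ℂ} (hu : u ∈ normalizedCochains X m)
    (ρ : C(stdSimplex ℝ ι, X)) :
    IsNormalized fun t : Fin (m + 2) → ι => u (ρ.comp (smap t)) := by
  intro t i j hij h
  obtain ⟨l, hl⟩ := exists_eq_comp_predAbove hij h
  have e : ρ.comp (smap t) = (ρ.comp (smap (t ∘ j.succAbove))).comp (smap l.predAbove) := by
    rw [ContinuousMap.comp_assoc, smap_comp, ← hl]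
  beta_reduce
  rw [e]
  exact hu _ _

theorem isNormalized_comp_aff {m N : ℕ} {u : C(stdSimplex ℝ (Fin (m + 2)), X) → ℂ}
    (hu : u ∈ normalizedCochains X m) (s : C(Fin N → I, X)) :
    IsNormalized fun t : Fin (m + 2) → Fin N → Bool => u (s.comp (aff t)) := by
  intro t i j hij h
  obtain ⟨l, hl⟩ := exists_eq_comp_predAbove hij h
  have e : s.comp (aff t) = (s.comp (aff (t ∘ j.succAbove))).comp (smap l.predAbove) := by
    rw [ContinuousMap.comp_assoc, aff_comp_smap, ← hl]
  beta_reduce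
  rw [e]
  exact hu _ _

/-- Normalized cochains vanish on the triangulations of degenerate cubes. -/
theorem cubeInt_comp_aff_eq_zero {m : ℕ} {u : C(stdSimplex ℝ (Fin (m + 2)), X) → ℂ}
    (hu : u ∈ normalizedCochains X m) {s : C(Fin (m + 1) → I, X)} (hs : IsDegenerate s) :
    (cubeInt (m + 1) fun t => u (s.comp (aff t))) = 0 := by
  obtain ⟨j, hj⟩ := hs
  have hs : s = (s.comp (face j 0)).comp ⟨fun x i => x (j.succAbove i), by fun_prop⟩ := by
    ext1 x
    refine hj _ _ fun i hi => ?_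
    obtain ⟨i, rfl⟩ := Fin.exists_succAbove_eq hi
    simp
  have e : ∀ t : Fin (m + 2) → Fin (m + 1) → Bool, s.comp (aff t) =
      (s.comp (face j 0)).comp (aff ((fun v : Fin (m + 1) → Bool => v ∘ j.succAbove) ∘ t)) :=
    fun t => by
      conv_lhs => rw [hs]
      rfl
  simp only [e]
  exact cubeInt_comp_removeNth m j (isNormalized_comp_aff hu (s.comp (face j 0)))

/-- The integral of a normalized cochain over cubical chains, by means of the triangulation of the
cube. -/
noncomputable def integral (m : ℕ) :
    normalizedCochains X m →ₗ[ℂ] (Chain (m + 1) X →ₗ[ℂ] ℂ) where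
  toFun u := lift (fun s => cubeInt (m + 1) fun t => u.1 (s.comp (aff t)))
    fun _ hs => cubeInt_comp_aff_eq_zero u.2 hs
  map_add' u v := hom_ext fun s => by
    rw [LinearMap.add_apply, lift_cube, lift_cube, lift_cube]
    simpa using cubeInt_add_mul (m + 1) 1 (fun t => u.1 (s.comp (aff t)))
      fun t => v.1 (s.comp (aff t))
  map_smul' c u := hom_ext fun s => by
    rw [RingHom.id_apply, LinearMap.smul_apply, lift_cube, lift_cube]
    simpa [cubeInt_zero] using cubeInt_add_mul (m + 1) c (fun _ => 0)
      fun t => u.1 (s.comp (aff t))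

theorem integral_cube {m : ℕ} (u : normalizedCochains X m) (s : C(Fin (m + 1) → I, X)) :
    integral m u (cube s) = cubeInt (m + 1) fun t => u.1 (s.comp (aff t)) :=
  lift_cube _ (fun _ hs => cubeInt_comp_aff_eq_zero u.2 hs) s

/-- A simplicial cochain is a cocycle if its alternating sums over the faces of simplices
vanish. -/
def IsCocycle {n : ℕ} (u : C(stdSimplex ℝ (Fin (n + 1)), X) → ℂ) : Prop :=
  ∀ τ : C(stdSimplex ℝ (Fin (n + 2)), X),
    ∑ l : Fin (n + 2), (-1 : ℂ) ^ (l : ℕ) * u (τ.comp (smap l.succAbove)) = 0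

/-- The integral of a cocycle over a boundary vanishes. -/
theorem integral_bd {m : ℕ} {u : normalizedCochains X m} (hu : IsCocycle u.1)
    (c : Chain (m + 2) X) : integral m u (bd (m + 1) c) = 0 := by
  suffices (integral m u).comp (bd (m + 1)) = 0 from LinearMap.congr_fun this c
  refine hom_ext fun s => ?_
  have h := cubeInt_delta (m + 1) fun t : Fin (m + 2) → Fin (m + 2) → Bool => u.1 (s.comp (aff t))
  have h0 : delta (fun t : Fin (m + 2) → Fin (m + 2) → Bool => u.1 (s.comp (aff t))) =
      fun _ => 0 := by
    ext t
    rw [← hu (s.comp (aff t))]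
    refine Finset.sum_congr rfl fun l _ => ?_
    rw [ContinuousMap.comp_assoc, aff_comp_smap]
  rw [h0, cubeInt_zero] at h
  rw [LinearMap.comp_apply, bd_cube, map_sum, LinearMap.zero_apply, h]
  refine Finset.sum_congr rfl fun j _ => ?_
  rw [map_smul, map_sub, integral_cube, integral_cube, smul_eq_mul]
  have e1 := fun t : Fin (m + 2) → Fin (m + 1) → Bool => face_comp_aff j t true
  have e0 := fun t : Fin (m + 2) → Fin (m + 1) → Bool => face_comp_aff j t false
  simp only [if_true, Bool.false_eq_true, if_false] at e0 e1
  simp only [ContinuousMap.comp_assoc, e0, e1]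

/-- The integral of a cochain over a collapsed simplex is its value on the simplex. -/
theorem integral_cube_collapse {m : ℕ} (u : normalizedCochains X m)
    (ρ : C(stdSimplex ℝ (Fin (m + 2)), X)) :
    integral m u (cube (ρ.comp (collapse (m + 1)))) = u.1 ρ := by
  rw [integral_cube, cubeInt_congr (U' := fun t => u.1 (ρ.comp (smap (id ∘ lead ∘ t)))),
    cubeInt_lead (m + 1) id (c := fun f => u.1 (ρ.comp (smap f))) (isNormalized_comp_smap u.2 ρ)]
  · refine congrArg u.1 (ContinuousMap.ext fun y => ?_)
    exact congrArg ρ (stdSimplex.map_id_apply y)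
  · intro t ht
    rw [ContinuousMap.comp_assoc, collapse_comp_aff ht]
    rfl

/-- A normalized simplicial cocycle whose integrals over cubical cycles vanish is a coboundary. -/
theorem exists_coboundary {m : ℕ} (u : normalizedCochains X m)
    (h : ∀ z ∈ cycles (m + 1) X, integral m u z = 0) :
    ∃ c : C(stdSimplex ℝ (Fin (m + 1)), X) → ℂ, ∀ ρ : C(stdSimplex ℝ (Fin (m + 2)), X),
      ∑ l : Fin (m + 2), (-1 : ℂ) ^ (l : ℕ) * c (ρ.comp (smap l.succAbove)) = u.1 ρ := by
  -- a functional which vanishes on cycles factors through the boundary map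
  obtain ⟨g, hg⟩ : ∃ g : Chain m X →ₗ[ℂ] ℂ, integral m u = g.comp (bd m) := by
    have hle : LinearMap.ker (bd m) ≤ LinearMap.ker (integral m u) := fun z hz => h z hz
    obtain ⟨g, hg⟩ := LinearMap.exists_extend
      (((LinearMap.ker (bd (X := X) m)).liftQ (integral m u) hle).comp
        (bd (X := X) m).quotKerEquivRange.symm.toLinearMap)
    refine ⟨g, LinearMap.ext fun z => ?_⟩
    have := LinearMap.congr_fun hg ⟨bd m z, z, rfl⟩
    simp only [LinearMap.comp_apply, Submodule.subtype_apply, LinearEquiv.coe_coe] at this ⊢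
    rw [this]
    have e : (bd (X := X) m).quotKerEquivRange.symm ⟨bd m z, z, rfl⟩ =
        (LinearMap.ker (bd (X := X) m)).mkQ z := by
      rw [LinearEquiv.symm_apply_eq]; rfl
    rw [e]
    rfl
  refine ⟨fun ρ => g (cube (ρ.comp (collapse m))), fun ρ => ?_⟩
  rw [← integral_cube_collapse, hg, LinearMap.comp_apply, bd_cube_collapse, map_sum]
  simp only [map_smul, smul_eq_mul]

end Cubical

/-! ### Normalization of simplicial cochains -/

namespace SSet

open CategoryTheory Simplicial AlgebraicTopology.DoldKan

theorem hom_sum_apply {ι : Type*} {M N : AddCommGrpCat.{u}} (s : Finset ι) (f : ι → (M ⟶ N))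
    (a : M) : (∑ i ∈ s, f i).hom a = ∑ i ∈ s, (f i).hom a := by
  have h := map_sum (AddCommGrpCat.homAddEquiv (M := M) (N := N)) f s
  exact (DFunLike.congr_fun h a).trans (AddMonoidHom.finsetSum_apply _ _ _)

/-- The simplicial free abelian group on a simplicial set. -/
noncomputable def freeAb (K : SSet.{u}) : SimplicialObject AddCommGrpCat.{u} :=
  ((SimplicialObject.whiskering (Type u) AddCommGrpCat.{u}).obj AddCommGrpCat.free).obj K

variable {K : SSet.{u}}

/-- The generator of the free abelian group given by a simplex. -/
def gen {n : ℕ} (y : K _⦋n⦌) : K.freeAb _⦋n⦌ := FreeAbelianGroup.of y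

theorem map_gen {m n : ℕ} (θ : ⦋m⦌ ⟶ ⦋n⦌) (y : K _⦋n⦌) :
    (K.freeAb.map θ.op).hom (gen y) = gen (K.map θ.op y) :=
  FreeAbelianGroup.map_of_apply _

/-- The additive extension of a cochain to the free abelian groups. -/
noncomputable def extend {n : ℕ} (c : K _⦋n⦌ → ℂ) : K.freeAb _⦋n⦌ →+ ℂ := FreeAbelianGroup.lift c

theorem extend_gen {n : ℕ} (c : K _⦋n⦌ → ℂ) (y : K _⦋n⦌) : extend c (gen y) = c y :=
  FreeAbelianGroup.lift_apply_of _ _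

theorem addHom_ext {n : ℕ} {f g : K.freeAb _⦋n⦌ →+ ℂ} (h : ∀ y : K _⦋n⦌, f (gen y) = g (gen y)) :
    f = g :=
  FreeAbelianGroup.lift_ext _ _ h

/-- If the coboundary of a cochain vanishes on degenerate simplices, then the cochain may be changed
to one which vanishes on degenerate simplices and has the same coboundary. The new cochain is the
composite with the projector onto the normalized chains of the Dold-Kan correspondence. -/
theorem exists_normalized {m : ℕ} (c : K _⦋m⦌ → ℂ) (v : K _⦋m + 1⦌ → ℂ)
    (hv : ∀ (y : K _⦋m⦌) (i : Fin (m + 1)), v (K.σ i y) = 0)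
    (hc : ∀ y, ∑ l : Fin (m + 2), (-1 : ℂ) ^ (l : ℕ) * c (K.δ l y) = v y) :
    ∃ c' : K _⦋m⦌ → ℂ, (∀ (n : ℕ) (θ : ⦋m⦌ ⟶ ⦋n⦌), ¬ Function.Injective θ.toOrderHom →
      ∀ y, c' (K.map θ.op y) = 0) ∧
      ∀ y, ∑ l : Fin (m + 2), (-1 : ℂ) ^ (l : ℕ) * c' (K.δ l y) = v y := by
  have hd : ∀ a : K.freeAb _⦋m + 1⦌,
      (∑ l : Fin (m + 2), (-1 : ℂ) ^ (l : ℕ) * extend c ((K.freeAb.δ l).hom a)) = extend v a := by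
    intro a
    suffices (∑ l : Fin (m + 2), (AddMonoidHom.mulLeft ((-1 : ℂ) ^ (l : ℕ))).comp
        ((extend c).comp (K.freeAb.δ l).hom)) = extend v by
      rw [← this]
      simp
    refine addHom_ext fun y => ?_
    rw [extend_gen, ← hc]
    simp only [AddMonoidHom.finsetSum_apply, AddMonoidHom.comp_apply, AddMonoidHom.coe_mulLeft]
    refine Finset.sum_congr rfl fun l _ => ?_
    rw [SimplicialObject.δ_def, map_gen, extend_gen]
    rfl
  have hsgn : ∀ (f : K.freeAb _⦋m⦌ →+ ℂ) (a : K.freeAb _⦋m + 1⦌),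
      f ((∑ l : Fin (m + 2), (-1 : ℤ) ^ (l : ℕ) • K.freeAb.δ l).hom a) =
        ∑ l : Fin (m + 2), (-1 : ℂ) ^ (l : ℕ) * f ((K.freeAb.δ l).hom a) := fun f a => by
    rw [hom_sum_apply, map_sum]
    refine Finset.sum_congr rfl fun l _ => ?_
    rw [AddCommGrpCat.hom_zsmul, AddMonoidHom.smul_apply, map_zsmul, zsmul_eq_mul]
    push_cast
    rfl
  have hcomm : ∀ a : K.freeAb _⦋m + 1⦌,
      (PInfty (X := K.freeAb).f m).hom
        ((∑ l : Fin (m + 2), (-1 : ℤ) ^ (l : ℕ) • K.freeAb.δ l).hom a) =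
      (∑ l : Fin (m + 2), (-1 : ℤ) ^ (l : ℕ) • K.freeAb.δ l).hom
        ((PInfty (X := K.freeAb).f (m + 1)).hom a) := fun a => by
    have h := (PInfty (X := K.freeAb)).comm (m + 1) m
    rw [AlgebraicTopology.AlternatingFaceMapComplex.obj_d_eq] at h
    exact (ConcreteCategory.congr_hom h a).symm
  have hdeg : ∀ a : K.freeAb _⦋m⦌, ∀ i : Fin (m + 1), extend v ((K.freeAb.σ i).hom a) = 0 := by
    intro a i
    suffices (extend v).comp (K.freeAb.σ i).hom = 0 from DFunLike.congr_fun this a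
    refine addHom_ext fun y => ?_
    rw [AddMonoidHom.comp_apply, SimplicialObject.σ_def, map_gen, extend_gen]
    exact hv y i
  -- the complementary projector has values in the degenerate simplices, where `v` vanishes
  have hQ : ∀ a : K.freeAb _⦋m + 1⦌,
      extend v ((PInfty (X := K.freeAb).f (m + 1)).hom a) = extend v a := fun a => by
    have h := ConcreteCategory.congr_hom (PInfty_f_add_QInfty_f (X := K.freeAb) (m + 1)) a
    have h' : extend v ((QInfty (X := K.freeAb).f (m + 1)).hom a) = 0 := by
      rw [QInfty_f, decomposition_Q, hom_sum_apply, map_sum]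
      exact Finset.sum_eq_zero fun i _ => hdeg _ _
    have h2 := congrArg (extend v) h
    refine Eq.trans ?_ h2
    refine Eq.trans ?_ (map_add (extend v) ((PInfty (X := K.freeAb).f (m + 1)).hom a)
      ((QInfty (X := K.freeAb).f (m + 1)).hom a)).symm
    rw [h', add_zero]
  refine ⟨fun y => extend c ((PInfty (X := K.freeAb).f m).hom (gen y)), fun n θ hθ y => ?_,
    fun y => ?_⟩
  · beta_reduce
    rw [← map_gen]
    have h := degeneracy_comp_PInfty K.freeAb m θ (by rwa [SimplexCategory.mono_iff_injective])
    have h' := ConcreteCategory.congr_hom h (gen y)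
    exact (congrArg (extend c) h').trans (map_zero _)
  · have h := hd ((PInfty (X := K.freeAb).f (m + 1)).hom (gen y))
    rw [hQ, extend_gen, ← hsgn, ← hcomm] at h
    rw [← h]
    refine Eq.trans ?_ (hsgn ((extend c).comp (PInfty (X := K.freeAb).f m).hom) (gen y)).symm
    refine Finset.sum_congr rfl fun l _ => ?_
    rw [SimplicialObject.δ_def K.freeAb, map_gen]
    rfl

end SSet

/-! ### Alternating extensions -/

namespace TupleCochain

variable {k : Type w} [Field k] {V V' : Type*}

theorem IsAlt.comp_perm {n : ℕ} {c : (Fin n → V) → k} (hc : IsAlt c) (t : Fin n → V)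
    (π : Equiv.Perm (Fin n)) : c (t ∘ π) = ((Equiv.Perm.sign π : ℤ) : k) * c t := by
  cases n with
  | zero => simp [Subsingleton.elim π 1]
  | succ n =>
    have hπ : π ∈ Submonoid.closure (Set.range fun i : Fin n => Equiv.swap i.castSucc i.succ) := by
      rw [Equiv.Perm.mclosure_swap_castSucc_succ]; trivial
    induction hπ using Submonoid.closure_induction generalizing t with
    | mem π hπ =>
      obtain ⟨i, rfl⟩ := hπ
      rw [hc t _ _ (by simp), Equiv.Perm.sign_swap (by simp [Fin.ext_iff])]
      simp
    | one => simp
    | mul π π' _ _ h h' =>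
      have := h' (t ∘ π)
      rw [Equiv.Perm.coe_mul, ← Function.comp_assoc, this, h, Equiv.Perm.sign_mul]
      push_cast
      ring

/-- An alternating function is determined by its values on monotone tuples. -/
theorem IsAlt.ext_monotone [LinearOrder V] {n : ℕ} {c c' : (Fin n → V) → k} (hc : IsAlt c)
    (hc' : IsAlt c') (h : ∀ t, Monotone t → c t = c' t) : c = c' := by
  ext t
  have ht : t = (t ∘ Tuple.sort t) ∘ ⇑(Tuple.sort t)⁻¹ := by
    ext i; simp
  rw [ht, hc.comp_perm, hc'.comp_perm, h _ (Tuple.monotone_sort t)]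

/-- The alternating cochain with prescribed values on monotone tuples. -/
def altExt [LinearOrder V] {n : ℕ} (g : (Fin n → V) → k) (t : Fin n → V) : k :=
  ((Equiv.Perm.sign (Tuple.sort t) : ℤ) : k) * g (t ∘ Tuple.sort t)

theorem altExt_of_monotone [LinearOrder V] {n : ℕ} (g : (Fin n → V) → k) {t : Fin n → V}
    (ht : Monotone t) : altExt g t = g t := by
  rw [altExt, Tuple.sort_eq_refl_iff_monotone.2 ht, Equiv.Perm.sign_refl]
  simp

/-- The alternating extension is natural for monotone maps, provided that the given values vanish on
non-injective tuples: a monotone map may create repeated entries, where the sorting permutations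
disagree. -/
theorem altExt_comp [LinearOrder V] [LinearOrder V'] {θ : V → V'} (hθ : Monotone θ) {n : ℕ}
    {g : (Fin n → V') → k} {g' : (Fin n → V) → k} (hgg' : ∀ t, Monotone t → g' t = g (θ ∘ t))
    (hg : ∀ t, Monotone t → ¬ Function.Injective t → g t = 0) (t : Fin n → V) :
    altExt g' t = altExt g (θ ∘ t) := by
  have e : (θ ∘ t) ∘ Tuple.sort t = (θ ∘ t) ∘ Tuple.sort (θ ∘ t) :=
    Tuple.unique_monotone (hθ.comp (Tuple.monotone_sort t)) (Tuple.monotone_sort _)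
  rw [altExt, altExt, hgg' _ (Tuple.monotone_sort t), ← Function.comp_assoc, e]
  by_cases h : Function.Injective (θ ∘ t)
  · rw [Equiv.coe_fn_injective (h.comp_left e)]
  · rw [hg _ (Tuple.monotone_sort _), mul_zero, mul_zero]
    rwa [(Equiv.injective_comp _ _)]

/-- The extension is alternating if the given values vanish on non-injective tuples. -/
theorem isAlt_altExt [LinearOrder V] {n : ℕ} {g : (Fin n → V) → k}
    (hg : ∀ t, Monotone t → ¬ Function.Injective t → g t = 0) : IsAlt (altExt g) := by
  intro t i j hij
  have e : (t ∘ Equiv.swap i j) ∘ Tuple.sort (t ∘ Equiv.swap i j) = t ∘ Tuple.sort t :=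
    Tuple.comp_perm_comp_sort_eq_comp_sort
  rw [altExt, altExt, e]
  by_cases h : Function.Injective t
  · have hs : Equiv.swap i j * Tuple.sort (t ∘ Equiv.swap i j) = Tuple.sort t :=
      Equiv.coe_fn_injective (h.comp_left e)
    rw [← hs, Equiv.Perm.sign_mul, Equiv.Perm.sign_swap fun h => by simp [h] at hij]
    push_cast
    ring
  · rw [hg _ (Tuple.monotone_sort _), mul_zero, mul_zero, neg_zero]
    rwa [(Equiv.injective_comp _ _)]

end TupleCochain

/-! ### Exactness of piecewise polynomial forms -/

namespace SSet

open CategoryTheory Simplicial TupleCochain PolyForm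

variable {K : SSet.{u}}

/-- A cochain on a simplicial set, evaluated on the monotone tuples of vertices of a simplex. -/
noncomputable def onTuples {m n : ℕ} (c : K _⦋m⦌ → ℂ) (y : K _⦋n⦌) (J : Fin (m + 1) → Fin (n + 1)) :
    ℂ :=
  open Classical in
  if h : Monotone J then c (K.map (SimplexCategory.mkHom ⟨J, h⟩).op y) else 0

theorem onTuples_map {m n l : ℕ} (c : K _⦋m⦌ → ℂ) (y : K _⦋n⦌) (θ : ⦋l⦌ ⟶ ⦋n⦌)
    {J : Fin (m + 1) → Fin (l + 1)} (hJ : Monotone J) :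
    onTuples c (K.map θ.op y) J = onTuples c y (θ.toOrderHom ∘ J) := by
  rw [onTuples, onTuples, dif_pos hJ, dif_pos (θ.toOrderHom.monotone.comp hJ)]
  congr 1
  exact (Functor.map_comp_apply K θ.op (SimplexCategory.mkHom ⟨J, hJ⟩).op y).symm

theorem coe_plForms_map {p m n : ℕ} (ω : K.plForms ℂ p) (θ : ⦋m⦌ ⟶ ⦋n⦌) (y : K _⦋n⦌) :
    ω.1 m (K.map θ.op y) = pullback ℂ θ.toOrderHom (ω.1 n y) :=
  ω.2.2 m n θ y

/-- The integrals of a form over simplices vanish on degenerate simplices. -/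
theorem res_degenerate {m : ℕ} (ω : K.plForms ℂ (m + 1)) (y : K _⦋m⦌) (i : Fin (m + 1)) :
    res (m + 1) id (ω.1 (m + 1) (K.σ i y)) = 0 := by
  -- the form on the smaller simplex vanishes, as its degree exceeds the dimension
  have h : ω.1 m y = 0 := by
    have := ω.2.1 m y
    rwa [deg_succ_eq_bot, Submodule.mem_bot] at this
  rw [SimplicialObject.σ_def, coe_plForms_map, h, map_zero, map_zero]

/-- A closed form is exact as soon as the cochain of its integrals is a coboundary. -/
theorem exists_primitive {m : ℕ} (ω : K.plForms ℂ (m + 1)) (hω : ∀ n y, d ℂ n (ω.1 n y) = 0)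
    (c : K _⦋m⦌ → ℂ) (hc : ∀ y : K _⦋m + 1⦌, ∑ l : Fin (m + 2), (-1 : ℂ) ^ (l : ℕ) * c (K.δ l y) =
      res (m + 1) id (ω.1 (m + 1) y)) :
    ∃ ξ : K.plForms ℂ m, ∀ n y, d ℂ n (ξ.1 n y) = ω.1 n y := by
  obtain ⟨c', hdeg, hc'⟩ := exists_normalized c (fun y => res (m + 1) id (ω.1 (m + 1) y))
    (fun y i => res_degenerate ω y i) hc
  have hg : ∀ {n : ℕ} (y : K _⦋n⦌) (J : Fin (m + 1) → Fin (n + 1)), Monotone J →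
      ¬ Function.Injective J → onTuples c' y J = 0 := fun {n} y J hJ hi => by
    rw [onTuples, dif_pos hJ]
    exact hdeg _ (SimplexCategory.mkHom ⟨J, hJ⟩) hi _
  -- both sides are alternating, and they agree on monotone tuples
  have hdelta : ∀ {n : ℕ} (y : K _⦋n⦌), delta (altExt (onTuples c' y)) =
      fun I => res (m + 1) I (ω.1 n y) := fun {n} y => by
    refine (isAlt_altExt (hg y)).delta.ext_monotone (isAlt_res (m + 1) (ω.1 n y)) fun I hI => ?_
    have h := hc' (K.map (SimplexCategory.mkHom ⟨I, hI⟩).op y)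
    rw [coe_plForms_map, res_pullback] at h
    refine Eq.trans (Finset.sum_congr rfl fun l _ => ?_) h
    have hl : Monotone (I ∘ l.succAbove) := hI.comp (Fin.strictMono_succAbove l).monotone
    rw [altExt_of_monotone _ hl, onTuples, dif_pos hl, SimplicialObject.δ_def]
    congr 2
    exact Functor.map_comp_apply K (SimplexCategory.mkHom ⟨I, hI⟩).op
      (SimplexCategory.δ l).op y
  refine ⟨⟨fun n y => sop (m + 2) (ω.1 n y) + whitney m (altExt (onTuples c' y)),
    fun n y => add_mem (sop_mem_deg _ (ω.2.1 n y)) (whitney_mem_deg _ _), fun l n θ y => ?_⟩,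
    fun n y => ?_⟩
  · beta_reduce
    rw [map_add, sop_pullback, pullback_whitney, coe_plForms_map]
    congr 2
    ext J
    exact altExt_comp θ.toOrderHom.monotone (fun J hJ => onTuples_map c' y θ hJ) (hg y) J
  · have h := eq_d_sop_add_whitney (ω.2.1 n y) (hω n y)
    rw [← hdelta, whitney_delta] at h
    rw [map_add, d_whitney]
    exact h.symm

end SSet

/-! ### Finiteness of the cohomology of Sullivan's algebra -/

namespace Cubical

open CategoryTheory Simplicial PolyForm

variable {X : Type u} [TopologicalSpace X]

/-- The simplex of the singular simplicial set given by a continuous map. -/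
noncomputable def toSimplex {n : ℕ} (ρ : C(stdSimplex ℝ (Fin (n + 1)), X)) :
    (TopCat.toSSet.obj (TopCat.of X)) _⦋n⦌ :=
  ((TopCat.of X).toSSetObjEquiv (Opposite.op ⦋n⦌)).symm ρ

theorem toSimplex_surjective {n : ℕ} : Function.Surjective (toSimplex (X := X) (n := n)) :=
  ((TopCat.of X).toSSetObjEquiv (Opposite.op ⦋n⦌)).symm.surjective

theorem map_toSimplex {m n : ℕ} (θ : ⦋m⦌ ⟶ ⦋n⦌) (ρ : C(stdSimplex ℝ (Fin (n + 1)), X)) :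
    (TopCat.toSSet.obj (TopCat.of X)).map θ.op (toSimplex ρ) =
      toSimplex (ρ.comp (smap θ.toOrderHom)) := by
  rfl

/-- The cochain of the integrals of a form over singular simplices. -/
noncomputable def formCochain (m : ℕ) :
    (TopCat.toSSet.obj (TopCat.of X)).plForms ℂ (m + 1) →ₗ[ℂ] normalizedCochains X m where
  toFun ω := ⟨fun ρ => res (m + 1) id (ω.1 (m + 1) (toSimplex ρ)), fun τ i => by
    have h := SSet.res_degenerate ω (toSimplex τ) i
    rw [SimplicialObject.σ_def, map_toSimplex] at h
    exact h⟩
  map_add' ω ω' := Subtype.ext (funext fun ρ => map_add (res (m + 1) id) _ _)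
  map_smul' c ω := Subtype.ext (funext fun ρ => (res (m + 1) id).map_smul c _)

/-- Stokes' theorem for closed forms. -/
theorem isCocycle_formCochain {m : ℕ} {ω : (TopCat.toSSet.obj (TopCat.of X)).plForms ℂ (m + 1)}
    (hω : ∀ n y, d ℂ n (ω.1 n y) = 0) : IsCocycle (formCochain m ω).1 := by
  intro τ
  have h := res_d (m + 1) id (ω.1 (m + 2) (toSimplex τ))
  rw [hω, map_zero] at h
  rw [h]
  refine Finset.sum_congr rfl fun l _ => ?_
  have e : toSimplex (τ.comp (smap l.succAbove)) =
      (TopCat.toSSet.obj (TopCat.of X)).map (SimplexCategory.δ l).op (toSimplex τ) :=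
    (map_toSimplex (SimplexCategory.δ l) τ).symm
  change _ * res (m + 1) id (ω.1 (m + 1) (toSimplex (τ.comp (smap l.succAbove)))) = _
  rw [e, SSet.coe_plForms_map, res_pullback]
  rfl

/-- A closed form whose integrals over all cubical cycles vanish is exact. -/
theorem mem_coboundaries_sullivanForms {m : ℕ}
    {ω : (TopCat.toSSet.obj (TopCat.of X)).plForms ℂ (m + 1)} (hω : ∀ n y, d ℂ n (ω.1 n y) = 0)
    (h : ∀ z ∈ cycles (m + 1) X, integral m (formCochain m ω) z = 0) :
    ω ∈ (sullivanForms X).coboundaries (m + 1) := by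
  obtain ⟨c, hc⟩ := exists_coboundary (formCochain m ω) h
  obtain ⟨ξ, hξ⟩ := SSet.exists_primitive ω hω
    (fun y => c ((TopCat.of X).toSSetObjEquiv (Opposite.op ⦋m⦌) y)) fun y => by
      obtain ⟨ρ, rfl⟩ := toSimplex_surjective y
      refine Eq.trans (Finset.sum_congr rfl fun l _ => ?_) (hc ρ)
      rw [SimplicialObject.δ_def, map_toSimplex]
      congr 2
  exact ⟨ξ, Subtype.ext (funext fun n => funext fun y => hξ n y)⟩

/-- If homology is finite-dimensional, then finitely many integrals decide whether a closed form is
exact. -/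
theorem FinHom.finiteDimensional_cohomology {m : ℕ} (hX : FinHom (m + 1) X) :
    FiniteDimensional ℂ ((sullivanForms X).Cohomology (m + 1)) := by
  obtain ⟨W, hW, hle⟩ := hX
  let Φ : (sullivanForms X).cocycles (m + 1) →ₗ[ℂ] (W →ₗ[ℂ] ℂ) :=
    LinearMap.lcomp ℂ ℂ W.subtype ∘ₗ integral m ∘ₗ formCochain m ∘ₗ
      ((sullivanForms X).cocycles (m + 1)).subtype
  have hker : LinearMap.ker Φ ≤ ((sullivanForms X).coboundaries (m + 1)).comap
      ((sullivanForms X).cocycles (m + 1)).subtype := by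
    rintro ⟨ω, hω⟩ h
    have h0 : (sullivanForms X).d (m + 1) ω = 0 := hω
    have hω' : ∀ n y, d ℂ n (ω.1 n y) = 0 := fun n y =>
      congrFun (congrFun (congrArg Subtype.val h0) n) y
    refine mem_coboundaries_sullivanForms hω' fun z hz => ?_
    obtain ⟨w, hw, _, ⟨b, rfl⟩, rfl⟩ := Submodule.mem_sup.1 (hle hz)
    change integral m (formCochain m ω) _ = 0
    rw [map_add, integral_bd (isCocycle_formCochain hω'), add_zero]
    exact LinearMap.congr_fun (LinearMap.mem_ker.1 h) ⟨w, hw⟩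
  have hfin : FiniteDimensional ℂ (_ ⧸ LinearMap.ker Φ) :=
    LinearEquiv.finiteDimensional Φ.quotKerEquivRange.symm
  exact Module.Finite.of_surjective (Submodule.factor hker) (Submodule.factor_surjective hker)

end Cubical

/-! ### Cohomology of the minimal model of a space -/

namespace CDGA

variable {k : Type w} [Field k]

/-- A minimal algebra is connected: its generators are in positive degrees. -/
theorem IsQMinimal.finiteDimensional_cohomology_zero {q : ℕ} {M : CDGA.{u, w} k}
    (hM : M.IsQMinimal q) : FiniteDimensional k (M.Cohomology 0) := by
  obtain ⟨V, hV0, -, hfree, -⟩ := hM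
  -- the subalgebra which consists of the scalars in degree zero and of everything in positive
  -- degrees contains the generators
  let S : ∀ n, Submodule k (M.carrier n) := fun n => Nat.rec (Submodule.span k {M.one})
    (fun _ _ => ⊤) n
  have hS : M.toGCAlg.IsSubalgebra S :=
    { one_mem := Submodule.mem_span_singleton_self _
      mul_mem := by
        intro i j n h a b ha hb
        cases n with
        | succ n => trivial
        | zero =>
          obtain ⟨rfl, rfl⟩ : i = 0 ∧ j = 0 := by omega
          obtain ⟨r, rfl⟩ := Submodule.mem_span_singleton.1 ha
          rw [map_smul, LinearMap.smul_apply]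
          refine Submodule.smul_mem _ _ ?_
          rw [M.one_mul']
          exact hb }
  have hVS : ∀ n, V n ≤ S n := fun n => by
    cases n with
    | zero => rw [hV0]; exact bot_le
    | succ n => exact le_top
  have h1 : (Submodule.span k {M.one} : Submodule k (M.carrier 0)) = ⊤ :=
    eq_top_iff.2 fun x _ => GCAlg.adjoin_le hS hVS 0 (hfree.mem_adjoin x)
  have : FiniteDimensional k (M.carrier 0) := Module.Finite.of_fg_top <| by
    rw [← h1]
    exact Submodule.fg_span (Set.finite_singleton _)
  infer_instance

end CDGA

namespace Cubical

variable {X : Type u} [TopologicalSpace X]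

/-- The cohomology of the minimal model embeds in that of Sullivan's algebra, up to degree
`q + 1`. -/
theorem FinHom.finiteDimensional_cohomology_minimalModel {q i : ℕ} (hX : FinHom i X)
    {M : CDGA.{u, 0} ℂ} (hM : M.IsQMinimalModel q (sullivanForms X)) (hi : i ≤ q + 1) :
    FiniteDimensional ℂ (M.Cohomology i) := by
  obtain ⟨hM, f, hf⟩ := hM
  cases i with
  | zero => exact hM.finiteDimensional_cohomology_zero
  | succ m =>
    have := hX.finiteDimensional_cohomology
    exact FiniteDimensional.of_injective (f.mapCohomology (m + 1)) (hf.injective hi)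

end Cubical

/-- Minimal models of a cdga of the `q`-type of a `q`-finite one have finite-dimensional cohomology
up to degree `q + 1`. -/
theorem CDGA.SameQType.finiteDimensional_cohomology {q : ℕ} {M A B : CDGA.{u, 0} ℂ}
    (hA : A.IsQFinite q) (hBA : CDGA.SameQType q B A) (hM : M.IsQMinimalModel q B) {i : ℕ}
    (hi : i ≤ q + 1) : FiniteDimensional ℂ (M.Cohomology i) := by
  obtain ⟨f, hf⟩ := (CDGA.SameQType.exists_isQEquivalence_iff hM.1 hBA).1 hM.2
  exact CDGA.IsQFinite.finiteDimensional_cohomology hA hM.1 hf hi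

theorem theorem2p3 :
    (∀ (q : ℕ), 1 ≤ q → ∀ (X : Type u) [TopologicalSpace X] [PathConnectedSpace X],
      ((∃ A : CDGA.{u, 0} ℂ, A.IsQFinite q ∧ CDGA.SameQType q (sullivanForms X) A) ∨
        IsQFiniteSpace (q + 1) X) →
      ∀ M : CDGA.{u, 0} ℂ, M.IsQMinimalModel q (sullivanForms X) →
        ∀ i ≤ q + 1, FiniteDimensional ℂ (M.Cohomology i)) ∧
    (∀ (π : Type w) [Group π] [Group.FG π] (X : Type u) [TopologicalSpace X],
      IsClassifyingSpace π X →
      ((∃ A : CDGA.{u, 0} ℂ, A.IsQFinite 1 ∧ CDGA.SameQType 1 (sullivanForms X) A) ∨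
        Group.IsFinitelyPresented π) →
      ∀ M : CDGA.{u, 0} ℂ, M.IsQMinimalModel 1 (sullivanForms X) →
        FiniteDimensional ℂ (M.Cohomology 2)) := by
  refine ⟨fun q _ X _ _ hX M hM i hi => ?_, fun π _ _ X _ hX h M hM => ?_⟩
  · rcases hX with ⟨A, hA, hXA⟩ | hX
    · exact hXA.finiteDimensional_cohomology hA hM hi
    · exact (Cubical.finHom_of_isQFiniteSpace hX hi).finiteDimensional_cohomology_minimalModel hM hi
  · rcases h with ⟨A, hA, hXA⟩ | hπ
    · exact hXA.finiteDimensional_cohomology hA hM le_rfl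
    · obtain ⟨hcw, hpi⟩ := hX
      have : PathConnectedSpace X := hcw.1
      obtain ⟨x⟩ := PathConnectedSpace.nonempty (X := X)
      obtain ⟨⟨e⟩, hpi2⟩ := hpi x
      have hfp : Group.IsFinitelyPresented (FundamentalGroup X x) :=
        Group.IsFinitelyPresented.equiv e.symm
      exact (Cubical.finHom_two_of_isFinitelyPresented
        (hpi2 2 le_rfl) hfp).finiteDimensional_cohomology_minimalModel hM le_rfl
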